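/- For $r>0$ let $D_r^+=\{x=(x^1,x^2)\in\mathbb R^2: |x|\le r,\ x^2\ge 0\}$, $D^+=D_1^+$, and $\partial^0D_r^+=\{(t,0): |t|<r\}$. Let $1\le k\le n$, let $N\subset\mathbb R^L$ be a compact smooth embedded $n$-dimensional submanifold (possibly with smooth boundary, and with the induced Riemannian metric), and let $K\subset N$ be a closed (i.e. compact, without boundary) smooth $k$-dimensional submanifold. Let $A$ be the second fundamental form of $N\subset\mathbb R^L$, with the sign $A(y)(X,Y)=-(D_X\widetilde Y)^{\perp}$ for $X,Y\in T_yN$, where $\widetilde Y$ is a tangential vector field of $N$ extending $Y$. For $u\in W^{2,p}(D_2^+,N)=\{u\in W^{2,p}(D_2^+,\mathbb R^L): u(x)\in N \text{ for a.e. } x\}$ the tension field is $$\tau(u)=\Delta u+A(u)(\nabla u,\nabla u)=\Delta u+\sum_{i=1}^2A(u)\Big(\frac{\partial u}{\partial x^i},\frac{\partial u}{\partial x^i}\Big),$$ and $u$ is said to have free boundary $u(\partial^0D_2^+)$ on $K$ if, in the sense of traces, $u(x)\in K$ and $du(x)(\vec n)\perp T_{u(x)}K$ for a.e. $x\in\partial^0D_2^+$,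 where $\vec n=(0,-1)$ is the outward unit normal. Let $1<p\le 2$. Then there are constants $\epsilon_4>0$ and $C$, depending only on $p$ and on the pair $(N,K)$, such that the following holds. Let $u\in W^{2,p}(D_2^+,N)$ be a map with tension field $\tau(u)\in L^p(D_2^+)$ and with free boundary $u(\partial^0D_2^+)$ on $K$, and suppose that $$\|\nabla u\|_{L^2(D_2^+)}+\|\tau(u)\|_{L^p(D_2^+)}\le\epsilon_4 .$$ Then $$\Big\|u-\frac1{|D^+|}\int_{D^+}u\,dx\Big\|_{W^{2,p}(D_{1/2}^+)}\le C\big(\|\nabla u\|_{L^p(D^+)}+\|\tau(u)\|_{L^p(D^+)}\big).$$ Moreover, $u$ agrees a.e. on $D_{1/2}^+$ with a function that is continuous on $D_{1/2}^+$, and this continuous representative satisfies $$\sup_{x,y\in D_{1/2}^+}|u(x)-u(y)|\le C\big(\|\nabla u\|_{L^p(D^+)}+\|\tau(u)\|_{L^p(D^+)}\big).$$ -/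

import Mathlib

open MeasureTheory Set Filter Topology
open scoped ENNReal NNReal ContDiff

noncomputable section

namespace FreeBoundary

/-- Euclidean space `ℝ^d`. -/
abbrev Euc (d : ℕ) : Type := EuclideanSpace ℝ (Fin d)

/-! ### Half disks in the plane -/

/-- The closed half disk of radius `r` about the origin, `{x : |x| ≤ r, x² ≥ 0}`. -/
def closedHalfDisk (r : ℝ) : Set (Euc 2) := {x | ‖x‖ ≤ r ∧ 0 ≤ x 1}

/-- Its interior, `{x : |x| < r, x² > 0}`. -/
def openHalfDisk (r : ℝ) : Set (Euc 2) := {x | ‖x‖ < r ∧ 0 < x 1}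

theorem isOpen_openHalfDisk (r : ℝ) : IsOpen (openHalfDisk r) := by
  unfold openHalfDisk
  exact (isOpen_lt continuous_norm continuous_const).inter
    (isOpen_lt continuous_const
      (show Continuous fun x : Euc 2 => x 1 by fun_prop))

/-! ### Weak derivatives and Sobolev spaces on open sets of the plane -/

section Sobolev

variable {F : Type*} [NormedAddCommGroup F] [NormedSpace ℝ F]

/-- The classical partial derivative `∂f/∂xⁱ`. -/
def classicalPartial (i : Fin 2) (f : Euc 2 → F) (x : Euc 2) : F :=
  fderiv ℝ f x (EuclideanSpace.single i 1)

/-- `g` is a weak partial derivative `∂f/∂xⁱ` on the open set `Ω`: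
`∫_Ω (∂ᵢφ) f = - ∫_Ω φ g` for all `φ ∈ C_c^∞(Ω)`. -/
def IsWeakPartial (Ω : Set (Euc 2)) (i : Fin 2) (f g : Euc 2 → F) : Prop :=
  LocallyIntegrableOn f Ω volume ∧ LocallyIntegrableOn g Ω volume ∧
    ∀ φ : Euc 2 → ℝ, ContDiff ℝ ∞ φ → HasCompactSupport φ → tsupport φ ⊆ Ω →
      ∫ x in Ω, classicalPartial i φ x • f x = -∫ x in Ω, φ x • g x

/-- Weak partial derivatives are unique up to null sets. -/
theorem IsWeakPartial.ae_eq [CompleteSpace F] {Ω : Set (Euc 2)} (hΩ : IsOpen Ω) {i : Fin 2}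
    {f g h : Euc 2 → F} (hg : IsWeakPartial Ω i f g) (hh : IsWeakPartial Ω i f h) :
    g =ᵐ[volume.restrict Ω] h := by
  have hint : ∀ k : Euc 2 → F, LocallyIntegrableOn k Ω volume → ∀ φ : Euc 2 → ℝ,
      ContDiff ℝ ∞ φ → HasCompactSupport φ → tsupport φ ⊆ Ω →
      Integrable (fun x => φ x • k x) volume := by
    intro k hk φ hφ hc hs
    have h1 : IntegrableOn (fun x => φ x • k x) (tsupport φ) volume :=
      (hk.integrableOn_compact_subset hs hc).continuousOn_smul
        hφ.continuous.continuousOn hc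
    refine (integrableOn_iff_integrable_of_support_subset ?_).1 h1
    exact (Function.support_smul_subset_left φ k).trans (subset_tsupport φ)
  have key := hΩ.ae_eq_zero_of_integral_contDiff_smul_eq_zero (f := fun x => g x - h x)
    (hg.2.1.sub hh.2.1) (fun φ hφ hc hs => by
      have e := (hg.2.2 φ hφ hc hs).symm.trans (hh.2.2 φ hφ hc hs)
      have hz : ∀ x, x ∉ Ω → φ x = 0 := fun x hx =>
        image_eq_zero_of_notMem_tsupport (fun hx2 => hx (hs hx2))
      rw [setIntegral_eq_integral_of_forall_compl_eq_zero
          (fun x hx => by rw [hz x hx, zero_smul]),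
        setIntegral_eq_integral_of_forall_compl_eq_zero
          (fun x hx => by rw [hz x hx, zero_smul])] at e
      simp only [smul_sub]
      rw [integral_sub (hint g hg.2.1 φ hφ hc hs) (hint h hh.2.1 φ hφ hc hs), neg_inj.1 e,
        sub_self])
  rw [Filter.EventuallyEq, ae_restrict_iff' hΩ.measurableSet]
  filter_upwards [key] with x hx hxΩ
  exact sub_eq_zero.1 (hx hxΩ)

open Classical in
/-- The weak partial derivative `∂f/∂xⁱ` on `Ω`, defined up to null sets
(the value is `0` if there is none). -/
def weakPartial (Ω : Set (Euc 2)) (i : Fin 2) (f : Euc 2 → F) : Euc 2 → F :=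
  if h : ∃ g, IsWeakPartial Ω i f g then h.choose else 0

theorem isWeakPartial_weakPartial {Ω : Set (Euc 2)} {i : Fin 2} {f g : Euc 2 → F}
    (h : IsWeakPartial Ω i f g) : IsWeakPartial Ω i f (weakPartial Ω i f) := by
  have h2 : ∃ g, IsWeakPartial Ω i f g := ⟨g, h⟩
  rw [weakPartial, dif_pos h2]
  exact h2.choose_spec

/-- Membership in the Sobolev space `W^{k,p}(Ω)`. -/
def MemSobolev (Ω : Set (Euc 2)) (p : ℝ≥0∞) : ℕ → (Euc 2 → F) → Prop
  | 0, f => MemLp f p (volume.restrict Ω)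
  | k + 1, f => MemLp f p (volume.restrict Ω) ∧
      ∀ i, ∃ g, IsWeakPartial Ω i f g ∧ MemSobolev Ω p k g

/-- The length `|∇f|` of the weak gradient on `Ω`. -/
def gradNorm (Ω : Set (Euc 2)) (f : Euc 2 → F) (x : Euc 2) : ℝ :=
  √(∑ i, ‖weakPartial Ω i f x‖ ^ 2)

/-- The length `|∇²f|` of the weak Hessian on `Ω`. -/
def hessNorm (Ω : Set (Euc 2)) (f : Euc 2 → F) (x : Euc 2) : ℝ :=
  √(∑ i, ∑ j, ‖weakPartial Ω j (weakPartial Ω i f) x‖ ^ 2)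

/-- The weak Laplacian `∂₁∂₁f + ∂₂∂₂f` on `Ω`. -/
def weakLaplacian (Ω : Set (Euc 2)) (f : Euc 2 → F) (x : Euc 2) : F :=
  ∑ i, weakPartial Ω i (weakPartial Ω i f) x

/-- The norm `‖f‖_{L^p} + ‖∇f‖_{L^p} + ‖∇²f‖_{L^p}` of `W^{2,p}(Ω)`. -/
def sobolevNormTwo (Ω : Set (Euc 2)) (p : ℝ≥0∞) (f : Euc 2 → F) : ℝ≥0∞ :=
  eLpNorm f p (volume.restrict Ω) + eLpNorm (gradNorm Ω f) p (volume.restrict Ω) +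
    eLpNorm (hessNorm Ω f) p (volume.restrict Ω)

/-- `g ∈ L^p(-r, r)` is the trace of `f ∈ W^{1,p}` of the half disk of radius `r` on the flat
part `{(t, 0) : |t| < r}` of its boundary: functions that are smooth up to the boundary converge
to `f` in `W^{1,p}` of the half disk while their boundary values converge to `g` in `L^p`. -/
def IsTrace (r : ℝ) (p : ℝ≥0∞) (f : Euc 2 → F) (g : ℝ → F) : Prop :=
  MemLp g p (volume.restrict (Ioo (-r) r)) ∧
  ∃ w : ℕ → Euc 2 → F, (∀ m, ContDiff ℝ ∞ (w m)) ∧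
    Tendsto (fun m => eLpNorm (fun x => w m x - f x) p (volume.restrict (openHalfDisk r)))
      atTop (𝓝 0) ∧
    (∀ i, Tendsto (fun m => eLpNorm
        (fun x => classicalPartial i (w m) x - weakPartial (openHalfDisk r) i f x) p
        (volume.restrict (openHalfDisk r))) atTop (𝓝 0)) ∧
    Tendsto (fun m => eLpNorm (fun t => w m !₂[t, 0] - g t) p (volume.restrict (Ioo (-r) r)))
      atTop (𝓝 0)

end Sobolev

/-! ### Submanifolds of Euclidean space and their second fundamental form -/

/-- `S` is an `n`-dimensional smooth embedded submanifold (without boundary) of `ℝ^L`: near each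
of its points a diffeomorphism of open sets of `ℝ^L` straightens `S` to `ℝ^n × {0}`. -/
def IsSubmanifold {L : ℕ} (n : ℕ) (S : Set (Euc L)) : Prop :=
  n ≤ L ∧ ∀ y ∈ S, ∃ Φ : OpenPartialHomeomorph (Euc L) (Euc L), y ∈ Φ.source ∧
    ContDiffOn ℝ ∞ Φ Φ.source ∧ ContDiffOn ℝ ∞ Φ.symm Φ.target ∧
    ∀ z ∈ Φ.source, z ∈ S ↔ ∀ i : Fin L, n ≤ i.val → Φ z i = 0

/-- `S` is an `n`-dimensional smooth embedded submanifold of `ℝ^L` with (possibly empty) smooth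
boundary: near each of its points a diffeomorphism of open sets of `ℝ^L` straightens `S` either to
`ℝ^n × {0}` or to `{v ∈ ℝ^n : v₁ ≥ 0} × {0}` (the coordinates are numbered from `0` below). -/
def IsSubmanifoldWithBoundary {L : ℕ} (n : ℕ) (S : Set (Euc L)) : Prop :=
  n ≤ L ∧ ∀ y ∈ S, ∃ Φ : OpenPartialHomeomorph (Euc L) (Euc L), y ∈ Φ.source ∧
    ContDiffOn ℝ ∞ Φ Φ.source ∧ ContDiffOn ℝ ∞ Φ.symm Φ.target ∧
    ((∀ z ∈ Φ.source, z ∈ S ↔ ∀ i : Fin L, n ≤ i.val → Φ z i = 0) ∨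
     (∀ z ∈ Φ.source, z ∈ S ↔
        (∀ i : Fin L, n ≤ i.val → Φ z i = 0) ∧ ∀ i : Fin L, i.val = 0 → 0 ≤ Φ z i))

/-- The tangent space `T_y S`, as a linear subspace of `ℝ^L`. At a boundary point of a submanifold
with boundary this is still the full `n`-dimensional tangent space. -/
def tangentSpace {L : ℕ} (S : Set (Euc L)) (y : Euc L) : Submodule ℝ (Euc L) :=
  Submodule.span ℝ (tangentConeAt ℝ S y)

/-- The second fundamental form of `S ⊆ ℝ^L`, with the sign for which the harmonic map equation
reads `Δu + A(u)(∇u, ∇u) = 0`: for `X, Y ∈ T_y S`, minus the normal component of the derivative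
in the direction `X` of a tangential vector field on `S` that extends `Y`; the field taken is
`z ↦ (orthogonal projection of Y to T_z S)`. -/
def secondFundamentalForm {L : ℕ} (S : Set (Euc L)) (y X Y : Euc L) : Euc L :=
  -((tangentSpace S y)ᗮ.starProjection
      (fderivWithin ℝ (fun z => (tangentSpace S z).starProjection Y) S y X))

/-! ### Maps into a submanifold -/

/-- `u ∈ W^{2,p}(Ω, N)`. -/
def MemSobolevTwoMap {L : ℕ} (Ω : Set (Euc 2)) (p : ℝ≥0∞) (N : Set (Euc L))
    (u : Euc 2 → Euc L) : Prop :=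
  MemSobolev Ω p 2 u ∧ ∀ᵐ x ∂(volume.restrict Ω), u x ∈ N

/-- The tension field `τ(u) = Δu + A(u)(∇u, ∇u)` of a map `u : Ω → N ⊆ ℝ^L`. -/
def tension {L : ℕ} (Ω : Set (Euc 2)) (N : Set (Euc L)) (u : Euc 2 → Euc L) (x : Euc 2) :
    Euc L :=
  weakLaplacian Ω u x +
    ∑ i, secondFundamentalForm N (u x) (weakPartial Ω i u x) (weakPartial Ω i u x)

/-- `u`, defined on the half disk of radius `r`, has free boundary on `K` along the flat part of
the boundary: in the sense of traces, for a.e. boundary point `x`, `u(x) ∈ K` and the normal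
derivative (`-∂u/∂x²`, as the outward unit normal is `(0, -1)`) is orthogonal to `T_{u(x)} K`. -/
def HasFreeBoundary {L : ℕ} (r : ℝ) (p : ℝ≥0∞) (K : Set (Euc L)) (u : Euc 2 → Euc L) : Prop :=
  ∃ b d : ℝ → Euc L, IsTrace r p u b ∧
    IsTrace r p (fun x => -weakPartial (openHalfDisk r) 1 u x) d ∧
    ∀ᵐ t ∂(volume.restrict (Ioo (-r) r)),
      b t ∈ K ∧ ∀ v ∈ tangentSpace K (b t), inner ℝ (d t) v = 0

end FreeBoundary

end

open FreeBoundary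

/-! The free boundary problem is reduced to two scalar linear problems with homogeneous boundary
conditions. Let `P` be a compactly supported smooth map of `ℝ^L` that is the identity on `K` and
whose differential at points of `K` annihilates the vectors normal to `K`
(`exists_normalProjection`). Each component is split as `u = P(u) + (u - P(u))`. On the flat
boundary `u` lies in `K`, so `u - P(u)` has zero trace. The normal derivative of `u` is orthogonal
to `K`, so `DP(u)` applied to it has zero trace. Thus `P(u)` satisfies a Neumann condition and `u -
P(u)` a Dirichlet condition. The first function is extended evenly across the flat boundary, the
second oddly, and neither extension acquires a singular part of the Laplacian on the line. Since `P`
is defined on the whole of `ℝ^L`, the image of `u` need not be small or close to `K`.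

Both Laplacians are bounded by `|τ| + C |∇u|²`. The Laplacian of `P(u)` is `DP(u) Δu` plus a term
quadratic in `∇u`. On the compact manifold `N` the second fundamental form is bounded on tangent
vectors (`exists_secondFundamentalForm_le`), and the partial derivatives of `u` are tangent to `N`
almost everywhere. The Calderón–Zygmund inequality for the cut-off extensions, with the Poincaré
inequality for the terms of order zero, then bounds `χ ∇²u` in `L^p` by `τ`, `χ |∇u|²` and `∇u`
(`exists_halfDisk_estimate`, `exists_component_hessian_le`).

The quadratic term has the critical scaling of the plane: `‖χ q²‖_p ≤ C ‖q‖_2 (‖χ ∇q‖_p + ‖q‖_p)`,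
by Hölder's and Sobolev's inequalities (`exists_halfDisk_mul_sq_le`). With `q` a component of `∇u`,
small in `L²`, the Hessian on the right is absorbed. This is legitimate because `u ∈ W^{2,p}` makes
it finite beforehand (`exists_hessian_le`). Continuity and the oscillation estimate follow since in
the plane a function of compact support is bounded by the `L¹` norm of its mixed second derivative
(`exists_oscillation_le`).

The Calderón–Zygmund inequality (`exists_eLpNorm_pd_pd_le`) rests on smooth compactly supported
approximations of the logarithm, assembled from dyadic blocks. Convolution with their second
derivatives is bounded on `L²` by integration by parts. It satisfies the Hörmander condition
uniformly (`exists_hormander`), hence a weak type estimate, and integration over the levels gives `1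
< p < 2`.

Boundary conditions enter only in integrated form. The relation `Green` is tested with functions
that need not vanish on the flat boundary. Against a reflected function a test function becomes its
symmetrization, which vanishes there or not according to the parity, and this decides whether a
boundary condition is needed. Traces are limits of smooth functions, so these formulas come from the
divergence theorem by approximation (`green_comp`, `green_neumann`). -/

noncomputable section

namespace FreeBoundary

/-! ### Partial derivatives of scalar functions on the plane -/

/-- The partial derivative `∂f/∂xⁱ` of a scalar function. -/
def pd (i : Fin 2) (f : Euc 2 → ℝ) (x : Euc 2) : ℝ :=
  fderiv ℝ f x (EuclideanSpace.single i 1)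

theorem ContDiff.pd {f : Euc 2 → ℝ} (hf : ContDiff ℝ ∞ f) (i : Fin 2) : ContDiff ℝ ∞ (pd i f) :=
  (hf.fderiv_right (m := ∞) (by simp)).clm_apply contDiff_const

theorem tsupport_pd_subset (f : Euc 2 → ℝ) (i : Fin 2) : tsupport (pd i f) ⊆ tsupport f :=
  (closure_mono fun x hx => by
    contrapose! hx
    simp only [Function.mem_support, pd, not_not]
    simp [Function.notMem_support.1 hx]).trans (tsupport_fderiv_subset ℝ (f := f)) |>.trans le_rfl

theorem hasCompactSupport_pd {f : Euc 2 → ℝ} (hf : HasCompactSupport f) (i : Fin 2) :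
    HasCompactSupport (pd i f) :=
  hf.of_isClosed_subset (isClosed_tsupport _) (tsupport_pd_subset f i)

theorem pd_comm {f : Euc 2 → ℝ} (hf : ContDiff ℝ ∞ f) (i j : Fin 2) :
    pd i (pd j f) = pd j (pd i f) := by
  have hd : Differentiable ℝ (fderiv ℝ f) :=
    (hf.fderiv_right (m := 1) (by norm_cast)).differentiable (by simp)
  have key : ∀ (i j : Fin 2) x, pd i (pd j f) x =
      fderiv ℝ (fderiv ℝ f) x (EuclideanSpace.single i 1) (EuclideanSpace.single j 1) := by
    intro i j x
    have : pd j f = fun x => fderiv ℝ f x (EuclideanSpace.single j 1) := rfl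
    rw [this]
    simp only [pd]
    rw [fderiv_clm_apply (hd x) (differentiableAt_const _)]
    simp
  ext x
  rw [key, key]
  have hs : IsSymmSndFDerivAt ℝ f x :=
    (hf.contDiffAt (x := x)).isSymmSndFDerivAt
      (by simpa using (by norm_cast : ((2 : ℕ∞) : WithTop ℕ∞) ≤ ((⊤ : ℕ∞) : WithTop ℕ∞)))
  exact hs _ _

theorem pd_mul {f g : Euc 2 → ℝ} (hf : Differentiable ℝ f) (hg : Differentiable ℝ g) (i : Fin 2)
    (x : Euc 2) : pd i (fun x => f x * g x) x = pd i f x * g x + f x * pd i g x := by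
  simp only [pd]
  rw [fderiv_fun_mul (hf x) (hg x)]
  simp
  ring

theorem pd_add {f g : Euc 2 → ℝ} (hf : Differentiable ℝ f) (hg : Differentiable ℝ g) (i : Fin 2)
    (x : Euc 2) : pd i (fun x => f x + g x) x = pd i f x + pd i g x := by
  simp only [pd]
  rw [fderiv_fun_add (hf x) (hg x)]
  simp

theorem pd_sub {f g : Euc 2 → ℝ} (hf : Differentiable ℝ f) (hg : Differentiable ℝ g) (i : Fin 2)
    (x : Euc 2) : pd i (fun x => f x - g x) x = pd i f x - pd i g x := by
  simp only [pd]
  rw [fderiv_fun_sub (hf x) (hg x)]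
  simp

theorem pd_const_mul {f : Euc 2 → ℝ} (c : ℝ) (hf : Differentiable ℝ f) (i : Fin 2)
    (x : Euc 2) : pd i (fun x => c * f x) x = c * pd i f x := by
  simp only [pd]
  rw [fderiv_const_mul (hf x)]
  simp

theorem pd_comp_clm {f : Euc 2 → ℝ} (A : Euc 2 →L[ℝ] Euc 2) (hf : Differentiable ℝ f) (i : Fin 2)
    (x : Euc 2) :
    pd i (fun x => f (A x)) x = fderiv ℝ f (A x) (A (EuclideanSpace.single i 1)) := by
  simp only [pd]
  have := (hf (A x)).hasFDerivAt.comp x A.hasFDerivAt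
  have h2 := HasFDerivAt.fderiv this
  have h3 : (f ∘ ⇑A) = fun x => f (A x) := rfl
  rw [← h3, h2]
  rfl

theorem pd_comp_smul {f : Euc 2 → ℝ} (c : ℝ) (hf : Differentiable ℝ f) (i : Fin 2)
    (x : Euc 2) : pd i (fun x => f (c • x)) x = c * pd i f (c • x) := by
  have := pd_comp_clm (c • ContinuousLinearMap.id ℝ (Euc 2)) hf i x
  simpa [pd] using this

/-- The partial derivative of a translated reflection. -/
theorem pd_const_sub {f : Euc 2 → ℝ} (hf : Differentiable ℝ f) (i : Fin 2) (x y : Euc 2) :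
    pd i (fun y => f (x - y)) y = -pd i f (x - y) := by
  have h1 : HasFDerivAt (fun y : Euc 2 => x - y) (-ContinuousLinearMap.id ℝ (Euc 2)) y := by
    simpa using (hasFDerivAt_id y).const_sub x
  have h2 := ((hf (x - y)).hasFDerivAt.comp y h1).fderiv
  have h3 : (f ∘ fun y => x - y) = fun y => f (x - y) := rfl
  rw [h3] at h2
  simp [pd, h2]

/-- The Laplacian of a scalar function. -/
def lap (f : Euc 2 → ℝ) (x : Euc 2) : ℝ := ∑ i, pd i (pd i f) x

theorem ContDiff.lap {f : Euc 2 → ℝ} (hf : ContDiff ℝ ∞ f) : ContDiff ℝ ∞ (lap f) := by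
  unfold FreeBoundary.lap
  exact ContDiff.sum fun i _ => (hf.pd i).pd i

theorem tsupport_lap_subset (f : Euc 2 → ℝ) : tsupport (lap f) ⊆ tsupport f := by
  refine closure_minimal ?_ (isClosed_tsupport _)
  intro x hx
  by_contra h
  apply hx
  have : ∀ i, pd i (pd i f) x = 0 := fun i => image_eq_zero_of_notMem_tsupport
    fun hx => h (tsupport_pd_subset f i (tsupport_pd_subset _ i hx))
  simp [lap, this]

theorem hasCompactSupport_lap {f : Euc 2 → ℝ} (hf : HasCompactSupport f) :
    HasCompactSupport (lap f) :=
  hf.of_isClosed_subset (isClosed_tsupport _) (tsupport_lap_subset f)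

/-! ### Convolution -/

/-- The convolution `∫ k(x - y) g(y) dy` of scalar functions on the plane. -/
def conv (k g : Euc 2 → ℝ) (x : Euc 2) : ℝ := ∫ y, k (x - y) * g y

theorem conv_eq (k g : Euc 2 → ℝ) :
    conv k g = convolution g k (ContinuousLinearMap.mul ℝ ℝ) volume := by
  ext x
  rw [convolution_mul]
  simp only [conv, mul_comm]

theorem conv_comm (k g : Euc 2 → ℝ) : conv k g = conv g k := by
  ext x
  rw [conv_eq, conv, convolution_mul_swap]

theorem contDiff_conv {k g : Euc 2 → ℝ} (hk : ContDiff ℝ ∞ k) (hc : HasCompactSupport k)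
    (hg : LocallyIntegrable g) : ContDiff ℝ ∞ (conv k g) := by
  rw [conv_eq]
  exact hc.contDiff_convolution_right (n := ⊤) _ hg hk

theorem hasCompactSupport_conv {k g : Euc 2 → ℝ} (hk : HasCompactSupport k)
    (hg : HasCompactSupport g) : HasCompactSupport (conv k g) := by
  rw [conv_eq]
  exact hg.convolution _ hk

theorem pd_conv {k g : Euc 2 → ℝ} (hk : ContDiff ℝ ∞ k) (hc : HasCompactSupport k)
    (hg : LocallyIntegrable g) (i : Fin 2) : pd i (conv k g) = conv (pd i k) g := by
  ext x
  rw [conv_eq, conv_eq]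
  simp only [pd]
  have h1 : ContDiff ℝ 1 k := hk.of_le (by norm_cast)
  rw [(hc.hasFDerivAt_convolution_right _ hg h1 x).fderiv,
    convolution_precompR_apply _ hg (hc.fderiv ℝ) (h1.continuous_fderiv (by simp))]
  rfl

theorem lap_conv {k g : Euc 2 → ℝ} (hk : ContDiff ℝ ∞ k) (hc : HasCompactSupport k)
    (hg : LocallyIntegrable g) : lap (conv k g) = conv (lap k) g := by
  have h : ∀ i, pd i (pd i (conv k g)) = conv (pd i (pd i k)) g := fun i => by
    rw [pd_conv hk hc hg, pd_conv (hk.pd i) (hasCompactSupport_pd hc i) hg]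
  have hi : ∀ i x, Integrable fun y => pd i (pd i k) (x - y) * g y := fun i x => by
    have := (hasCompactSupport_pd (hasCompactSupport_pd hc i) i).convolutionExists_right
      (ContinuousLinearMap.mul ℝ ℝ) hg ((hk.pd i).pd i).continuous x
    simpa [ConvolutionExistsAt, mul_comm] using this
  ext x
  simp only [lap, h]
  simp only [conv]
  rw [← integral_finsetSum _ fun i _ => hi i x]
  simp only [lap, Finset.sum_mul]

theorem integrable_conv_integrand {k g : Euc 2 → ℝ} (hk : Continuous k) (hc : HasCompactSupport k)
    (hg : LocallyIntegrable g) (x : Euc 2) : Integrable fun y => k (x - y) * g y := by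
  have := hc.convolutionExists_right (ContinuousLinearMap.mul ℝ ℝ) hg hk x
  simpa [ConvolutionExistsAt, mul_comm] using this

/-! ### Young's inequality -/

/-- Hölder's inequality for the weight `K (x - ·)`, written as `K^(1 - 1/q) (K G^q)^(1/q)`, followed
by Tonelli's theorem. With integrals in `ℝ≥0∞` no integrability has to be known beforehand. -/
theorem lintegral_young {K G : Euc 2 → ℝ≥0∞} (hK : Measurable K) (hG : AEMeasurable G) {q : ℝ}
    (hq : 1 ≤ q) :
    ∫⁻ x, (∫⁻ y, K (x - y) * G y) ^ q ≤ (∫⁻ x, K x) ^ q * ∫⁻ x, G x ^ q := by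
  have hq0 : 0 < q := by linarith
  have hKs : ∀ x, ∫⁻ y, K (x - y) = ∫⁻ y, K y := fun x => lintegral_sub_left_eq_self K x
  have hKs' : ∀ y, ∫⁻ x, K (x - y) = ∫⁻ y, K y := fun x => lintegral_sub_right_eq_self K x
  have hKm : ∀ x, Measurable fun y => K (x - y) := fun x => hK.comp (measurable_const.sub measurable_id)
  have h1 : ∀ x, (∫⁻ y, K (x - y) * G y) ^ q ≤
      (∫⁻ y, K y) ^ (q - 1) * ∫⁻ y, K (x - y) * G y ^ q := by
    intro x
    have h2 := ENNReal.lintegral_mul_norm_pow_le (μ := volume) (f := fun y => K (x - y))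
      (g := fun y => K (x - y) * G y ^ q) (hKm x).aemeasurable
      ((hKm x).aemeasurable.mul (hG.pow_const q)) (p := 1 - 1 / q) (q := 1 / q)
      (by rw [sub_nonneg, div_le_one hq0]; exact hq) (by positivity) (by ring)
    have h3 : ∀ y, K (x - y) ^ (1 - 1 / q) * (K (x - y) * G y ^ q) ^ (1 / q) = K (x - y) * G y := by
      intro y
      rw [ENNReal.mul_rpow_of_nonneg _ _ (by positivity), ← mul_assoc,
        ← ENNReal.rpow_add_of_nonneg _ _ (by rw [sub_nonneg, div_le_one hq0]; exact hq)
          (by positivity), ← ENNReal.rpow_mul]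
      rw [mul_one_div_cancel hq0.ne']
      simp
    simp only [h3, hKs] at h2
    refine (ENNReal.rpow_le_rpow h2 hq0.le).trans_eq ?_
    rw [ENNReal.mul_rpow_of_nonneg _ _ hq0.le, ← ENNReal.rpow_mul, ← ENNReal.rpow_mul]
    congr 2
    · field_simp
    · rw [one_div_mul_cancel hq0.ne', ENNReal.rpow_one]
  refine (lintegral_mono h1).trans ?_
  have hm : AEMeasurable (fun z : Euc 2 × Euc 2 => K (z.1 - z.2) * G z.2 ^ q)
      (volume.prod volume) :=
    ((hK.comp (measurable_fst.sub measurable_snd)).aemeasurable).mul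
      ((hG.comp_snd).pow_const q)
  rw [lintegral_const_mul'' _ (hm.lintegral_prod_right'), lintegral_lintegral_swap hm]
  have h4 : ∀ᵐ y : Euc 2, ∫⁻ x, K (x - y) * G y ^ q = (∫⁻ x, K x) * G y ^ q := by
    refine Eventually.of_forall fun y => ?_
    rw [lintegral_mul_const (f := fun x => K (x - y)) _
      (hK.comp (measurable_id.sub measurable_const)), hKs']
  rw [lintegral_congr_ae h4, lintegral_const_mul'' _ (hG.pow_const q), ← mul_assoc]
  gcongr
  nth_rewrite 2 [← ENNReal.rpow_one (∫⁻ x, K x)]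
  rw [← ENNReal.rpow_add_of_nonneg _ _ (by linarith) (by norm_num), sub_add_cancel]

theorem eLpNorm_conv_le {k g : Euc 2 → ℝ} (hk : Measurable k) (hg : AEStronglyMeasurable g)
    {p : ℝ≥0∞} (hp : 1 ≤ p) (hp' : p ≠ ⊤) :
    eLpNorm (conv k g) p volume ≤ eLpNorm k 1 volume * eLpNorm g p volume := by
  have hp0 : p ≠ 0 := (zero_lt_one.trans_le hp).ne'
  have hq : 1 ≤ p.toReal := by
    have := ENNReal.toReal_mono hp' hp
    simpa using this
  have hq0 : 0 < p.toReal := by linarith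
  rw [eLpNorm_eq_lintegral_rpow_enorm_toReal hp0 hp', eLpNorm_eq_lintegral_rpow_enorm_toReal hp0 hp',
    eLpNorm_one_eq_lintegral_enorm]
  have h1 : ∀ x, ‖conv k g x‖ₑ ≤ ∫⁻ y, ‖k (x - y)‖ₑ * ‖g y‖ₑ := fun x => by
    refine (enorm_integral_le_lintegral_enorm _).trans_eq ?_
    simp only [enorm_mul]
  have h2 := lintegral_young (K := fun x => ‖k x‖ₑ) (G := fun x => ‖g x‖ₑ) hk.enorm hg.enorm hq
  refine (ENNReal.rpow_le_rpow ((lintegral_mono fun x =>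
    ENNReal.rpow_le_rpow (h1 x) hq0.le).trans h2) (by positivity)).trans_eq ?_
  rw [ENNReal.mul_rpow_of_nonneg _ _ (by positivity), ← ENNReal.rpow_mul,
    mul_one_div_cancel hq0.ne', ENNReal.rpow_one]

/-! ### Dyadic squares and the Calderón–Zygmund decomposition -/

/-- The index of the dyadic square of side `2⁻ᵏ` that contains `x`. -/
def dyadicIndex (k : ℤ) (x : Euc 2) : Fin 2 → ℤ := fun i => ⌊(2 : ℝ) ^ k * x i⌋

/-- The dyadic square of side `2⁻ᵏ` with index `n`. -/
def dyadicSquare (k : ℤ) (n : Fin 2 → ℤ) : Set (Euc 2) := {x | dyadicIndex k x = n}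

/-- The lower left corner of a dyadic square. -/
def dyadicCorner (k : ℤ) (n : Fin 2 → ℤ) : Euc 2 := WithLp.toLp 2 fun i => (2 : ℝ) ^ (-k) * n i

theorem dyadicIndex_corner (k : ℤ) (n : Fin 2 → ℤ) : dyadicIndex k (dyadicCorner k n) = n := by
  ext i
  simp only [dyadicIndex, dyadicCorner]
  rw [← mul_assoc, ← zpow_add₀ (by norm_num)]
  simp

theorem mem_dyadicSquare_iff {k : ℤ} {n : Fin 2 → ℤ} {x : Euc 2} :
    x ∈ dyadicSquare k n ↔
      ∀ i, x i ∈ Ico ((2 : ℝ) ^ (-k) * n i) ((2 : ℝ) ^ (-k) * (n i + 1)) := by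
  simp only [dyadicSquare, dyadicIndex, mem_ofPred_eq, funext_iff, Int.floor_eq_iff, mem_Ico]
  have h2 : (0 : ℝ) < 2 ^ k := by positivity
  refine forall_congr' fun i => ?_
  rw [zpow_neg, ← div_eq_inv_mul, ← div_eq_inv_mul, div_le_iff₀ h2, lt_div_iff₀ h2, mul_comm]

theorem dyadicSquare_eq_preimage (k : ℤ) (n : Fin 2 → ℤ) :
    dyadicSquare k n = (WithLp.ofLp : Euc 2 → Fin 2 → ℝ) ⁻¹' (Set.pi univ fun i =>
      Ico ((2 : ℝ) ^ (-k) * n i) ((2 : ℝ) ^ (-k) * (n i + 1))) := by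
  ext x
  rw [mem_dyadicSquare_iff]
  simp

theorem measurableSet_dyadicSquare (k : ℤ) (n : Fin 2 → ℤ) :
    MeasurableSet (dyadicSquare k n) := by
  rw [dyadicSquare_eq_preimage]
  exact (MeasurableSet.univ_pi fun i => measurableSet_Ico).preimage
    (PiLp.volume_preserving_ofLp (Fin 2)).measurable

theorem volume_dyadicSquare (k : ℤ) (n : Fin 2 → ℤ) :
    volume (dyadicSquare k n) = ENNReal.ofReal (((2 : ℝ) ^ (-k)) ^ 2) := by
  rw [dyadicSquare_eq_preimage, (PiLp.volume_preserving_ofLp (Fin 2)).measure_preimage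
    (MeasurableSet.univ_pi fun i => measurableSet_Ico).nullMeasurableSet, volume_pi_pi]
  simp only [Real.volume_Ico, Fin.prod_univ_two]
  rw [← ENNReal.ofReal_mul (by ring_nf; positivity)]
  congr 1
  ring

/-- The factor `3 / 2` is a rational bound for `√2`, the ratio of the diagonal to the side. -/
theorem dyadicSquare_subset_closedBall (k : ℤ) (n : Fin 2 → ℤ) :
    dyadicSquare k n ⊆ Metric.closedBall (dyadicCorner k n) (3 / 2 * (2 : ℝ) ^ (-k)) := by
  intro x hx
  rw [mem_dyadicSquare_iff] at hx
  have hs : (0 : ℝ) < 2 ^ (-k) := by positivity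
  rw [Metric.mem_closedBall, EuclideanSpace.dist_eq]
  refine Real.sqrt_le_iff.2 ⟨by positivity, ?_⟩
  have h : ∀ i, (dist (x i) (dyadicCorner k n i)) ^ 2 ≤ ((2 : ℝ) ^ (-k)) ^ 2 := by
    intro i
    rw [Real.dist_eq, sq_abs]
    have h1 := (hx i).1
    have h2 := (hx i).2
    have h3 : dyadicCorner k n i = (2 : ℝ) ^ (-k) * n i := rfl
    rw [h3]
    exact pow_le_pow_left₀ (by linarith) (by linarith) 2
  have := h 0
  have := h 1
  rw [Fin.sum_univ_two]
  nlinarith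

/-- Dyadic squares are nested: the floor of half a number depends only on the floor of the number.
-/
theorem dyadicIndex_pred {k : ℤ} {x y : Euc 2} (h : dyadicIndex k x = dyadicIndex k y) :
    dyadicIndex (k - 1) x = dyadicIndex (k - 1) y := by
  have key : ∀ z : Euc 2, ∀ i, dyadicIndex (k - 1) z i = dyadicIndex k z i / 2 := by
    intro z i
    simp only [dyadicIndex]
    rw [zpow_sub_one₀ (by norm_num : (2 : ℝ) ≠ 0)]
    have : (2 : ℝ) ^ k * 2⁻¹ * z i = (2 : ℝ) ^ k * z i / (2 : ℕ) := by push_cast; ring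
    rw [this, Int.floor_div_natCast]
    rfl
  ext i
  rw [key, key, h]

theorem dyadicIndex_of_le {j k : ℤ} (hjk : j ≤ k) {x y : Euc 2}
    (h : dyadicIndex k x = dyadicIndex k y) : dyadicIndex j x = dyadicIndex j y := by
  obtain ⟨m, rfl⟩ : ∃ m : ℕ, j = k - m := ⟨(k - j).toNat, by omega⟩
  clear hjk
  induction m with
  | zero => simpa using h
  | succ m ih =>
    have := dyadicIndex_pred ih
    rwa [show k - ((m + 1 : ℕ) : ℤ) = k - m - 1 by push_cast; ring]

/-- The Calderón–Zygmund decomposition of the domain of a continuous function with compact support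
at the level `l`: outside a disjoint union of squares, on each of which the mean value of the
function is comparable to `l`, the function is bounded by `l`. -/
theorem exists_calderonZygmund_squares {f : Euc 2 → ℝ} (hf : Continuous f)
    (hc : HasCompactSupport f) {l : ℝ} (hl : 0 < l) :
    ∃ (ι : Type) (_ : Countable ι) (Q : ι → Set (Euc 2)) (c : ι → Euc 2) (s : ι → ℝ),
      (∀ i, 0 < s i) ∧ (∀ i, MeasurableSet (Q i)) ∧ Pairwise (Function.onFun Disjoint Q) ∧
      (∀ i, volume (Q i) = ENNReal.ofReal (s i ^ 2)) ∧
      (∀ i, Q i ⊆ Metric.closedBall (c i) (3 / 2 * s i)) ∧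
      (∀ i, ENNReal.ofReal l * volume (Q i) ≤ ∫⁻ x in Q i, ‖f x‖ₑ) ∧
      (∀ i, ∫⁻ x in Q i, ‖f x‖ₑ ≤ ENNReal.ofReal (4 * l) * volume (Q i)) ∧
      ∀ x, x ∉ ⋃ i, Q i → |f x| ≤ l := by
  have hfi : Integrable f := hf.integrable_of_hasCompactSupport hc
  set T : ℝ≥0∞ := ∫⁻ x, ‖f x‖ₑ with hT
  have hTfin : T < ⊤ := hfi.2
  let big : ℤ → (Fin 2 → ℤ) → Prop := fun k n =>
    ENNReal.ofReal l * volume (dyadicSquare k n) < ∫⁻ x in dyadicSquare k n, ‖f x‖ₑ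
  -- The maximal squares among those on which the mean of `|f|` exceeds `l`. Maximality is expressed
  -- through the points of the square, whose larger dyadic squares must not be big.
  let I : Set (ℤ × (Fin 2 → ℤ)) := {i | big i.1 i.2 ∧
    ∀ x ∈ dyadicSquare i.1 i.2, ∀ j < i.1, ¬ big j (dyadicIndex j x)}
  have hmem : ∀ k x, x ∈ dyadicSquare k (dyadicIndex k x) := fun k x => rfl
  -- Squares of large side are not selected.
  obtain ⟨k₀, hk₀⟩ : ∃ k₀ : ℤ, ∀ k ≤ k₀, ∀ n, ¬ big k n := by
    obtain ⟨m, hm⟩ := pow_unbounded_of_one_lt (T.toReal / l) (by norm_num : (1 : ℝ) < 4)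
    refine ⟨-m, fun k hk n hb => ?_⟩
    have h1 : ENNReal.ofReal l * volume (dyadicSquare k n) < T :=
      hb.trans_le (setLIntegral_le_lintegral _ _)
    rw [volume_dyadicSquare, ← ENNReal.ofReal_mul hl.le,
      ← ENNReal.ofReal_toReal hTfin.ne, ENNReal.ofReal_lt_ofReal_iff_of_nonneg (by positivity)] at h1
    rw [div_lt_iff₀ hl] at hm
    have h2 : (4 : ℝ) ^ m ≤ ((2 : ℝ) ^ (-k)) ^ 2 := by
      have : (2 : ℝ) ^ (m : ℤ) ≤ 2 ^ (-k) := zpow_le_zpow_right₀ (by norm_num) (by omega)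
      rw [zpow_natCast] at this
      calc (4 : ℝ) ^ m = (2 ^ m) ^ 2 := by rw [← pow_mul, mul_comm, pow_mul]; norm_num
        _ ≤ _ := pow_le_pow_left₀ (by positivity) this 2
    nlinarith
  refine ⟨I, inferInstance, fun i => dyadicSquare i.1.1 i.1.2, fun i => dyadicCorner i.1.1 i.1.2,
    fun i => 2 ^ (-i.1.1), fun i => by positivity, fun i => measurableSet_dyadicSquare _ _, ?_,
    fun i => volume_dyadicSquare _ _, fun i => dyadicSquare_subset_closedBall _ _,
    fun i => i.2.1.le, ?_, ?_⟩
  · rintro ⟨⟨k, n⟩, hi⟩ ⟨⟨k', n'⟩, hi'⟩ hne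
    rw [Function.onFun, Set.disjoint_left]
    intro x hx hx'
    simp only at hx hx'
    have e1 : dyadicIndex k x = n := hx
    have e2 : dyadicIndex k' x = n' := hx'
    rcases lt_trichotomy k k' with h | h | h
    · exact hi'.2 x hx' k h (e1 ▸ hi.1)
    · subst h
      exact hne (by simp [← e1, ← e2])
    · exact hi.2 x hx k' h (e2 ▸ hi'.1)
  · rintro ⟨⟨k, n⟩, hi⟩
    simp only
    set x := dyadicCorner k n
    have hx : dyadicIndex k x = n := dyadicIndex_corner k n
    have hsub : dyadicSquare k n ⊆ dyadicSquare (k - 1) (dyadicIndex (k - 1) x) := fun y hy =>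
      dyadicIndex_pred ((show dyadicIndex k y = n from hy).trans hx.symm)
    -- The parent square is not big and has four times the area; this is the factor `4` in the upper
    -- bound.
    have h := hi.2 x hx (k - 1) (sub_one_lt k)
    refine (lintegral_mono_set hsub).trans ((not_lt.1 h).trans_eq ?_)
    rw [volume_dyadicSquare, volume_dyadicSquare, ← ENNReal.ofReal_mul hl.le,
      ← ENNReal.ofReal_mul (by positivity)]
    congr 1
    rw [show -(k - 1) = -k + 1 by ring, zpow_add_one₀ (by norm_num)]
    ring
  · intro x hx
    -- If some square about `x` were big, there would be a largest one, because squares of large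
    -- side are not big. That one would be selected and would contain `x`.
    have hsmall : ∀ k, ¬ big k (dyadicIndex k x) := by
      by_contra! hcon
      obtain ⟨k₁, hk₁⟩ := hcon
      obtain ⟨k, hk, hkmin⟩ := Int.exists_least_of_bdd (P := fun k => big k (dyadicIndex k x))
        ⟨k₀, fun z hz => by
          by_contra! h
          exact hk₀ z h.le _ hz⟩ ⟨k₁, hk₁⟩
      refine hx (mem_iUnion.2 ⟨⟨(k, dyadicIndex k x), hk, fun y hy j hj hb => ?_⟩, hmem k x⟩)
      have : dyadicIndex j y = dyadicIndex j x := dyadicIndex_of_le hj.le hy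
      replace hb : big j (dyadicIndex j y) := hb
      rw [this] at hb
      exact absurd (hkmin j hb) (not_le.2 hj)
    -- Continuity of `f` takes the place of the differentiation theorem: where `|f| > l`, all
    -- sufficiently small squares about the point are big.
    by_contra! hlt
    obtain ⟨δ, hδ, hball⟩ := Metric.isOpen_iff.1
      (isOpen_lt continuous_const hf.abs : IsOpen {y | l < |f y|}) x hlt
    obtain ⟨m, hm⟩ := exists_pow_lt_of_lt_one (show 0 < δ / 3 by positivity)
      (by norm_num : (1 / 2 : ℝ) < 1)
    have hm2 : (2 : ℝ) ^ (-(m : ℤ)) < δ / 3 := by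
      rw [zpow_neg, zpow_natCast, ← inv_pow]
      simpa using hm
    refine hsmall m ?_
    simp only [big]
    set Q := dyadicSquare m (dyadicIndex m x)
    have hQ : ∀ y ∈ Q, l < |f y| := by
      intro y hy
      apply hball
      have h1 := dyadicSquare_subset_closedBall _ _ hy
      have h2 := dyadicSquare_subset_closedBall _ _ (hmem m x)
      rw [Metric.mem_closedBall] at h1 h2
      rw [Metric.mem_ball]
      have := dist_triangle_right y x (dyadicCorner m (dyadicIndex m x))
      linarith
    have hQm : MeasurableSet Q := measurableSet_dyadicSquare _ _
    rw [← setLIntegral_const]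
    refine setLIntegral_strict_mono hQm ?_ hf.measurable.enorm ?_ ?_
    · rw [volume_dyadicSquare]
      simp
    · simp [Q, volume_dyadicSquare, ENNReal.mul_eq_top]
    · refine Eventually.of_forall fun y hy => ?_
      rw [← ofReal_norm, Real.norm_eq_abs]
      exact (ENNReal.ofReal_lt_ofReal_iff (hl.trans (hQ y hy))).2 (hQ y hy)

/-! ### The weak type estimate for singular convolution operators. -/

theorem eLpNorm_two_sq {α : Type*} [MeasurableSpace α] {E : Type*} [NormedAddCommGroup E]
    (g : α → E) (μ : Measure α) :
    eLpNorm g 2 μ ^ 2 = ∫⁻ x, ‖g x‖ₑ ^ 2 ∂μ := by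
  have := eLpNorm_nnreal_pow_eq_lintegral (f := g) (μ := μ) (p := 2) (by norm_num)
  simpa using this

/-- The weak type estimate for a convolution operator that is bounded on `L²` and satisfies the
Hörmander condition. -/
theorem volume_conv_gt_le {k : Euc 2 → ℝ} (hk : Continuous k) (hkc : HasCompactSupport k)
    {A B : ℝ≥0∞}
    (hA : ∀ g, MemLp g 1 volume → MemLp g 2 volume →
      eLpNorm (conv k g) 2 volume ≤ A * eLpNorm g 2 volume)
    (hB : ∀ y, ∫⁻ x in {x | 2 * ‖y‖ < ‖x‖}, ‖k (x - y) - k x‖ₑ ≤ B)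
    {f : Euc 2 → ℝ} (hf : Continuous f) (hc : HasCompactSupport f) {l : ℝ} (hl : 0 < l) :
    volume {x | 2 * l < |conv k f x|} ≤
      (16 * A ^ 2 + 8 * B + 40) * (ENNReal.ofReal (2 / l) *
        ∫⁻ x in {x | l / 2 < |f x|}, ‖f x‖ₑ) +
      A ^ 2 * (ENNReal.ofReal (l⁻¹ ^ 2) * ∫⁻ x in {x | |f x| ≤ l}, ‖f x‖ₑ ^ 2) := by
  classical
  obtain ⟨ι, _, Q, c, s, hs, hQm, hdisj, hvol, hball, hlow, hup, hout⟩ :=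
    exists_calderonZygmund_squares hf hc hl
  have hfi : Integrable f := hf.integrable_of_hasCompactSupport hc
  set Ω : Set (Euc 2) := ⋃ i, Q i with hΩ
  have hΩm : MeasurableSet Ω := MeasurableSet.iUnion hQm
  set V := volume Ω with hV
  have hVsum : V = ∑' i, volume (Q i) := measure_iUnion hdisj hQm
  have hfΩ : ∫⁻ x in Ω, ‖f x‖ₑ = ∑' i, ∫⁻ x in Q i, ‖f x‖ₑ := lintegral_iUnion hQm hdisj _
  have hlV : ENNReal.ofReal l * V ≤ ∫⁻ x in Ω, ‖f x‖ₑ := by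
    rw [hVsum, ← ENNReal.tsum_mul_left, hfΩ]
    exact ENNReal.tsum_le_tsum hlow
  have hfV : ∫⁻ x in Ω, ‖f x‖ₑ ≤ ENNReal.ofReal (4 * l) * V := by
    rw [hVsum, ← ENNReal.tsum_mul_left, hfΩ]
    exact ENNReal.tsum_le_tsum hup
  have hl0 : ENNReal.ofReal l ≠ 0 := by simpa using hl
  have hVfin : V ≠ ⊤ := by
    intro h
    rw [h, ENNReal.mul_top hl0] at hlV
    exact absurd (hlV.trans (setLIntegral_le_lintegral _ _)) (not_le.2 hfi.2)
  -- On the squares the values with `|f| ≤ l / 2` contribute at most half of `l V`, which is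
  -- absorbed. Hence only large values of `f` enter, and the estimate can later be integrated over
  -- `l` without splitting `f` at each level.
  have hVbound : V ≤ ENNReal.ofReal (2 / l) * ∫⁻ x in {x | l / 2 < |f x|}, ‖f x‖ₑ := by
    set J := ∫⁻ x in {x | l / 2 < |f x|}, ‖f x‖ₑ with hJ
    have hm : MeasurableSet {x | l / 2 < |f x|} := (isOpen_lt continuous_const hf.abs).measurableSet
    have h1 : ∫⁻ x in Ω, ‖f x‖ₑ ≤ J + ENNReal.ofReal (l / 2) * V := by
      calc ∫⁻ x in Ω, ‖f x‖ₑ ≤ ∫⁻ x in Ω, ({x | l / 2 < |f x|}.indicator (fun x => ‖f x‖ₑ) x +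
              ENNReal.ofReal (l / 2)) := by
            refine lintegral_mono fun x => ?_
            by_cases hx : l / 2 < |f x|
            · rw [indicator_of_mem (show x ∈ {x | l / 2 < |f x|} from hx)]
              exact le_self_add
            · refine le_trans ?_ le_add_self
              rw [← ofReal_norm]
              exact ENNReal.ofReal_le_ofReal (not_lt.1 hx)
        _ = (∫⁻ x in Ω, {x | l / 2 < |f x|}.indicator (fun x => ‖f x‖ₑ) x) +
              ENNReal.ofReal (l / 2) * V := by
            rw [lintegral_add_right _ measurable_const, setLIntegral_const]
        _ ≤ _ := by
            gcongr
            refine (setLIntegral_le_lintegral _ _).trans_eq ?_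
            rw [lintegral_indicator hm]
    have h2 : ENNReal.ofReal (l / 2) * V ≤ J := by
      have h3 := hlV.trans h1
      rw [show l = l / 2 + l / 2 by ring, ENNReal.ofReal_add (by positivity) (by positivity),
        add_mul] at h3
      have e : l / 2 + l / 2 = l := by ring
      rw [e] at h3
      exact (ENNReal.add_le_add_iff_right (ENNReal.mul_ne_top ENNReal.ofReal_ne_top hVfin)).1 h3
    calc V = ENNReal.ofReal (2 / l) * (ENNReal.ofReal (l / 2) * V) := by
          rw [← mul_assoc, ← ENNReal.ofReal_mul (by positivity)]
          rw [show 2 / l * (l / 2) = 1 by field_simp]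
          simp
      _ ≤ _ := by gcongr
  -- The good part and the bad part.
  let avg : ι → ℝ := fun i => ⨍ x in Q i, f x
  let g : Euc 2 → ℝ := fun x => if h : ∃ i, x ∈ Q i then avg h.choose else f x
  -- The squares are disjoint, so the choice of a square in the definition of `g` does not matter.
  have hgQ : ∀ i, ∀ x ∈ Q i, g x = avg i := by
    intro i x hx
    have h : ∃ i, x ∈ Q i := ⟨i, hx⟩
    simp only [g, dif_pos h]
    congr 1
    by_contra hne
    exact Set.disjoint_left.1 (hdisj hne) h.choose_spec hx
  have hgo : ∀ x, x ∉ Ω → g x = f x := by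
    intro x hx
    have h : ¬ ∃ i, x ∈ Q i := by simpa [hΩ] using hx
    simp only [g, dif_neg h]
  have havg : ∀ i, |avg i| ≤ 4 * l := by
    intro i
    have hv : volume.real (Q i) = s i ^ 2 := by
      rw [Measure.real, hvol, ENNReal.toReal_ofReal (by positivity)]
    have hsi : 0 < s i ^ 2 := pow_pos (hs i) 2
    simp only [avg]
    rw [setAverage_eq, hv, smul_eq_mul, abs_mul, abs_of_pos (inv_pos.2 hsi), inv_mul_le_iff₀ hsi]
    have h1 : |∫ x in Q i, f x| ≤ ∫ x in Q i, ‖f x‖ := by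
      rw [← Real.norm_eq_abs]; exact norm_integral_le_integral_norm _
    refine h1.trans ?_
    rw [integral_norm_eq_lintegral_enorm hf.aestronglyMeasurable.restrict]
    have h2 := ENNReal.toReal_mono (by rw [hvol]; simp [ENNReal.mul_eq_top]) (hup i)
    rw [ENNReal.toReal_mul, hvol, ENNReal.toReal_ofReal (by positivity),
      ENNReal.toReal_ofReal (by positivity)] at h2
    linarith
  have hgm : Measurable g := by
    intro S hS
    have : g ⁻¹' S = (Ωᶜ ∩ f ⁻¹' S) ∪ ⋃ i, ⋃ _ : avg i ∈ S, Q i := by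
      ext x
      by_cases hx : x ∈ Ω
      · obtain ⟨i, hi⟩ := mem_iUnion.1 hx
        constructor
        · intro h
          refine Or.inr (mem_iUnion₂.2 ⟨i, ?_, hi⟩)
          rw [← hgQ i x hi]; exact h
        · rintro (h | h)
          · exact absurd hx h.1
          · obtain ⟨j, hj, hxj⟩ := mem_iUnion₂.1 h
            simp only [mem_preimage]
            rwa [hgQ j x hxj]
      · constructor
        · intro h
          exact Or.inl ⟨hx, by simpa only [mem_preimage, hgo x hx] using h⟩
        · rintro (h | h)
          · simpa only [mem_preimage, hgo x hx] using h.2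
          · obtain ⟨j, hj, hxj⟩ := mem_iUnion₂.1 h
            exact absurd (mem_iUnion.2 ⟨j, hxj⟩) hx
    rw [this]
    exact (hΩm.compl.inter (hf.measurable hS)).union
      (MeasurableSet.iUnion fun i => MeasurableSet.iUnion fun _ => hQm i)
  have hgΩ : ∀ x ∈ Ω, ‖g x‖ₑ ≤ ENNReal.ofReal (4 * l) := by
    intro x hx
    obtain ⟨i, hi⟩ := mem_iUnion.1 hx
    rw [hgQ i x hi, ← ofReal_norm]
    exact ENNReal.ofReal_le_ofReal (havg i)
  have hg1 : Integrable g := by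
    refine ⟨hgm.aestronglyMeasurable, ?_⟩
    rw [HasFiniteIntegral, ← lintegral_add_compl _ hΩm]
    refine ENNReal.add_lt_top.2 ⟨?_, ?_⟩
    · calc ∫⁻ x in Ω, ‖g x‖ₑ ≤ ∫⁻ x in Ω, ENNReal.ofReal (4 * l) :=
            setLIntegral_mono' hΩm hgΩ
        _ < ⊤ := by
            rw [setLIntegral_const]
            exact ENNReal.mul_lt_top ENNReal.ofReal_lt_top hVfin.lt_top
    · calc ∫⁻ x in Ωᶜ, ‖g x‖ₑ = ∫⁻ x in Ωᶜ, ‖f x‖ₑ :=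
            setLIntegral_congr_fun hΩm.compl fun x hx => by simp only [hgo x hx]
        _ ≤ _ := setLIntegral_le_lintegral _ _
        _ < ⊤ := hfi.2
  set S2 := ∫⁻ x in {x | |f x| ≤ l}, ‖f x‖ₑ ^ 2 with hS2
  have hS2m : MeasurableSet {x | |f x| ≤ l} := (isClosed_le hf.abs continuous_const).measurableSet
  have hg2 : ∫⁻ x, ‖g x‖ₑ ^ 2 ≤ ENNReal.ofReal (16 * l ^ 2) * V + S2 := by
    rw [← lintegral_add_compl _ hΩm]
    refine add_le_add ?_ ?_
    · calc ∫⁻ x in Ω, ‖g x‖ₑ ^ 2 ≤ ∫⁻ x in Ω, ENNReal.ofReal (4 * l) ^ 2 :=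
            setLIntegral_mono' hΩm fun x hx => by gcongr; exact hgΩ x hx
        _ = _ := by
            rw [setLIntegral_const, ← ENNReal.ofReal_pow (by positivity)]
            congr 2
            ring
    · calc ∫⁻ x in Ωᶜ, ‖g x‖ₑ ^ 2 = ∫⁻ x in Ωᶜ, ‖f x‖ₑ ^ 2 :=
            setLIntegral_congr_fun hΩm.compl fun x hx => by simp only [hgo x hx]
        _ ≤ _ := lintegral_mono_set fun x hx => hout x hx
  have hS2fin : S2 < ⊤ := by
    refine (setLIntegral_le_lintegral _ _).trans_lt ?_
    have h := (hf.memLp_of_hasCompactSupport (p := 2) (μ := volume) hc).2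
    rw [← eLpNorm_two_sq]
    exact ENNReal.pow_lt_top h
  have hgL2 : MemLp g 2 volume := by
    refine ⟨hgm.aestronglyMeasurable, ?_⟩
    have : eLpNorm g 2 volume ^ 2 < ⊤ := by
      rw [eLpNorm_two_sq]
      exact hg2.trans_lt (ENNReal.add_lt_top.2
        ⟨ENNReal.mul_lt_top ENNReal.ofReal_lt_top hVfin.lt_top, hS2fin⟩)
    by_contra h
    rw [not_lt, top_le_iff] at h
    simp [h] at this
  let b : Euc 2 → ℝ := fun x => f x - g x
  have hb1 : Integrable b := hfi.sub hg1
  have hbo : ∀ x, x ∉ Ω → b x = 0 := fun x hx => by simp [b, hgo x hx]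
  have hbQ : ∀ i, ∫ x in Q i, b x = 0 := by
    intro i
    have h1 : ∫ x in Q i, b x = ∫ x in Q i, (f x - avg i) :=
      setIntegral_congr_fun (hQm i) fun x hx => by simp only [b, hgQ i x hx]
    have hv : volume.real (Q i) = s i ^ 2 := by
      rw [Measure.real, hvol, ENNReal.toReal_ofReal (by positivity)]
    have hsi : 0 < s i ^ 2 := pow_pos (hs i) 2
    rw [h1, integral_sub hfi.integrableOn (by rw [integrable_const_iff]; right; exact ⟨by simp [hvol]⟩),
      setIntegral_const]
    simp only [avg]
    rw [setAverage_eq, hv, smul_eq_mul, smul_eq_mul, ← mul_assoc, mul_inv_cancel₀ hsi.ne', one_mul,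
      sub_self]
  have hbΩ : ∫⁻ x in Ω, ‖b x‖ₑ ≤ ENNReal.ofReal (8 * l) * V := by
    calc ∫⁻ x in Ω, ‖b x‖ₑ ≤ ∫⁻ x in Ω, (‖f x‖ₑ + ‖g x‖ₑ) :=
          lintegral_mono fun x => enorm_sub_le
      _ = (∫⁻ x in Ω, ‖f x‖ₑ) + ∫⁻ x in Ω, ‖g x‖ₑ := lintegral_add_left hf.measurable.enorm _
      _ ≤ ENNReal.ofReal (4 * l) * V + ∫⁻ x in Ω, ENNReal.ofReal (4 * l) := by
          gcongr ?_ + ?_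
          exact setLIntegral_mono' hΩm hgΩ
      _ = _ := by
          rw [setLIntegral_const, ← add_mul, ← ENNReal.ofReal_add (by positivity) (by positivity)]
          congr 2
          ring
  have hsplit : ∀ x, conv k f x = conv k g x + conv k b x := by
    intro x
    simp only [conv]
    rw [← integral_add (integrable_conv_integrand hk hkc hg1.locallyIntegrable x)
      (integrable_conv_integrand hk hkc hb1.locallyIntegrable x)]
    congr 1
    ext y
    simp only [b]
    ring
  -- The exceptional set.
  let Ω' : Set (Euc 2) := ⋃ i, Metric.closedBall (c i) (3 * s i)
  have hΩ'm : MeasurableSet Ω' := MeasurableSet.iUnion fun i => measurableSet_closedBall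
  -- Each ball has `9π` times the area of its square, and `9π < 40`.
  have hΩ'V : volume Ω' ≤ 40 * V := by
    refine (measure_iUnion_le _).trans ?_
    rw [hVsum, ← ENNReal.tsum_mul_left]
    refine ENNReal.tsum_le_tsum fun i => ?_
    have hsi := hs i
    rw [EuclideanSpace.volume_closedBall_fin_two, hvol, ← ENNReal.ofReal_pow (by positivity)]
    rw [← ENNReal.ofReal_mul (by positivity), show (40 : ℝ≥0∞) = ENNReal.ofReal 40 by simp,
      ← ENNReal.ofReal_mul (by positivity)]
    apply ENNReal.ofReal_le_ofReal
    nlinarith [Real.pi_lt_four, sq_nonneg (s i)]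
  -- The bad part has mean zero over each square, so the value of the kernel at the centre may be
  -- subtracted.
  have hconvb : ∀ x, ‖conv k b x‖ₑ ≤
      ∑' i, ∫⁻ y in Q i, ‖k (x - y) - k (x - c i)‖ₑ * ‖b y‖ₑ := by
    intro x
    have hint := integrable_conv_integrand hk hkc hb1.locallyIntegrable x
    have h1 : conv k b x = ∫ y in Ω, k (x - y) * b y := by
      rw [conv, setIntegral_eq_integral_of_forall_compl_eq_zero]
      intro y hy
      rw [hbo y hy, mul_zero]
    have h2 := hasSum_integral_iUnion (μ := volume) (f := fun y => k (x - y) * b y)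
      hQm hdisj hint.integrableOn
    rw [h1, ← h2.tsum_eq]
    have h4 : ∀ i, ∫ y in Q i, k (x - y) * b y =
        ∫ y in Q i, (k (x - y) - k (x - c i)) * b y := by
      intro i
      simp only [sub_mul]
      rw [integral_sub hint.integrableOn (hb1.integrableOn.const_mul _),
        integral_const_mul, hbQ i, mul_zero, sub_zero]
    refine enorm_tsum_le_tsum_enorm.trans (ENNReal.tsum_le_tsum fun i => ?_)
    rw [h4]
    refine (enorm_integral_le_lintegral_enorm _).trans_eq ?_
    simp only [enorm_mul]
  -- A point `y` of a square satisfies `|y - c| ≤ 3 s / 2`. Outside the ball of radius `3 s` one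
  -- therefore has `|x - c| > 2 |y - c|`, the region of the Hörmander condition.
  have hbad : ∫⁻ x in Ω'ᶜ, ‖conv k b x‖ₑ ≤ B * (ENNReal.ofReal (8 * l) * V) := by
    have hbm : AEMeasurable (fun y => ‖b y‖ₑ) volume := hb1.aestronglyMeasurable.enorm
    have hkm2 : ∀ i, Measurable fun z : Euc 2 × Euc 2 => ‖k (z.1 - z.2) - k (z.1 - c i)‖ₑ :=
      fun i => ((hk.comp (continuous_fst.sub continuous_snd)).sub
        (hk.comp (continuous_fst.sub continuous_const))).measurable.enorm
    have hjm : ∀ i, AEMeasurable (fun z : Euc 2 × Euc 2 =>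
        ‖k (z.1 - z.2) - k (z.1 - c i)‖ₑ * ‖b z.2‖ₑ)
        ((volume.restrict Ω'ᶜ).prod (volume.restrict (Q i))) := fun i =>
      (hkm2 i).aemeasurable.mul (hbm.restrict.comp_snd)
    calc ∫⁻ x in Ω'ᶜ, ‖conv k b x‖ₑ
        ≤ ∫⁻ x in Ω'ᶜ, ∑' i, ∫⁻ y in Q i, ‖k (x - y) - k (x - c i)‖ₑ * ‖b y‖ₑ :=
          lintegral_mono hconvb
      _ = ∑' i, ∫⁻ x in Ω'ᶜ, ∫⁻ y in Q i, ‖k (x - y) - k (x - c i)‖ₑ * ‖b y‖ₑ :=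
          lintegral_tsum fun i => (hjm i).lintegral_prod_right'
      _ ≤ ∑' i, ∫⁻ y in Q i, B * ‖b y‖ₑ := by
          refine ENNReal.tsum_le_tsum fun i => ?_
          rw [lintegral_lintegral_swap (hjm i)]
          refine setLIntegral_mono_ae (hbm.const_mul B).restrict (Eventually.of_forall fun y hy => ?_)
          have hm1 : Measurable fun x => ‖k (x - y) - k (x - c i)‖ₑ :=
            (hkm2 i).comp (measurable_id.prodMk measurable_const)
          rw [lintegral_mul_const _ hm1]
          gcongr
          have hyc := hball i hy
          rw [Metric.mem_closedBall, dist_eq_norm] at hyc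
          refine le_trans ?_ (hB (y - c i))
          have hsub : Ω'ᶜ ⊆ (fun x => x - c i) ⁻¹' {x | 2 * ‖y - c i‖ < ‖x‖} := by
            intro x hx
            have h3 : x ∉ Metric.closedBall (c i) (3 * s i) := fun h => hx (mem_iUnion.2 ⟨i, h⟩)
            rw [Metric.mem_closedBall, dist_eq_norm, not_le] at h3
            simp only [mem_preimage, mem_ofPred_eq]
            linarith
          refine (lintegral_mono_set hsub).trans_eq ?_
          have hmS : MeasurableSet {x : Euc 2 | 2 * ‖y - c i‖ < ‖x‖} :=
            (isOpen_lt continuous_const continuous_norm).measurableSet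
          rw [← (measurePreserving_sub_right volume (c i)).setLIntegral_comp_preimage_emb
            (MeasurableEquiv.subRight (c i)).measurableEmbedding
            (fun x => ‖k (x - (y - c i)) - k x‖ₑ) {x : Euc 2 | 2 * ‖y - c i‖ < ‖x‖}]
          refine lintegral_congr fun x => ?_
          rw [show x - c i - (y - c i) = x - y by abel]
      _ = B * ∫⁻ x in Ω, ‖b x‖ₑ := by
          rw [lintegral_iUnion hQm hdisj, ← ENNReal.tsum_mul_left]
          refine tsum_congr fun i => ?_
          rw [lintegral_const_mul'' _ hbm.restrict]
      _ ≤ _ := by gcongr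
  -- Conclusion.
  have hcm : ∀ h : Euc 2 → ℝ, Integrable h → Continuous (conv k h) := by
    intro h hh
    rw [conv_eq]
    exact hkc.continuous_convolution_right _ hh.locallyIntegrable hk
  -- Chebyshev's inequality and the `L²` bound. The good part is at most `4 l` on the squares and
  -- equals `f`, with `|f| ≤ l`, elsewhere.
  have hE1 : volume {x | l ≤ |conv k g x|} ≤
      ENNReal.ofReal (l⁻¹ ^ 2) * (A ^ 2 * (ENNReal.ofReal (16 * l ^ 2) * V + S2)) := by
    have h1 := mul_meas_ge_le_lintegral (μ := volume) (f := fun x => ‖conv k g x‖ₑ ^ 2)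
      (((hcm g hg1).measurable.enorm).pow_const 2) (ENNReal.ofReal (l ^ 2))
    have h2 : {x | l ≤ |conv k g x|} ⊆ {x | ENNReal.ofReal (l ^ 2) ≤ ‖conv k g x‖ₑ ^ 2} := by
      intro x hx
      simp only [mem_ofPred_eq] at hx ⊢
      rw [← ofReal_norm, ← ENNReal.ofReal_pow (norm_nonneg _)]
      exact ENNReal.ofReal_le_ofReal (pow_le_pow_left₀ hl.le hx 2)
    have h3 : ∫⁻ x, ‖conv k g x‖ₑ ^ 2 ≤ A ^ 2 * (ENNReal.ofReal (16 * l ^ 2) * V + S2) := by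
      rw [← eLpNorm_two_sq]
      calc _ ≤ (A * eLpNorm g 2 volume) ^ 2 := by
            gcongr; exact hA g (memLp_one_iff_integrable.2 hg1) hgL2
        _ = A ^ 2 * ∫⁻ x, ‖g x‖ₑ ^ 2 := by rw [mul_pow, eLpNorm_two_sq]
        _ ≤ _ := by gcongr
    calc volume {x | l ≤ |conv k g x|}
        = ENNReal.ofReal (l⁻¹ ^ 2) * (ENNReal.ofReal (l ^ 2) * volume {x | l ≤ |conv k g x|}) := by
          rw [← mul_assoc, ← ENNReal.ofReal_mul (by positivity),
            show l⁻¹ ^ 2 * l ^ 2 = 1 by field_simp]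
          simp
      _ ≤ _ := by
          refine mul_le_mul_right ?_ _
          exact (mul_le_mul_right (measure_mono h2) _).trans (h1.trans h3)
  have hE2 : volume ({x | l ≤ |conv k b x|} ∩ Ω'ᶜ) ≤ 8 * B * V := by
    have h1 := mul_meas_ge_le_lintegral (μ := volume.restrict Ω'ᶜ) (f := fun x => ‖conv k b x‖ₑ)
      ((hcm b hb1).measurable.enorm) (ENNReal.ofReal l)
    have h2 : {x | l ≤ |conv k b x|} = {x | ENNReal.ofReal l ≤ ‖conv k b x‖ₑ} := by
      ext x
      simp only [mem_ofPred_eq]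
      rw [← ofReal_norm, ENNReal.ofReal_le_ofReal_iff (norm_nonneg _), Real.norm_eq_abs]
    rw [Measure.restrict_apply' hΩ'm.compl, ← h2] at h1
    have h3 := h1.trans hbad
    rw [show B * (ENNReal.ofReal (8 * l) * V) = ENNReal.ofReal l * (8 * B * V) by
      rw [ENNReal.ofReal_mul (by norm_num)]
      simp only [ENNReal.ofReal_ofNat]
      ring] at h3
    exact (ENNReal.mul_le_mul_iff_right hl0 ENNReal.ofReal_ne_top).1 h3
  have hcover : {x | 2 * l < |conv k f x|} ⊆
      {x | l ≤ |conv k g x|} ∪ ({x | l ≤ |conv k b x|} ∩ Ω'ᶜ) ∪ Ω' := by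
    intro x hx
    simp only [mem_ofPred_eq] at hx
    rw [hsplit] at hx
    by_cases h1 : x ∈ Ω'
    · exact Or.inr h1
    · refine Or.inl ?_
      by_contra h2
      simp only [mem_union, mem_ofPred_eq, mem_inter_iff, not_or, not_and_or, not_le] at h2
      have h3 : |conv k b x| < l := h2.2.resolve_right (by simpa using h1)
      have := abs_add_le (conv k g x) (conv k b x)
      linarith [h2.1]
  refine (measure_mono hcover).trans ((measure_union_le _ _).trans
    ((add_le_add_left (measure_union_le _ _) _).trans ?_))
  calc _ ≤ ENNReal.ofReal (l⁻¹ ^ 2) * (A ^ 2 * (ENNReal.ofReal (16 * l ^ 2) * V + S2)) +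
        8 * B * V + 40 * V := by gcongr
    _ = (ENNReal.ofReal (l⁻¹ ^ 2) * ENNReal.ofReal (16 * l ^ 2) * A ^ 2 + 8 * B + 40) * V +
        A ^ 2 * (ENNReal.ofReal (l⁻¹ ^ 2) * S2) := by ring
    _ = (16 * A ^ 2 + 8 * B + 40) * V + A ^ 2 * (ENNReal.ofReal (l⁻¹ ^ 2) * S2) := by
        rw [← ENNReal.ofReal_mul (by positivity), show l⁻¹ ^ 2 * (16 * l ^ 2) = 16 by field_simp]
        simp
    _ ≤ _ := by gcongr

/-! ### From the weak type to the strong type estimate. -/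

theorem lintegral_Ioo_rpow {s a : ℝ} (hs : -1 < s) (ha : 0 ≤ a) :
    ∫⁻ t in Ioo 0 a, ENNReal.ofReal (t ^ s) = ENNReal.ofReal (a ^ (s + 1) / (s + 1)) := by
  have hi : IntervalIntegrable (fun t : ℝ => t ^ s) volume 0 a := intervalIntegral.intervalIntegrable_rpow' hs
  rw [← setLIntegral_congr Ioo_ae_eq_Ioc.symm, ← ofReal_integral_eq_lintegral_ofReal]
  · rw [← intervalIntegral.integral_of_le ha, integral_rpow (Or.inl hs),
      Real.zero_rpow (by linarith), sub_zero]
  · exact (intervalIntegrable_iff_integrableOn_Ioc_of_le ha).1 hi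
  · filter_upwards [ae_restrict_mem measurableSet_Ioc] with t ht
    exact Real.rpow_nonneg ht.1.le _

theorem lintegral_Ici_rpow {s a : ℝ} (hs : s < -1) (ha : 0 < a) :
    ∫⁻ t in Ici a, ENNReal.ofReal (t ^ s) = ENNReal.ofReal (a ^ (s + 1) / (-(s + 1))) := by
  rw [← setLIntegral_congr Ioi_ae_eq_Ici, ← ofReal_integral_eq_lintegral_ofReal]
  · rw [integral_Ioi_rpow_of_lt hs ha, div_neg, neg_div]
  · exact integrableOn_Ioi_rpow_of_lt hs ha
  · filter_upwards [ae_restrict_mem measurableSet_Ioi] with t ht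
    exact Real.rpow_nonneg (ha.trans ht).le _

/-- The strong type estimate for a convolution operator that is bounded on `L²` and satisfies the
Hörmander condition. -/
theorem lintegral_conv_rpow_le {k : Euc 2 → ℝ} (hk : Continuous k) (hkc : HasCompactSupport k)
    {A B : ℝ≥0∞}
    (hA : ∀ g, MemLp g 1 volume → MemLp g 2 volume →
      eLpNorm (conv k g) 2 volume ≤ A * eLpNorm g 2 volume)
    (hB : ∀ y, ∫⁻ x in {x | 2 * ‖y‖ < ‖x‖}, ‖k (x - y) - k x‖ₑ ≤ B)
    {f : Euc 2 → ℝ} (hf : Continuous f) (hc : HasCompactSupport f) {p : ℝ} (hp1 : 1 < p)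
    (hp2 : p < 2) :
    ∫⁻ x, ENNReal.ofReal (|conv k f x| ^ p) ≤
      ENNReal.ofReal (2 ^ p) * (ENNReal.ofReal p *
        ((16 * A ^ 2 + 8 * B + 40) * ENNReal.ofReal (2 ^ p / (p - 1)) +
          A ^ 2 * ENNReal.ofReal (2 - p)⁻¹)) * ∫⁻ x, ENNReal.ofReal (|f x| ^ p) := by
  have hp0 : 0 < p := by linarith
  have hfi : Integrable f := hf.integrable_of_hasCompactSupport hc
  have hcm : Continuous (conv k f) := by
    rw [conv_eq]
    exact hkc.continuous_convolution_right _ hfi.locallyIntegrable hk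
  set M : ℝ≥0∞ := 16 * A ^ 2 + 8 * B + 40 with hM
  -- The layer cake formula is applied to half of the convolution, so that the level `t` meets the
  -- level `2 t` of the weak type estimate.
  have hlay := lintegral_rpow_eq_lintegral_meas_lt_mul volume (f := fun x => |conv k f x| / 2)
    (Eventually.of_forall fun x => by positivity) (hcm.abs.div_const 2).aemeasurable hp0
  have hS1 : MeasurableSet {z : ℝ × Euc 2 | z.1 / 2 < |f z.2|} :=
    (isOpen_lt (continuous_fst.div_const 2) (hf.comp continuous_snd).abs).measurableSet
  have hS2 : MeasurableSet {z : ℝ × Euc 2 | |f z.2| ≤ z.1} :=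
    (isClosed_le (hf.comp continuous_snd).abs continuous_fst).measurableSet
  -- Multiplied by `t ^ (p - 1)`, the two terms of the weak type estimate become integrals of `F1`
  -- and `F2` in `x`. After interchanging the integrals, `t ^ (p - 2)` is integrated near zero,
  -- where `p > 1` is needed, and `t ^ (p - 3)` near infinity, where `p < 2` is needed.
  let F1 : ℝ → Euc 2 → ℝ≥0∞ := fun t x =>
    {z : ℝ × Euc 2 | z.1 / 2 < |f z.2|}.indicator
      (fun z => ENNReal.ofReal (2 * z.1 ^ (p - 2)) * ‖f z.2‖ₑ) (t, x)
  let F2 : ℝ → Euc 2 → ℝ≥0∞ := fun t x =>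
    {z : ℝ × Euc 2 | |f z.2| ≤ z.1}.indicator
      (fun z => ENNReal.ofReal (z.1 ^ (p - 3)) * ‖f z.2‖ₑ ^ 2) (t, x)
  have hF1m : Measurable (Function.uncurry F1) := by
    refine Measurable.indicator ?_ hS1
    exact ((measurable_const.mul (measurable_fst.pow_const _)).ennreal_ofReal).mul
      (hf.measurable.comp measurable_snd).enorm
  have hF2m : Measurable (Function.uncurry F2) := by
    refine Measurable.indicator ?_ hS2
    exact ((measurable_fst.pow_const _).ennreal_ofReal).mul
      ((hf.measurable.comp measurable_snd).enorm.pow_const 2)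
  have hfm : Measurable fun x => ‖f x‖ₑ := hf.measurable.enorm
  have hpt : ∀ t ∈ Ioi (0 : ℝ), volume {x | t < |conv k f x| / 2} * ENNReal.ofReal (t ^ (p - 1)) ≤
      M * (∫⁻ x, F1 t x) + A ^ 2 * ∫⁻ x, F2 t x := by
    intro t ht
    have ht0 : (0 : ℝ) < t := ht
    have e1 : ∫⁻ x, F1 t x = ENNReal.ofReal (2 * t ^ (p - 2)) * ∫⁻ x in {x | t / 2 < |f x|}, ‖f x‖ₑ := by
      rw [← lintegral_const_mul _ hfm,
        ← lintegral_indicator (isOpen_lt continuous_const hf.abs).measurableSet]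
      exact lintegral_congr fun x => by simp [F1, indicator]
    have e2 : ∫⁻ x, F2 t x = ENNReal.ofReal (t ^ (p - 3)) * ∫⁻ x in {x | |f x| ≤ t}, ‖f x‖ₑ ^ 2 := by
      rw [← lintegral_const_mul _ (hfm.pow_const 2),
        ← lintegral_indicator (isClosed_le hf.abs continuous_const).measurableSet]
      exact lintegral_congr fun x => by simp [F2, indicator]
    have e3 : {x | t < |conv k f x| / 2} = {x | 2 * t < |conv k f x|} := by
      ext x
      simp only [mem_ofPred_eq]
      constructor <;> intro h <;> linarith
    have h1 := volume_conv_gt_le hk hkc hA hB hf hc ht0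
    have e4 : ENNReal.ofReal (2 / t) * ENNReal.ofReal (t ^ (p - 1)) =
        ENNReal.ofReal (2 * t ^ (p - 2)) := by
      rw [← ENNReal.ofReal_mul (by positivity)]
      congr 1
      rw [show p - 1 = (p - 2) + 1 by ring, Real.rpow_add_one ht0.ne']
      field_simp
    have e5 : ENNReal.ofReal (t⁻¹ ^ 2) * ENNReal.ofReal (t ^ (p - 1)) =
        ENNReal.ofReal (t ^ (p - 3)) := by
      rw [← ENNReal.ofReal_mul (by positivity)]
      congr 1
      rw [show p - 1 = (p - 3) + 2 by ring, Real.rpow_add ht0]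
      norm_num
      field_simp
    rw [e3, e1, e2, ← e4, ← e5]
    calc _ ≤ _ := mul_le_mul_left h1 _
      _ = _ := by rw [← hM]; ring
  have hx1 : ∀ x, ∫⁻ t in Ioi 0, F1 t x =
      ENNReal.ofReal (2 ^ p / (p - 1)) * ENNReal.ofReal (|f x| ^ p) := by
    intro x
    have e1 : ∀ t, F1 t x = (Iio (2 * |f x|)).indicator
        (fun t => ENNReal.ofReal 2 * ‖f x‖ₑ * ENNReal.ofReal (t ^ (p - 2))) t := by
      intro t
      have : t / 2 < |f x| ↔ t < 2 * |f x| := by constructor <;> intro h <;> linarith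
      simp only [F1, indicator, mem_ofPred_eq, mem_Iio, this]
      split_ifs
      · rw [ENNReal.ofReal_mul (by norm_num)]; ring
      · rfl
    simp only [e1]
    rw [setLIntegral_indicator measurableSet_Iio, Iio_inter_Ioi,
      lintegral_const_mul _ (by fun_prop), lintegral_Ioo_rpow (by linarith) (by positivity),
      ← ofReal_norm, ← ENNReal.ofReal_mul (by norm_num), ← ENNReal.ofReal_mul (by positivity),
      ← ENNReal.ofReal_mul (by have : 0 < p - 1 := by linarith
                               positivity)]
    congr 1
    rw [Real.norm_eq_abs, show p - 2 + 1 = p - 1 by ring, Real.mul_rpow (by norm_num) (abs_nonneg _)]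
    rcases (abs_nonneg (f x)).eq_or_lt with h0 | h0
    · rw [← h0, Real.zero_rpow hp0.ne']; ring
    · have h2 : (2 : ℝ) ^ p = 2 ^ (p - 1) * 2 := by
        rw [← Real.rpow_add_one (by norm_num)]; congr 1; ring
      have h3 : |f x| ^ p = |f x| ^ (p - 1) * |f x| := by
        rw [← Real.rpow_add_one h0.ne']; congr 1; ring
      rw [h2, h3]
      ring
  have hx2 : ∀ x, ∫⁻ t in Ioi 0, F2 t x =
      ENNReal.ofReal (2 - p)⁻¹ * ENNReal.ofReal (|f x| ^ p) := by
    intro x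
    rcases (abs_nonneg (f x)).eq_or_lt with h0 | h0
    · have hz : f x = 0 := by simpa using h0.symm
      have e1 : ∀ t, F2 t x = 0 := by
        intro t
        simp [F2, indicator, hz]
      simp [e1, ← h0, Real.zero_rpow hp0.ne']
    have e1 : ∀ t, F2 t x = (Ici |f x|).indicator
        (fun t => ‖f x‖ₑ ^ 2 * ENNReal.ofReal (t ^ (p - 3))) t := by
      intro t
      simp only [F2, indicator, mem_ofPred_eq, mem_Ici]
      split_ifs
      · ring
      · rfl
    have hsub : Ici |f x| ∩ Ioi 0 = Ici |f x| := inter_eq_left.2 fun t ht => h0.trans_le ht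
    simp only [e1]
    rw [setLIntegral_indicator measurableSet_Ici, hsub,
      lintegral_const_mul _ (by fun_prop), lintegral_Ici_rpow (by linarith) h0,
      ← ofReal_norm, ← ENNReal.ofReal_pow (norm_nonneg _), ← ENNReal.ofReal_mul (by positivity),
      ← ENNReal.ofReal_mul (by have : 0 < 2 - p := by linarith
                               positivity)]
    congr 1
    rw [Real.norm_eq_abs, show p - 3 + 1 = p - 2 by ring, show -(p - 2) = 2 - p by ring]
    have h3 : |f x| ^ p = |f x| ^ (p - 2) * |f x| ^ 2 := by
      rw [← Real.rpow_natCast, ← Real.rpow_add h0]; congr 1; push_cast; ring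
    rw [h3]
    ring
  have hpm : Measurable fun x => ENNReal.ofReal (|f x| ^ p) :=
    ((hf.abs.measurable).pow_const p).ennreal_ofReal
  have hscale : ∫⁻ x, ENNReal.ofReal (|conv k f x| ^ p) =
      ENNReal.ofReal (2 ^ p) * ∫⁻ x, ENNReal.ofReal ((|conv k f x| / 2) ^ p) := by
    rw [← lintegral_const_mul _ (by fun_prop)]
    refine lintegral_congr fun x => ?_
    rw [← ENNReal.ofReal_mul (by positivity), ← Real.mul_rpow (by norm_num) (by positivity)]
    congr 2
    ring
  rw [hscale, hlay, mul_assoc, mul_assoc]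
  refine mul_le_mul_right (mul_le_mul_right ?_ _) _
  calc ∫⁻ t in Ioi 0, volume {x | t < |conv k f x| / 2} * ENNReal.ofReal (t ^ (p - 1))
      ≤ ∫⁻ t in Ioi 0, (M * (∫⁻ x, F1 t x) + A ^ 2 * ∫⁻ x, F2 t x) :=
        setLIntegral_mono' measurableSet_Ioi hpt
    _ = M * (∫⁻ t in Ioi 0, ∫⁻ x, F1 t x) + A ^ 2 * ∫⁻ t in Ioi 0, ∫⁻ x, F2 t x := by
        have hm1 : Measurable fun t => ∫⁻ x, F1 t x := hF1m.lintegral_prod_right'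
        have hm2 : Measurable fun t => ∫⁻ x, F2 t x := hF2m.lintegral_prod_right'
        rw [lintegral_add_left (hm1.const_mul M), lintegral_const_mul _ hm1,
          lintegral_const_mul _ hm2]
    _ = M * (∫⁻ x, ∫⁻ t in Ioi 0, F1 t x) + A ^ 2 * ∫⁻ x, ∫⁻ t in Ioi 0, F2 t x := by
        rw [lintegral_lintegral_swap hF1m.aemeasurable, lintegral_lintegral_swap hF2m.aemeasurable]
    _ = _ := by
        simp only [hx1, hx2]
        rw [lintegral_const_mul _ hpm, lintegral_const_mul _ hpm]
        ring

/-! ### A compactly supported parametrix of the Laplacian -/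

/-- Two integrations by parts, with the derivatives interchanged in between. The third derivatives
serve only to make the products integrable. -/
theorem memLp_pd_pd_integral {v : Euc 2 → ℝ} (hv : ContDiff ℝ ∞ v)
    (h1 : ∀ i, MemLp (pd i v) 2 volume) (h2 : ∀ i j, MemLp (pd i (pd j v)) 2 volume)
    (h3 : ∀ i j l, MemLp (pd i (pd j (pd l v))) 2 volume) (i j : Fin 2) :
    ∫ x, pd i (pd j v) x * pd i (pd j v) x = ∫ x, pd i (pd i v) x * pd j (pd j v) x := by
  have hmul : ∀ {f g : Euc 2 → ℝ}, MemLp f 2 volume → MemLp g 2 volume →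
      Integrable (fun x => f x * g x) := fun hf hg => hf.integrable_mul hg
  have hdiff : ∀ {f : Euc 2 → ℝ}, ContDiff ℝ ∞ f → Differentiable ℝ f :=
    fun h => h.differentiable (by simp)
  have ibp : ∀ {f g : Euc 2 → ℝ} (l : Fin 2), ContDiff ℝ ∞ f → ContDiff ℝ ∞ g →
      MemLp f 2 volume → MemLp g 2 volume → MemLp (pd l f) 2 volume → MemLp (pd l g) 2 volume →
      ∫ x, f x * pd l g x = -∫ x, pd l f x * g x := fun l hf hg mf mg mf' mg' =>
    integral_mul_fderiv_eq_neg_fderiv_mul_of_integrable (hmul mf' mg) (hmul mf mg') (hmul mf mg)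
      (fun x _ => hdiff hf x) (fun x _ => hdiff hg x)
  have e1 := ibp i ((hv.pd j).pd i) (hv.pd j) (h2 i j) (h1 j) (h3 i i j) (h2 i j)
  have e2 : pd i (pd i (pd j v)) = pd j (pd i (pd i v)) := by
    rw [pd_comm hv i j, pd_comm (hv.pd i) i j]
  have e3 := ibp j ((hv.pd i).pd i) (hv.pd j) (h2 i i) (h1 j) (h3 j i i) (h2 j j)
  rw [e1, e2, e3]

/-- Summing `memLp_pd_pd_integral` over `i` and `j` shows that the squared `L²` norms of all second
derivatives add up to that of the Laplacian. -/
theorem eLpNorm_pd_pd_le_lap {v : Euc 2 → ℝ} (hv : ContDiff ℝ ∞ v)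
    (h1 : ∀ i, MemLp (pd i v) 2 volume) (h2 : ∀ i j, MemLp (pd i (pd j v)) 2 volume)
    (h3 : ∀ i j l, MemLp (pd i (pd j (pd l v))) 2 volume) (i j : Fin 2) :
    eLpNorm (pd i (pd j v)) 2 volume ≤ eLpNorm (lap v) 2 volume := by
  have hmul : ∀ {f g : Euc 2 → ℝ}, MemLp f 2 volume → MemLp g 2 volume →
      Integrable (fun x => f x * g x) := fun hf hg => hf.integrable_mul hg
  have hl : MemLp (lap v) 2 volume := by
    have : lap v = fun x => pd 0 (pd 0 v) x + pd 1 (pd 1 v) x := by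
      ext x; simp [lap, Fin.sum_univ_two]
    rw [this]
    exact (h2 0 0).add (h2 1 1)
  have key : ∫ x, pd i (pd j v) x ^ 2 ≤ ∫ x, lap v x ^ 2 := by
    have e0 : ∫ x, lap v x ^ 2 = ∑ a, ∑ b, ∫ x, pd a (pd a v) x * pd b (pd b v) x := by
      simp only [Fin.sum_univ_two]
      have i1 : Integrable (fun x => pd 0 (pd 0 v) x * pd 0 (pd 0 v) x +
          pd 0 (pd 0 v) x * pd 1 (pd 1 v) x) :=
        (hmul (h2 0 0) (h2 0 0)).add (hmul (h2 0 0) (h2 1 1))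
      have i2 : Integrable (fun x => pd 1 (pd 1 v) x * pd 0 (pd 0 v) x +
          pd 1 (pd 1 v) x * pd 1 (pd 1 v) x) :=
        (hmul (h2 1 1) (h2 0 0)).add (hmul (h2 1 1) (h2 1 1))
      rw [← integral_add (hmul (h2 0 0) (h2 0 0)) (hmul (h2 0 0) (h2 1 1)),
        ← integral_add (hmul (h2 1 1) (h2 0 0)) (hmul (h2 1 1) (h2 1 1)), ← integral_add i1 i2]
      congr 1
      ext x
      simp only [lap, Fin.sum_univ_two]
      ring
    have e1 : ∀ a b, ∫ x, pd a (pd a v) x * pd b (pd b v) x = ∫ x, pd a (pd b v) x ^ 2 := by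
      intro a b
      rw [← memLp_pd_pd_integral hv h1 h2 h3]
      simp only [sq]
    simp only [e0, e1]
    have hn : ∀ a b, 0 ≤ ∫ x, pd a (pd b v) x ^ 2 := fun a b =>
      integral_nonneg fun x => sq_nonneg _
    exact (Finset.single_le_sum (f := fun b => ∫ x, pd i (pd b v) x ^ 2) (fun b _ => hn i b)
      (Finset.mem_univ j)).trans
      (Finset.single_le_sum (f := fun a => ∑ b, ∫ x, pd a (pd b v) x ^ 2)
        (fun a _ => Finset.sum_nonneg fun b _ => hn a b) (Finset.mem_univ i))
  have conv2 : ∀ {f : Euc 2 → ℝ}, MemLp f 2 volume →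
      eLpNorm f 2 volume ^ 2 = ENNReal.ofReal (∫ x, f x ^ 2) := by
    intro f hf
    rw [eLpNorm_two_sq, ofReal_integral_eq_lintegral_ofReal hf.integrable_sq
      (Eventually.of_forall fun x => sq_nonneg _)]
    refine lintegral_congr fun x => ?_
    rw [← ofReal_norm, ← ENNReal.ofReal_pow (norm_nonneg _)]
    simp
  have : eLpNorm (pd i (pd j v)) 2 volume ^ 2 ≤ eLpNorm (lap v) 2 volume ^ 2 := by
    rw [conv2 (h2 i j), conv2 hl]
    exact ENNReal.ofReal_le_ofReal key
  exact (ENNReal.pow_le_pow_left_iff (by norm_num)).1 this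

/-- `½ log s` for `s ≥ ½`, cut off near the origin. -/
def cutLog (s : ℝ) : ℝ := Real.smoothTransition (4 * s - 1) * (Real.log s / 2)

theorem contDiff_cutLog : ContDiff ℝ ∞ cutLog := by
  rw [contDiff_iff_contDiffAt]
  intro s
  rcases lt_or_ge s (1 / 4) with h | h
  · have : cutLog =ᶠ[𝓝 s] fun _ => 0 := by
      filter_upwards [Iio_mem_nhds h] with t ht
      rw [cutLog, Real.smoothTransition.zero_of_nonpos (by linarith [mem_Iio.1 ht]), zero_mul]
    exact contDiffAt_const.congr_of_eventuallyEq this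
  · refine ContDiffAt.mul ?_ ((Real.contDiffAt_log.2 (by linarith)).div_const 2)
    exact (Real.smoothTransition.contDiff.comp (by fun_prop)).contDiffAt

theorem cutLog_eq {s : ℝ} (hs : 1 / 2 ≤ s) : cutLog s = Real.log s / 2 := by
  rw [cutLog, Real.smoothTransition.one_of_one_le (by linarith), one_mul]

theorem deriv_cutLog {s : ℝ} (hs : 1 / 2 < s) : deriv cutLog s = s⁻¹ / 2 := by
  have : cutLog =ᶠ[𝓝 s] fun t => Real.log t / 2 := by
    filter_upwards [Ioi_mem_nhds hs] with t ht using cutLog_eq (le_of_lt ht)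
  rw [this.deriv_eq, deriv_div_const, Real.deriv_log]

theorem deriv_deriv_cutLog {s : ℝ} (hs : 1 / 2 < s) :
    deriv (deriv cutLog) s = -(s ^ 2)⁻¹ / 2 := by
  have : deriv cutLog =ᶠ[𝓝 s] fun t => t⁻¹ / 2 := by
    filter_upwards [Ioi_mem_nhds hs] with t ht using deriv_cutLog ht
  rw [this.deriv_eq, deriv_div_const, deriv_inv]

theorem pd_radial {f : ℝ → ℝ} (hf : Differentiable ℝ f) (i : Fin 2) (x : Euc 2) :
    pd i (fun x => f (‖x‖ ^ 2)) x = 2 * x i * deriv f (‖x‖ ^ 2) := by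
  have h1 : HasFDerivAt (fun x : Euc 2 => ‖x‖ ^ 2) (2 • innerSL ℝ x) x :=
    (hasStrictFDerivAt_norm_sq x).hasFDerivAt
  have h2 := (hf (‖x‖ ^ 2)).hasDerivAt.comp_hasFDerivAt x h1
  have h3 : (f ∘ fun x : Euc 2 => ‖x‖ ^ 2) = fun x => f (‖x‖ ^ 2) := rfl
  rw [h3] at h2
  rw [pd, h2.fderiv]
  simp [EuclideanSpace.inner_single_right]
  ring

theorem pd_coord (i j : Fin 2) (x : Euc 2) :
    pd i (fun x : Euc 2 => x j) x = if i = j then 1 else 0 := by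
  have : (fun x : Euc 2 => x j) = (EuclideanSpace.proj j : Euc 2 →L[ℝ] ℝ) := rfl
  rw [pd, this, ContinuousLinearMap.fderiv]
  simp [eq_comm]

theorem lap_radial {f : ℝ → ℝ} (hf : ContDiff ℝ ∞ f) (x : Euc 2) :
    lap (fun x => f (‖x‖ ^ 2)) x =
      4 * deriv f (‖x‖ ^ 2) + 4 * ‖x‖ ^ 2 * deriv (deriv f) (‖x‖ ^ 2) := by
  have hd : Differentiable ℝ f := hf.differentiable (by simp)
  have hf' : ContDiff ℝ ∞ (deriv f) := by
    exact ((contDiff_infty_iff_deriv (𝕜 := ℝ)).1 hf).2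
  have hd' : Differentiable ℝ (deriv f) := hf'.differentiable (by simp)
  have hns : Differentiable ℝ fun x : Euc 2 => ‖x‖ ^ 2 := (contDiff_norm_sq ℝ (n := 1)).differentiable (by simp)
  have h : ∀ i, pd i (pd i fun x => f (‖x‖ ^ 2)) x =
      2 * deriv f (‖x‖ ^ 2) + 4 * x i ^ 2 * deriv (deriv f) (‖x‖ ^ 2) := by
    intro i
    have e : (pd i fun x => f (‖x‖ ^ 2)) = fun x : Euc 2 => (2 * x i) * deriv f (‖x‖ ^ 2) := by
      ext x; exact pd_radial hd i x
    have hc : Differentiable ℝ fun x : Euc 2 => x i := by fun_prop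
    rw [e, pd_mul (g := fun x => deriv f (‖x‖ ^ 2)) (hc.const_mul 2) (hd'.comp hns), pd_const_mul 2 hc, pd_coord, pd_radial hd']
    simp
    ring
  rw [lap, Fin.sum_univ_two, h, h, EuclideanSpace.real_norm_sq_eq, Fin.sum_univ_two]
  ring

/-- A smooth function that agrees with `log |x|` for `|x| ≥ 1`. -/
def smoothLog (x : Euc 2) : ℝ := cutLog (‖x‖ ^ 2)

theorem contDiff_smoothLog : ContDiff ℝ ∞ smoothLog :=
  contDiff_cutLog.comp (contDiff_norm_sq ℝ)

/-- The Laplacian of `smoothLog`, a smooth function with compact support. -/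
def logSource : Euc 2 → ℝ := lap smoothLog

theorem contDiff_logSource : ContDiff ℝ ∞ logSource := contDiff_smoothLog.lap

/-- Outside the unit disk the cutoff is inactive, and `log |x|` is harmonic in the punctured plane.
-/
theorem logSource_eq_zero {x : Euc 2} (hx : 1 ≤ ‖x‖) : logSource x = 0 := by
  have h1 : 1 / 2 < ‖x‖ ^ 2 := by nlinarith
  rw [logSource, show smoothLog = fun x => cutLog (‖x‖ ^ 2) from rfl,
    lap_radial contDiff_cutLog, deriv_cutLog h1, deriv_deriv_cutLog h1]
  have : ‖x‖ ≠ 0 := by positivity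
  field_simp
  ring

theorem hasCompactSupport_of_eq_zero {f : Euc 2 → ℝ} (hf : ∀ x, 1 ≤ ‖x‖ → f x = 0) :
    HasCompactSupport f :=
  HasCompactSupport.intro (isCompact_closedBall (0 : Euc 2) 1) fun x hx => hf x (by
    rw [mem_closedBall_zero_iff, not_le] at hx; exact hx.le)

/-- In polar coordinates the integrand `r F(r)` is the derivative of `2 r² cutLog'(r²)`, the flux
through the circle of radius `r` up to `2π`. It is `0` at the origin and `1` once `r ≥ 1`.
Positivity allows division by the integral in `exists_eLpNorm_pd_pd_le`. -/
theorem integral_logSource_pos : 0 < ∫ x, logSource x := by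
  let F : ℝ → ℝ := fun r => 4 * deriv cutLog (r ^ 2) + 4 * r ^ 2 * deriv (deriv cutLog) (r ^ 2)
  have h1 : ∀ x, logSource x = F ‖x‖ := fun x => lap_radial contDiff_cutLog x
  have hd : ContDiff ℝ ∞ (deriv cutLog) := ((contDiff_infty_iff_deriv (𝕜 := ℝ)).1 contDiff_cutLog).2
  have hder : ∀ r, HasDerivAt (fun r : ℝ => 2 * r ^ 2 * deriv cutLog (r ^ 2)) (r * F r) r := by
    intro r
    have h2 : HasDerivAt (fun r : ℝ => r ^ 2) (2 * r) r := by simpa using hasDerivAt_pow 2 r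
    have h3 := ((hd.differentiable (by simp) (r ^ 2)).hasDerivAt).comp r h2
    have h4 := (h2.const_mul 2).mul h3
    convert! h4 using 1
    simp only [F, Function.comp]
    ring
  have hz : ∀ r, 1 ≤ r → F r = 0 := by
    intro r hr
    have h1 : 1 / 2 < r ^ 2 := by nlinarith
    simp only [F]
    rw [deriv_cutLog h1, deriv_deriv_cutLog h1]
    have : r ≠ 0 := by positivity
    field_simp
    ring
  have hFc : Continuous F := by
    have := ((contDiff_infty_iff_deriv (𝕜 := ℝ)).1 hd).2.continuous
    have := hd.continuous
    fun_prop
  have hint : ∫ r in Ioi (0 : ℝ), r * F r = 1 := by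
    have e1 : ∫ r in Ioi (0 : ℝ), r * F r = ∫ r in (0 : ℝ)..2, r * F r := by
      rw [intervalIntegral.integral_of_le (by norm_num)]
      refine setIntegral_eq_of_subset_of_forall_sdiff_eq_zero measurableSet_Ioi
        (fun r hr => hr.1) fun r hr => ?_
      have : 2 < r := by
        by_contra! h
        exact hr.2 ⟨hr.1, h⟩
      rw [hz r (by linarith), mul_zero]
    rw [e1, intervalIntegral.integral_eq_sub_of_hasDerivAt (fun r _ => hder r)
      ((continuous_id.mul hFc).intervalIntegrable _ _)]
    rw [deriv_cutLog (by norm_num)]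
    norm_num
  simp only [h1]
  rw [integral_fun_norm_addHaar volume F]
  simp only [finrank_euclideanSpace, Fintype.card_fin, smul_eq_mul]
  norm_num
  rw [hint]
  simp [Measure.real, EuclideanSpace.volume_ball_fin_two, ENNReal.toReal_ofReal Real.pi_pos.le,
    Real.pi_pos]

/-- The building block of the parametrix. -/
def logBlock (x : Euc 2) : ℝ := smoothLog ((2 : ℝ) • x) - smoothLog x - Real.log 2

theorem contDiff_logBlock : ContDiff ℝ ∞ logBlock :=
  ((contDiff_smoothLog.comp (contDiff_const_smul _)).sub contDiff_smoothLog).sub contDiff_const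

/-- Both logarithms are exact for `|x| ≥ 1` and differ by `log 2`, which was subtracted. Sums of
dilated blocks telescope, so they approximate the logarithm near the origin, up to additive
constants, and still have support in the unit disk. -/
theorem logBlock_eq_zero {x : Euc 2} (hx : 1 ≤ ‖x‖) : logBlock x = 0 := by
  have h0 : ‖x‖ ≠ 0 := by positivity
  rw [logBlock, smoothLog, smoothLog, norm_smul, mul_pow, cutLog_eq (by norm_num; nlinarith),
    cutLog_eq (by nlinarith), Real.log_mul (by norm_num) (by positivity)]
  rw [show ‖(2 : ℝ)‖ ^ 2 = 2 ^ 2 by norm_num, Real.log_pow]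
  push_cast
  ring

theorem lap_comp_smul {f : Euc 2 → ℝ} (hf : ContDiff ℝ ∞ f) (c : ℝ) (x : Euc 2) :
    lap (fun x => f (c • x)) x = c ^ 2 * lap f (c • x) := by
  have hd : ∀ {f : Euc 2 → ℝ}, ContDiff ℝ ∞ f → Differentiable ℝ f :=
    fun h => h.differentiable (by simp)
  have h : ∀ i, pd i (pd i fun x => f (c • x)) x = c ^ 2 * pd i (pd i f) (c • x) := by
    intro i
    have e : (pd i fun x => f (c • x)) = fun x => c * pd i f (c • x) := by
      ext x; exact pd_comp_smul c (hd hf) i x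
    rw [e, pd_const_mul (f := fun x => pd i f (c • x)) c
      ((hd (hf.pd i)).comp (differentiable_id.const_smul c)),
      pd_comp_smul c (hd (hf.pd i))]
    ring
  simp only [lap, h, Finset.mul_sum]

theorem pd_pd_comp_smul {f : Euc 2 → ℝ} (hf : ContDiff ℝ ∞ f) (c : ℝ) (i j : Fin 2) (x : Euc 2) :
    pd i (pd j fun x => f (c • x)) x = c ^ 2 * pd i (pd j f) (c • x) := by
  have hd : ∀ {f : Euc 2 → ℝ}, ContDiff ℝ ∞ f → Differentiable ℝ f :=
    fun h => h.differentiable (by simp)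
  have e : (pd j fun x => f (c • x)) = fun x => c * pd j f (c • x) := by
    ext x; exact pd_comp_smul c (hd hf) j x
  rw [e, pd_const_mul (f := fun x => pd j f (c • x)) c
    ((hd (hf.pd j)).comp (differentiable_id.const_smul c)), pd_comp_smul c (hd (hf.pd j))]
  ring

theorem pd_finset_sum {ι : Type*} {s : Finset ι} {f : ι → Euc 2 → ℝ}
    (hf : ∀ k, Differentiable ℝ (f k)) (i : Fin 2) :
    pd i (fun x => ∑ k ∈ s, f k x) = fun x => ∑ k ∈ s, pd i (f k) x := by
  ext x
  simp only [pd]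
  rw [fderiv_fun_sum fun k _ => hf k x]
  simp

theorem lap_logBlock (x : Euc 2) :
    lap logBlock x = 4 * logSource ((2 : ℝ) • x) - logSource x := by
  have hd : ∀ {f : Euc 2 → ℝ}, ContDiff ℝ ∞ f → Differentiable ℝ f :=
    fun h => h.differentiable (by simp)
  have hs : ContDiff ℝ ∞ fun x : Euc 2 => smoothLog ((2 : ℝ) • x) :=
    contDiff_smoothLog.comp (contDiff_const_smul _)
  have h : ∀ i, pd i (pd i logBlock) x =
      pd i (pd i fun x => smoothLog ((2 : ℝ) • x)) x - pd i (pd i smoothLog) x := by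
    intro i
    have e : pd i logBlock = fun x => pd i (fun x => smoothLog ((2 : ℝ) • x)) x - pd i smoothLog x := by
      ext x
      have : logBlock = fun x => (smoothLog ((2 : ℝ) • x) - smoothLog x) - Real.log 2 := rfl
      rw [this, pd_sub (f := fun x => smoothLog ((2 : ℝ) • x) - smoothLog x)
        ((hd hs).sub (hd contDiff_smoothLog)) (differentiable_const _),
        pd_sub (f := fun x => smoothLog ((2 : ℝ) • x)) (hd hs) (hd contDiff_smoothLog)]
      simp [pd]
    rw [e, pd_sub (hd (hs.pd i)) (hd (contDiff_smoothLog.pd i))]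
  have h2 := lap_comp_smul contDiff_smoothLog 2 x
  simp only [lap] at h2
  simp only [lap, h, Finset.sum_sub_distrib, logSource, h2]
  norm_num

/-- The parametrix at scale `2⁻ᵐ`. -/
def parametrix (m : ℕ) (x : Euc 2) : ℝ := ∑ k ∈ Finset.range m, logBlock ((2 : ℝ) ^ k • x)

theorem contDiff_logBlock_smul (c : ℝ) : ContDiff ℝ ∞ fun x : Euc 2 => logBlock (c • x) :=
  contDiff_logBlock.comp (contDiff_const_smul _)

theorem contDiff_parametrix (m : ℕ) : ContDiff ℝ ∞ (parametrix m) :=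
  ContDiff.sum fun _ _ => contDiff_logBlock_smul _

theorem le_norm_pow_smul {x : Euc 2} (k : ℕ) (hx : 1 ≤ ‖x‖) : 1 ≤ ‖(2 : ℝ) ^ k • x‖ := by
  rw [norm_smul, norm_pow]
  have : (1 : ℝ) ≤ ‖(2 : ℝ)‖ ^ k := one_le_pow₀ (by norm_num)
  nlinarith

theorem hasCompactSupport_parametrix (m : ℕ) : HasCompactSupport (parametrix m) :=
  hasCompactSupport_of_eq_zero fun _ hx =>
    Finset.sum_eq_zero fun k _ => logBlock_eq_zero (le_norm_pow_smul k hx)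

theorem pd_pd_parametrix (m : ℕ) (i j : Fin 2) (x : Euc 2) :
    pd i (pd j (parametrix m)) x =
      ∑ k ∈ Finset.range m, ((2 : ℝ) ^ k) ^ 2 * pd i (pd j logBlock) ((2 : ℝ) ^ k • x) := by
  have hd : ∀ {f : Euc 2 → ℝ}, ContDiff ℝ ∞ f → Differentiable ℝ f :=
    fun h => h.differentiable (by simp)
  have e : parametrix m = fun x => ∑ k ∈ Finset.range m, logBlock ((2 : ℝ) ^ k • x) := rfl
  rw [e, pd_finset_sum (f := fun k x => logBlock ((2 : ℝ) ^ k • x))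
    fun k => hd (contDiff_logBlock_smul _)]
  rw [pd_finset_sum fun k => hd ((contDiff_logBlock_smul _).pd j)]
  exact Finset.sum_congr rfl fun k _ => pd_pd_comp_smul contDiff_logBlock _ i j x

/-- The source rescaled to the scale `2⁻ᵐ`. -/
def scaledSource (m : ℕ) (x : Euc 2) : ℝ := 4 ^ m * logSource ((2 : ℝ) ^ m • x)

/-- The Laplacians of the dilated blocks telescope. As `scaledSource m` is an approximate identity
up to a constant factor, the parametrix inverts the Laplacian up to the fixed smooth error
`logSource`. -/
theorem lap_parametrix (m : ℕ) (x : Euc 2) :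
    lap (parametrix m) x = scaledSource m x - logSource x := by
  have h : lap (parametrix m) x =
      ∑ k ∈ Finset.range m, ((2 : ℝ) ^ k) ^ 2 * lap logBlock ((2 : ℝ) ^ k • x) := by
    simp only [lap, pd_pd_parametrix, Finset.mul_sum]
    exact Finset.sum_comm
  rw [h]
  have h2 : ∀ k, ((2 : ℝ) ^ k) ^ 2 * lap logBlock ((2 : ℝ) ^ k • x) =
      scaledSource (k + 1) x - scaledSource k x := by
    intro k
    rw [lap_logBlock, scaledSource, scaledSource, smul_smul, ← pow_succ', ← pow_mul, mul_comm k 2,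
      pow_mul]
    norm_num
    ring
  simp only [h2]
  rw [Finset.sum_range_sub (fun k => scaledSource k x)]
  simp [scaledSource]

theorem contDiff_scaledSource (m : ℕ) : ContDiff ℝ ∞ (scaledSource m) :=
  contDiff_const.mul (contDiff_logSource.comp (contDiff_const_smul _))

theorem hasCompactSupport_scaledSource (m : ℕ) : HasCompactSupport (scaledSource m) :=
  hasCompactSupport_of_eq_zero fun x hx => by
    rw [scaledSource, logSource_eq_zero (le_norm_pow_smul m hx), mul_zero]

theorem integral_scaledSource_mul (m : ℕ) (F : Euc 2 → ℝ) :
    ∫ y, scaledSource m y * F y = ∫ z, logSource z * F (((2 : ℝ) ^ m)⁻¹ • z) := by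
  have h := Measure.integral_comp_smul volume
    (fun z : Euc 2 => logSource z * F (((2 : ℝ) ^ m)⁻¹ • z)) ((2 : ℝ) ^ m)
  have h2 : ∀ y : Euc 2, ((2 : ℝ) ^ m)⁻¹ • (2 : ℝ) ^ m • y = y := fun y => by
    rw [smul_smul, inv_mul_cancel₀ (by positivity), one_smul]
  simp only [h2, finrank_euclideanSpace, Fintype.card_fin, smul_eq_mul] at h
  have h3 : (4 : ℝ) ^ m = ((2 : ℝ) ^ m) ^ 2 := by rw [← pow_mul, mul_comm, pow_mul]; norm_num
  simp only [scaledSource, mul_assoc]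
  rw [integral_const_mul, h, h3, abs_of_pos (by positivity), ← mul_assoc,
    mul_inv_cancel₀ (by positivity), one_mul]

theorem eLpNorm_scaledSource (m : ℕ) :
    eLpNorm (scaledSource m) 1 volume = eLpNorm logSource 1 volume := by
  have hi : ∀ {f : Euc 2 → ℝ}, ContDiff ℝ ∞ f → HasCompactSupport f →
      eLpNorm f 1 volume = ENNReal.ofReal (∫ x, |f x|) := by
    intro f hf hc
    rw [eLpNorm_one_eq_lintegral_enorm, ← ofReal_integral_norm_eq_lintegral_enorm
      (hf.continuous.integrable_of_hasCompactSupport hc)]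
    rfl
  rw [hi (contDiff_scaledSource m) (hasCompactSupport_scaledSource m),
    hi contDiff_logSource (hasCompactSupport_of_eq_zero fun _ => logSource_eq_zero)]
  congr 1
  have h := Measure.integral_comp_smul volume (fun z : Euc 2 => |logSource z|) ((2 : ℝ) ^ m)
  have h3 : (4 : ℝ) ^ m = ((2 : ℝ) ^ m) ^ 2 := by rw [← pow_mul, mul_comm, pow_mul]; norm_num
  simp only [scaledSource, abs_mul]
  simp only [finrank_euclideanSpace, Fintype.card_fin, smul_eq_mul] at h
  rw [integral_const_mul, h, h3, abs_of_pos (by positivity), abs_of_pos (by positivity),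
    ← mul_assoc, mul_inv_cancel₀ (by positivity), one_mul]

/-- A geometric progression with ratio two, stopped before it reaches `1`, has sum less than `2`,
however many terms there are. The sharper bound `2 - a` closes the induction, in which `a` is
replaced by `2 a`. -/
theorem geometric_cutoff_sum_le (m : ℕ) : ∀ a : ℝ, 0 ≤ a →
    ∑ k ∈ Finset.range m, (if 2 ^ k * a < 1 then 2 ^ k * a else 0) ≤ max 0 (2 - a) := by
  induction m with
  | zero => intro a _; simp
  | succ m ih =>
    intro a ha
    rw [Finset.sum_range_succ']
    have h := ih (2 * a) (by positivity)
    simp only [pow_succ, mul_assoc, pow_zero, one_mul]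
    by_cases h1 : a < 1
    · rw [if_pos h1, max_eq_right (by linarith)]
      rw [max_eq_right (by linarith)] at h
      linarith
    · rw [if_neg h1, add_zero]
      refine h.trans ?_
      rw [max_eq_left (by linarith)]
      exact le_max_left _ _

/-- The second derivatives of the parametrix satisfy the Hörmander condition uniformly. -/
theorem exists_hormander (i j : Fin 2) : ∃ B : ℝ≥0, ∀ (m : ℕ) (y : Euc 2),
    ∫⁻ x in {x | 2 * ‖y‖ < ‖x‖},
      ‖pd i (pd j (parametrix m)) (x - y) - pd i (pd j (parametrix m)) x‖ₑ ≤ B := by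
  set κ := pd i (pd j logBlock) with hκ
  have hκs : ContDiff ℝ ∞ κ := (contDiff_logBlock.pd j).pd i
  have hcL : HasCompactSupport logBlock := hasCompactSupport_of_eq_zero fun _ => logBlock_eq_zero
  have hκc : HasCompactSupport κ := hasCompactSupport_pd (hasCompactSupport_pd hcL j) i
  obtain ⟨ℓ, hℓ⟩ := ContDiff.lipschitzWith_of_hasCompactSupport hκc hκs (by simp)
  have hts : ∀ x, 1 < ‖x‖ → κ x = 0 := by
    intro x hx
    refine image_eq_zero_of_notMem_tsupport fun h => ?_
    have h2 : x ∈ tsupport logBlock := tsupport_pd_subset _ j (tsupport_pd_subset _ i h)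
    have h3 : tsupport logBlock ⊆ Metric.closedBall 0 1 := by
      refine closure_minimal (fun z hz => ?_) Metric.isClosed_closedBall
      rw [mem_closedBall_zero_iff]
      by_contra! h4
      exact hz (logBlock_eq_zero h4.le)
    have := mem_closedBall_zero_iff.1 (h3 h2)
    linarith
  refine ⟨32 * ℓ, fun m y => ?_⟩
  -- The block with factor `t = 2 ^ k` lives in `|x| ≤ 1 / t`. If `t |y| ≥ 1`, both of its values
  -- vanish in the region. Otherwise the Lipschitz bound gives `t² ℓ t |y|` on a disk of radius `2 /
  -- t`, and `16` bounds `4π`.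
  have hsingle : ∀ k : ℕ, ∫⁻ x in {x | 2 * ‖y‖ < ‖x‖},
      ‖((2 : ℝ) ^ k) ^ 2 * (κ ((2 : ℝ) ^ k • (x - y)) - κ ((2 : ℝ) ^ k • x))‖ₑ ≤
      16 * ℓ * ENNReal.ofReal (if 2 ^ k * ‖y‖ < 1 then 2 ^ k * ‖y‖ else 0) := by
    intro k
    have hm : MeasurableSet {x : Euc 2 | 2 * ‖y‖ < ‖x‖} :=
      (isOpen_lt continuous_const continuous_norm).measurableSet
    set t : ℝ := 2 ^ k with ht
    have ht0 : 0 < t := by positivity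
    have hbig : ∀ x : Euc 2, 2 * ‖y‖ < ‖x‖ → ‖y‖ < ‖x - y‖ := fun x hx => by
      have := norm_sub_norm_le x y
      linarith
    have hnt : ∀ z : Euc 2, ‖t • z‖ = t * ‖z‖ := fun z => by
      rw [norm_smul, Real.norm_of_nonneg ht0.le]
    split_ifs with h1
    · calc _ ≤ ∫⁻ x in {x : Euc 2 | 2 * ‖y‖ < ‖x‖}, (Metric.ball (0 : Euc 2) (2 * t⁻¹)).indicator
              (fun _ => ENNReal.ofReal (t ^ 2 * (ℓ * (t * ‖y‖)))) x := by
            refine lintegral_mono fun x => ?_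
            by_cases hx : x ∈ Metric.ball 0 (2 * t⁻¹)
            · rw [indicator_of_mem hx, ← ofReal_norm]
              apply ENNReal.ofReal_le_ofReal
              rw [norm_mul, Real.norm_of_nonneg (by positivity)]
              gcongr
              have := hℓ.dist_le_mul (t • (x - y)) (t • x)
              rw [dist_eq_norm, dist_eq_norm, ← smul_sub, sub_sub_cancel_left, hnt, norm_neg] at this
              exact this
            · rw [mem_ball_zero_iff, not_lt] at hx
              have hx2 : 2 ≤ t * ‖x‖ := by
                rw [← div_eq_mul_inv, div_le_iff₀ ht0] at hx
                linarith
              have e1 : κ (t • x) = 0 := hts _ (by rw [hnt]; linarith)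
              have e2 : κ (t • (x - y)) = 0 := hts _ (by
                rw [hnt]
                have := norm_sub_norm_le x y
                nlinarith)
              rw [e1, e2]
              simp
        _ ≤ ∫⁻ x : Euc 2, (Metric.ball (0 : Euc 2) (2 * t⁻¹)).indicator
              (fun _ => ENNReal.ofReal (t ^ 2 * (ℓ * (t * ‖y‖)))) x := setLIntegral_le_lintegral _ _
        _ = ENNReal.ofReal (t ^ 2 * (ℓ * (t * ‖y‖))) * volume (Metric.ball (0 : Euc 2) (2 * t⁻¹)) := by
            rw [lintegral_indicator measurableSet_ball, setLIntegral_const]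
        _ ≤ _ := by
            rw [EuclideanSpace.volume_ball_fin_two, ← ENNReal.ofReal_pow (by positivity),
              ← ENNReal.ofReal_coe_nnreal (p := ℓ), show (16 : ℝ≥0∞) = ENNReal.ofReal 16 by simp,
              ← ENNReal.ofReal_mul (sq_nonneg _), ← ENNReal.ofReal_mul (by positivity),
              ← ENNReal.ofReal_mul (by norm_num : (0 : ℝ) ≤ 16), ← ENNReal.ofReal_mul (by positivity)]
            apply ENNReal.ofReal_le_ofReal
            have e : t ^ 2 * (ℓ * (t * ‖y‖)) * ((2 * t⁻¹) ^ 2 * Real.pi) =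
              ℓ * (t * ‖y‖) * (4 * Real.pi) := by field_simp; ring
            rw [e]
            have hp := Real.pi_lt_four
            have h0 : 0 ≤ ℓ * (t * ‖y‖) := by positivity
            nlinarith
    · rw [ENNReal.ofReal_zero, mul_zero, nonpos_iff_eq_zero]
      rw [setLIntegral_congr_fun (g := fun _ => 0) hm]
      · simp
      · intro x hx
        have hx' : 2 * ‖y‖ < ‖x‖ := hx
        have hy := hbig x hx'
        have e1 : κ (t • x) = 0 := hts _ (by rw [hnt]; nlinarith [norm_nonneg y])
        have e2 : κ (t • (x - y)) = 0 := hts _ (by rw [hnt]; nlinarith)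
        simp only [e1, e2]
        simp
  have hcont : ∀ k : ℕ, Continuous fun x : Euc 2 =>
      ((2 : ℝ) ^ k) ^ 2 * (κ ((2 : ℝ) ^ k • (x - y)) - κ ((2 : ℝ) ^ k • x)) := by
    intro k
    have := hκs.continuous
    fun_prop
  calc _ ≤ ∫⁻ x in {x | 2 * ‖y‖ < ‖x‖}, ∑ k ∈ Finset.range m,
        ‖((2 : ℝ) ^ k) ^ 2 * (κ ((2 : ℝ) ^ k • (x - y)) - κ ((2 : ℝ) ^ k • x))‖ₑ := by
        refine lintegral_mono fun x => ?_
        rw [pd_pd_parametrix, pd_pd_parametrix, ← Finset.sum_sub_distrib]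
        simp only [← mul_sub]
        exact enorm_sum_le _ _
    _ = ∑ k ∈ Finset.range m, ∫⁻ x in {x | 2 * ‖y‖ < ‖x‖},
        ‖((2 : ℝ) ^ k) ^ 2 * (κ ((2 : ℝ) ^ k • (x - y)) - κ ((2 : ℝ) ^ k • x))‖ₑ :=
        lintegral_finsetSum _ fun k _ => (hcont k).measurable.enorm
    _ ≤ ∑ k ∈ Finset.range m, 16 * ℓ * ENNReal.ofReal (if 2 ^ k * ‖y‖ < 1 then 2 ^ k * ‖y‖ else 0) :=
        Finset.sum_le_sum fun k _ => hsingle k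
    _ = 16 * ℓ * ENNReal.ofReal (∑ k ∈ Finset.range m,
          if 2 ^ k * ‖y‖ < 1 then 2 ^ k * ‖y‖ else 0) := by
        rw [← Finset.mul_sum, ENNReal.ofReal_sum_of_nonneg]
        intro k _
        split_ifs <;> positivity
    _ ≤ 16 * ℓ * ENNReal.ofReal 2 := by
        gcongr
        refine (geometric_cutoff_sum_le m ‖y‖ (norm_nonneg y)).trans ?_
        exact max_le (by norm_num) (by linarith [norm_nonneg y])
    _ = _ := by
        rw [ENNReal.ofReal_ofNat]
        push_cast
        ring

/-- The second derivatives of the smooth function `conv (parametrix m) g` are bounded by its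
Laplacian. That is the convolution of `g` with `scaledSource m - logSource`, two kernels of equal
`L¹` norm, so the bound is uniform in `m`. -/
theorem eLpNorm_conv_parametrix_two (m : ℕ) (i j : Fin 2) {g : Euc 2 → ℝ} (h1 : MemLp g 1 volume)
    (h2 : MemLp g 2 volume) :
    eLpNorm (conv (pd i (pd j (parametrix m))) g) 2 volume ≤
      2 * eLpNorm logSource 1 volume * eLpNorm g 2 volume := by
  have hs := contDiff_parametrix m
  have hc := hasCompactSupport_parametrix m
  have hg : LocallyIntegrable g := (memLp_one_iff_integrable.1 h1).locallyIntegrable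
  have hmem : ∀ {k : Euc 2 → ℝ}, ContDiff ℝ ∞ k → HasCompactSupport k →
      MemLp (conv k g) 2 volume := by
    intro k hk hkc
    refine ⟨(contDiff_conv hk hkc hg).continuous.aestronglyMeasurable, ?_⟩
    refine (eLpNorm_conv_le hk.continuous.measurable h2.1 (by norm_num) (by norm_num)).trans_lt ?_
    exact ENNReal.mul_lt_top (hk.continuous.memLp_of_hasCompactSupport hkc).2 h2.2
  have e1 : ∀ l, pd l (conv (parametrix m) g) = conv (pd l (parametrix m)) g := fun l =>
    pd_conv hs hc hg l
  have e2 : ∀ l l', pd l (pd l' (conv (parametrix m) g)) = conv (pd l (pd l' (parametrix m))) g :=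
    fun l l' => by rw [e1, pd_conv (hs.pd l') (hasCompactSupport_pd hc l') hg]
  have hL := eLpNorm_pd_pd_le_lap (contDiff_conv hs hc hg)
    (fun l => by rw [e1]; exact hmem (hs.pd l) (hasCompactSupport_pd hc l))
    (fun l l' => by
      rw [e2]; exact hmem ((hs.pd l').pd l) (hasCompactSupport_pd (hasCompactSupport_pd hc l') l))
    (fun l l' l'' => by
      rw [e2, pd_conv ((hs.pd _).pd _) (hasCompactSupport_pd (hasCompactSupport_pd hc _) _) hg]
      exact hmem (((hs.pd _).pd _).pd _)
        (hasCompactSupport_pd (hasCompactSupport_pd (hasCompactSupport_pd hc _) _) _)) i j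
  rw [e2, lap_conv hs hc hg] at hL
  refine hL.trans ((eLpNorm_conv_le hs.lap.continuous.measurable h2.1 (by norm_num)
    (by norm_num)).trans ?_)
  gcongr
  have e3 : lap (parametrix m) = fun x => scaledSource m x - logSource x := by
    ext x; exact lap_parametrix m x
  rw [e3]
  refine (eLpNorm_sub_le (f := scaledSource m) (g := logSource)
    (contDiff_scaledSource m).continuous.aestronglyMeasurable
    contDiff_logSource.continuous.aestronglyMeasurable le_rfl).trans_eq ?_
  rw [eLpNorm_scaledSource, two_mul]

theorem eLpNorm_logSource_lt_top : eLpNorm logSource 1 volume < ⊤ :=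
  (contDiff_logSource.continuous.memLp_of_hasCompactSupport
    (hasCompactSupport_of_eq_zero fun _ => logSource_eq_zero)).2

theorem exists_eLpNorm_conv_parametrix_le {p : ℝ} (hp1 : 1 < p) (hp2 : p ≤ 2) (i j : Fin 2) :
    ∃ C : ℝ≥0, ∀ (m : ℕ) (f : Euc 2 → ℝ), Continuous f → HasCompactSupport f →
      eLpNorm (conv (pd i (pd j (parametrix m))) f) (ENNReal.ofReal p) volume ≤
        C * eLpNorm f (ENNReal.ofReal p) volume := by
  have hA : 2 * eLpNorm logSource 1 volume ≠ ⊤ :=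
    ENNReal.mul_ne_top (by norm_num) eLpNorm_logSource_lt_top.ne
  -- The interpolated constant contains `(2 - p)⁻¹`; for `p = 2` the `L²` bound is used directly.
  rcases hp2.eq_or_lt with rfl | hp2
  · refine ⟨(2 * eLpNorm logSource 1 volume).toNNReal, fun m f hf hc => ?_⟩
    rw [ENNReal.coe_toNNReal hA, show ENNReal.ofReal 2 = 2 by simp]
    exact eLpNorm_conv_parametrix_two m i j (hf.memLp_of_hasCompactSupport hc)
      (hf.memLp_of_hasCompactSupport hc)
  · obtain ⟨B, hB⟩ := exists_hormander i j
    have hp0 : 0 < p := by linarith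
    set A := 2 * eLpNorm logSource 1 volume
    set D : ℝ≥0∞ := ENNReal.ofReal (2 ^ p) * (ENNReal.ofReal p *
        ((16 * A ^ 2 + 8 * B + 40) * ENNReal.ofReal (2 ^ p / (p - 1)) +
          A ^ 2 * ENNReal.ofReal (2 - p)⁻¹)) with hD
    have hDfin : D ^ (1 / p) ≠ ⊤ := by
      have hA2 : A ^ 2 ≠ ⊤ := ENNReal.pow_ne_top hA
      refine ENNReal.rpow_ne_top_of_nonneg (by positivity) ?_
      rw [hD]
      finiteness
    refine ⟨(D ^ (1 / p)).toNNReal, fun m f hf hc => ?_⟩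
    rw [ENNReal.coe_toNNReal hDfin]
    have hks := ((contDiff_parametrix m).pd j).pd i
    have hkc := hasCompactSupport_pd (hasCompactSupport_pd (hasCompactSupport_parametrix m) j) i
    have h := lintegral_conv_rpow_le hks.continuous hkc
      (fun g h1 h2 => eLpNorm_conv_parametrix_two m i j h1 h2) (hB m) hf hc hp1 hp2
    have hr0 : ENNReal.ofReal p ≠ 0 := by simpa using hp0
    rw [eLpNorm_eq_lintegral_rpow_enorm_toReal hr0 ENNReal.ofReal_ne_top,
      eLpNorm_eq_lintegral_rpow_enorm_toReal hr0 ENNReal.ofReal_ne_top,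
      ENNReal.toReal_ofReal hp0.le, ← ENNReal.mul_rpow_of_nonneg _ _ (by positivity)]
    have e : ∀ z : ℝ, ‖z‖ₑ ^ p = ENNReal.ofReal (|z| ^ p) := fun z => by
      rw [← ofReal_norm, ENNReal.ofReal_rpow_of_nonneg (norm_nonneg _) hp0.le, Real.norm_eq_abs]
    simp only [e]
    exact ENNReal.rpow_le_rpow h (by positivity)

/-- After rescaling, the kernel is fixed and the argument of `ψ` tends to `x`, so dominated
convergence applies. -/
theorem conv_scaledSource_tendsto {ψ : Euc 2 → ℝ} (hψ : Continuous ψ) (hc : HasCompactSupport ψ)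
    (x : Euc 2) :
    Tendsto (fun m => conv (scaledSource m) ψ x) atTop (𝓝 ((∫ z, logSource z) * ψ x)) := by
  obtain ⟨M, hM⟩ := hψ.bounded_above_of_compact_support hc
  have e : ∀ m, conv (scaledSource m) ψ x = ∫ z, logSource z * ψ (x - ((2 : ℝ) ^ m)⁻¹ • z) := by
    intro m
    rw [conv_comm, conv, ← integral_scaledSource_mul m fun y => ψ (x - y)]
    simp only [mul_comm]
  simp only [e]
  rw [← integral_mul_const]
  have hli : Integrable logSource := contDiff_logSource.continuous.integrable_of_hasCompactSupport
    (hasCompactSupport_of_eq_zero fun _ => logSource_eq_zero)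
  refine tendsto_integral_of_dominated_convergence (fun z => ‖logSource z‖ * M) ?_ (hli.norm.mul_const M) ?_ ?_
  · intro m
    exact (contDiff_logSource.continuous.mul (by fun_prop)).aestronglyMeasurable
  · intro m
    refine Eventually.of_forall fun z => ?_
    rw [norm_mul]
    gcongr
    exact hM _
  · refine Eventually.of_forall fun z => ?_
    refine Tendsto.const_mul _ ?_
    have h1 : Tendsto (fun m : ℕ => ((2 : ℝ) ^ m)⁻¹) atTop (𝓝 0) := by
      have := tendsto_pow_atTop_nhds_zero_of_lt_one (r := (2 : ℝ)⁻¹) (by norm_num) (by norm_num)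
      simpa only [inv_pow] using this
    have h2 : Tendsto (fun m : ℕ => x - ((2 : ℝ) ^ m)⁻¹ • z) atTop (𝓝 x) := by
      simpa using tendsto_const_nhds.sub (h1.smul_const z)
    exact (hψ.tendsto x).comp h2

/-- **The Calderón–Zygmund estimate** for test functions in the plane. -/
theorem exists_eLpNorm_pd_pd_le {p : ℝ} (hp1 : 1 < p) (hp2 : p ≤ 2) :
    ∃ C : ℝ≥0, ∀ (i j : Fin 2) (φ : Euc 2 → ℝ), ContDiff ℝ ∞ φ → HasCompactSupport φ →
      eLpNorm (pd i (pd j φ)) (ENNReal.ofReal p) volume ≤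
        C * (eLpNorm (lap φ) (ENNReal.ofReal p) volume + eLpNorm φ (ENNReal.ofReal p) volume) := by
  set r := ENNReal.ofReal p with hr
  have hr1 : 1 ≤ r := by rw [hr, ← ENNReal.ofReal_one]; exact ENNReal.ofReal_le_ofReal hp1.le
  have hrt : r ≠ ⊤ := ENNReal.ofReal_ne_top
  have hls := contDiff_logSource
  have hlc : HasCompactSupport logSource := hasCompactSupport_of_eq_zero fun _ => logSource_eq_zero
  have key : ∀ i j : Fin 2, ∃ C : ℝ≥0, ∀ (φ : Euc 2 → ℝ), ContDiff ℝ ∞ φ → HasCompactSupport φ →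
      eLpNorm (pd i (pd j φ)) r volume ≤ C * (eLpNorm (lap φ) r volume + eLpNorm φ r volume) := by
    intro i j
    obtain ⟨C₀, hC₀⟩ := exists_eLpNorm_conv_parametrix_le hp1 hp2 i j
    set c := ∫ z, logSource z with hc
    have hc0 : 0 < c := integral_logSource_pos
    set C₁ := eLpNorm (pd i (pd j logSource)) 1 volume with hC₁
    have hC₁t : C₁ ≠ ⊤ := (((hls.pd j).pd i).continuous.memLp_of_hasCompactSupport
      (hasCompactSupport_pd (hasCompactSupport_pd hlc j) i)).2.ne
    refine ⟨c.toNNReal⁻¹ * (C₀ + C₁.toNNReal), fun φ hφ hφc => ?_⟩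
    set ψ := pd i (pd j φ) with hψ
    have hψs : ContDiff ℝ ∞ ψ := (hφ.pd j).pd i
    have hψc : HasCompactSupport ψ := hasCompactSupport_pd (hasCompactSupport_pd hφc j) i
    have hloc : ∀ {f : Euc 2 → ℝ}, ContDiff ℝ ∞ f → LocallyIntegrable f := fun h =>
      h.continuous.locallyIntegrable
    have hpd2 : ∀ {k g : Euc 2 → ℝ}, ContDiff ℝ ∞ k → HasCompactSupport k → ContDiff ℝ ∞ g →
        conv (pd i (pd j k)) g = pd i (pd j (conv k g)) := fun hk hkc hg => by
      rw [pd_conv hk hkc (hloc hg), pd_conv (hk.pd j) (hasCompactSupport_pd hkc j) (hloc hg)]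
    have hmove : ∀ {k : Euc 2 → ℝ}, ContDiff ℝ ∞ k → HasCompactSupport k →
        conv (pd i (pd j k)) φ = conv k ψ := fun hk hkc => by
      rw [hpd2 hk hkc hφ, conv_comm, ← hpd2 hφ hφc hk, conv_comm]
    -- All factors are smooth and one in each convolution has compact support, so derivatives may be
    -- moved freely: two pass from the parametrix to `φ`, and the Laplacian passes back.
    have hid : ∀ m, conv (pd i (pd j (parametrix m))) (lap φ) = conv (lap (parametrix m)) ψ := by
      intro m
      have hs := contDiff_parametrix m
      have hcm := hasCompactSupport_parametrix m
      rw [conv_comm, ← lap_conv hφ hφc (hloc ((hs.pd j).pd i)), conv_comm, hmove hs hcm,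
        lap_conv hs hcm (hloc hψs)]
    have hF : ∀ m, conv (scaledSource m) ψ =
        fun x => conv (pd i (pd j (parametrix m))) (lap φ) x + conv (pd i (pd j logSource)) φ x := by
      intro m
      ext x
      rw [hid, hmove hls hlc]
      have e3 : lap (parametrix m) = fun x => scaledSource m x - logSource x := by
        ext x; exact lap_parametrix m x
      simp only [conv, e3, sub_mul]
      rw [integral_sub
        (integrable_conv_integrand (contDiff_scaledSource m).continuous
          (hasCompactSupport_scaledSource m) (hloc hψs) x)
        (integrable_conv_integrand hls.continuous hlc (hloc hψs) x)]
      ring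
    have hbound : ∀ m, eLpNorm (conv (scaledSource m) ψ) r volume ≤
        (C₀ + C₁) * (eLpNorm (lap φ) r volume + eLpNorm φ r volume) := by
      intro m
      have hks := ((contDiff_parametrix m).pd j).pd i
      have hkc := hasCompactSupport_pd (hasCompactSupport_pd (hasCompactSupport_parametrix m) j) i
      rw [hF]
      refine (eLpNorm_add_le (f := conv (pd i (pd j (parametrix m))) (lap φ))
        (g := conv (pd i (pd j logSource)) φ)
        (contDiff_conv hks hkc (hloc hφ.lap)).continuous.aestronglyMeasurable
        (contDiff_conv ((hls.pd j).pd i) (hasCompactSupport_pd (hasCompactSupport_pd hlc j) i)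
          (hloc hφ)).continuous.aestronglyMeasurable hr1).trans ?_
      calc _ ≤ C₀ * eLpNorm (lap φ) r volume + C₁ * eLpNorm φ r volume :=
            add_le_add (hC₀ m _ hφ.lap.continuous (hasCompactSupport_lap hφc))
              (eLpNorm_conv_le ((hls.pd j).pd i).continuous.measurable
                hφ.continuous.aestronglyMeasurable hr1 hrt)
        _ ≤ (C₀ + C₁) * eLpNorm (lap φ) r volume + (C₀ + C₁) * eLpNorm φ r volume := by
            gcongr
            · exact le_self_add
            · exact le_add_self
        _ = _ := by rw [mul_add]
    -- The bound is uniform in `m` while the left side tends pointwise to `c ψ`, so Fatou's lemma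
    -- gives the estimate for the second derivative itself.
    have hlim := Lp.eLpNorm_lim_le_liminf_eLpNorm (p := r) (μ := volume)
      (f := fun m => conv (scaledSource m) ψ)
      (fun m => (contDiff_conv (contDiff_scaledSource m) (hasCompactSupport_scaledSource m)
        (hloc hψs)).continuous.aestronglyMeasurable) (fun x => c * ψ x)
      (Eventually.of_forall fun x => conv_scaledSource_tendsto hψs.continuous hψc x)
    have h3 : eLpNorm (fun x => c * ψ x) r volume ≤
        (C₀ + C₁) * (eLpNorm (lap φ) r volume + eLpNorm φ r volume) :=
      hlim.trans (liminf_le_of_le (by isBoundedDefault) fun b hb => by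
        obtain ⟨m, hm⟩ := hb.exists
        exact hm.trans (hbound m))
    have h4 : eLpNorm (fun x => c * ψ x) r volume = ENNReal.ofReal c * eLpNorm ψ r volume := by
      have := eLpNorm_const_smul (p := r) (μ := volume) c ψ
      rw [← ofReal_norm, Real.norm_of_nonneg hc0.le] at this
      exact this
    rw [h4] at h3
    have hc1 : ENNReal.ofReal c ≠ 0 := by simpa using hc0
    have h5 : eLpNorm ψ r volume = (ENNReal.ofReal c)⁻¹ * (ENNReal.ofReal c * eLpNorm ψ r volume) := by
      rw [← mul_assoc, ENNReal.inv_mul_cancel hc1 ENNReal.ofReal_ne_top, one_mul]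
    rw [h5]
    refine (mul_le_mul_right h3 _).trans_eq ?_
    rw [← mul_assoc]
    congr 1
    push_cast
    rw [ENNReal.coe_inv (by simpa using hc0), ENNReal.coe_toNNReal hC₁t]
    rfl
  choose C hC using key
  refine ⟨∑ i, ∑ j, C i j, fun i j φ hφ hφc => (hC i j φ hφ hφc).trans ?_⟩
  gcongr
  exact (Finset.single_le_sum (f := fun j => C i j) (fun _ _ => zero_le) (Finset.mem_univ j)).trans
    (Finset.single_le_sum (f := fun i => ∑ j, C i j) (fun _ _ => zero_le) (Finset.mem_univ i))

/-! ### Mollification -/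

/-- The bump functions from which the mollifiers are made. -/
def mollBump (m : ℕ) : ContDiffBump (0 : Euc 2) where
  rIn := 1 / (2 * (m + 1))
  rOut := 1 / (m + 1)
  rIn_pos := by positivity
  rIn_lt_rOut := by
    apply one_div_lt_one_div_of_lt (by positivity)
    have : (0 : ℝ) < m + 1 := by positivity
    linarith

/-- A sequence of mollifiers, the `m`-th one supported in the ball of radius `1 / (m + 1)`. -/
def moll (m : ℕ) : Euc 2 → ℝ := (mollBump m).normed volume

theorem contDiff_moll (m : ℕ) : ContDiff ℝ ∞ (moll m) := (mollBump m).contDiff_normed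

theorem hasCompactSupport_moll (m : ℕ) : HasCompactSupport (moll m) :=
  (mollBump m).hasCompactSupport_normed

theorem tsupport_moll (m : ℕ) : tsupport (moll m) = Metric.closedBall 0 (1 / (m + 1)) :=
  (mollBump m).tsupport_normed_eq

theorem eLpNorm_moll (m : ℕ) : eLpNorm (moll m) 1 volume = 1 := by
  have hi : Integrable (moll m) := (mollBump m).integrable_normed
  rw [eLpNorm_one_eq_lintegral_enorm, ← ofReal_integral_norm_eq_lintegral_enorm hi]
  have : ∀ x, ‖moll m x‖ = moll m x := fun x => Real.norm_of_nonneg ((mollBump m).nonneg_normed x)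
  have h1 : ∫ x, moll m x = 1 := (mollBump m).integral_normed
  simp only [this]
  rw [h1, ENNReal.ofReal_one]

theorem tendsto_rOut : Tendsto (fun m => (mollBump m).rOut) atTop (𝓝 0) :=
  tendsto_one_div_add_atTop_nhds_zero_nat

theorem moll_conv_eq (m : ℕ) (g : Euc 2 → ℝ) :
    conv (moll m) g = convolution (moll m) g (ContinuousLinearMap.lsmul ℝ ℝ) volume := by
  rw [conv_comm]
  ext x
  rw [convolution_lsmul]
  simp only [conv, smul_eq_mul, mul_comm]

theorem contDiff_moll_conv (m : ℕ) {g : Euc 2 → ℝ} (hg : LocallyIntegrable g) :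
    ContDiff ℝ ∞ (conv (moll m) g) := contDiff_conv (contDiff_moll m) (hasCompactSupport_moll m) hg

theorem eLpNorm_moll_conv_le (m : ℕ) {g : Euc 2 → ℝ} (hg : AEStronglyMeasurable g)
    {p : ℝ≥0∞} (hp : 1 ≤ p) (hp' : p ≠ ⊤) :
    eLpNorm (conv (moll m) g) p volume ≤ eLpNorm g p volume := by
  have := eLpNorm_conv_le (contDiff_moll m).continuous.measurable hg hp hp'
  rwa [eLpNorm_moll, one_mul] at this

theorem ae_tendsto_moll_conv {g : Euc 2 → ℝ} (hg : LocallyIntegrable g) :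
    ∀ᵐ x, Tendsto (fun m => conv (moll m) g x) atTop (𝓝 (g x)) := by
  simp only [moll_conv_eq]
  refine ContDiffBump.ae_convolution_tendsto_right_of_locallyIntegrable (K := 2) tendsto_rOut
    (Eventually.of_forall fun m => ?_) hg
  simp only [mollBump]
  have : (0 : ℝ) < m + 1 := by positivity
  apply le_of_eq
  field_simp

theorem tendsto_moll_conv_of_continuous {h : Euc 2 → ℝ} (hc : Continuous h)
    (hs : HasCompactSupport h) (p : ℝ≥0∞) :
    Tendsto (fun m => eLpNorm (fun x => conv (moll m) h x - h x) p volume) atTop (𝓝 0) := by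
  set K' := Metric.cthickening 1 (tsupport h) with hK'
  have hKc : IsCompact K' := IsCompact.cthickening hs
  have hKfin : volume K' ^ p.toReal⁻¹ ≠ ⊤ :=
    ENNReal.rpow_ne_top_of_nonneg (by positivity) hKc.measure_lt_top.ne
  have hsupp : ∀ m, Function.support (fun x => conv (moll m) h x - h x) ⊆ K' := by
    intro m x hx
    by_contra hxK
    apply hx
    have h0 : h x = 0 := image_eq_zero_of_notMem_tsupport fun hx2 =>
      hxK (Metric.self_subset_cthickening _ hx2)
    have h1 : conv (moll m) h x = 0 := by
      rw [conv]
      refine integral_eq_zero_of_ae (Eventually.of_forall fun y => ?_)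
      simp only [Pi.zero_apply, mul_eq_zero]
      by_contra! hy
      have hy1 : x - y ∈ tsupport (moll m) := subset_tsupport _ hy.1
      have hy2 : y ∈ tsupport h := subset_tsupport _ hy.2
      rw [tsupport_moll, mem_closedBall_zero_iff] at hy1
      refine hxK (Metric.mem_cthickening_of_dist_le x y 1 _ hy2 ?_)
      rw [dist_eq_norm]
      refine hy1.trans ?_
      rw [div_le_one (by positivity)]
      simp
    simp [h0, h1]
  rw [ENNReal.tendsto_nhds_zero]
  intro ε hε
  rcases eq_or_ne ε ⊤ with rfl | hεt
  · exact Eventually.of_forall fun _ => le_top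
  obtain ⟨δ, hδ, hδε⟩ : ∃ δ : ℝ, 0 < δ ∧ volume K' ^ p.toReal⁻¹ * ENNReal.ofReal δ ≤ ε := by
    have : Tendsto (fun δ : ℝ => volume K' ^ p.toReal⁻¹ * ENNReal.ofReal δ) (𝓝[>] 0)
        (𝓝 (volume K' ^ p.toReal⁻¹ * ENNReal.ofReal 0)) :=
      (ENNReal.Tendsto.const_mul ((ENNReal.continuous_ofReal.tendsto 0))
        (Or.inr hKfin)).mono_left nhdsWithin_le_nhds
    rw [ENNReal.ofReal_zero, mul_zero] at this
    obtain ⟨δ, h1, h2⟩ := ((this.eventually_le_const hε).and self_mem_nhdsWithin).exists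
    exact ⟨δ, h2, h1⟩
  have huc := HasCompactSupport.uniformContinuous_of_continuous hs hc
  obtain ⟨η, hη, hηδ⟩ := Metric.uniformContinuous_iff.1 huc δ hδ
  filter_upwards [tendsto_rOut.eventually_lt_const hη] with m hm
  refine le_trans ?_ hδε
  rw [← eLpNorm_restrict_eq_of_support_subset (hsupp m)]
  refine (eLpNorm_le_of_ae_bound (C := δ) (Eventually.of_forall fun x => ?_)).trans_eq ?_
  · rw [moll_conv_eq, ← dist_eq_norm]
    refine (mollBump m).dist_normed_convolution_le hc.aestronglyMeasurable fun y hy => ?_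
    exact (hηδ (lt_trans (Metric.mem_ball.1 hy) hm)).le
  · simp

theorem tendsto_moll_conv {g : Euc 2 → ℝ} {p : ℝ≥0∞} (hp : 1 ≤ p) (hp' : p ≠ ⊤)
    (hg : MemLp g p volume) :
    Tendsto (fun m => eLpNorm (fun x => conv (moll m) g x - g x) p volume) atTop (𝓝 0) := by
  rw [ENNReal.tendsto_nhds_zero]
  intro ε hε
  have hε3 : ε / 3 ≠ 0 := by simpa using hε.ne'
  obtain ⟨h, hs, hgh, hc, hm⟩ := hg.exists_hasCompactSupport_eLpNorm_sub_le hp' hε3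
  filter_upwards [(ENNReal.tendsto_nhds_zero.1 (tendsto_moll_conv_of_continuous hc hs p)) (ε / 3)
    (pos_iff_ne_zero.2 hε3)] with m hmε
  have hgl : LocallyIntegrable g := hg.locallyIntegrable hp
  have hhl : LocallyIntegrable h := hc.locallyIntegrable
  have e : (fun x => conv (moll m) g x - g x) =
      (conv (moll m) (g - h) + fun x => conv (moll m) h x - h x) - (g - h) := by
    ext x
    have : conv (moll m) (g - h) x = conv (moll m) g x - conv (moll m) h x := by
      simp only [conv, Pi.sub_apply, mul_sub]
      exact integral_sub
        (integrable_conv_integrand (contDiff_moll m).continuous (hasCompactSupport_moll m) hgl x)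
        (integrable_conv_integrand (contDiff_moll m).continuous (hasCompactSupport_moll m) hhl x)
    simp only [Pi.add_apply, Pi.sub_apply, this]
    ring
  have hghm : AEStronglyMeasurable (g - h) volume := hg.1.sub hm.1
  have m1 : AEStronglyMeasurable (conv (moll m) (g - h)) volume :=
    (contDiff_moll_conv m (hgl.sub hhl)).continuous.aestronglyMeasurable
  have m2 : AEStronglyMeasurable (fun x => conv (moll m) h x - h x) volume :=
    ((contDiff_moll_conv m hhl).continuous.sub hc).aestronglyMeasurable
  rw [e]
  calc _ ≤ eLpNorm (conv (moll m) (g - h)) p volume +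
        eLpNorm (fun x => conv (moll m) h x - h x) p volume + eLpNorm (g - h) p volume :=
        (eLpNorm_sub_le (m1.add m2) hghm hp).trans
          (add_le_add_left (eLpNorm_add_le m1 m2 hp) _)
    _ ≤ ε / 3 + ε / 3 + ε / 3 :=
        add_le_add (add_le_add ((eLpNorm_moll_conv_le m hghm hp hp').trans hgh) hmε) hgh
    _ = ε := ENNReal.add_thirds ε

/-- `g'` is a weak derivative of `g` in the direction `i` with respect to the test functions
supported in `S`. -/
def WeakDeriv (S : Set (Euc 2)) (i : Fin 2) (g g' : Euc 2 → ℝ) : Prop :=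
  ∀ φ : Euc 2 → ℝ, ContDiff ℝ ∞ φ → HasCompactSupport φ → tsupport φ ⊆ S →
    ∫ x, pd i φ x * g x = -∫ x, φ x * g' x

theorem tsupport_comp_const_sub {f : Euc 2 → ℝ} (x : Euc 2) :
    tsupport (fun y => f (x - y)) ⊆ {y | x - y ∈ tsupport f} := by
  refine closure_minimal (fun y hy => subset_tsupport f hy) ?_
  exact (isClosed_tsupport f).preimage (by fun_prop)

theorem moll_testFunction (m : ℕ) (x : Euc 2) :
    ContDiff ℝ ∞ (fun y => moll m (x - y)) ∧ HasCompactSupport (fun y => moll m (x - y)) ∧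
      tsupport (fun y => moll m (x - y)) ⊆ Metric.closedBall x (1 / (m + 1)) := by
  have h : tsupport (fun y => moll m (x - y)) ⊆ Metric.closedBall x (1 / (m + 1)) := by
    refine (tsupport_comp_const_sub x).trans fun y hy => ?_
    rw [mem_ofPred_eq, tsupport_moll, mem_closedBall_zero_iff] at hy
    rwa [Metric.mem_closedBall, dist_comm, dist_eq_norm]
  exact ⟨(contDiff_moll m).comp (contDiff_const.sub contDiff_id),
    (isCompact_closedBall x _).of_isClosed_subset (isClosed_tsupport _) h, h⟩

/-- Mollification commutes with weak differentiation. -/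
theorem WeakDeriv.pd_moll_conv {S : Set (Euc 2)} {i : Fin 2} {g g' : Euc 2 → ℝ}
    (h : WeakDeriv S i g g') (hg : LocallyIntegrable g) {m : ℕ} {x : Euc 2}
    (hx : Metric.closedBall x (1 / (m + 1)) ⊆ S) :
    pd i (conv (moll m) g) x = conv (moll m) g' x := by
  obtain ⟨h1, h2, h3⟩ := moll_testFunction m x
  rw [pd_conv (contDiff_moll m) (hasCompactSupport_moll m) hg]
  have := h _ h1 h2 (h3.trans hx)
  simp only [pd_const_sub ((contDiff_moll m).differentiable (by simp)), neg_mul, integral_neg,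
    neg_inj] at this
  exact this

theorem lap_moll_testFunction (m : ℕ) (x y : Euc 2) :
    lap (fun y => moll m (x - y)) y = lap (moll m) (x - y) := by
  have hd : ∀ {f : Euc 2 → ℝ}, ContDiff ℝ ∞ f → Differentiable ℝ f :=
    fun h => h.differentiable (by simp)
  simp only [lap]
  refine Finset.sum_congr rfl fun i _ => ?_
  have e : (pd i fun y => moll m (x - y)) = fun y => (-1) * pd i (moll m) (x - y) := by
    ext y
    rw [pd_const_sub (hd (contDiff_moll m))]
    ring
  rw [e, pd_const_mul (f := fun y => pd i (moll m) (x - y)) (-1)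
    ((hd ((contDiff_moll m).pd i)).comp (differentiable_const x |>.sub differentiable_id)),
    pd_const_sub (hd ((contDiff_moll m).pd i))]
  ring

/-- The Calderón–Zygmund estimate for the mollifications of a function with compact support whose
Laplacian in the sense of distributions is a function. -/
theorem exists_eLpNorm_pd_pd_moll_conv_le {p : ℝ} (hp1 : 1 < p) (hp2 : p ≤ 2) :
    ∃ C : ℝ≥0, ∀ (w k : Euc 2 → ℝ), LocallyIntegrable w → HasCompactSupport w →
      AEStronglyMeasurable k →
      (∀ φ, ContDiff ℝ ∞ φ → HasCompactSupport φ → ∫ x, lap φ x * w x = ∫ x, φ x * k x) →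
      ∀ (m : ℕ) (i j : Fin 2),
        eLpNorm (pd i (pd j (conv (moll m) w))) (ENNReal.ofReal p) volume ≤
          C * (eLpNorm k (ENNReal.ofReal p) volume + eLpNorm w (ENNReal.ofReal p) volume) := by
  obtain ⟨C, hC⟩ := exists_eLpNorm_pd_pd_le hp1 hp2
  have hr1 : 1 ≤ ENNReal.ofReal p := by
    rw [← ENNReal.ofReal_one]; exact ENNReal.ofReal_le_ofReal hp1.le
  refine ⟨C, fun w k hw hwc hk hwk m i j => ?_⟩
  refine (hC i j _ (contDiff_moll_conv m hw)
    (hasCompactSupport_conv (hasCompactSupport_moll m) hwc)).trans ?_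
  -- The reflected and translated mollifier is an admissible test function in the distributional
  -- equation.
  have e : lap (conv (moll m) w) = conv (moll m) k := by
    rw [lap_conv (contDiff_moll m) (hasCompactSupport_moll m) hw]
    ext x
    obtain ⟨h1, h2, -⟩ := moll_testFunction m x
    have := hwk _ h1 h2
    simp only [lap_moll_testFunction] at this
    exact this
  rw [e]
  gcongr
  · exact eLpNorm_moll_conv_le m hk hr1 ENNReal.ofReal_ne_top
  · exact eLpNorm_moll_conv_le m hw.aestronglyMeasurable hr1 ENNReal.ofReal_ne_top

/-! ### The multiplicative Sobolev inequality -/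

theorem norm_fderiv_le (f : Euc 2 → ℝ) (x : Euc 2) :
    ‖fderiv ℝ f x‖ ≤ ‖pd 0 f x‖ + ‖pd 1 f x‖ := by
  refine ContinuousLinearMap.opNorm_le_bound _ (by positivity) fun y => ?_
  have hy : y = y 0 • EuclideanSpace.single 0 1 + y 1 • EuclideanSpace.single (1 : Fin 2) (1 : ℝ) := by
    ext i
    fin_cases i <;> simp
  have h : fderiv ℝ f x y = y 0 * pd 0 f x + y 1 * pd 1 f x := by
    conv_lhs => rw [hy]
    simp [pd]
  rw [h]
  have h0 : |y 0| ≤ ‖y‖ := by simpa using PiLp.norm_apply_le y 0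
  have h1 : |y 1| ≤ ‖y‖ := by simpa using PiLp.norm_apply_le y 1
  calc ‖y 0 * pd 0 f x + y 1 * pd 1 f x‖ ≤ |y 0| * ‖pd 0 f x‖ + |y 1| * ‖pd 1 f x‖ := by
        refine (norm_add_le _ _).trans_eq ?_
        rw [norm_mul, norm_mul]
        rfl
    _ ≤ ‖y‖ * ‖pd 0 f x‖ + ‖y‖ * ‖pd 1 f x‖ := by gcongr
    _ = _ := by ring

theorem eLpNorm_fderiv_le {f : Euc 2 → ℝ} (hf : ContDiff ℝ ∞ f) {p : ℝ≥0∞} (hp : 1 ≤ p) :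
    eLpNorm (fderiv ℝ f) p volume ≤ ∑ i, eLpNorm (pd i f) p volume := by
  rw [Fin.sum_univ_two]
  refine le_trans (eLpNorm_mono_real (g := fun x => ‖pd 0 f x‖ + ‖pd 1 f x‖) (norm_fderiv_le f)) ?_
  refine (eLpNorm_add_le (f := fun x => ‖pd 0 f x‖) (g := fun x => ‖pd 1 f x‖)
    (hf.pd 0).continuous.norm.aestronglyMeasurable
    (hf.pd 1).continuous.norm.aestronglyMeasurable hp).trans_eq ?_
  rw [eLpNorm_norm, eLpNorm_norm]

/-- For `p < 2` the product `q · (χ q)` is estimated by Hölder's inequality with `1 / p = 1 / 2 + 1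
/ p'`. Here `p' = 2 p / (2 - p)` is the Sobolev conjugate of `p`, so the second factor is bounded by
the gradient of `χ q` in `L^p`. For `p = 2` the conjugate is infinite, and the embedding of
`W^{1,1}` into `L²` is applied to `χ q²` itself, whose gradient contains the factor `q`. -/
theorem exists_eLpNorm_mul_sq_le_of_contDiff {p : ℝ} (hp1 : 1 < p) (hp2 : p ≤ 2) :
    ∃ C : ℝ≥0, ∀ χ q : Euc 2 → ℝ, ContDiff ℝ ∞ χ → HasCompactSupport χ → ContDiff ℝ ∞ q →
      eLpNorm (fun x => χ x * q x ^ 2) (ENNReal.ofReal p) volume ≤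
        C * eLpNorm q 2 volume * ∑ i, (eLpNorm (fun x => χ x * pd i q x) (ENNReal.ofReal p) volume +
          eLpNorm (fun x => pd i χ x * q x) (ENNReal.ofReal p) volume) := by
  have hd : ∀ {f : Euc 2 → ℝ}, ContDiff ℝ ∞ f → Differentiable ℝ f :=
    fun h => h.differentiable (by simp)
  have hr1 : 1 ≤ ENNReal.ofReal p := by
    rw [← ENNReal.ofReal_one]; exact ENNReal.ofReal_le_ofReal hp1.le
  rcases hp2.eq_or_lt with rfl | hp2
  · refine ⟨2 * SNormLESNormFDerivOfEqConst ℝ (volume : Measure (Euc 2)) 1, fun χ q hχ hχc hq => ?_⟩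
    rw [show ENNReal.ofReal 2 = ((2 : ℝ≥0) : ℝ≥0∞) by simp]
    have hs : ContDiff ℝ ∞ fun x => χ x * q x ^ 2 := hχ.mul (hq.pow 2)
    have h1 := eLpNorm_le_eLpNorm_fderiv_of_eq (F := ℝ) (volume : Measure (Euc 2))
      (u := fun x => χ x * q x ^ 2) (hs.of_le (by norm_cast))
      hχc.mul_right (p := 1) (p' := 2) le_rfl
      (by simp) (by simp; norm_num)
    refine h1.trans ?_
    push_cast
    rw [mul_comm (2 : ℝ≥0∞), mul_assoc, mul_assoc]
    gcongr
    refine (eLpNorm_fderiv_le hs le_rfl).trans ?_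
    rw [Finset.mul_sum, Finset.mul_sum]
    refine Finset.sum_le_sum fun i _ => ?_
    have e : pd i (fun x => χ x * q x ^ 2) =
        q • ((fun x => pd i χ x * q x) + (2 : ℝ) • fun x => χ x * pd i q x) := by
      ext x
      have hq2 : (fun x => q x ^ 2) = fun x => q x * q x := by ext; ring
      rw [pd_mul (hd hχ) (hd (hq.pow 2)), hq2, pd_mul (hd hq) (hd hq)]
      simp
      ring
    have c1 : Continuous fun x => pd i χ x * q x := (hχ.pd i).continuous.mul hq.continuous
    have c2 : Continuous fun x => χ x * pd i q x := hχ.continuous.mul (hq.pd i).continuous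
    rw [e]
    refine (eLpNorm_smul_le_mul_eLpNorm (p := 2) (q := 2) (r := 1)
      (c1.add (c2.const_smul 2)).aestronglyMeasurable hq.continuous.aestronglyMeasurable).trans ?_
    rw [mul_comm 2, mul_assoc]
    gcongr
    refine (eLpNorm_add_le c1.aestronglyMeasurable (c2.const_smul 2).aestronglyMeasurable
      (by norm_num)).trans ?_
    rw [eLpNorm_const_smul, add_mul, add_comm, mul_comm]
    gcongr
    · exact le_of_eq (by rw [← ofReal_norm]; norm_num)
    · exact le_mul_of_one_le_right' (by norm_num)
  · have hp0 : 0 < p := by linarith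
    set P : ℝ≥0 := ⟨p, hp0.le⟩ with hP
    have h2p : 0 < 2 - p := by linarith
    set P' : ℝ≥0 := ⟨2 * p / (2 - p), by positivity⟩ with hP'
    refine ⟨SNormLESNormFDerivOfEqConst ℝ (volume : Measure (Euc 2)) P, fun χ q hχ hχc hq => ?_⟩
    have hPr : ENNReal.ofReal p = (P : ℝ≥0∞) := by
      rw [← ENNReal.ofReal_coe_nnreal]
      rfl
    have hs : ContDiff ℝ ∞ fun x => χ x * q x := hχ.mul hq
    have h1 := eLpNorm_le_eLpNorm_fderiv_of_eq (F := ℝ) (volume : Measure (Euc 2))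
      (u := fun x => χ x * q x) (hs.of_le (by norm_cast))
      hχc.mul_right (p := P) (p' := P') (by rw [← NNReal.coe_le_coe]; exact hp1.le)
      (by simp) (by
        simp only [finrank_euclideanSpace, Fintype.card_fin]
        show (2 * p / (2 - p))⁻¹ = p⁻¹ - ((2 : ℕ) : ℝ)⁻¹
        push_cast
        field_simp)
    have hT : ENNReal.HolderTriple 2 (P' : ℝ≥0∞) (P : ℝ≥0∞) := by
      constructor
      have e2 : (2 : ℝ≥0∞) = ((2 : ℝ≥0) : ℝ≥0∞) := by simp
      have hPne : P ≠ 0 := by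
        intro h
        have : p = 0 := congrArg NNReal.toReal h
        linarith
      have hPne' : P' ≠ 0 := by
        intro h
        have h3 : 2 * p / (2 - p) = 0 := congrArg NNReal.toReal h
        have : 0 < 2 * p / (2 - p) := by positivity
        linarith
      rw [e2, ← ENNReal.coe_inv (by norm_num), ← ENNReal.coe_inv hPne, ← ENNReal.coe_inv hPne',
        ← ENNReal.coe_add, ENNReal.coe_inj, ← NNReal.coe_inj]
      push_cast
      show (2 : ℝ)⁻¹ + (2 * p / (2 - p))⁻¹ = p⁻¹
      field_simp
      ring
    have e : (fun x => χ x * q x ^ 2) = q • fun x => χ x * q x := by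
      ext x; simp; ring
    rw [e, hPr]
    refine (eLpNorm_smul_le_mul_eLpNorm (p := 2) (q := P') (r := P)
      hs.continuous.aestronglyMeasurable hq.continuous.aestronglyMeasurable).trans ?_
    rw [mul_comm _ (eLpNorm q 2 volume), mul_assoc]
    gcongr
    refine h1.trans ?_
    gcongr
    refine (eLpNorm_fderiv_le hs (hPr ▸ hr1)).trans (Finset.sum_le_sum fun i _ => ?_)
    have e2 : pd i (fun x => χ x * q x) =
        (fun x => χ x * pd i q x) + fun x => pd i χ x * q x := by
      ext x
      rw [pd_mul (hd hχ) (hd hq)]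
      simp
      ring
    rw [e2]
    exact eLpNorm_add_le (hχ.continuous.mul (hq.pd i).continuous).aestronglyMeasurable
      ((hχ.pd i).continuous.mul hq.continuous).aestronglyMeasurable (hPr ▸ hr1)

/-- Fatou's lemma for `L^p` norms. -/
theorem eLpNorm_le_of_ae_tendsto {X : Type*} [MeasurableSpace X] {μ : Measure X} {p : ℝ≥0∞}
    {f : ℕ → X → ℝ} {g : X → ℝ} {b : ℕ → ℝ≥0∞} {B : ℝ≥0∞}
    (hf : ∀ m, AEStronglyMeasurable (f m) μ)
    (hb : ∀ᶠ m in atTop, eLpNorm (f m) p μ ≤ b m) (hB : Tendsto b atTop (𝓝 B))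
    (h : ∀ᵐ x ∂μ, Tendsto (fun m => f m x) atTop (𝓝 (g x))) : eLpNorm g p μ ≤ B := by
  refine (Lp.eLpNorm_lim_le_liminf_eLpNorm hf g h).trans ?_
  rw [← hB.liminf_eq]
  exact liminf_le_liminf hb

/-- A convergent sequence of upper bounds is all that `eLpNorm_le_of_ae_tendsto` asks for. -/
theorem tendsto_eLpNorm_mul_moll_conv {χ g : Euc 2 → ℝ} {p : ℝ≥0∞} (hp : 1 ≤ p) (hp' : p ≠ ⊤)
    (hχ : Continuous χ) (hχc : HasCompactSupport χ) (hg : MemLp g p volume) :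
    ∃ b : ℕ → ℝ≥0∞, Tendsto b atTop (𝓝 (eLpNorm (fun x => χ x * g x) p volume)) ∧
      ∀ m, eLpNorm (fun x => χ x * conv (moll m) g x) p volume ≤ b m := by
  obtain ⟨M, hM⟩ := hχ.bounded_above_of_compact_support hχc
  refine ⟨fun m => eLpNorm (fun x => χ x * g x) p volume +
    ENNReal.ofReal M * eLpNorm (fun x => conv (moll m) g x - g x) p volume, ?_, fun m => ?_⟩
  · have := (ENNReal.Tendsto.const_mul (a := ENNReal.ofReal M) (tendsto_moll_conv hp hp' hg)
      (Or.inr ENNReal.ofReal_ne_top)).const_add (eLpNorm (fun x => χ x * g x) p volume)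
    simpa using this
  · have hc := (contDiff_moll_conv m (hg.locallyIntegrable hp)).continuous
    have e : (fun x => χ x * conv (moll m) g x) =
        (fun x => χ x * g x) + fun x => χ x * (conv (moll m) g x - g x) := by
      ext x; simp only [Pi.add_apply]; ring
    rw [e]
    have m1 : AEStronglyMeasurable (fun x => conv (moll m) g x - g x) volume :=
      hc.aestronglyMeasurable.sub hg.1
    refine (eLpNorm_add_le (hχ.aestronglyMeasurable.mul hg.1)
      (hχ.aestronglyMeasurable.mul m1) hp).trans ?_
    refine add_le_add le_rfl ?_
    refine eLpNorm_le_mul_eLpNorm_of_ae_le_mul (Eventually.of_forall fun x => ?_) p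
    rw [Pi.mul_apply, norm_mul]
    exact mul_le_mul_of_nonneg_right (hM x) (norm_nonneg _)

/-- The multiplicative Sobolev inequality for weakly differentiable functions. -/
theorem exists_eLpNorm_mul_sq_le {p : ℝ} (hp1 : 1 < p) (hp2 : p ≤ 2) :
    ∃ C : ℝ≥0, ∀ (χ q : Euc 2 → ℝ) (q' : Fin 2 → Euc 2 → ℝ), ContDiff ℝ ∞ χ →
      tsupport χ ⊆ Metric.ball 0 1 → MemLp q 2 volume → MemLp q (ENNReal.ofReal p) volume →
      (∀ i, MemLp (q' i) (ENNReal.ofReal p) volume) →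
      (∀ i, WeakDeriv (Metric.ball 0 2) i q (q' i)) →
      eLpNorm (fun x => χ x * q x ^ 2) (ENNReal.ofReal p) volume ≤
        C * eLpNorm q 2 volume * ∑ i, (eLpNorm (fun x => χ x * q' i x) (ENNReal.ofReal p) volume +
          eLpNorm (fun x => pd i χ x * q x) (ENNReal.ofReal p) volume) := by
  obtain ⟨C, hC⟩ := exists_eLpNorm_mul_sq_le_of_contDiff hp1 hp2
  have hr1 : 1 ≤ ENNReal.ofReal p := by
    rw [← ENNReal.ofReal_one]; exact ENNReal.ofReal_le_ofReal hp1.le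
  have hrt : ENNReal.ofReal p ≠ ⊤ := ENNReal.ofReal_ne_top
  refine ⟨C, fun χ q q' hχ hs hq2 hq hq' hw => ?_⟩
  have hχc : HasCompactSupport χ := (isCompact_closedBall (0 : Euc 2) 1).of_isClosed_subset
    (isClosed_tsupport _) (hs.trans Metric.ball_subset_closedBall)
  have hql := hq.locallyIntegrable hr1
  have hsm := fun m => contDiff_moll_conv m hql
  choose b hb hbm using fun i => tendsto_eLpNorm_mul_moll_conv hr1 hrt hχ.continuous hχc (hq' i)
  choose d hd hdm using fun i => tendsto_eLpNorm_mul_moll_conv hr1 hrt (hχ.pd i).continuous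
    (hasCompactSupport_pd hχc i) hq
  -- The mollifiers have radius at most one and `χ` lives in the unit ball, so only values in the
  -- ball of radius two, where the weak derivative is known, are used.
  have e : ∀ m i, (fun x => χ x * pd i (conv (moll m) q) x) =
      fun x => χ x * conv (moll m) (q' i) x := by
    intro m i
    ext x
    by_cases hx : x ∈ tsupport χ
    · rw [(hw i).pd_moll_conv hql]
      intro y hy
      have h1 := mem_ball_zero_iff.1 (hs hx)
      have h2 := mem_closedBall_iff_norm.1 hy
      have h3 : (1 : ℝ) / (m + 1) ≤ 1 := by
        rw [div_le_one (by positivity)]; simp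
      rw [mem_ball_zero_iff]
      calc ‖y‖ = ‖(y - x) + x‖ := by simp
        _ ≤ ‖y - x‖ + ‖x‖ := norm_add_le _ _
        _ < 2 := by linarith
    · simp [image_eq_zero_of_notMem_tsupport hx]
  refine eLpNorm_le_of_ae_tendsto (f := fun m x => χ x * conv (moll m) q x ^ 2)
    (b := fun m => C * eLpNorm q 2 volume * ∑ i, (b i m + d i m))
    (fun m => (hχ.continuous.mul ((hsm m).continuous.pow 2)).aestronglyMeasurable)
    (Eventually.of_forall fun m => ?_) ?_ ?_
  · refine (hC χ _ hχ hχc (hsm m)).trans ?_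
    gcongr with i
    · exact eLpNorm_moll_conv_le m hq2.1 (by norm_num) (by norm_num)
    · rw [e]; exact hbm i m
    · exact hdm i m
  · refine ENNReal.Tendsto.const_mul (tendsto_finsetSum _ fun i _ => (hb i).add (hd i))
      (Or.inr ?_)
    exact ENNReal.mul_ne_top ENNReal.coe_ne_top hq2.2.ne
  · filter_upwards [ae_tendsto_moll_conv hql] with x hx
    exact (hx.pow 2).const_mul _

/-- The bounds for the second derivatives of the mollifications pass to the weak second
derivatives. -/
theorem eLpNorm_restrict_le_of_moll_conv {S : Set (Euc 2)} (hS : IsOpen S) {p B : ℝ≥0∞}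
    {i j : Fin 2} {w w₁ w₂ : Euc 2 → ℝ} (hw : LocallyIntegrable w) (hw₁ : LocallyIntegrable w₁)
    (hw₂ : LocallyIntegrable w₂) (h₁ : WeakDeriv S j w w₁) (h₂ : WeakDeriv S i w₁ w₂)
    (hB : ∀ m, eLpNorm (pd i (pd j (conv (moll m) w))) p volume ≤ B) :
    eLpNorm w₂ p (volume.restrict S) ≤ B := by
  refine eLpNorm_le_of_ae_tendsto (f := fun m => pd i (pd j (conv (moll m) w))) (b := fun _ => B)
    (fun m => (((contDiff_moll_conv m hw).pd j).pd i).continuous.aestronglyMeasurable)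
    (Eventually.of_forall fun m => (eLpNorm_mono_measure _ Measure.restrict_le_self).trans (hB m))
    tendsto_const_nhds ?_
  rw [ae_restrict_iff' hS.measurableSet]
  filter_upwards [ae_tendsto_moll_conv hw₂] with x hx hxS
  refine hx.congr' ?_
  obtain ⟨δ, hδ, hδS⟩ := Metric.isOpen_iff.1 hS x hxS
  have hlim : Tendsto (fun m : ℕ => 1 / ((m : ℝ) + 1)) atTop (𝓝 0) :=
    tendsto_one_div_add_atTop_nhds_zero_nat
  filter_upwards [hlim.eventually_lt_const (half_pos hδ)] with m hm
  -- A radius of mollification below `δ / 2` is uniform for all points near `x`. Thus the first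
  -- derivative is identified in a whole neighbourhood and can be differentiated once more.
  have hb : ∀ y ∈ Metric.ball x (δ / 2), Metric.closedBall y (1 / ((m : ℝ) + 1)) ⊆ S := by
    refine fun y hy => Subset.trans (fun z hz => ?_) hδS
    rw [Metric.mem_ball] at hy ⊢
    rw [Metric.mem_closedBall] at hz
    linarith [dist_triangle z y x]
  have e : pd j (conv (moll m) w) =ᶠ[𝓝 x] conv (moll m) w₁ := by
    filter_upwards [Metric.ball_mem_nhds x (half_pos hδ)] with y hy
    exact h₁.pd_moll_conv hw (hb y hy)
  have e2 : pd i (pd j (conv (moll m) w)) x = pd i (conv (moll m) w₁) x := by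
    simp only [pd] at e ⊢
    rw [e.fderiv_eq]
  rw [e2, h₂.pd_moll_conv hw₁ (hb x (Metric.mem_ball_self (half_pos hδ)))]

/-! ### Integration by parts on the half plane -/

theorem measurePreserving_toProd :
    MeasurePreserving ((MeasurableEquiv.toLp 2 (Fin 2 → ℝ)).symm.trans MeasurableEquiv.finTwoArrow)
      (volume : Measure (Euc 2)) (volume : Measure (ℝ × ℝ)) :=
  (volume_preserving_finTwoArrow ℝ).comp (PiLp.volume_preserving_ofLp (Fin 2))

theorem integral_euc_eq (F : Euc 2 → ℝ) : ∫ x, F x = ∫ z : ℝ × ℝ, F !₂[z.1, z.2] := by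
  rw [← measurePreserving_toProd.integral_comp (MeasurableEquiv.measurableEmbedding _)]
  refine integral_congr_ae (Eventually.of_forall fun x => ?_)
  simp only
  congr 1
  ext i
  fin_cases i <;> rfl

theorem integrable_euc_iff (F : Euc 2 → ℝ) :
    Integrable F ↔ Integrable (fun z : ℝ × ℝ => F !₂[z.1, z.2]) := by
  rw [← measurePreserving_toProd.integrable_comp_emb (MeasurableEquiv.measurableEmbedding _)]
  refine integrable_congr (Eventually.of_forall fun x => ?_)
  simp only [Function.comp]
  congr 1
  ext i
  fin_cases i <;> rfl

theorem hasDerivAt_mk_zero {f : Euc 2 → ℝ} (hf : Differentiable ℝ f) (s t : ℝ) :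
    HasDerivAt (fun s => f !₂[s, t]) (pd 0 f !₂[s, t]) s := by
  have h : HasDerivAt (fun s : ℝ => (!₂[s, t] : Euc 2)) (EuclideanSpace.single 0 1) s := by
    have h1 : (fun s : ℝ => (!₂[s, t] : Euc 2)) = fun s => s • EuclideanSpace.single (0 : Fin 2) (1 : ℝ)
        + !₂[0, t] := by
      ext s i; fin_cases i <;> simp
    rw [h1]
    simpa using ((hasDerivAt_id s).smul_const (EuclideanSpace.single (0 : Fin 2) (1 : ℝ))).add_const (!₂[0, t] : Euc 2)
  exact (hf _).hasFDerivAt.comp_hasDerivAt s h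

theorem hasDerivAt_mk_one {f : Euc 2 → ℝ} (hf : Differentiable ℝ f) (s t : ℝ) :
    HasDerivAt (fun t => f !₂[s, t]) (pd 1 f !₂[s, t]) t := by
  have h : HasDerivAt (fun t : ℝ => (!₂[s, t] : Euc 2)) (EuclideanSpace.single 1 1) t := by
    have h1 : (fun t : ℝ => (!₂[s, t] : Euc 2)) = fun t => t • EuclideanSpace.single (1 : Fin 2) (1 : ℝ)
        + !₂[s, 0] := by
      ext t i; fin_cases i <;> simp
    rw [h1]
    simpa using ((hasDerivAt_id t).smul_const (EuclideanSpace.single (1 : Fin 2) (1 : ℝ))).add_const (!₂[s, 0] : Euc 2)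
  exact (hf _).hasFDerivAt.comp_hasDerivAt t h

theorem continuous_mk : Continuous fun z : ℝ × ℝ => (!₂[z.1, z.2] : Euc 2) := by
  refine (PiLp.continuous_toLp 2 _).comp (continuous_pi fun i => ?_)
  fin_cases i
  · exact continuous_fst
  · exact continuous_snd

/-- The open upper half plane. -/
def halfPlane : Set (Euc 2) := {x | 0 < x 1}

theorem isOpen_halfPlane : IsOpen halfPlane :=
  isOpen_lt continuous_const (show Continuous fun x : Euc 2 => x 1 by fun_prop)

theorem continuous_pd {f : Euc 2 → ℝ} (hf : ContDiff ℝ 1 f) (i : Fin 2) : Continuous (pd i f) :=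
  (hf.continuous_fderiv (by simp)).clm_apply continuous_const

theorem abs_le_of_mem_ball {s t R : ℝ} (h : ‖(!₂[s, t] : Euc 2)‖ ≤ R) : |s| ≤ R ∧ |t| ≤ R := by
  have h0 := PiLp.norm_apply_le (!₂[s, t] : Euc 2) 0
  have h1 := PiLp.norm_apply_le (!₂[s, t] : Euc 2) 1
  simp at h0 h1
  exact ⟨h0.trans h, h1.trans h⟩

/-- Fubini's theorem and the fundamental theorem of calculus along coordinate lines. Horizontal
lines never meet the boundary, and vertical half lines start on it. -/
theorem setIntegral_halfPlane_pd {θ : Euc 2 → ℝ} (hθ : ContDiff ℝ 1 θ) (hc : HasCompactSupport θ)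
    (i : Fin 2) : ∫ x in halfPlane, pd i θ x = if i = 0 then 0 else -∫ t, θ !₂[t, 0] := by
  have hd : Differentiable ℝ θ := hθ.differentiable (by simp)
  obtain ⟨R, hR⟩ := hc.isBounded.subset_closedBall (0 : Euc 2)
  have hz : ∀ s t : ℝ, (R < |s| ∨ R < |t|) → θ !₂[s, t] = 0 := by
    intro s t h
    by_contra h0
    have := abs_le_of_mem_ball (mem_closedBall_zero_iff.1 (hR (subset_tsupport _ h0)))
    rcases h with h | h <;> linarith [this.1, this.2]
  have hint : Integrable (fun x => halfPlane.indicator (pd i θ) x) :=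
    ((continuous_pd hθ i).integrable_of_hasCompactSupport
      (hasCompactSupport_pd hc i)).indicator isOpen_halfPlane.measurableSet
  have hind : ∀ s t : ℝ, halfPlane.indicator (pd i θ) !₂[s, t] =
      (Ioi (0 : ℝ)).indicator (fun t => pd i θ !₂[s, t]) t := by
    intro s t
    by_cases h : 0 < t
    · rw [indicator_of_mem (show (!₂[s, t] : Euc 2) ∈ halfPlane by simpa [halfPlane] using h),
        indicator_of_mem (by exact h)]
    · rw [indicator_of_notMem (show (!₂[s, t] : Euc 2) ∉ halfPlane by simpa [halfPlane] using h),
        indicator_of_notMem (by exact h)]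
  have hcont : ∀ i, Continuous fun z : ℝ × ℝ => pd i θ !₂[z.1, z.2] :=
    fun i => (continuous_pd hθ i).comp continuous_mk
  have hi2 := (integrable_euc_iff _).1 hint
  rw [← integral_indicator isOpen_halfPlane.measurableSet, integral_euc_eq]
  obtain rfl | rfl : i = 0 ∨ i = 1 := by fin_cases i <;> simp
  · simp only [if_true]
    rw [Measure.volume_eq_prod, integral_prod_symm _ hi2]
    simp only [hind]
    refine integral_eq_zero_of_ae (Eventually.of_forall fun t => ?_)
    by_cases h : t ∈ Ioi (0 : ℝ)
    · simp only [indicator_of_mem h, Pi.zero_apply]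
      have hcs : HasCompactSupport fun s => pd 0 θ !₂[s, t] := by
        refine HasCompactSupport.of_support_subset_isCompact (isCompact_closedBall (0 : ℝ) R) fun s hs => ?_
        have := hR ((tsupport_pd_subset θ 0) (subset_tsupport _ hs))
        simpa using (abs_le_of_mem_ball (mem_closedBall_zero_iff.1 this)).1
      have := integral_of_hasDerivAt_of_tendsto (f := fun s => θ !₂[s, t]) (m := 0) (n := 0)
        (fun s => hasDerivAt_mk_zero hd s t)
        (((hcont 0).comp (by fun_prop : Continuous fun s : ℝ => (s, t))).integrable_of_hasCompactSupport hcs)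
        (tendsto_const_nhds.congr' (by
          filter_upwards [eventually_lt_atBot (-R)] with s hs
          exact (hz s t (Or.inl (by rw [lt_abs]; right; linarith))).symm))
        (tendsto_const_nhds.congr' (by
          filter_upwards [eventually_gt_atTop R] with s hs
          exact (hz s t (Or.inl (by rw [lt_abs]; left; exact hs))).symm))
      simpa using this
    · simp [indicator_of_notMem h]
  · simp only [one_ne_zero, if_false]
    rw [Measure.volume_eq_prod, integral_prod _ hi2, ← integral_neg]
    refine integral_congr_ae (Eventually.of_forall fun s => ?_)
    simp only [hind]
    rw [integral_indicator measurableSet_Ioi]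
    have hcs : HasCompactSupport fun t => pd 1 θ !₂[s, t] := by
      refine HasCompactSupport.of_support_subset_isCompact (isCompact_closedBall (0 : ℝ) R) fun t hs => ?_
      have := hR ((tsupport_pd_subset θ 1) (subset_tsupport _ hs))
      simpa using (abs_le_of_mem_ball (mem_closedBall_zero_iff.1 this)).2
    have := integral_Ioi_of_hasDerivAt_of_tendsto' (a := 0) (f := fun t => θ !₂[s, t]) (m := 0)
      (fun t _ => hasDerivAt_mk_one hd s t)
      (((hcont 1).comp (by fun_prop : Continuous fun t : ℝ => (s, t))).integrable_of_hasCompactSupport hcs).integrableOn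
      (tendsto_const_nhds.congr' (by
          filter_upwards [eventually_gt_atTop R] with t ht
          exact (hz s t (Or.inr (by rw [lt_abs]; left; exact ht))).symm))
    simpa using this

/-- Smooth functions whose support is a compact subset of the disk of radius `2`. They need not
vanish on the flat part of the boundary of the half disk. -/
def IsTest (ψ : Euc 2 → ℝ) : Prop := ContDiff ℝ ∞ ψ ∧ tsupport ψ ⊆ Metric.ball 0 2

theorem IsTest.hasCompactSupport {ψ : Euc 2 → ℝ} (h : IsTest ψ) : HasCompactSupport ψ :=
  (isCompact_closedBall (0 : Euc 2) 2).of_isClosed_subset (isClosed_tsupport _)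
    (h.2.trans Metric.ball_subset_closedBall)

theorem IsTest.pd {ψ : Euc 2 → ℝ} (h : IsTest ψ) (i : Fin 2) : IsTest (pd i ψ) :=
  ⟨h.1.pd i, (tsupport_pd_subset ψ i).trans h.2⟩

theorem openHalfDisk_eq (r : ℝ) : openHalfDisk r = halfPlane ∩ Metric.ball 0 r := by
  ext x
  simp only [openHalfDisk, halfPlane, mem_inter_iff, mem_ofPred_eq, mem_ball_zero_iff]
  exact and_comm

instance isFiniteMeasure_openHalfDisk (r : ℝ) :
    IsFiniteMeasure ((volume : Measure (Euc 2)).restrict (openHalfDisk r)) := by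
  refine ⟨?_⟩
  rw [Measure.restrict_apply_univ, openHalfDisk_eq]
  exact (measure_mono inter_subset_right).trans_lt measure_ball_lt_top

theorem setIntegral_openHalfDisk_eq {F : Euc 2 → ℝ} (hF : ∀ x, x ∉ Metric.ball (0 : Euc 2) 2 → F x = 0) :
    ∫ x in openHalfDisk 2, F x = ∫ x in halfPlane, F x := by
  rw [openHalfDisk_eq]
  refine (setIntegral_eq_of_subset_of_forall_sdiff_eq_zero isOpen_halfPlane.measurableSet
    inter_subset_left fun x hx => hF x fun h => hx.2 ⟨hx.1, h⟩).symm

theorem norm_mk_zero (t : ℝ) : ‖(!₂[t, 0] : Euc 2)‖ = |t| := by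
  simp [EuclideanSpace.norm_eq, Real.sqrt_sq_eq_abs]

theorem setIntegral_openHalfDisk_pd {θ : Euc 2 → ℝ} (hθ : ContDiff ℝ 1 θ)
    (hs : tsupport θ ⊆ Metric.ball 0 2) (i : Fin 2) :
    ∫ x in openHalfDisk 2, pd i θ x =
      if i = 0 then 0 else -∫ t in Ioo (-2 : ℝ) 2, θ !₂[t, 0] := by
  have hc : HasCompactSupport θ := (isCompact_closedBall (0 : Euc 2) 2).of_isClosed_subset
    (isClosed_tsupport _) (hs.trans Metric.ball_subset_closedBall)
  rw [setIntegral_openHalfDisk_eq fun x hx => image_eq_zero_of_notMem_tsupport fun h =>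
    hx (hs (tsupport_pd_subset θ i h)), setIntegral_halfPlane_pd hθ hc,
    setIntegral_eq_integral_of_forall_compl_eq_zero]
  intro t ht
  refine image_eq_zero_of_notMem_tsupport fun h => ht ?_
  have := mem_ball_zero_iff.1 (hs h)
  rw [norm_mk_zero, abs_lt] at this
  exact this

theorem lipschitz_of_fderiv_le {E : Type*} [NormedAddCommGroup E] [NormedSpace ℝ E] {Ψ : E → ℝ}
    (hΨ : ContDiff ℝ 1 Ψ) {M : ℝ} (hM : ∀ z, ‖fderiv ℝ Ψ z‖ ≤ M) (a b : E) :
    ‖Ψ a - Ψ b‖ ≤ M * ‖a - b‖ :=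
  Convex.norm_image_sub_le_of_norm_fderiv_le (fun z _ => (hΨ.differentiable (by simp)) z)
    (fun z _ => hM z) convex_univ (mem_univ _) (mem_univ _)

theorem integrable_comp_of_fderiv_le {E : Type*} [NormedAddCommGroup E] [NormedSpace ℝ E]
    {Ψ : E → ℝ} (hΨ : ContDiff ℝ 1 Ψ) {M : ℝ} (hM : ∀ z, ‖fderiv ℝ Ψ z‖ ≤ M)
    {X : Type*} [MeasurableSpace X] {μ : Measure X} [IsFiniteMeasure μ] {Z : X → E}
    (hZ : Integrable Z μ) : Integrable (fun x => Ψ (Z x)) μ := by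
  refine ((integrable_const ‖Ψ 0‖).add (hZ.norm.const_mul M)).mono'
    (hΨ.continuous.comp_aestronglyMeasurable hZ.1) (Eventually.of_forall fun x => ?_)
  have := lipschitz_of_fderiv_le hΨ hM (Z x) 0
  rw [sub_zero] at this
  calc ‖Ψ (Z x)‖ = ‖Ψ 0 + (Ψ (Z x) - Ψ 0)‖ := by congr 1; ring
    _ ≤ ‖Ψ 0‖ + M * ‖Z x‖ := (norm_add_le _ _).trans (by gcongr)

theorem integrable_fderiv_comp {E : Type*} [NormedAddCommGroup E] [NormedSpace ℝ E]
    {Ψ : E → ℝ} (hΨ : ContDiff ℝ 1 Ψ) {M : ℝ} (hM : ∀ z, ‖fderiv ℝ Ψ z‖ ≤ M)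
    {X : Type*} [MeasurableSpace X] {μ : Measure X} {Z Z' : X → E}
    (hZ : AEStronglyMeasurable Z μ) (hZ' : Integrable Z' μ) :
    Integrable (fun x => fderiv ℝ Ψ (Z x) (Z' x)) μ := by
  refine (hZ'.norm.const_mul M).mono'
    ((isBoundedBilinearMap_apply (𝕜 := ℝ) (E := E) (F := ℝ)).continuous.comp_aestronglyMeasurable
      (((hΨ.continuous_fderiv (by simp)).comp_aestronglyMeasurable hZ).prodMk hZ'.1))
    (Eventually.of_forall fun x => ?_)
  exact (ContinuousLinearMap.le_opNorm _ _).trans (by gcongr; exact hM _)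

/-- The derivative of a function on the plane in a coordinate direction. -/
theorem pd_comp {E : Type*} [NormedAddCommGroup E] [NormedSpace ℝ E] {Ψ : E → ℝ}
    (hΨ : Differentiable ℝ Ψ) {W : Euc 2 → E} (hW : Differentiable ℝ W) (i : Fin 2) (x : Euc 2) :
    pd i (fun x => Ψ (W x)) x = fderiv ℝ Ψ (W x) (classicalPartial i W x) := by
  have := fderiv_comp x (hΨ (W x)) (hW x)
  simp only [pd, classicalPartial]
  rw [show (fun x => Ψ (W x)) = Ψ ∘ W from rfl, this]
  rfl

theorem green_comp_of_contDiff {E : Type*} [NormedAddCommGroup E] [NormedSpace ℝ E] {Ψ : E → ℝ}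
    (hΨ : ContDiff ℝ 1 Ψ) {W : Euc 2 → E} (hW : ContDiff ℝ 1 W) {ψ : Euc 2 → ℝ} (hψ : IsTest ψ)
    (i : Fin 2) :
    ∫ x in openHalfDisk 2, (pd i ψ x * Ψ (W x) + ψ x * fderiv ℝ Ψ (W x) (classicalPartial i W x)) =
      if i = 0 then 0 else -∫ t in Ioo (-2 : ℝ) 2, ψ !₂[t, 0] * Ψ (W !₂[t, 0]) := by
  have h1 : ContDiff ℝ 1 fun x => Ψ (W x) := hΨ.comp hW
  have h2 : ContDiff ℝ 1 ψ := hψ.1.of_le (by norm_cast)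
  have hd : ∀ {f : Euc 2 → ℝ}, ContDiff ℝ 1 f → Differentiable ℝ f :=
    fun h => h.differentiable (by simp)
  rw [← setIntegral_openHalfDisk_pd (θ := fun x => ψ x * Ψ (W x)) (h2.mul h1)
    ((tsupport_mul_subset_left).trans hψ.2)]
  refine integral_congr_ae (Eventually.of_forall fun x => ?_)
  simp only
  rw [pd_mul (hd h2) (hd h1), pd_comp (hΨ.differentiable (by simp)) (hW.differentiable (by simp))]

/-- The formula for smooth `W` passes to the limit under mere `L¹` convergence, because `Ψ` is
Lipschitz. The only term not controlled by this is `DΨ(W) - DΨ(Z)` applied to `Z'`, which tends to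
zero by dominated convergence. A general target `E` allows `Z` to be the pair of a map and its
normal derivative. -/
theorem green_comp {E : Type*} [NormedAddCommGroup E] [NormedSpace ℝ E] {Ψ : E → ℝ}
    (hΨ : ContDiff ℝ 1 Ψ) {M : ℝ} (hM : ∀ z, ‖fderiv ℝ Ψ z‖ ≤ M) {Z Z' : Euc 2 → E} {T : ℝ → E}
    {W : ℕ → Euc 2 → E} {i : Fin 2} (hW : ∀ m, ContDiff ℝ 1 (W m))
    (hZ : Integrable Z (volume.restrict (openHalfDisk 2)))
    (hZ' : Integrable Z' (volume.restrict (openHalfDisk 2)))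
    (hT : Integrable T (volume.restrict (Ioo (-2) 2)))
    (c0 : Tendsto (fun m => eLpNorm (fun x => W m x - Z x) 1 (volume.restrict (openHalfDisk 2)))
      atTop (𝓝 0))
    (c1 : Tendsto (fun m => eLpNorm (fun x => classicalPartial i (W m) x - Z' x) 1
      (volume.restrict (openHalfDisk 2))) atTop (𝓝 0))
    (cT : Tendsto (fun m => eLpNorm (fun t => W m !₂[t, 0] - T t) 1
      (volume.restrict (Ioo (-2) 2))) atTop (𝓝 0))
    {ψ : Euc 2 → ℝ} (hψ : IsTest ψ) :
    ∫ x in openHalfDisk 2, (pd i ψ x * Ψ (Z x) + ψ x * fderiv ℝ Ψ (Z x) (Z' x)) =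
      if i = 0 then 0 else -∫ t in Ioo (-2 : ℝ) 2, ψ !₂[t, 0] * Ψ (T t) := by
  set μ := (volume : Measure (Euc 2)).restrict (openHalfDisk 2) with hμ
  set ν := (volume : Measure ℝ).restrict (Ioo (-2) 2) with hν
  -- All hypotheses survive the passage to a subsequence, along which the convergence is also
  -- pointwise almost everywhere.
  wlog hae : ∀ᵐ x ∂μ, Tendsto (fun m => W m x) atTop (𝓝 (Z x)) generalizing W
  · obtain ⟨ns, hns, h⟩ := (tendstoInMeasure_of_tendsto_eLpNorm (p := 1) one_ne_zero
      (fun m => (hW m).continuous.aestronglyMeasurable) hZ.1 c0).exists_seq_tendsto_ae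
    exact this (W := fun m => W (ns m)) (fun m => hW _) (c0.comp hns.tendsto_atTop)
      (c1.comp hns.tendsto_atTop) (cT.comp hns.tendsto_atTop) h
  have hM0 : 0 ≤ M := (norm_nonneg _).trans (hM 0)
  obtain ⟨B₀, hB₀⟩ := hψ.1.continuous.bounded_above_of_compact_support hψ.hasCompactSupport
  obtain ⟨B₁, hB₁⟩ := (hψ.pd i).1.continuous.bounded_above_of_compact_support
    (hψ.pd i).hasCompactSupport
  have hB₀0 : 0 ≤ B₀ := (norm_nonneg _).trans (hB₀ 0)
  have hB₁0 : 0 ≤ B₁ := (norm_nonneg _).trans (hB₁ 0)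
  have hDc : Continuous (fderiv ℝ Ψ) := hΨ.continuous_fderiv (by simp)
  have hWc : ∀ m, Continuous (classicalPartial i (W m)) := fun m =>
    ((hW m).continuous_fderiv (by simp)).clm_apply continuous_const
  have bdd : ∀ {f g : Euc 2 → ℝ} {B : ℝ}, Continuous f → (∀ x, ‖f x‖ ≤ B) → Integrable g μ →
      Integrable (fun x => f x * g x) μ := fun hf hB hg =>
    hg.bdd_mul hf.aestronglyMeasurable (Eventually.of_forall hB)
  have lim1 : Tendsto (fun m => ∫ x, (pd i ψ x * Ψ (W m x) +
      ψ x * fderiv ℝ Ψ (W m x) (classicalPartial i (W m) x)) ∂μ) atTop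
      (𝓝 (∫ x, (pd i ψ x * Ψ (Z x) + ψ x * fderiv ℝ Ψ (Z x) (Z' x)) ∂μ)) := by
    have hint : Integrable (fun x => pd i ψ x * Ψ (Z x) + ψ x * fderiv ℝ Ψ (Z x) (Z' x)) μ :=
      (bdd (hψ.pd i).1.continuous hB₁ (integrable_comp_of_fderiv_le hΨ hM hZ)).add
        (bdd hψ.1.continuous hB₀ (integrable_fderiv_comp hΨ hM hZ.1 hZ'))
    refine tendsto_integral_of_L1 _ hint.1 (Eventually.of_forall fun m => ?_) ?_
    · have hc : Continuous fun x => pd i ψ x * Ψ (W m x) +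
          ψ x * fderiv ℝ Ψ (W m x) (classicalPartial i (W m) x) :=
        ((hψ.pd i).1.continuous.mul (hΨ.continuous.comp (hW m).continuous)).add
          (hψ.1.continuous.mul ((hDc.comp (hW m).continuous).clm_apply (hWc m)))
      refine (hc.integrable_of_hasCompactSupport ?_).integrableOn
      exact ((hψ.pd i).hasCompactSupport.mul_right).add hψ.hasCompactSupport.mul_right
    · have hlim3 : Tendsto (fun m => ∫⁻ x, ‖fderiv ℝ Ψ (W m x) - fderiv ℝ Ψ (Z x)‖ₑ * ‖Z' x‖ₑ ∂μ)
          atTop (𝓝 0) := by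
        rw [show (0 : ℝ≥0∞) = ∫⁻ x, 0 ∂μ by simp]
        refine tendsto_lintegral_of_dominated_convergence' (fun x => ENNReal.ofReal (M + M) * ‖Z' x‖ₑ)
          (fun m => ?_) (fun m => Eventually.of_forall fun x => ?_) ?_ ?_
        · exact (((hDc.comp (hW m).continuous).aestronglyMeasurable.sub
            (hDc.comp_aestronglyMeasurable hZ.1)).enorm).mul hZ'.1.enorm
        · refine mul_le_mul_left ?_ _
          rw [← ofReal_norm]
          exact ENNReal.ofReal_le_ofReal ((norm_sub_le _ _).trans (add_le_add (hM _) (hM _)))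
        · rw [lintegral_const_mul'' _ hZ'.1.enorm]
          exact ENNReal.mul_ne_top ENNReal.ofReal_ne_top hZ'.2.ne
        · filter_upwards [hae] with x hx
          have h1 : Tendsto (fun m => fderiv ℝ Ψ (W m x) - fderiv ℝ Ψ (Z x)) atTop (𝓝 0) := by
            have := ((hDc.tendsto (Z x)).comp hx).sub_const (fderiv ℝ Ψ (Z x))
            rwa [sub_self] at this
          have h2 := ENNReal.Tendsto.mul_const (b := ‖Z' x‖ₑ) h1.enorm (Or.inr enorm_ne_top)
          have h3 : ‖(0 : StrongDual ℝ E)‖ₑ * ‖Z' x‖ₑ = 0 := by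
            rw [← ofReal_norm, norm_zero, ENNReal.ofReal_zero, zero_mul]
          exact h3 ▸ h2
      have hup : Tendsto (fun m => ENNReal.ofReal (B₁ * M) * eLpNorm (fun x => W m x - Z x) 1 μ +
          ENNReal.ofReal (B₀ * M) * eLpNorm (fun x => classicalPartial i (W m) x - Z' x) 1 μ +
          ENNReal.ofReal B₀ * ∫⁻ x, ‖fderiv ℝ Ψ (W m x) - fderiv ℝ Ψ (Z x)‖ₑ * ‖Z' x‖ₑ ∂μ)
          atTop (𝓝 0) := by
        have := ((ENNReal.Tendsto.const_mul (a := ENNReal.ofReal (B₁ * M)) c0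
          (Or.inr ENNReal.ofReal_ne_top)).add (ENNReal.Tendsto.const_mul
          (a := ENNReal.ofReal (B₀ * M)) c1 (Or.inr ENNReal.ofReal_ne_top))).add
          (ENNReal.Tendsto.const_mul (a := ENNReal.ofReal B₀) hlim3 (Or.inr ENNReal.ofReal_ne_top))
        simpa using this
      refine tendsto_of_tendsto_of_tendsto_of_le_of_le tendsto_const_nhds hup
        (fun _ => zero_le) fun m => ?_
      have a1 : AEMeasurable (fun x => ‖W m x - Z x‖ₑ) μ :=
        ((hW m).continuous.aestronglyMeasurable.sub hZ.1).enorm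
      have a2 : AEMeasurable (fun x => ‖classicalPartial i (W m) x - Z' x‖ₑ) μ :=
        ((hWc m).aestronglyMeasurable.sub hZ'.1).enorm
      have a3 : AEMeasurable (fun x => ‖fderiv ℝ Ψ (W m x) - fderiv ℝ Ψ (Z x)‖ₑ * ‖Z' x‖ₑ) μ :=
        (((hDc.comp (hW m).continuous).aestronglyMeasurable.sub
            (hDc.comp_aestronglyMeasurable hZ.1)).enorm).mul hZ'.1.enorm
      simp only
      rw [eLpNorm_one_eq_lintegral_enorm, eLpNorm_one_eq_lintegral_enorm,
        ← lintegral_const_mul'' _ a1, ← lintegral_const_mul'' _ a2, ← lintegral_const_mul'' _ a3,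
        ← lintegral_add_left' (a1.const_mul _), ← lintegral_add_left' (f := fun x => ENNReal.ofReal (B₁ * M) * ‖W m x - Z x‖ₑ +
          ENNReal.ofReal (B₀ * M) * ‖classicalPartial i (W m) x - Z' x‖ₑ)
          ((a1.const_mul _).add (a2.const_mul _))]
      refine lintegral_mono fun x => ?_
      -- Three differences: of the values of `Ψ`, of the derivatives of the maps, and of the
      -- differentials of `Ψ` at the fixed vector `Z'`.
      have e : pd i ψ x * Ψ (W m x) + ψ x * fderiv ℝ Ψ (W m x) (classicalPartial i (W m) x) -
          (pd i ψ x * Ψ (Z x) + ψ x * fderiv ℝ Ψ (Z x) (Z' x)) =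
          pd i ψ x * (Ψ (W m x) - Ψ (Z x)) +
          ψ x * fderiv ℝ Ψ (W m x) (classicalPartial i (W m) x - Z' x) +
          ψ x * (fderiv ℝ Ψ (W m x) - fderiv ℝ Ψ (Z x)) (Z' x) := by
        rw [map_sub]
        simp only [sub_apply]
        ring
      rw [e]
      simp only [← ofReal_norm]
      rw [← ENNReal.ofReal_mul (norm_nonneg _), ← ENNReal.ofReal_mul (by positivity),
        ← ENNReal.ofReal_mul (by positivity), ← ENNReal.ofReal_mul (by positivity),
        ← ENNReal.ofReal_add (by positivity) (by positivity),
        ← ENNReal.ofReal_add (by positivity) (by positivity)]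
      refine ENNReal.ofReal_le_ofReal ((norm_add₃_le).trans ?_)
      simp only [norm_mul]
      refine add_le_add (add_le_add ?_ ?_) ?_
      · rw [mul_assoc]
        exact mul_le_mul (hB₁ x) (lipschitz_of_fderiv_le hΨ hM _ _) (norm_nonneg _) hB₁0
      · rw [mul_assoc]
        exact mul_le_mul (hB₀ x) ((ContinuousLinearMap.le_opNorm _ _).trans
          (mul_le_mul_of_nonneg_right (hM _) (norm_nonneg _))) (norm_nonneg _) hB₀0
      · exact mul_le_mul (hB₀ x) (ContinuousLinearMap.le_opNorm _ _) (norm_nonneg _) hB₀0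
  have lim2 : Tendsto (fun m => ∫ t, ψ !₂[t, 0] * Ψ (W m !₂[t, 0]) ∂ν) atTop
      (𝓝 (∫ t, ψ !₂[t, 0] * Ψ (T t) ∂ν)) := by
    have hmk : Continuous fun t : ℝ => (!₂[t, 0] : Euc 2) :=
      continuous_mk.comp (by fun_prop : Continuous fun t : ℝ => (t, (0 : ℝ)))
    have hψm : AEStronglyMeasurable (fun t => ψ !₂[t, 0]) ν :=
      (hψ.1.continuous.comp hmk).aestronglyMeasurable
    have hint : Integrable (fun t => ψ !₂[t, 0] * Ψ (T t)) ν :=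
      (integrable_comp_of_fderiv_le hΨ hM hT).bdd_mul hψm (Eventually.of_forall fun t => hB₀ _)
    refine tendsto_integral_of_L1 _ hint.1 (Eventually.of_forall fun m => ?_) ?_
    · have hc : Continuous fun t : ℝ => ψ !₂[t, 0] * Ψ (W m !₂[t, 0]) :=
        (hψ.1.continuous.comp hmk).mul (hΨ.continuous.comp ((hW m).continuous.comp hmk))
      exact (hc.continuousOn.integrableOn_compact (isCompact_Icc (a := (-2 : ℝ)) (b := 2))).mono_set
        Ioo_subset_Icc_self
    · have hup := ENNReal.Tendsto.const_mul (a := ENNReal.ofReal (B₀ * M)) cT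
          (Or.inr ENNReal.ofReal_ne_top)
      rw [mul_zero] at hup
      refine tendsto_of_tendsto_of_tendsto_of_le_of_le tendsto_const_nhds hup
        (fun _ => zero_le) fun m => ?_
      have a1 : AEMeasurable (fun t => ‖W m !₂[t, 0] - T t‖ₑ) ν :=
        (((hW m).continuous.comp hmk).aestronglyMeasurable.sub hT.1).enorm
      simp only
      rw [eLpNorm_one_eq_lintegral_enorm, ← lintegral_const_mul'' _ a1]
      refine lintegral_mono fun t => ?_
      rw [← mul_sub]
      simp only [← ofReal_norm]
      rw [← ENNReal.ofReal_mul (by positivity), norm_mul, mul_assoc]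
      exact ENNReal.ofReal_le_ofReal
        (mul_le_mul (hB₀ _) (lipschitz_of_fderiv_le hΨ hM _ _) (norm_nonneg _) hB₀0)
  refine tendsto_nhds_unique lim1 ?_
  simp only [hμ, green_comp_of_contDiff hΨ (hW _) hψ]
  split_ifs
  · exact tendsto_const_nhds
  · exact lim2.neg

/-- The formula `∫ ∂ᵢψ f = -∫ ψ g` on the half disk of radius `2`. -/
def Green (i : Fin 2) (f g ψ : Euc 2 → ℝ) : Prop :=
  ∫ x in openHalfDisk 2, pd i ψ x * f x = -∫ x in openHalfDisk 2, ψ x * g x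

theorem weakDeriv_iff_green {i : Fin 2} {f g : Euc 2 → ℝ} :
    WeakDeriv (openHalfDisk 2) i f g ↔ ∀ φ : Euc 2 → ℝ, ContDiff ℝ ∞ φ → HasCompactSupport φ →
      tsupport φ ⊆ openHalfDisk 2 → Green i f g φ := by
  refine forall_congr' fun φ => forall_congr' fun h1 => forall_congr' fun h2 =>
    forall_congr' fun h3 => ?_
  have hz : ∀ x, x ∉ openHalfDisk 2 → φ x = 0 := fun x hx =>
    image_eq_zero_of_notMem_tsupport fun h => hx (h3 h)
  have hz' : ∀ x, x ∉ openHalfDisk 2 → pd i φ x = 0 := fun x hx =>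
    image_eq_zero_of_notMem_tsupport fun h => hx (h3 (tsupport_pd_subset φ i h))
  rw [Green, setIntegral_eq_integral_of_forall_compl_eq_zero fun x hx => by rw [hz' x hx, zero_mul],
    setIntegral_eq_integral_of_forall_compl_eq_zero fun x hx => by rw [hz x hx, zero_mul]]

theorem IsTest.of_tsupport_subset {φ : Euc 2 → ℝ} (h1 : ContDiff ℝ ∞ φ)
    (h3 : tsupport φ ⊆ openHalfDisk 2) : IsTest φ :=
  ⟨h1, h3.trans (by rw [openHalfDisk_eq]; exact inter_subset_right)⟩

theorem exists_abs_deriv_smoothTransition_le : ∃ S : ℝ, ∀ t, |deriv Real.smoothTransition t| ≤ S := by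
  have hc : Continuous (deriv Real.smoothTransition) :=
    (Real.smoothTransition.contDiff (n := 1)).continuous_deriv (by simp)
  obtain ⟨S, hS⟩ := (isCompact_Icc (a := (0 : ℝ)) (b := 1)).exists_bound_of_continuousOn hc.continuousOn
  have hS0 : 0 ≤ S := (norm_nonneg _).trans (hS 0 (by simp))
  refine ⟨S, fun t => ?_⟩
  by_cases h : t ∈ Icc (0 : ℝ) 1
  · exact hS t h
  · have hz : deriv Real.smoothTransition t = 0 := by
      rw [mem_Icc, not_and_or, not_le, not_le] at h
      rcases h with h | h
      · have : Real.smoothTransition =ᶠ[𝓝 t] fun _ => 0 := by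
          filter_upwards [gt_mem_nhds h] with y hy
          exact Real.smoothTransition.zero_of_nonpos (le_of_lt hy)
        rw [this.deriv_eq]; simp
      · have : Real.smoothTransition =ᶠ[𝓝 t] fun _ => 1 := by
          filter_upwards [lt_mem_nhds h] with y hy
          exact Real.smoothTransition.one_of_one_le (le_of_lt hy)
        rw [this.deriv_eq]; simp
    rw [hz, abs_zero]
    exact hS0

/-- A function vanishing near the boundary of the upper half plane. -/
def bdryCut (m : ℕ) (x : Euc 2) : ℝ := Real.smoothTransition ((m + 1) * x 1 - 1)

theorem contDiff_bdryCut (m : ℕ) : ContDiff ℝ ∞ (bdryCut m) :=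
  Real.smoothTransition.contDiff.comp (by fun_prop)

theorem pd_bdryCut (m : ℕ) (i : Fin 2) (x : Euc 2) :
    pd i (bdryCut m) x =
      if i = 0 then 0 else (m + 1) * deriv Real.smoothTransition ((m + 1) * x 1 - 1) := by
  have h1 : HasFDerivAt (fun x : Euc 2 => (m + 1) * x 1 - 1)
      (((m : ℝ) + 1) • (EuclideanSpace.proj 1 : Euc 2 →L[ℝ] ℝ)) x :=
    ((EuclideanSpace.proj (1 : Fin 2) : Euc 2 →L[ℝ] ℝ).hasFDerivAt.const_mul ((m : ℝ) + 1)).sub_const 1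
  have h2 : HasDerivAt Real.smoothTransition (deriv Real.smoothTransition ((m + 1) * x 1 - 1))
      ((m + 1) * x 1 - 1) :=
    ((Real.smoothTransition.contDiff (n := 1)).differentiable (by simp) _).hasDerivAt
  have h3 := h2.comp_hasFDerivAt x h1
  simp only [pd]
  rw [show bdryCut m = Real.smoothTransition ∘ fun x : Euc 2 => (m + 1) * x 1 - 1 from rfl, h3.fderiv]
  fin_cases i
  · simp
  · simp [mul_comm]

theorem abs_bdryCut_le (m : ℕ) (x : Euc 2) : |bdryCut m x| ≤ 1 := by
  rw [bdryCut, abs_of_nonneg (Real.smoothTransition.nonneg _)]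
  exact Real.smoothTransition.le_one _

theorem eventually_bdryCut {x : Euc 2} (hx : 0 < x 1) :
    ∀ᶠ m in atTop, bdryCut m x = 1 ∧ ∀ i, pd i (bdryCut m) x = 0 := by
  have hlim : Tendsto (fun m : ℕ => ((m : ℝ) + 1) * x 1 - 1) atTop atTop :=
    tendsto_atTop_add_const_right _ _ ((tendsto_natCast_atTop_atTop.atTop_add
      tendsto_const_nhds).atTop_mul_const hx)
  filter_upwards [hlim.eventually_gt_atTop 1] with m hm
  have h1 : ∀ᶠ y in 𝓝 x, bdryCut m y = 1 := by
    have : Continuous fun y : Euc 2 => ((m : ℝ) + 1) * y 1 - 1 := by fun_prop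
    filter_upwards [this.continuousAt.eventually (lt_mem_nhds hm)] with y hy
    exact Real.smoothTransition.one_of_one_le (le_of_lt hy)
  refine ⟨h1.self_of_nhds, fun i => ?_⟩
  have h2 : bdryCut m =ᶠ[𝓝 x] fun _ => 1 := h1
  simp only [pd]
  rw [h2.fderiv_eq]
  simp

theorem IsTest.exists_abs_le {ψ : Euc 2 → ℝ} (hψ : IsTest ψ) (h0 : ∀ t : ℝ, ψ !₂[t, 0] = 0) :
    ∃ B : ℝ, 0 ≤ B ∧ ∀ x, |ψ x| ≤ B * |x 1| := by
  obtain ⟨B, hB⟩ := (hψ.1.continuous_fderiv (by simp)).bounded_above_of_compact_support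
    (hψ.hasCompactSupport.fderiv (𝕜 := ℝ))
  refine ⟨B, (norm_nonneg _).trans (hB 0), fun x => ?_⟩
  have := lipschitz_of_fderiv_le (hψ.1.of_le (by norm_cast)) hB x !₂[x 0, 0]
  rw [h0, sub_zero] at this
  refine this.trans_eq ?_
  congr 1
  simp [EuclideanSpace.norm_eq, Real.sqrt_sq_eq_abs]

/-- An interior weak derivative may be tested with functions that do not vanish at the flat
boundary if the derivative is tangential, and always with functions that vanish there. -/
theorem WeakDeriv.green {i : Fin 2} {f g : Euc 2 → ℝ} (h : WeakDeriv (openHalfDisk 2) i f g)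
    (hf : Integrable f (volume.restrict (openHalfDisk 2)))
    (hg : Integrable g (volume.restrict (openHalfDisk 2))) {ψ : Euc 2 → ℝ} (hψ : IsTest ψ)
    (hi : i = 0 ∨ ∀ t : ℝ, ψ !₂[t, 0] = 0) : Green i f g ψ := by
  rw [weakDeriv_iff_green] at h
  obtain ⟨S, hS⟩ := exists_abs_deriv_smoothTransition_le
  have hS0 : 0 ≤ S := (abs_nonneg _).trans (hS 0)
  obtain ⟨B₀, hB₀⟩ := hψ.1.continuous.bounded_above_of_compact_support hψ.hasCompactSupport
  obtain ⟨B₁, hB₁⟩ := (hψ.pd i).1.continuous.bounded_above_of_compact_support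
    (hψ.pd i).hasCompactSupport
  have hd : ∀ {f : Euc 2 → ℝ}, ContDiff ℝ ∞ f → Differentiable ℝ f :=
    fun h => h.differentiable (by simp)
  set φ : ℕ → Euc 2 → ℝ := fun m x => bdryCut m x * ψ x with hφ
  have hφc : ∀ m, ContDiff ℝ ∞ (φ m) := fun m => (contDiff_bdryCut m).mul hψ.1
  have hpd : ∀ m x, pd i (φ m) x = pd i (bdryCut m) x * ψ x + bdryCut m x * pd i ψ x := by
    intro m x
    simp only [hφ]
    rw [pd_mul (hd (contDiff_bdryCut m)) (hd hψ.1)]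
  have hsupp : ∀ m, tsupport (φ m) ⊆ openHalfDisk 2 := by
    intro m x hx
    rw [openHalfDisk_eq]
    refine ⟨?_, hψ.2 (tsupport_mul_subset_right hx)⟩
    have h1 : tsupport (bdryCut m) ⊆ {x : Euc 2 | 1 ≤ (m + 1) * x 1} := by
      refine closure_minimal (fun y hy => ?_) (isClosed_le continuous_const (by fun_prop))
      by_contra hlt
      rw [mem_ofPred_eq, not_le] at hlt
      exact hy (Real.smoothTransition.zero_of_nonpos (by linarith))
    have h2 : 1 ≤ ((m : ℝ) + 1) * x 1 := h1 (tsupport_mul_subset_left hx)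
    have h3 : (0 : ℝ) < m + 1 := by positivity
    exact pos_of_mul_pos_right (one_pos.trans_le h2) h3.le
  have hgr := fun m => h (φ m) (hφc m) ((IsTest.of_tsupport_subset (hφc m) (hsupp m)).hasCompactSupport)
    (hsupp m)
  -- The derivative of the boundary cutoff has size `m + 1` and lives where `x² ≤ 2 / (m + 1)`. In
  -- the tangential direction it vanishes; in the normal direction the bound `|ψ| ≤ B x²`
  -- compensates its size.
  have hbd : ∃ B₂ : ℝ, ∀ m x, 0 < x 1 → |pd i (bdryCut m) x * ψ x| ≤ B₂ := by
    rcases hi with rfl | h0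
    · exact ⟨0, fun m x _ => by simp [pd_bdryCut]⟩
    · obtain ⟨B, hB0, hB⟩ := hψ.exists_abs_le h0
      refine ⟨S * (2 * B), fun m x hx => ?_⟩
      rw [pd_bdryCut]
      split_ifs
      · rw [zero_mul, abs_zero]; positivity
      · by_cases hx2 : ((m : ℝ) + 1) * x 1 ≤ 2
        · rw [abs_mul, abs_mul, abs_of_nonneg (by positivity : (0 : ℝ) ≤ m + 1)]
          calc ((m : ℝ) + 1) * |deriv Real.smoothTransition ((m + 1) * x 1 - 1)| * |ψ x|
              ≤ (m + 1) * S * (B * |x 1|) := by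
                gcongr
                · exact hS _
                · exact hB x
            _ = S * (((m + 1) * x 1) * B) := by rw [abs_of_pos hx]; ring
            _ ≤ S * (2 * B) := by gcongr
        · have : Real.smoothTransition =ᶠ[𝓝 (((m : ℝ) + 1) * x 1 - 1)] fun _ => 1 := by
            filter_upwards [lt_mem_nhds (show 1 < ((m : ℝ) + 1) * x 1 - 1 by linarith)] with y hy
            exact Real.smoothTransition.one_of_one_le (le_of_lt hy)
          rw [this.deriv_eq]
          simp only [deriv_const, mul_zero, zero_mul, abs_zero]
          positivity
  obtain ⟨B₂, hB₂⟩ := hbd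
  have hU : ∀ᵐ x ∂(volume.restrict (openHalfDisk 2)), 0 < x 1 := by
    filter_upwards [ae_restrict_mem (isOpen_openHalfDisk 2).measurableSet] with x hx
    exact hx.2
  have l1 : Tendsto (fun m => ∫ x in openHalfDisk 2, pd i (φ m) x * f x) atTop
      (𝓝 (∫ x in openHalfDisk 2, pd i ψ x * f x)) := by
    refine tendsto_integral_of_dominated_convergence (fun x => (B₂ + B₁) * ‖f x‖)
      (fun m => ((hφc m).pd i).continuous.aestronglyMeasurable.mul hf.1)
      (hf.norm.const_mul _) (fun m => ?_) ?_
    · filter_upwards [hU] with x hx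
      rw [norm_mul, hpd]
      refine mul_le_mul_of_nonneg_right ((norm_add_le _ _).trans (add_le_add (hB₂ m x hx) ?_))
        (norm_nonneg _)
      rw [norm_mul]
      calc _ ≤ 1 * B₁ := mul_le_mul (abs_bdryCut_le m x) (hB₁ x) (norm_nonneg _) zero_le_one
        _ = B₁ := one_mul _
    · filter_upwards [hU] with x hx
      refine tendsto_const_nhds.congr' ?_
      filter_upwards [eventually_bdryCut hx] with m hm
      rw [hpd, hm.1, hm.2]
      ring
  have l2 : Tendsto (fun m => ∫ x in openHalfDisk 2, φ m x * g x) atTop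
      (𝓝 (∫ x in openHalfDisk 2, ψ x * g x)) := by
    refine tendsto_integral_of_dominated_convergence (fun x => B₀ * ‖g x‖)
      (fun m => (hφc m).continuous.aestronglyMeasurable.mul hg.1)
      (hg.norm.const_mul _) (fun m => ?_) ?_
    · filter_upwards with x
      rw [norm_mul]
      refine mul_le_mul_of_nonneg_right ?_ (norm_nonneg _)
      rw [hφ, norm_mul]
      calc _ ≤ 1 * B₀ := mul_le_mul (abs_bdryCut_le m x) (hB₀ x) (norm_nonneg _) zero_le_one
        _ = B₀ := one_mul _
    · filter_upwards [hU] with x hx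
      refine tendsto_const_nhds.congr' ?_
      filter_upwards [eventually_bdryCut hx] with m hm
      simp only [hφ]
      rw [hm.1]
      ring
  refine tendsto_nhds_unique l1 ?_
  simp only [Green] at hgr
  simp only [hgr]
  exact l2.neg

theorem tendsto_integral_mul_of_tendsto_eLpNorm {X : Type*} [MeasurableSpace X] {μ : Measure X}
    {p q : ℝ≥0∞} [ENNReal.HolderTriple p q 1] {h g : X → ℝ} {G : ℕ → X → ℝ} (hh : MemLp h p μ)
    (hg : MemLp g q μ) (hG : ∀ m, MemLp (G m) q μ)
    (hlim : Tendsto (fun m => eLpNorm (fun x => G m x - g x) q μ) atTop (𝓝 0)) :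
    Tendsto (fun m => ∫ x, h x * G m x ∂μ) atTop (𝓝 (∫ x, h x * g x ∂μ)) := by
  have hi : ∀ {k : X → ℝ}, MemLp k q μ → Integrable (fun x => h x * k x) μ := fun hk =>
    memLp_one_iff_integrable.1 (hk.mul (r := 1) hh)
  refine tendsto_integral_of_L1 _ (hi hg).1 (Eventually.of_forall fun m => hi (hG m)) ?_
  have hup := ENNReal.Tendsto.const_mul (a := eLpNorm h p μ) hlim (Or.inr hh.2.ne)
  rw [mul_zero] at hup
  refine tendsto_of_tendsto_of_tendsto_of_le_of_le tendsto_const_nhds hup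
    (fun _ => zero_le) fun m => ?_
  simp only [← mul_sub]
  rw [← eLpNorm_one_eq_lintegral_enorm]
  exact eLpNorm_smul_le_mul_eLpNorm (f := fun x => G m x - g x) (φ := h) ((hG m).1.sub hg.1) hh.1

/-- The product rule for weak derivatives. -/
theorem WeakDeriv.mul {i : Fin 2} {A A' q q' : Euc 2 → ℝ}
    (hA : WeakDeriv (openHalfDisk 2) i A A') (hq : WeakDeriv (openHalfDisk 2) i q q')
    (mA : MemLp A ⊤ (volume.restrict (openHalfDisk 2)))
    (mA' : MemLp A' 2 (volume.restrict (openHalfDisk 2)))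
    (mq : MemLp q 2 (volume.restrict (openHalfDisk 2)))
    (mq' : Integrable q' (volume.restrict (openHalfDisk 2))) :
    WeakDeriv (openHalfDisk 2) i (fun x => A x * q x) (fun x => A' x * q x + A x * q' x) := by
  have hU := (isOpen_openHalfDisk 2).measurableSet
  set μ := (volume : Measure (Euc 2)).restrict (openHalfDisk 2) with hμ
  rw [weakDeriv_iff_green] at hA ⊢
  intro φ h1 h2 h3
  have hd : ∀ {f : Euc 2 → ℝ}, ContDiff ℝ ∞ f → Differentiable ℝ f :=
    fun h => h.differentiable (by simp)
  -- Only `q` is mollified, after extension by zero, so that `φ` times its mollification is a test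
  -- function for `A`. The integrability classes of the factors are exactly those that allow the
  -- limit in each product.
  set Q := (openHalfDisk 2).indicator q with hQ
  set Q' := (openHalfDisk 2).indicator q' with hQ'
  have nQ : MemLp Q 2 volume := (memLp_indicator_iff_restrict hU).2 mq
  have nQ' : MemLp Q' 1 volume := (memLp_indicator_iff_restrict hU).2 (memLp_one_iff_integrable.2 mq')
  have lQ : LocallyIntegrable Q := nQ.locallyIntegrable (by norm_num)
  have lQ' : LocallyIntegrable Q' := nQ'.locallyIntegrable le_rfl
  have wQ : WeakDeriv (openHalfDisk 2) i Q Q' := by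
    rw [weakDeriv_iff_green] at hq ⊢
    intro φ h1 h2 h3
    have := hq φ h1 h2 h3
    rw [Green] at this ⊢
    rw [setIntegral_congr_fun hU (g := fun x => pd i φ x * q x) fun x hx => by
        simp only [hQ, indicator_of_mem hx],
      setIntegral_congr_fun hU (f := fun x => φ x * Q' x) (g := fun x => φ x * q' x) fun x hx => by
        simp only [hQ', indicator_of_mem hx]]
    exact this
  have sm := fun m => contDiff_moll_conv m lQ
  have sm' := fun m => contDiff_moll_conv m lQ'
  have dQ : Tendsto (fun m => eLpNorm (fun x => conv (moll m) Q x - q x) 2 μ) atTop (𝓝 0) := by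
    refine tendsto_of_tendsto_of_tendsto_of_le_of_le tendsto_const_nhds
      (tendsto_moll_conv (by norm_num) (by norm_num) nQ) (fun _ => zero_le) fun m => ?_
    refine (eLpNorm_congr_ae ?_).trans_le (eLpNorm_mono_measure _ (Measure.restrict_le_self (s := openHalfDisk 2)))
    filter_upwards [ae_restrict_mem hU] with x hx
    rw [hQ, indicator_of_mem hx]
  have dQ' : Tendsto (fun m => eLpNorm (fun x => conv (moll m) Q' x - q' x) 1 μ) atTop (𝓝 0) := by
    refine tendsto_of_tendsto_of_tendsto_of_le_of_le tendsto_const_nhds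
      (tendsto_moll_conv (by norm_num) (by norm_num) nQ') (fun _ => zero_le) fun m => ?_
    refine (eLpNorm_congr_ae ?_).trans_le (eLpNorm_mono_measure _ (Measure.restrict_le_self (s := openHalfDisk 2)))
    filter_upwards [ae_restrict_mem hU] with x hx
    rw [hQ', indicator_of_mem hx]
  have mQ : ∀ m, MemLp (conv (moll m) Q) 2 μ := fun m =>
    MemLp.mono_measure Measure.restrict_le_self ⟨(sm m).continuous.aestronglyMeasurable,
      (eLpNorm_moll_conv_le m nQ.1 (by norm_num) (by norm_num)).trans_lt nQ.2⟩
  have mQ' : ∀ m, MemLp (conv (moll m) Q') 1 μ := fun m =>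
    MemLp.mono_measure Measure.restrict_le_self ⟨(sm' m).continuous.aestronglyMeasurable,
      (eLpNorm_moll_conv_le m nQ'.1 (by norm_num) (by norm_num)).trans_lt nQ'.2⟩
  have hφt : ∀ {p : ℝ≥0∞} {f g : Euc 2 → ℝ}, Continuous f → HasCompactSupport f → MemLp g p μ →
      MemLp (fun x => f x * g x) p μ := by
    intro p f g hf hfc hg
    obtain ⟨B, hB⟩ := hf.bounded_above_of_compact_support hfc
    exact hg.of_le_mul (c := B) (hf.aestronglyMeasurable.mul hg.1) (Eventually.of_forall fun x => by
      rw [norm_mul]; exact mul_le_mul_of_nonneg_right (hB x) (norm_nonneg _))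
  have mpφA : MemLp (fun x => pd i φ x * A x) ⊤ μ :=
    hφt (h1.pd i).continuous (hasCompactSupport_pd h2 i) mA
  have mφA : MemLp (fun x => φ x * A x) ⊤ μ := hφt h1.continuous h2 mA
  have mφA' : MemLp (fun x => φ x * A' x) 2 μ := hφt h1.continuous h2 mA'
  have lim1 := tendsto_integral_mul_of_tendsto_eLpNorm (p := 2) (q := 2)
    (mpφA.mono_exponent le_top) mq mQ dQ
  have lim2 := tendsto_integral_mul_of_tendsto_eLpNorm (p := ⊤) (q := 1)
    mφA (memLp_one_iff_integrable.2 mq') mQ' dQ'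
  have lim3 := tendsto_integral_mul_of_tendsto_eLpNorm (p := 2) (q := 2) mφA' mq mQ dQ
  -- As soon as the radius of mollification is less than the distance from the support of `φ` to the
  -- complement of the half disk, differentiation and mollification commute on that support.
  have hev : ∀ᶠ m in atTop, (∫ x, pd i φ x * A x * conv (moll m) Q x ∂μ) +
      ∫ x, φ x * A x * conv (moll m) Q' x ∂μ = -∫ x, φ x * A' x * conv (moll m) Q x ∂μ := by
    obtain ⟨δ, hδ, hδU⟩ := h2.isCompact.exists_cthickening_subset_open (isOpen_openHalfDisk 2) h3
    have hlim : Tendsto (fun m : ℕ => 1 / ((m : ℝ) + 1)) atTop (𝓝 0) :=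
      tendsto_one_div_add_atTop_nhds_zero_nat
    filter_upwards [hlim.eventually_lt_const hδ] with m hm
    have hprod := hA (fun x => φ x * conv (moll m) Q x) (h1.mul (sm m)) h2.mul_right
      ((tsupport_mul_subset_left).trans h3)
    rw [Green] at hprod
    have e : ∀ x, pd i (fun x => φ x * conv (moll m) Q x) x * A x =
        pd i φ x * A x * conv (moll m) Q x + φ x * A x * conv (moll m) Q' x := by
      intro x
      rw [pd_mul (hd h1) (hd (sm m))]
      by_cases hx : x ∈ tsupport φ
      · rw [wQ.pd_moll_conv lQ (m := m) (x := x)]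
        · ring
        · intro y hy
          exact hδU (Metric.mem_cthickening_of_dist_le y x δ _ hx ((Metric.mem_closedBall.1 hy).trans hm.le))
      · rw [image_eq_zero_of_notMem_tsupport hx]
        ring
    simp only [e] at hprod
    rw [integral_add] at hprod
    · rw [hprod]
      congr 1
      refine integral_congr_ae (Eventually.of_forall fun x => ?_)
      simp only
      ring
    · exact memLp_one_iff_integrable.1
        ((mQ m).mul (r := 1) (p := 2) (mpφA.mono_exponent le_top))
    · exact memLp_one_iff_integrable.1 ((mQ' m).mul (r := 1) mφA)
  have heq := tendsto_nhds_unique ((lim1.add lim2).congr' hev) lim3.neg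
  have i2 : Integrable (fun x => φ x * A x * q' x) μ := memLp_one_iff_integrable.1
    ((memLp_one_iff_integrable.2 mq').mul (r := 1) mφA)
  have i3 : Integrable (fun x => φ x * A' x * q x) μ := memLp_one_iff_integrable.1
    (mq.mul (r := 1) mφA')
  rw [Green]
  have e1 : ∫ x, φ x * (A' x * q x + A x * q' x) ∂μ =
      (∫ x, φ x * A' x * q x ∂μ) + ∫ x, φ x * A x * q' x ∂μ := by
    rw [← integral_add i3 i2]
    refine integral_congr_ae (Eventually.of_forall fun x => ?_)
    simp only
    ring
  have e2 : ∫ x, pd i φ x * (A x * q x) ∂μ = ∫ x, pd i φ x * A x * q x ∂μ :=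
    integral_congr_ae (Eventually.of_forall fun x => by simp only; ring)
  rw [e1, e2]
  linarith

/-! ### The natural boundary condition -/

theorem trunc_pos {E : Type*} [NormedAddCommGroup E] {s : ℝ} (hs : 0 ≤ s) (z : E) : 0 < 1 + s * ‖z‖ ^ 2 := by positivity

section Truncation

variable {E : Type*} [NormedAddCommGroup E] [InnerProductSpace ℝ E]

/-- A smooth bounded approximation of the identity map. -/
def trunc (s : ℝ) (z : E) : E := (1 + s * ‖z‖ ^ 2)⁻¹ • z

/-- The derivative of `trunc s`. -/
def truncDeriv (s : ℝ) (z : E) : E →L[ℝ] E :=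
  (1 + s * ‖z‖ ^ 2)⁻¹ • ContinuousLinearMap.id ℝ E +
    ((-(s * 2) * ((1 + s * ‖z‖ ^ 2) ^ 2)⁻¹) • innerSL ℝ z).smulRight z

theorem hasFDerivAt_trunc {s : ℝ} (hs : 0 ≤ s) (z : E) :
    HasFDerivAt (trunc s) (truncDeriv s z) z := by
  have h1 : HasFDerivAt (fun z : E => 1 + s * ‖z‖ ^ 2) (s • (2 • innerSL ℝ z)) z :=
    ((hasStrictFDerivAt_norm_sq z).hasFDerivAt.const_mul s).const_add 1
  have h2 := (hasDerivAt_inv (trunc_pos hs z).ne').comp_hasFDerivAt z h1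
  have h3 := h2.smul (hasFDerivAt_id z)
  refine h3.congr_fderiv ?_
  ext v
  simp [truncDeriv]
  congr 1
  ring

theorem contDiff_trunc {s : ℝ} (hs : 0 ≤ s) : ContDiff ℝ 1 (trunc s : E → E) := by
  refine ContDiff.smul (ContDiff.inv (contDiff_const.add (contDiff_const.mul (contDiff_norm_sq ℝ)))
    fun z => (trunc_pos hs z).ne') contDiff_id

theorem norm_trunc_le {s : ℝ} (hs : 0 ≤ s) (z : E) : ‖trunc s z‖ ≤ ‖z‖ := by
  rw [trunc, norm_smul, norm_inv, Real.norm_of_nonneg (trunc_pos hs z).le]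
  have : (1 + s * ‖z‖ ^ 2)⁻¹ ≤ 1 := inv_le_one_of_one_le₀ (by
    have : 0 ≤ s * ‖z‖ ^ 2 := by positivity
    linarith)
  calc _ ≤ 1 * ‖z‖ := by gcongr
    _ = ‖z‖ := one_mul _

theorem norm_trunc_le_const {s : ℝ} (hs : 0 < s) (z : E) : ‖trunc s z‖ ≤ 1 + s⁻¹ := by
  have hs' : 0 < s⁻¹ := by positivity
  rcases le_total ‖z‖ 1 with h | h
  · exact (norm_trunc_le hs.le z).trans (by linarith)
  · rw [trunc, norm_smul, norm_inv, Real.norm_of_nonneg (trunc_pos hs.le z).le, inv_mul_le_iff₀ (trunc_pos hs.le z)]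
    have h1 : (1 + s * ‖z‖ ^ 2) * (1 + s⁻¹) = 1 + s⁻¹ + s * ‖z‖ ^ 2 + ‖z‖ ^ 2 := by
      field_simp
      ring
    rw [h1]
    have : 0 ≤ s * ‖z‖ ^ 2 := by positivity
    nlinarith

/-- Independence of `s` is the point: it gives the domination for the limit `s → 0` in
`green_neumann`. -/
theorem norm_truncDeriv_apply_le {s : ℝ} (hs : 0 ≤ s) (z v : E) :
    ‖truncDeriv s z v‖ ≤ 3 * ‖v‖ := by
  have hp := trunc_pos hs z
  have hsz : 0 ≤ s * ‖z‖ ^ 2 := by positivity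
  simp only [truncDeriv, add_apply, smul_apply,
    ContinuousLinearMap.smulRight_apply, ContinuousLinearMap.id_apply, innerSL_apply_apply]
  refine (norm_add_le _ _).trans ?_
  have h1 : ‖(1 + s * ‖z‖ ^ 2)⁻¹ • v‖ ≤ ‖v‖ := by
    rw [norm_smul, norm_inv, Real.norm_of_nonneg hp.le]
    have : (1 + s * ‖z‖ ^ 2)⁻¹ ≤ 1 := inv_le_one_of_one_le₀ (by linarith)
    calc _ ≤ 1 * ‖v‖ := by gcongr
      _ = ‖v‖ := one_mul _
  have h2 : ‖((-(s * 2) * ((1 + s * ‖z‖ ^ 2) ^ 2)⁻¹) • inner ℝ z v) • z‖ ≤ 2 * ‖v‖ := by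
    rw [norm_smul, norm_smul, norm_mul, norm_neg, norm_inv, Real.norm_of_nonneg (by positivity : 0 ≤ s * 2),
      Real.norm_of_nonneg (by positivity : 0 ≤ (1 + s * ‖z‖ ^ 2) ^ 2)]
    have h3 : ‖inner ℝ z v‖ ≤ ‖z‖ * ‖v‖ := norm_inner_le_norm z v
    have h4 : s * ‖z‖ ^ 2 * ((1 + s * ‖z‖ ^ 2) ^ 2)⁻¹ ≤ 1 := by
      rw [mul_inv_le_iff₀ (by positivity), one_mul]
      nlinarith
    calc s * 2 * ((1 + s * ‖z‖ ^ 2) ^ 2)⁻¹ * ‖inner ℝ z v‖ * ‖z‖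
        ≤ s * 2 * ((1 + s * ‖z‖ ^ 2) ^ 2)⁻¹ * (‖z‖ * ‖v‖) * ‖z‖ := by gcongr
      _ = 2 * (s * ‖z‖ ^ 2 * ((1 + s * ‖z‖ ^ 2) ^ 2)⁻¹) * ‖v‖ := by ring
      _ ≤ 2 * 1 * ‖v‖ := by gcongr
      _ = 2 * ‖v‖ := by ring
  linarith

theorem tendsto_truncDeriv_apply {s : ℕ → ℝ} (hs : Tendsto s atTop (𝓝 0)) (z v : E) :
    Tendsto (fun m => truncDeriv (s m) z v) atTop (𝓝 v) := by
  have hc : ContinuousAt (fun s : ℝ => truncDeriv s z v) 0 := by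
    simp only [truncDeriv, add_apply, smul_apply,
      ContinuousLinearMap.smulRight_apply, ContinuousLinearMap.id_apply, innerSL_apply_apply]
    have h1 : ContinuousAt (fun s : ℝ => (1 + s * ‖z‖ ^ 2)⁻¹) 0 :=
      ContinuousAt.inv₀ (by fun_prop) (by simp)
    have h2 : ContinuousAt (fun s : ℝ => ((1 + s * ‖z‖ ^ 2) ^ 2)⁻¹) 0 :=
      ContinuousAt.inv₀ (by fun_prop) (by simp)
    fun_prop
  have := hc.tendsto.comp hs
  simpa [truncDeriv, Function.comp_def] using this

theorem tendsto_trunc {s : ℕ → ℝ} (hs : Tendsto s atTop (𝓝 0)) (z : E) :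
    Tendsto (fun m => trunc (s m) z) atTop (𝓝 z) := by
  have hc : ContinuousAt (fun s : ℝ => trunc s z) 0 := by
    simp only [trunc]
    have h1 : ContinuousAt (fun s : ℝ => (1 + s * ‖z‖ ^ 2)⁻¹) 0 :=
      ContinuousAt.inv₀ (by fun_prop) (by simp)
    fun_prop
  have := hc.tendsto.comp hs
  simpa [trunc, Function.comp_def] using this

end Truncation

/-! ### The differential of `P` applied to a normal derivative. -/

theorem tendsto_eLpNorm_one {X E : Type*} [MeasurableSpace X] [NormedAddCommGroup E] {μ : Measure X}
    [IsFiniteMeasure μ] {p : ℝ≥0∞} (hp : 1 ≤ p) {f : ℕ → X → E}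
    (hf : ∀ m, AEStronglyMeasurable (f m) μ)
    (h : Tendsto (fun m => eLpNorm (f m) p μ) atTop (𝓝 0)) :
    Tendsto (fun m => eLpNorm (f m) 1 μ) atTop (𝓝 0) := by
  have hup := ENNReal.Tendsto.mul_const (b := μ univ ^ (1 / (1 : ℝ≥0∞).toReal - 1 / p.toReal)) h
    (Or.inr (by
      refine ENNReal.rpow_ne_top_of_nonneg ?_ (measure_ne_top _ _)
      rw [ENNReal.toReal_one, div_one, sub_nonneg]
      rcases eq_or_ne p ⊤ with rfl | hpt
      · simp
      · rw [div_le_one (ENNReal.toReal_pos (by positivity) hpt)]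
        rw [← ENNReal.toReal_one]
        exact ENNReal.toReal_mono hpt hp))
  rw [zero_mul] at hup
  exact tendsto_of_tendsto_of_tendsto_of_le_of_le tendsto_const_nhds hup (fun _ => zero_le)
    fun m => eLpNorm_le_eLpNorm_mul_rpow_measure_univ hp (hf m)

theorem tendsto_eLpNorm_prodMk {X E : Type*} [MeasurableSpace X] [NormedAddCommGroup E]
    {μ : Measure X} {f g : ℕ → X → E} (hf : ∀ m, AEStronglyMeasurable (f m) μ)
    (hg : ∀ m, AEStronglyMeasurable (g m) μ)
    (h1 : Tendsto (fun m => eLpNorm (f m) 1 μ) atTop (𝓝 0))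
    (h2 : Tendsto (fun m => eLpNorm (g m) 1 μ) atTop (𝓝 0)) :
    Tendsto (fun m => eLpNorm (fun x => (f m x, g m x)) 1 μ) atTop (𝓝 0) := by
  have hup := h1.add h2
  rw [add_zero] at hup
  refine tendsto_of_tendsto_of_tendsto_of_le_of_le tendsto_const_nhds hup (fun _ => zero_le)
    fun m => ?_
  refine (eLpNorm_mono_real (g := fun x => ‖f m x‖ + ‖g m x‖) fun x => ?_).trans
    ((eLpNorm_add_le (f := fun x => ‖f m x‖) (g := fun x => ‖g m x‖) (hf m).norm (hg m).norm
      le_rfl).trans_eq ?_)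
  · rw [Prod.norm_mk]
    exact max_le (by linarith [norm_nonneg (g m x)]) (by linarith [norm_nonneg (f m x)])
  · rw [eLpNorm_norm, eLpNorm_norm]

theorem exists_fderiv_bound {L : ℕ} {P : Euc L → ℝ} (hP : ContDiff ℝ ∞ P)
    (hPc : HasCompactSupport P) : ∃ M : ℝ, 0 ≤ M ∧ (∀ y, ‖fderiv ℝ P y‖ ≤ M) ∧
      ∀ y v w, ‖fderiv ℝ (fderiv ℝ P) y v w‖ ≤ M * ‖v‖ * ‖w‖ := by
  have hP1 : ContDiff ℝ ∞ (fderiv ℝ P) := hP.fderiv_right (by simp)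
  obtain ⟨M₁, hM₁⟩ := hP1.continuous.bounded_above_of_compact_support (hPc.fderiv (𝕜 := ℝ))
  have hc : HasCompactSupport (fderiv ℝ (fderiv ℝ P)) := (hPc.fderiv (𝕜 := ℝ)).fderiv (𝕜 := ℝ)
  have hP2c : Continuous (fderiv ℝ (fderiv ℝ P)) := hP1.continuous_fderiv (by simp)
  obtain ⟨M₂, hM₂⟩ := IsCompact.exists_bound_of_continuousOn
    (E := Euc L →L[ℝ] Euc L →L[ℝ] ℝ) hc.isCompact hP2c.continuousOn
  refine ⟨max (max M₁ M₂) 0, le_max_right _ _,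
    fun y => (hM₁ y).trans ((le_max_left _ _).trans (le_max_left _ _)), fun y v w => ?_⟩
  by_cases hy : y ∈ tsupport (fderiv ℝ (fderiv ℝ P))
  · refine (ContinuousLinearMap.le_opNorm₂ _ v w).trans ?_
    gcongr
    exact (hM₂ y hy).trans ((le_max_right _ _).trans (le_max_left _ _))
  · rw [image_eq_zero_of_notMem_tsupport hy]
    have : (0 : Euc L →L[ℝ] Euc L →L[ℝ] ℝ) v w = 0 := rfl
    rw [this, norm_zero]
    positivity

/-- The function `(y, z) ↦ DP(y) (trunc s z)`. -/
def fderivTrunc {L : ℕ} (P : Euc L → ℝ) (s : ℝ) (y : Euc L × Euc L) : ℝ :=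
  fderiv ℝ P y.1 (trunc s y.2)

section FDerivTrunc

variable {L : ℕ} {P : Euc L → ℝ} (hP : ContDiff ℝ ∞ P) {s : ℝ}

theorem contDiff_fderivTrunc (hP : ContDiff ℝ ∞ P) (hs : 0 ≤ s) :
    ContDiff ℝ 1 (fderivTrunc P s) := by
  have hP1 : ContDiff ℝ ∞ (fderiv ℝ P) := hP.fderiv_right (by simp)
  exact ((hP1.of_le (by norm_cast)).comp contDiff_fst).clm_apply ((contDiff_trunc hs).comp contDiff_snd)

theorem fderiv_fderivTrunc (hP : ContDiff ℝ ∞ P) (hs : 0 ≤ s) (y w : Euc L × Euc L) :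
    fderiv ℝ (fderivTrunc P s) y w =
      fderiv ℝ (fderiv ℝ P) y.1 w.1 (trunc s y.2) + fderiv ℝ P y.1 (truncDeriv s y.2 w.2) := by
  have hP1 : ContDiff ℝ ∞ (fderiv ℝ P) := hP.fderiv_right (by simp)
  have h1 : HasFDerivAt (fun y : Euc L × Euc L => fderiv ℝ P y.1)
      ((fderiv ℝ (fderiv ℝ P) y.1).comp (ContinuousLinearMap.fst ℝ _ _)) y :=
    ((hP1.differentiable (by simp) y.1).hasFDerivAt).comp y hasFDerivAt_fst
  have h2 : HasFDerivAt (fun y : Euc L × Euc L => trunc s y.2)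
      ((truncDeriv s y.2).comp (ContinuousLinearMap.snd ℝ _ _)) y :=
    (hasFDerivAt_trunc hs y.2).comp y hasFDerivAt_snd
  have h3 : HasFDerivAt (fderivTrunc P s) _ y := h1.clm_apply h2
  rw [h3.fderiv, add_apply, add_comm]
  rfl

theorem norm_fderiv_fderivTrunc_le (hP : ContDiff ℝ ∞ P) (hs : 0 < s) {M₁ M₂ : ℝ}
    (hM₂0 : 0 ≤ M₂) (hM₁ : ∀ y, ‖fderiv ℝ P y‖ ≤ M₁)
    (hM₂ : ∀ y v w, ‖fderiv ℝ (fderiv ℝ P) y v w‖ ≤ M₂ * ‖v‖ * ‖w‖)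
    (y : Euc L × Euc L) : ‖fderiv ℝ (fderivTrunc P s) y‖ ≤ M₂ * (1 + s⁻¹) + M₁ * 3 := by
  have hM₁0 : 0 ≤ M₁ := (norm_nonneg _).trans (hM₁ 0)
  refine ContinuousLinearMap.opNorm_le_bound _ (by positivity) fun w => ?_
  rw [fderiv_fderivTrunc hP hs.le, add_mul]
  refine (norm_add_le _ _).trans (add_le_add ?_ ?_)
  · calc ‖fderiv ℝ (fderiv ℝ P) y.1 w.1 (trunc s y.2)‖
        ≤ M₂ * ‖w.1‖ * ‖trunc s y.2‖ := hM₂ _ _ _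
      _ ≤ M₂ * ‖w‖ * (1 + s⁻¹) :=
        mul_le_mul (mul_le_mul_of_nonneg_left (norm_fst_le w) hM₂0)
          (norm_trunc_le_const hs _) (norm_nonneg _) (by positivity)
      _ = M₂ * (1 + s⁻¹) * ‖w‖ := by ring
  · calc _ ≤ ‖fderiv ℝ P y.1‖ * ‖truncDeriv s y.2 w.2‖ := ContinuousLinearMap.le_opNorm _ _
      _ ≤ M₁ * (3 * ‖w‖) :=
        mul_le_mul (hM₁ _) ((norm_truncDeriv_apply_le hs.le _ _).trans
          (mul_le_mul_of_nonneg_left (norm_snd_le w) (by norm_num))) (norm_nonneg _) hM₁0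
      _ = _ := by ring

end FDerivTrunc

/-- The map `(y, z) ↦ DP(y) z` is not globally Lipschitz, but after truncation of `z` it is, and
`green_comp` applies to the pair `(u, v)`. A truncated vector is a multiple of the vector itself, so
the condition `DP(b) d = 0` survives truncation and the boundary integral vanishes. -/
theorem integral_trunc_eq_zero {L : ℕ} {P : Euc L → ℝ} (hP : ContDiff ℝ ∞ P) (hPc : HasCompactSupport P)
    {u v u₁ v₁ : Euc 2 → Euc L} {b d : ℝ → Euc L} {W V : ℕ → Euc 2 → Euc L}
    (hW : ∀ m, ContDiff ℝ 1 (W m)) (hV : ∀ m, ContDiff ℝ 1 (V m))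
    (hu : Integrable u (volume.restrict (openHalfDisk 2)))
    (hu₁ : Integrable u₁ (volume.restrict (openHalfDisk 2)))
    (hv : Integrable v (volume.restrict (openHalfDisk 2)))
    (hv₁ : Integrable v₁ (volume.restrict (openHalfDisk 2)))
    (hb : Integrable b (volume.restrict (Ioo (-2) 2)))
    (hd : Integrable d (volume.restrict (Ioo (-2) 2)))
    (cW : Tendsto (fun m => eLpNorm (fun x => W m x - u x) 1 (volume.restrict (openHalfDisk 2)))
      atTop (𝓝 0))
    (cV : Tendsto (fun m => eLpNorm (fun x => V m x - v x) 1 (volume.restrict (openHalfDisk 2)))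
      atTop (𝓝 0))
    (cW₁ : Tendsto (fun m => eLpNorm (fun x => classicalPartial 1 (W m) x - u₁ x) 1
      (volume.restrict (openHalfDisk 2))) atTop (𝓝 0))
    (cV₁ : Tendsto (fun m => eLpNorm (fun x => classicalPartial 1 (V m) x - v₁ x) 1
      (volume.restrict (openHalfDisk 2))) atTop (𝓝 0))
    (cb : Tendsto (fun m => eLpNorm (fun t => W m !₂[t, 0] - b t) 1
      (volume.restrict (Ioo (-2) 2))) atTop (𝓝 0))
    (cd : Tendsto (fun m => eLpNorm (fun t => V m !₂[t, 0] - d t) 1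
      (volume.restrict (Ioo (-2) 2))) atTop (𝓝 0))
    (hbd : ∀ᵐ t ∂(volume.restrict (Ioo (-2 : ℝ) 2)), fderiv ℝ P (b t) (d t) = 0)
    {ψ : Euc 2 → ℝ} (hψ : IsTest ψ) :
    ∀ s : ℝ, 0 < s →
      ∫ x in openHalfDisk 2, (pd 1 ψ x * fderiv ℝ P (u x) (trunc s (v x)) +
        ψ x * (fderiv ℝ (fderiv ℝ P) (u x) (u₁ x) (trunc s (v x)) +
          fderiv ℝ P (u x) (truncDeriv s (v x) (v₁ x)))) = 0 := by
  intro s hs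
  obtain ⟨M, hM0, hM₁, hM₂⟩ := exists_fderiv_bound hP hPc
  have hcp : ∀ m x, classicalPartial 1 (fun x => (W m x, V m x)) x =
      (classicalPartial 1 (W m) x, classicalPartial 1 (V m) x) := by
    intro m x
    simp only [classicalPartial]
    rw [DifferentiableAt.fderiv_prodMk ((hW m).differentiable (by simp) x)
      ((hV m).differentiable (by simp) x)]
    rfl
  have hmk : Continuous fun t : ℝ => (!₂[t, 0] : Euc 2) :=
    continuous_mk.comp (by fun_prop : Continuous fun t : ℝ => (t, (0 : ℝ)))
  have hcpc : ∀ {f : Euc 2 → Euc L}, ContDiff ℝ 1 f → Continuous (classicalPartial 1 f) :=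
    fun h => (h.continuous_fderiv (by simp)).clm_apply continuous_const
  have k1 := tendsto_eLpNorm_prodMk (f := fun m x => W m x - u x) (g := fun m x => V m x - v x)
        (fun m => (hW m).continuous.aestronglyMeasurable.sub hu.1)
        (fun m => (hV m).continuous.aestronglyMeasurable.sub hv.1) cW cV
  have k2 := tendsto_eLpNorm_prodMk (f := fun m x => classicalPartial 1 (W m) x - u₁ x)
          (g := fun m x => classicalPartial 1 (V m) x - v₁ x)
          (fun m => (hcpc (hW m)).aestronglyMeasurable.sub hu₁.1)
          (fun m => (hcpc (hV m)).aestronglyMeasurable.sub hv₁.1) cW₁ cV₁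
  have k3 := tendsto_eLpNorm_prodMk (f := fun m t => W m !₂[t, 0] - b t)
        (g := fun m t => V m !₂[t, 0] - d t)
        (fun m => ((hW m).continuous.comp hmk).aestronglyMeasurable.sub hb.1)
        (fun m => ((hV m).continuous.comp hmk).aestronglyMeasurable.sub hd.1) cb cd
  have := green_comp (i := 1) (Ψ := fderivTrunc P s) (contDiff_fderivTrunc hP hs.le)
      (norm_fderiv_fderivTrunc_le hP hs hM0 hM₁ hM₂) (Z := fun x => (u x, v x))
      (Z' := fun x => (u₁ x, v₁ x)) (T := fun t => (b t, d t)) (W := fun m x => (W m x, V m x))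
      (fun m => (hW m).prodMk (hV m)) (hu.prodMk hv) (hu₁.prodMk hv₁) (hb.prodMk hd)
      k1 (by simp only [hcp]; exact k2) k3 hψ
  simp only [fderiv_fderivTrunc hP hs.le, fderivTrunc] at this
  rw [if_neg (by simp)] at this
  rw [this, neg_eq_zero]
  refine integral_eq_zero_of_ae ?_
  filter_upwards [hbd] with t ht
  simp only [trunc, map_smul, ht, smul_zero, mul_zero, Pi.zero_apply]

set_option maxHeartbeats 1000000 in
/-- If the boundary values `d` of `v` are annihilated by the derivative of `P` at the boundary
values `b` of `u`, then `DP(u) v` has trace zero. -/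
theorem green_neumann {L : ℕ} {P : Euc L → ℝ} (hP : ContDiff ℝ ∞ P) (hPc : HasCompactSupport P)
    {u v u₁ v₁ : Euc 2 → Euc L} {b d : ℝ → Euc L} {W V : ℕ → Euc 2 → Euc L}
    (hW : ∀ m, ContDiff ℝ 1 (W m)) (hV : ∀ m, ContDiff ℝ 1 (V m))
    (hu : Integrable u (volume.restrict (openHalfDisk 2)))
    (hu₁ : MemLp u₁ 2 (volume.restrict (openHalfDisk 2)))
    (hv : MemLp v 2 (volume.restrict (openHalfDisk 2)))
    (hv₁ : Integrable v₁ (volume.restrict (openHalfDisk 2)))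
    (hb : Integrable b (volume.restrict (Ioo (-2) 2)))
    (hd : Integrable d (volume.restrict (Ioo (-2) 2)))
    (cW : Tendsto (fun m => eLpNorm (fun x => W m x - u x) 1 (volume.restrict (openHalfDisk 2)))
      atTop (𝓝 0))
    (cV : Tendsto (fun m => eLpNorm (fun x => V m x - v x) 1 (volume.restrict (openHalfDisk 2)))
      atTop (𝓝 0))
    (cW₁ : Tendsto (fun m => eLpNorm (fun x => classicalPartial 1 (W m) x - u₁ x) 1
      (volume.restrict (openHalfDisk 2))) atTop (𝓝 0))
    (cV₁ : Tendsto (fun m => eLpNorm (fun x => classicalPartial 1 (V m) x - v₁ x) 1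
      (volume.restrict (openHalfDisk 2))) atTop (𝓝 0))
    (cb : Tendsto (fun m => eLpNorm (fun t => W m !₂[t, 0] - b t) 1
      (volume.restrict (Ioo (-2) 2))) atTop (𝓝 0))
    (cd : Tendsto (fun m => eLpNorm (fun t => V m !₂[t, 0] - d t) 1
      (volume.restrict (Ioo (-2) 2))) atTop (𝓝 0))
    (hbd : ∀ᵐ t ∂(volume.restrict (Ioo (-2 : ℝ) 2)), fderiv ℝ P (b t) (d t) = 0)
    {ψ : Euc 2 → ℝ} (hψ : IsTest ψ) :
    Green 1 (fun x => fderiv ℝ P (u x) (v x))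
      (fun x => fderiv ℝ (fderiv ℝ P) (u x) (u₁ x) (v x) + fderiv ℝ P (u x) (v₁ x)) ψ := by
  set μ := (volume : Measure (Euc 2)).restrict (openHalfDisk 2) with hμ
  set ν := (volume : Measure ℝ).restrict (Ioo (-2) 2) with hν
  have hP1 : ContDiff ℝ ∞ (fderiv ℝ P) := hP.fderiv_right (by simp)
  have hP2c : Continuous (fderiv ℝ (fderiv ℝ P)) := hP1.continuous_fderiv (by simp)
  obtain ⟨M, hM0, hM₁, hM₂⟩ := exists_fderiv_bound hP hPc
  obtain ⟨B₀, hB₀⟩ := hψ.1.continuous.bounded_above_of_compact_support hψ.hasCompactSupport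
  obtain ⟨B₁, hB₁⟩ := (hψ.pd 1).1.continuous.bounded_above_of_compact_support
    (hψ.pd 1).hasCompactSupport
  have hB₀0 : 0 ≤ B₀ := (norm_nonneg _).trans (hB₀ 0)
  have hB₁0 : 0 ≤ B₁ := (norm_nonneg _).trans (hB₁ 0)
  have hu₁i : Integrable u₁ μ := hu₁.integrable (by norm_num)
  have hvi : Integrable v μ := hv.integrable (by norm_num)
  have key := integral_trunc_eq_zero hP hPc hW hV hu hu₁i hvi hv₁ hb hd cW cV cW₁ cV₁ cb cd hbd hψ
  set s : ℕ → ℝ := fun m => 1 / ((m : ℝ) + 1) with hs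
  have hs0 : ∀ m, 0 < s m := fun m => by positivity
  have hslim : Tendsto s atTop (𝓝 0) := tendsto_one_div_add_atTop_nhds_zero_nat
  have e0 := fun m => key (s m) (hs0 m)
  have aP : AEStronglyMeasurable (fun x => fderiv ℝ P (u x)) μ :=
    hP1.continuous.comp_aestronglyMeasurable hu.1
  have aP2 : AEStronglyMeasurable (fun x => fderiv ℝ (fderiv ℝ P) (u x) (u₁ x)) μ :=
    (isBoundedBilinearMap_apply (𝕜 := ℝ) (E := Euc L) (F := Euc L →L[ℝ] ℝ)).continuous.comp_aestronglyMeasurable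
      ((hP2c.comp_aestronglyMeasurable hu.1).prodMk hu₁i.1)
  have app : ∀ {f : Euc 2 → Euc L →L[ℝ] ℝ} {g : Euc 2 → Euc L}, AEStronglyMeasurable f μ →
      AEStronglyMeasurable g μ → AEStronglyMeasurable (fun x => f x (g x)) μ := fun hf hg =>
    (isBoundedBilinearMap_apply (𝕜 := ℝ) (E := Euc L) (F := ℝ)).continuous.comp_aestronglyMeasurable
      (hf.prodMk hg)
  have atr : ∀ m, AEStronglyMeasurable (fun x => trunc (s m) (v x)) μ := fun m =>
    (contDiff_trunc (hs0 m).le).continuous.comp_aestronglyMeasurable hvi.1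
  have atrd : ∀ m, AEStronglyMeasurable (fun x => truncDeriv (s m) (v x) (v₁ x)) μ := fun m => by
    have hc : Continuous (truncDeriv (s m) : Euc L → _) := by
      have := (contDiff_trunc (E := Euc L) (hs0 m).le).continuous_fderiv (by simp)
      rwa [show fderiv ℝ (trunc (s m)) = truncDeriv (s m) from
        funext fun z => (hasFDerivAt_trunc (hs0 m).le z).fderiv] at this
    exact (isBoundedBilinearMap_apply (𝕜 := ℝ) (E := Euc L) (F := Euc L)).continuous.comp_aestronglyMeasurable
      ((hc.comp_aestronglyMeasurable hvi.1).prodMk hv₁.1)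
  have b1 : ∀ x z : Euc L, ‖fderiv ℝ P x z‖ ≤ M * ‖z‖ := fun x z =>
    (ContinuousLinearMap.le_opNorm _ _).trans (mul_le_mul_of_nonneg_right (hM₁ _) (norm_nonneg _))
  have b2 : ∀ x y z : Euc L, ‖fderiv ℝ (fderiv ℝ P) x y z‖ ≤ M * (‖y‖ * ‖z‖) := fun x y z => by
    rw [← mul_assoc]
    exact hM₂ x y z
  -- The second derivative of `P` produces the product of `u₁` and `v`, integrable because both are
  -- in `L²`. It enters the dominating function for the removal of the truncation.
  have huv : Integrable (fun x => ‖u₁ x‖ * ‖v x‖) μ :=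
    memLp_one_iff_integrable.1 (hv.norm.mul' (r := 1) hu₁.norm)
  have hlim := tendsto_integral_of_dominated_convergence (μ := μ)
    (F := fun m x => pd 1 ψ x * fderiv ℝ P (u x) (trunc (s m) (v x)) +
      ψ x * (fderiv ℝ (fderiv ℝ P) (u x) (u₁ x) (trunc (s m) (v x)) +
        fderiv ℝ P (u x) (truncDeriv (s m) (v x) (v₁ x))))
    (f := fun x => pd 1 ψ x * fderiv ℝ P (u x) (v x) +
      ψ x * (fderiv ℝ (fderiv ℝ P) (u x) (u₁ x) (v x) + fderiv ℝ P (u x) (v₁ x)))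
    (fun x => B₁ * (M * ‖v x‖) + B₀ * (M * (‖u₁ x‖ * ‖v x‖) + M * (3 * ‖v₁ x‖)))
    (fun m => ((hψ.pd 1).1.continuous.aestronglyMeasurable.mul (app aP (atr m))).add
      (hψ.1.continuous.aestronglyMeasurable.mul ((app aP2 (atr m)).add (app aP (atrd m)))))
    (((hvi.norm.const_mul _).const_mul _).add
      (((huv.const_mul _).add ((hv₁.norm.const_mul _).const_mul _)).const_mul _))
    (fun m => Eventually.of_forall fun x => by
      refine (norm_add_le _ _).trans (add_le_add ?_ ?_)
      · rw [norm_mul]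
        refine mul_le_mul (hB₁ x) ((b1 _ _).trans ?_) (norm_nonneg _) hB₁0
        gcongr
        exact norm_trunc_le (hs0 m).le _
      · rw [norm_mul]
        refine mul_le_mul (hB₀ x) ((norm_add_le _ _).trans (add_le_add ((b2 _ _ _).trans ?_)
          ((b1 _ _).trans ?_))) (norm_nonneg _) hB₀0
        · gcongr
          exact norm_trunc_le (hs0 m).le _
        · gcongr
          exact norm_truncDeriv_apply_le (hs0 m).le _ _)
    (Eventually.of_forall fun x => by
      have t1 := tendsto_trunc hslim (v x)
      have t2 := tendsto_truncDeriv_apply hslim (v x) (v₁ x)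
      refine Tendsto.add (Tendsto.const_mul _ ?_) (Tendsto.const_mul _ (Tendsto.add ?_ ?_))
      · exact ((fderiv ℝ P (u x)).continuous.tendsto _).comp t1
      · exact ((fderiv ℝ (fderiv ℝ P) (u x) (u₁ x)).continuous.tendsto _).comp t1
      · exact ((fderiv ℝ P (u x)).continuous.tendsto _).comp t2)
  rw [funext e0] at hlim
  have hfin := tendsto_nhds_unique hlim tendsto_const_nhds
  rw [Green, eq_neg_iff_add_eq_zero, ← integral_add]
  · exact hfin
  · refine Integrable.bdd_mul (c := B₁) ?_ (hψ.pd 1).1.continuous.aestronglyMeasurable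
      (Eventually.of_forall hB₁)
    exact (hvi.norm.const_mul M).mono' (app aP hvi.1) (Eventually.of_forall fun x => b1 _ _)
  · refine Integrable.bdd_mul (c := B₀) ?_ hψ.1.continuous.aestronglyMeasurable
      (Eventually.of_forall hB₀)
    exact ((huv.const_mul M).mono' (app aP2 hvi.1) (Eventually.of_forall fun x => b2 _ _ _)).add
      ((hv₁.norm.const_mul M).mono' (app aP hv₁.1) (Eventually.of_forall fun x => b1 _ _))

/-! ### Reflection -/

/-- The reflection in the boundary of the upper half plane. -/
def reflect : Euc 2 ≃ₗᵢ[ℝ] Euc 2 :=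
  LinearIsometryEquiv.piLpCongrRight 2
    ![LinearIsometryEquiv.refl ℝ ℝ, LinearIsometryEquiv.neg ℝ]

@[simp] theorem reflect_zero (x : Euc 2) : reflect x 0 = x 0 := rfl

@[simp] theorem reflect_one (x : Euc 2) : reflect x 1 = -x 1 := rfl

@[simp] theorem reflect_reflect (x : Euc 2) : reflect (reflect x) = x := by
  ext i; fin_cases i <;> simp

theorem reflect_mk (t : ℝ) : reflect !₂[t, 0] = !₂[t, 0] := by
  ext i; fin_cases i <;> simp

theorem measurePreserving_reflect : MeasurePreserving reflect (volume : Measure (Euc 2)) volume :=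
  reflect.measurePreserving

/-- The sign of the reflection in the direction `i`. -/
def reflSign (i : Fin 2) : ℝ := if i = 0 then 1 else -1

theorem contDiff_comp_reflect {φ : Euc 2 → ℝ} (h : ContDiff ℝ ∞ φ) :
    ContDiff ℝ ∞ fun x => φ (reflect x) := h.comp reflect.toContinuousLinearEquiv.contDiff

theorem pd_comp_reflect {φ : Euc 2 → ℝ} (h : Differentiable ℝ φ) (i : Fin 2) (x : Euc 2) :
    pd i (fun x => φ (reflect x)) x = reflSign i * pd i φ (reflect x) := by
  have h1 := (h (reflect x)).hasFDerivAt.comp x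
    (reflect.toContinuousLinearEquiv.toContinuousLinearMap.hasFDerivAt (x := x))
  have h2 : reflect (EuclideanSpace.single i (1 : ℝ)) = reflSign i • EuclideanSpace.single i (1 : ℝ) := by
    ext j
    fin_cases i <;> fin_cases j <;> simp [reflSign]
  have h3 : pd i (fun x => φ (reflect x)) x = fderiv ℝ φ (reflect x) (reflect (EuclideanSpace.single i 1)) := by
    simp only [pd]
    exact congrArg (fun A : Euc 2 →L[ℝ] ℝ => A (EuclideanSpace.single i 1)) h1.fderiv
  rw [h3, h2, map_smul]
  rfl

theorem reflSign_mul_self (i : Fin 2) : reflSign i * reflSign i = 1 := by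
  fin_cases i <;> simp [reflSign]

/-- The even (`s = 1`) or odd (`s = -1`) extension of a function on the half disk. -/
def refl (s : ℝ) (G : Euc 2 → ℝ) (x : Euc 2) : ℝ :=
  (openHalfDisk 2).indicator G x + s * (openHalfDisk 2).indicator G (reflect x)

theorem memLp_refl {s : ℝ} {G : Euc 2 → ℝ} {p : ℝ≥0∞}
    (hG : MemLp G p (volume.restrict (openHalfDisk 2))) : MemLp (refl s G) p volume := by
  have h1 := (memLp_indicator_iff_restrict (isOpen_openHalfDisk 2).measurableSet).2 hG
  exact h1.add ((h1.comp_measurePreserving measurePreserving_reflect).const_mul s)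

theorem eLpNorm_refl_le {s : ℝ} (hs : |s| = 1) {G : Euc 2 → ℝ} {p : ℝ≥0∞} (hp : 1 ≤ p)
    (hG : AEStronglyMeasurable G (volume.restrict (openHalfDisk 2))) :
    eLpNorm (refl s G) p volume ≤ 2 * eLpNorm G p (volume.restrict (openHalfDisk 2)) := by
  have hU := (isOpen_openHalfDisk 2).measurableSet
  have h1 : AEStronglyMeasurable ((openHalfDisk 2).indicator G) volume :=
    (aestronglyMeasurable_indicator_iff hU).2 hG
  have h2 : AEStronglyMeasurable (fun x => (openHalfDisk 2).indicator G (reflect x)) volume :=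
    h1.comp_measurePreserving measurePreserving_reflect
  refine (eLpNorm_add_le h1 (h2.const_mul s) hp).trans ?_
  have e1 : eLpNorm (fun x => s * (openHalfDisk 2).indicator G (reflect x)) p volume =
      eLpNorm ((openHalfDisk 2).indicator G) p volume := by
    rw [← eLpNorm_comp_measurePreserving h1 measurePreserving_reflect]
    refine eLpNorm_congr_norm_ae (Eventually.of_forall fun x => ?_)
    rw [norm_mul, Real.norm_eq_abs s, hs, one_mul]
    rfl
  rw [e1, eLpNorm_indicator_eq_eLpNorm_restrict hU, two_mul]

theorem aestronglyMeasurable_refl {s : ℝ} {G : Euc 2 → ℝ}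
    (hG : AEStronglyMeasurable G (volume.restrict (openHalfDisk 2))) :
    AEStronglyMeasurable (refl s G) volume := by
  have h1 : AEStronglyMeasurable ((openHalfDisk 2).indicator G) volume :=
    (aestronglyMeasurable_indicator_iff (isOpen_openHalfDisk 2).measurableSet).2 hG
  exact h1.add ((h1.comp_measurePreserving measurePreserving_reflect).const_mul s)

theorem refl_eq_of_mem {s : ℝ} {G : Euc 2 → ℝ} {x : Euc 2} (hx : x ∈ openHalfDisk 2) :
    refl s G x = G x := by
  have : reflect x ∉ openHalfDisk 2 := fun h => by
    have h1 := h.2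
    have h2 := hx.2
    rw [reflect_one] at h1
    linarith
  rw [refl, indicator_of_mem hx, indicator_of_notMem this, mul_zero, add_zero]

theorem hasCompactSupport_refl (s : ℝ) (G : Euc 2 → ℝ) : HasCompactSupport (refl s G) := by
  refine HasCompactSupport.of_support_subset_isCompact (isCompact_closedBall (0 : Euc 2) 2) fun x hx => ?_
  rw [mem_closedBall_zero_iff]
  by_contra h
  have h1 : x ∉ openHalfDisk 2 := fun h2 => h h2.1.le
  have h3 : reflect x ∉ openHalfDisk 2 := fun h2 => h (by simpa using h2.1.le)
  exact hx (by simp [refl, indicator_of_notMem h1, indicator_of_notMem h3])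

/-- Change of variables by the reflection on the lower half. It turns questions about the extended
function into questions on the half disk with symmetrized test functions. -/
theorem integral_mul_refl {φ G : Euc 2 → ℝ} (hφ : Continuous φ) (hφc : HasCompactSupport φ) (s : ℝ)
    (hG : Integrable G (volume.restrict (openHalfDisk 2))) :
    ∫ x, φ x * refl s G x = ∫ x in openHalfDisk 2, (φ x + s * φ (reflect x)) * G x := by
  have hU := (isOpen_openHalfDisk 2).measurableSet
  obtain ⟨B, hB⟩ := hφ.bounded_above_of_compact_support hφc
  have hI : Integrable ((openHalfDisk 2).indicator G) volume := (integrable_indicator_iff hU).2 hG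
  have hI' : Integrable (fun x => (openHalfDisk 2).indicator G (reflect x)) volume :=
    (measurePreserving_reflect.integrable_comp hI.1).2 hI
  have i1 : Integrable (fun x => φ x * (openHalfDisk 2).indicator G x) :=
    hI.bdd_mul hφ.aestronglyMeasurable (Eventually.of_forall hB)
  have i2 : Integrable (fun x => φ x * (openHalfDisk 2).indicator G (reflect x)) :=
    hI'.bdd_mul hφ.aestronglyMeasurable (Eventually.of_forall hB)
  have i3 : Integrable (fun x => φ (reflect x) * (openHalfDisk 2).indicator G x) :=
    hI.bdd_mul (hφ.comp reflect.continuous).aestronglyMeasurable (Eventually.of_forall fun x => hB _)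
  have e1 : ∫ x, φ x * refl s G x = (∫ x, φ x * (openHalfDisk 2).indicator G x) +
      s * ∫ x, φ x * (openHalfDisk 2).indicator G (reflect x) := by
    rw [← integral_const_mul, ← integral_add i1 (i2.const_mul s)]
    refine integral_congr_ae (Eventually.of_forall fun x => ?_)
    simp only [refl]
    ring
  have e2 : ∫ x, φ x * (openHalfDisk 2).indicator G (reflect x) =
      ∫ x, φ (reflect x) * (openHalfDisk 2).indicator G x := by
    rw [← measurePreserving_reflect.integral_comp reflect.toHomeomorph.measurableEmbedding]
    simp
  rw [e1, e2, ← integral_const_mul, ← integral_add i1 (i3.const_mul s), ← integral_indicator hU]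
  refine integral_congr_ae (Eventually.of_forall fun x => ?_)
  by_cases hx : x ∈ openHalfDisk 2
  · simp only [indicator_of_mem hx]; ring
  · simp only [indicator_of_notMem hx]; ring

theorem IsTest.add_reflect {φ : Euc 2 → ℝ} (h : IsTest φ) (s : ℝ) :
    IsTest fun x => φ x + s * φ (reflect x) := by
  refine ⟨h.1.add (contDiff_const.mul (contDiff_comp_reflect h.1)), ?_⟩
  refine (tsupport_add φ fun x => s * φ (reflect x)).trans (union_subset h.2 ?_)
  refine (tsupport_mul_subset_right (f := fun _ => s) (g := fun x => φ (reflect x))).trans fun x hx => ?_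
  have h1 : x ∈ reflect ⁻¹' tsupport φ := by
    refine closure_minimal (fun y hy => ?_) ((isClosed_tsupport φ).preimage reflect.continuous) hx
    exact subset_tsupport φ hy
  simpa using h.2 h1

theorem pd_add_reflect {φ : Euc 2 → ℝ} (h : Differentiable ℝ φ) (s : ℝ) (i : Fin 2) (x : Euc 2) :
    pd i (fun x => φ x + s * φ (reflect x)) x = pd i φ x + s * reflSign i * pd i φ (reflect x) := by
  have hr : Differentiable ℝ fun x => φ (reflect x) :=
    h.comp reflect.toContinuousLinearEquiv.differentiable
  rw [pd_add (f := φ) (g := fun x => s * φ (reflect x)) h (hr.const_mul s),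
    pd_const_mul (f := fun x => φ (reflect x)) s hr, pd_comp_reflect h, mul_assoc]

/-- A normal derivative reverses the parity of an extension, a tangential one keeps it. For the
normal derivative of an even extension the symmetrized test function vanishes on the flat boundary
and no boundary condition is needed. For an odd extension it does not vanish there, and `Green`
encodes the zero trace. -/
theorem weakDeriv_refl {G G' : Euc 2 → ℝ} {i : Fin 2} {s : ℝ}
    (hG : Integrable G (volume.restrict (openHalfDisk 2)))
    (hG' : Integrable G' (volume.restrict (openHalfDisk 2)))
    {S : Set (Euc 2)}
    (h : ∀ ψ, ContDiff ℝ ∞ ψ → HasCompactSupport ψ → tsupport ψ ⊆ S →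
      Green i G G' fun x => ψ x + s * reflSign i * ψ (reflect x)) :
    WeakDeriv S i (refl s G) (refl (s * reflSign i) G') := by
  intro φ h1 h2 h3
  have hd : Differentiable ℝ φ := h1.differentiable (by simp)
  rw [integral_mul_refl (h1.pd i).continuous (hasCompactSupport_pd h2 i) s hG,
    integral_mul_refl h1.continuous h2 _ hG']
  have := h φ h1 h2 h3
  rw [Green] at this
  rw [← this]
  refine integral_congr_ae (Eventually.of_forall fun x => ?_)
  simp only
  rw [pd_add_reflect hd, mul_assoc s, reflSign_mul_self, mul_one]

/-! ### Cutting off -/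

theorem WeakDeriv.congr {i : Fin 2} {f f' g g' : Euc 2 → ℝ} (h : WeakDeriv (openHalfDisk 2) i f g)
    (hf : ∀ᵐ x ∂(volume.restrict (openHalfDisk 2)), f x = f' x)
    (hg : ∀ᵐ x ∂(volume.restrict (openHalfDisk 2)), g x = g' x) :
    WeakDeriv (openHalfDisk 2) i f' g' := by
  rw [weakDeriv_iff_green] at h ⊢
  intro φ h1 h2 h3
  have := h φ h1 h2 h3
  rw [Green] at this ⊢
  rw [integral_congr_ae (g := fun x => pd i φ x * f x) (by filter_upwards [hf] with x hx; rw [hx]),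
    integral_congr_ae (f := fun x => φ x * g' x) (g := fun x => φ x * g x)
      (by filter_upwards [hg] with x hx; rw [hx])]
  exact this

theorem IsTest.integrable_mul {ψ f : Euc 2 → ℝ} (h : IsTest ψ)
    (hf : Integrable f (volume.restrict (openHalfDisk 2))) :
    Integrable (fun x => ψ x * f x) (volume.restrict (openHalfDisk 2)) := by
  obtain ⟨B, hB⟩ := h.1.continuous.bounded_above_of_compact_support h.hasCompactSupport
  exact hf.bdd_mul h.1.continuous.aestronglyMeasurable (Eventually.of_forall hB)

theorem IsTest.mul {χ ψ : Euc 2 → ℝ} (h : IsTest χ) (hψ : ContDiff ℝ ∞ ψ) :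
    IsTest fun x => χ x * ψ x :=
  ⟨h.1.mul hψ, tsupport_mul_subset_left.trans h.2⟩

/-- Green's formula for the product with a cutoff function. -/
theorem green_cutoff_mul {i : Fin 2} {f g χ ψ : Euc 2 → ℝ} (hχ : IsTest χ) (hψ : ContDiff ℝ ∞ ψ)
    (hf : Integrable f (volume.restrict (openHalfDisk 2)))
    (hg : Integrable g (volume.restrict (openHalfDisk 2)))
    (h : Green i f g fun x => χ x * ψ x) :
    Green i (fun x => χ x * f x) (fun x => pd i χ x * f x + χ x * g x) ψ := by
  have hd : ∀ {f : Euc 2 → ℝ}, ContDiff ℝ ∞ f → Differentiable ℝ f :=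
    fun h => h.differentiable (by simp)
  rw [Green] at h ⊢
  have i1 := ((hχ.pd i).mul hψ).integrable_mul hf
  have i2 := (hχ.mul (hψ.pd i)).integrable_mul hf
  have i3 := (hχ.mul hψ).integrable_mul hg
  have e1 : ∫ x in openHalfDisk 2, pd i (fun x => χ x * ψ x) x * f x =
      (∫ x in openHalfDisk 2, pd i χ x * ψ x * f x) + ∫ x in openHalfDisk 2, χ x * pd i ψ x * f x := by
    rw [← integral_add i1 i2]
    refine integral_congr_ae (Eventually.of_forall fun x => ?_)
    simp only
    rw [pd_mul (hd hχ.1) (hd hψ)]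
    ring
  have e2 : ∫ x in openHalfDisk 2, ψ x * (pd i χ x * f x + χ x * g x) =
      (∫ x in openHalfDisk 2, pd i χ x * ψ x * f x) + ∫ x in openHalfDisk 2, χ x * ψ x * g x := by
    rw [← integral_add i1 i3]
    refine integral_congr_ae (Eventually.of_forall fun x => ?_)
    simp only
    ring
  have e3 : ∫ x in openHalfDisk 2, pd i ψ x * (χ x * f x) =
      ∫ x in openHalfDisk 2, χ x * pd i ψ x * f x :=
    integral_congr_ae (Eventually.of_forall fun x => by simp only; ring)
  rw [e2, e3]
  linarith

theorem WeakDeriv.cutoff_mul {i : Fin 2} {f g χ : Euc 2 → ℝ}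
    (h : WeakDeriv (openHalfDisk 2) i f g) (hχ : IsTest χ)
    (hf : Integrable f (volume.restrict (openHalfDisk 2)))
    (hg : Integrable g (volume.restrict (openHalfDisk 2))) :
    WeakDeriv (openHalfDisk 2) i (fun x => χ x * f x) (fun x => pd i χ x * f x + χ x * g x) := by
  rw [weakDeriv_iff_green] at h ⊢
  intro φ h1 h2 h3
  exact green_cutoff_mul hχ h1 hf hg (h _ (hχ.1.mul h1) h2.mul_left (tsupport_mul_subset_right.trans h3))

/-- The weak Laplacian of the product with a cutoff function. -/
theorem integral_lap_mul_cutoff {χ Θ h : Euc 2 → ℝ} {h₁ h₂ : Fin 2 → Euc 2 → ℝ} (hχ : IsTest χ)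
    (hΘ : ContDiff ℝ ∞ Θ) (ih : Integrable h (volume.restrict (openHalfDisk 2)))
    (ih₁ : ∀ i, Integrable (h₁ i) (volume.restrict (openHalfDisk 2)))
    (ih₂ : ∀ i, Integrable (h₂ i) (volume.restrict (openHalfDisk 2)))
    (g1 : ∀ i, Green i h (h₁ i) fun x => χ x * pd i Θ x)
    (g2 : ∀ i, Green i h (h₁ i) fun x => pd i χ x * Θ x)
    (g3 : ∀ i, Green i (h₁ i) (h₂ i) fun x => χ x * Θ x) :
    ∫ x in openHalfDisk 2, lap Θ x * (χ x * h x) = ∫ x in openHalfDisk 2,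
      Θ x * ∑ i, (χ x * h₂ i x + 2 * pd i χ x * h₁ i x + pd i (pd i χ) x * h x) := by
  have key : ∀ i, ∫ x in openHalfDisk 2, pd i (pd i Θ) x * (χ x * h x) = ∫ x in openHalfDisk 2,
      Θ x * (χ x * h₂ i x + 2 * pd i χ x * h₁ i x + pd i (pd i χ) x * h x) := by
    intro i
    have a1 := green_cutoff_mul hχ (hΘ.pd i) ih (ih₁ i) (g1 i)
    have a2 := green_cutoff_mul (hχ.pd i) hΘ ih (ih₁ i) (g2 i)
    have a3 := green_cutoff_mul hχ hΘ (ih₁ i) (ih₂ i) (g3 i)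
    rw [Green] at a1 a2 a3
    have j1 := ((hχ.pd i).mul (hΘ.pd i)).integrable_mul ih
    have j2 := (hχ.mul (hΘ.pd i)).integrable_mul (ih₁ i)
    have j3 := (((hχ.pd i).pd i).mul hΘ).integrable_mul ih
    have j4 := ((hχ.pd i).mul hΘ).integrable_mul (ih₁ i)
    have j5 := (hχ.mul hΘ).integrable_mul (ih₂ i)
    have e1 : ∫ x in openHalfDisk 2, pd i Θ x * (pd i χ x * h x + χ x * h₁ i x) =
        (∫ x in openHalfDisk 2, pd i Θ x * (pd i χ x * h x)) +
          ∫ x in openHalfDisk 2, pd i Θ x * (χ x * h₁ i x) := by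
      rw [← integral_add]
      · exact integral_congr_ae (Eventually.of_forall fun x => by simp only; ring)
      · exact j1.congr (Eventually.of_forall fun x => by simp only; ring)
      · exact j2.congr (Eventually.of_forall fun x => by simp only; ring)
    have e2 : (∫ x in openHalfDisk 2, Θ x *
        (χ x * h₂ i x + 2 * pd i χ x * h₁ i x + pd i (pd i χ) x * h x)) =
        (∫ x in openHalfDisk 2, Θ x * (pd i (pd i χ) x * h x + pd i χ x * h₁ i x)) +
          ∫ x in openHalfDisk 2, Θ x * (pd i χ x * h₁ i x + χ x * h₂ i x) := by
      rw [← integral_add]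
      · exact integral_congr_ae (Eventually.of_forall fun x => by simp only; ring)
      · exact (j3.add j4).congr (Eventually.of_forall fun x => by simp only [Pi.add_apply]; ring)
      · exact (j4.add j5).congr (Eventually.of_forall fun x => by simp only [Pi.add_apply]; ring)
    rw [e1] at a1
    rw [e2]
    linarith
  have s1 : ∫ x in openHalfDisk 2, lap Θ x * (χ x * h x) =
      ∑ i, ∫ x in openHalfDisk 2, pd i (pd i Θ) x * (χ x * h x) := by
    rw [← integral_finsetSum]
    · exact integral_congr_ae (Eventually.of_forall fun x => by simp only [lap, Finset.sum_mul])
    · intro i _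
      exact ((hχ.mul ((hΘ.pd i).pd i)).integrable_mul ih).congr
        (Eventually.of_forall fun x => by simp only; ring)
  rw [s1, Finset.sum_congr rfl fun i _ => key i, ← integral_finsetSum]
  · exact integral_congr_ae (Eventually.of_forall fun x => by simp only [Finset.mul_sum])
  · intro i _
    refine ((((hχ.mul hΘ).integrable_mul (ih₂ i)).add
      ((((hχ.pd i).mul hΘ).integrable_mul (ih₁ i)).const_mul 2)).add
      ((((hχ.pd i).pd i).mul hΘ).integrable_mul ih)).congr (Eventually.of_forall fun x => ?_)
    simp only [Pi.add_apply]
    ring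

theorem openHalfDisk_subset {r s : ℝ} (h : r ≤ s) : openHalfDisk r ⊆ openHalfDisk s :=
  fun _ hx => ⟨hx.1.trans_le h, hx.2⟩

theorem eLpNorm_mul_restrict_le {ψ h : Euc 2 → ℝ} {M : ℝ≥0} (hM : ∀ x, ‖ψ x‖ ≤ M)
    (hs : tsupport ψ ⊆ Metric.ball 0 1) (p : ℝ≥0∞) :
    eLpNorm (fun x => ψ x * h x) p (volume.restrict (openHalfDisk 2)) ≤
      M * eLpNorm h p (volume.restrict (openHalfDisk 1)) := by
  have hU := (isOpen_openHalfDisk 1).measurableSet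
  have e : eLpNorm (fun x => ψ x * h x) p (volume.restrict (openHalfDisk 2)) =
      eLpNorm ((openHalfDisk 1).indicator fun x => ψ x * h x) p (volume.restrict (openHalfDisk 2)) := by
    refine eLpNorm_congr_ae ?_
    filter_upwards [ae_restrict_mem (isOpen_openHalfDisk 2).measurableSet] with x hx
    by_cases h1 : x ∈ openHalfDisk 1
    · rw [indicator_of_mem h1]
    · rw [indicator_of_notMem h1, image_eq_zero_of_notMem_tsupport (f := ψ)
        fun h2 => h1 ⟨mem_ball_zero_iff.1 (hs h2), hx.2⟩, zero_mul]
  rw [e, eLpNorm_indicator_eq_eLpNorm_restrict hU, Measure.restrict_restrict hU,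
    inter_eq_left.2 (openHalfDisk_subset (by norm_num))]
  refine (eLpNorm_le_mul_eLpNorm_of_ae_le_mul (c := (M : ℝ)) (g := h)
    (Eventually.of_forall fun x => ?_) p).trans_eq ?_
  · rw [norm_mul]
    exact mul_le_mul_of_nonneg_right (hM x) (norm_nonneg _)
  · rw [ENNReal.ofReal_coe_nnreal]

/-- A common bound for a cutoff function and its derivatives as multipliers. -/
theorem exists_multiplier_bound {χ : Euc 2 → ℝ} (hχ : IsTest χ) (hs : tsupport χ ⊆ Metric.ball 0 1)
    (p : ℝ≥0∞) : ∃ M : ℝ≥0, ∀ ψ ∈ ({χ, lap χ} ∪ range (fun i => pd i χ) ∪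
        range fun ij : Fin 2 × Fin 2 => pd ij.1 (pd ij.2 χ) : Set (Euc 2 → ℝ)), ∀ h : Euc 2 → ℝ,
      eLpNorm (fun x => ψ x * h x) p (volume.restrict (openHalfDisk 2)) ≤
        M * eLpNorm h p (volume.restrict (openHalfDisk 1)) := by
  have key : ∀ ψ : Euc 2 → ℝ, ContDiff ℝ ∞ ψ → tsupport ψ ⊆ Metric.ball 0 1 → ∃ M : ℝ≥0, ∀ x, ‖ψ x‖ ≤ M := by
    intro ψ h1 h2
    have hc : HasCompactSupport ψ := (isCompact_closedBall (0 : Euc 2) 1).of_isClosed_subset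
      (isClosed_tsupport _) (h2.trans Metric.ball_subset_closedBall)
    obtain ⟨B, hB⟩ := h1.continuous.bounded_above_of_compact_support hc
    exact ⟨⟨B, (norm_nonneg _).trans (hB 0)⟩, hB⟩
  obtain ⟨M₀, h₀⟩ := key χ hχ.1 hs
  obtain ⟨M₁, h₁⟩ := key (lap χ) hχ.1.lap ((tsupport_lap_subset χ).trans hs)
  choose M₂ h₂ using fun i => key (pd i χ) (hχ.1.pd i) ((tsupport_pd_subset χ i).trans hs)
  choose M₃ h₃ using fun ij : Fin 2 × Fin 2 => key (pd ij.1 (pd ij.2 χ)) ((hχ.1.pd _).pd _)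
    ((tsupport_pd_subset _ _).trans ((tsupport_pd_subset χ _).trans hs))
  refine ⟨M₀ + M₁ + ∑ i, M₂ i + ∑ ij, M₃ ij, fun ψ hψ h => ?_⟩
  have hle : ∀ M : ℝ≥0, M ≤ M₀ + M₁ + ∑ i, M₂ i + ∑ ij, M₃ ij → (∀ x, ‖ψ x‖ ≤ M) →
      ∀ x, ‖ψ x‖ ≤ ((M₀ + M₁ + ∑ i, M₂ i + ∑ ij, M₃ ij : ℝ≥0) : ℝ) :=
    fun M h1 h2 x => (h2 x).trans (by exact_mod_cast h1)
  rcases hψ with ((rfl | rfl) | ⟨i, rfl⟩) | ⟨ij, rfl⟩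
  · exact eLpNorm_mul_restrict_le (hle M₀ (by rw [add_assoc, add_assoc]; exact le_self_add) h₀) hs p
  · exact eLpNorm_mul_restrict_le (hle M₁ (by
      rw [add_assoc, add_comm M₀, add_assoc]; exact le_self_add) h₁) ((tsupport_lap_subset χ).trans hs) p
  · refine eLpNorm_mul_restrict_le (hle (M₂ i) ?_ (h₂ i)) ((tsupport_pd_subset χ i).trans hs) p
    exact (Finset.single_le_sum (f := M₂) (fun _ _ => zero_le) (Finset.mem_univ i)).trans
      (le_add_self.trans le_self_add)
  · refine eLpNorm_mul_restrict_le (hle (M₃ ij) ?_ (h₃ ij))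
      ((tsupport_pd_subset _ _).trans ((tsupport_pd_subset χ _).trans hs)) p
    exact (Finset.single_le_sum (f := M₃) (fun _ _ => zero_le) (Finset.mem_univ ij)).trans le_add_self

/-- The Calderón–Zygmund estimate is applied to the reflection of `χ h`. Its distributional
Laplacian is the reflection, with the same sign, of the expanded expression for the Laplacian of `χ
h`. The three formulas for symmetrized test functions are the places where a boundary condition can
enter. Leaving them as hypotheses lets the lemma serve both parities. -/
theorem exists_eLpNorm_pd_pd_moll_conv_refl_le {p : ℝ} (hp1 : 1 < p) (hp2 : p ≤ 2) {χ : Euc 2 → ℝ}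
    (hχ : IsTest χ) (hs : tsupport χ ⊆ Metric.ball 0 1) :
    ∃ C : ℝ≥0, ∀ (s : ℝ) (h : Euc 2 → ℝ) (h₁ h₂ : Fin 2 → Euc 2 → ℝ), |s| = 1 →
      Integrable h (volume.restrict (openHalfDisk 2)) →
      (∀ i, Integrable (h₁ i) (volume.restrict (openHalfDisk 2))) →
      (∀ i, Integrable (h₂ i) (volume.restrict (openHalfDisk 2))) →
      (∀ φ, ContDiff ℝ ∞ φ → ∀ i,
        (Green i h (h₁ i) fun x => χ x * pd i (fun x => φ x + s * φ (reflect x)) x) ∧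
        (Green i h (h₁ i) fun x => pd i χ x * (φ x + s * φ (reflect x))) ∧
        Green i (h₁ i) (h₂ i) fun x => χ x * (φ x + s * φ (reflect x))) →
      ∀ (m : ℕ) (i j : Fin 2),
        eLpNorm (pd i (pd j (conv (moll m) (refl s fun x => χ x * h x)))) (ENNReal.ofReal p) volume ≤
          C * (eLpNorm (fun x => χ x * ∑ i, h₂ i x) (ENNReal.ofReal p)
              (volume.restrict (openHalfDisk 2)) +
            ∑ i, eLpNorm (h₁ i) (ENNReal.ofReal p) (volume.restrict (openHalfDisk 1)) +
            eLpNorm h (ENNReal.ofReal p) (volume.restrict (openHalfDisk 1))) := by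
  obtain ⟨C, hC⟩ := exists_eLpNorm_pd_pd_moll_conv_le hp1 hp2
  set r := ENNReal.ofReal p with hr
  have hr1 : 1 ≤ r := by
    rw [← ENNReal.ofReal_one]; exact ENNReal.ofReal_le_ofReal hp1.le
  obtain ⟨M, hM⟩ := exists_multiplier_bound hχ hs r
  set μ := (volume : Measure (Euc 2)).restrict (openHalfDisk 2) with hμ
  refine ⟨C * (2 + 8 * M), fun s h h₁ h₂ hs1 ih ih₁ ih₂ hg m i j => ?_⟩
  set F : Euc 2 → ℝ := fun x =>
    ∑ i, (χ x * h₂ i x + 2 * pd i χ x * h₁ i x + pd i (pd i χ) x * h x) with hF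
  have iχh : Integrable (fun x => χ x * h x) μ := hχ.integrable_mul ih
  have a1 : Integrable (fun x => χ x * ∑ i, h₂ i x) μ :=
    hχ.integrable_mul (integrable_finsetSum _ fun i _ => ih₂ i)
  have a2 : ∀ i, Integrable (fun x => pd i χ x * (2 * h₁ i x)) μ := fun i =>
    (hχ.pd i).integrable_mul ((ih₁ i).const_mul 2)
  have hlapt : IsTest (lap χ) := ⟨hχ.1.lap, (tsupport_lap_subset χ).trans hχ.2⟩
  have a3 : Integrable (fun x => lap χ x * h x) μ := hlapt.integrable_mul ih
  have eF : F = (fun x => χ x * ∑ i, h₂ i x) + (∑ i, fun x => pd i χ x * (2 * h₁ i x)) +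
      fun x => lap χ x * h x := by
    ext x
    simp only [hF, Pi.add_apply, lap, Fin.sum_univ_two]
    ring
  have iF : Integrable F μ := by
    rw [eF]
    exact (a1.add (integrable_finsetSum' _ fun i _ => a2 i)).add a3
  have nF : eLpNorm F r μ ≤ eLpNorm (fun x => χ x * ∑ i, h₂ i x) r μ +
      ∑ i, M * (2 * eLpNorm (h₁ i) r (volume.restrict (openHalfDisk 1))) +
      M * eLpNorm h r (volume.restrict (openHalfDisk 1)) := by
    rw [eF]
    refine (eLpNorm_add_le (a1.add (integrable_finsetSum' _ fun i _ => a2 i)).1 a3.1 hr1).trans ?_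
    refine add_le_add ((eLpNorm_add_le a1.1 (integrable_finsetSum' _ fun i _ => a2 i).1 hr1).trans
      (add_le_add le_rfl ?_)) (hM _ (by simp) h)
    refine (eLpNorm_sum_le (fun i _ => (a2 i).1) hr1).trans (Finset.sum_le_sum fun i _ => ?_)
    refine (hM (pd i χ) (by simp) fun x => 2 * h₁ i x).trans ?_
    have : (fun x => 2 * h₁ i x) = (2 : ℝ) • h₁ i := rfl
    rw [this, eLpNorm_const_smul]
    gcongr
    rw [← ofReal_norm]
    norm_num
  -- The Laplacian commutes with symmetrization because the sign of the reflection in each direction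
  -- squares to one.
  have hweak : ∀ φ, ContDiff ℝ ∞ φ → HasCompactSupport φ →
      ∫ x, lap φ x * refl s (fun x => χ x * h x) x = ∫ x, φ x * refl s F x := by
    intro φ h1 h2
    have hd : ∀ {f : Euc 2 → ℝ}, ContDiff ℝ ∞ f → Differentiable ℝ f :=
      fun h => h.differentiable (by simp)
    rw [integral_mul_refl h1.lap.continuous (hasCompactSupport_lap h2) s iχh,
      integral_mul_refl h1.continuous h2 s iF]
    have hΘ : ContDiff ℝ ∞ fun x => φ x + s * φ (reflect x) :=
      h1.add (contDiff_const.mul (contDiff_comp_reflect h1))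
    have := integral_lap_mul_cutoff hχ hΘ ih ih₁ ih₂ (fun i => (hg φ h1 i).1) (fun i => (hg φ h1 i).2.1)
      fun i => (hg φ h1 i).2.2
    rw [← this]
    refine integral_congr_ae (Eventually.of_forall fun x => ?_)
    simp only
    congr 1
    simp only [lap, Finset.mul_sum]
    rw [← Finset.sum_add_distrib]
    refine Finset.sum_congr rfl fun i _ => ?_
    have e : (pd i fun x => φ x + s * φ (reflect x)) =
        fun x => pd i φ x + (s * reflSign i) * pd i φ (reflect x) :=
      funext fun x => pd_add_reflect (hd h1) s i x
    rw [e, pd_add_reflect (hd (h1.pd i)), mul_assoc s, reflSign_mul_self, mul_one]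
  have mw : Integrable (refl s fun x => χ x * h x) :=
    memLp_one_iff_integrable.1 (memLp_refl (memLp_one_iff_integrable.2 iχh))
  refine (hC _ _ mw.locallyIntegrable (hasCompactSupport_refl _ _) (aestronglyMeasurable_refl iF.1)
    hweak m i j).trans ?_
  have n1 := (eLpNorm_refl_le hs1 hr1 iF.1).trans (mul_le_mul_right nF 2)
  have n2 := (eLpNorm_refl_le (s := s) hs1 hr1 iχh.1).trans (mul_le_mul_right (hM χ (by simp) h) 2)
  refine (mul_le_mul_right (add_le_add n1 n2) _).trans ?_
  rw [← Finset.mul_sum, ← Finset.mul_sum]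
  push_cast
  rw [mul_assoc]
  refine mul_le_mul_right ?_ _
  set A := eLpNorm (fun x => χ x * ∑ i, h₂ i x) r μ
  set B := ∑ i, eLpNorm (h₁ i) r (volume.restrict (openHalfDisk 1))
  set D := eLpNorm h r (volume.restrict (openHalfDisk 1))
  calc 2 * (A + M * (2 * B) + M * D) + 2 * (M * D)
      = 2 * A + (4 * M) * B + (4 * M) * D := by ring
    _ ≤ (2 + 8 * M) * A + (2 + 8 * M) * B + (2 + 8 * M) * D := by
      have h4 : (4 : ℝ≥0∞) * M ≤ 2 + 8 * M :=
        (mul_le_mul_left (by norm_num : (4 : ℝ≥0∞) ≤ 8) _).trans le_add_self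
      exact add_le_add (add_le_add (mul_le_mul_left le_self_add _) (mul_le_mul_left h4 _))
        (mul_le_mul_left h4 _)
    _ = _ := by ring

theorem pd_one_eq_zero_of_even {φ : Euc 2 → ℝ} (h : Differentiable ℝ φ)
    (hs : ∀ x, φ (reflect x) = φ x) (t : ℝ) : pd 1 φ !₂[t, 0] = 0 := by
  have := pd_comp_reflect h 1 !₂[t, 0]
  simp only [hs, reflect_mk, reflSign] at this
  norm_num at this
  linarith

theorem conv_add {k f g : Euc 2 → ℝ} (hk : Continuous k) (hkc : HasCompactSupport k)
    (hf : LocallyIntegrable f) (hg : LocallyIntegrable g) :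
    conv k (fun x => f x + g x) = fun x => conv k f x + conv k g x := by
  ext x
  simp only [conv, mul_add]
  exact integral_add (integrable_conv_integrand hk hkc hf x) (integrable_conv_integrand hk hkc hg x)

/-- The Hessian estimate on a half disk for the sum of a function `f` with a homogeneous Neumann
condition and a function `g` with a homogeneous Dirichlet condition. -/
theorem exists_halfDisk_estimate {p : ℝ} (hp1 : 1 < p) (hp2 : p ≤ 2) {χ : Euc 2 → ℝ}
    (hχ : IsTest χ) (hs : tsupport χ ⊆ Metric.ball 0 1) (hsym : ∀ x, χ (reflect x) = χ x) :
    ∃ C : ℝ≥0, ∀ (f g w : Euc 2 → ℝ) (f₁ f₂ g₁ g₂ w₁ : Fin 2 → Euc 2 → ℝ)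
      (w₂ : Fin 2 → Fin 2 → Euc 2 → ℝ),
      Integrable f (volume.restrict (openHalfDisk 2)) →
      (∀ i, Integrable (f₁ i) (volume.restrict (openHalfDisk 2))) →
      (∀ i, Integrable (f₂ i) (volume.restrict (openHalfDisk 2))) →
      Integrable g (volume.restrict (openHalfDisk 2)) →
      (∀ i, Integrable (g₁ i) (volume.restrict (openHalfDisk 2))) →
      (∀ i, Integrable (g₂ i) (volume.restrict (openHalfDisk 2))) →
      Integrable w (volume.restrict (openHalfDisk 2)) →
      (∀ i, Integrable (w₁ i) (volume.restrict (openHalfDisk 2))) →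
      (∀ i j, Integrable (w₂ i j) (volume.restrict (openHalfDisk 2))) →
      (∀ i, WeakDeriv (openHalfDisk 2) i f (f₁ i)) →
      (∀ i ψ, IsTest ψ → Green i (f₁ i) (f₂ i) ψ) →
      (∀ i ψ, IsTest ψ → Green i g (g₁ i) ψ) →
      (∀ i, WeakDeriv (openHalfDisk 2) i (g₁ i) (g₂ i)) →
      (∀ x, w x = f x + g x) →
      (∀ j, WeakDeriv (openHalfDisk 2) j w (w₁ j)) →
      (∀ i j, WeakDeriv (openHalfDisk 2) i (w₁ j) (w₂ i j)) →
      ∀ i j, eLpNorm (fun x => χ x * w₂ i j x) (ENNReal.ofReal p) (volume.restrict (openHalfDisk 2)) ≤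
        C * (eLpNorm (fun x => χ x * ∑ i, f₂ i x) (ENNReal.ofReal p)
            (volume.restrict (openHalfDisk 2)) +
          eLpNorm (fun x => χ x * ∑ i, g₂ i x) (ENNReal.ofReal p)
            (volume.restrict (openHalfDisk 2)) +
          (∑ i, eLpNorm (f₁ i) (ENNReal.ofReal p) (volume.restrict (openHalfDisk 1)) +
            ∑ i, eLpNorm (g₁ i) (ENNReal.ofReal p) (volume.restrict (openHalfDisk 1)) +
            ∑ i, eLpNorm (w₁ i) (ENNReal.ofReal p) (volume.restrict (openHalfDisk 1))) +
          (eLpNorm f (ENNReal.ofReal p) (volume.restrict (openHalfDisk 1)) +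
            eLpNorm g (ENNReal.ofReal p) (volume.restrict (openHalfDisk 1)) +
            eLpNorm w (ENNReal.ofReal p) (volume.restrict (openHalfDisk 1)))) := by
  obtain ⟨C, hC⟩ := exists_eLpNorm_pd_pd_moll_conv_refl_le hp1 hp2 hχ hs
  set r := ENNReal.ofReal p with hr
  have hr1 : 1 ≤ r := by
    rw [← ENNReal.ofReal_one]; exact ENNReal.ofReal_le_ofReal hp1.le
  obtain ⟨M, hM⟩ := exists_multiplier_bound hχ hs r
  set μ := (volume : Measure (Euc 2)).restrict (openHalfDisk 2) with hμ
  have hd : ∀ {f : Euc 2 → ℝ}, ContDiff ℝ ∞ f → Differentiable ℝ f :=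
    fun h => h.differentiable (by simp)
  have hU := isOpen_openHalfDisk 2
  refine ⟨C + 2 * M, fun f g w f₁ f₂ g₁ g₂ w₁ w₂ If If₁ If₂ Ig Ig₁ Ig₂ Iw Iw₁ Iw₂ hf hf₁ hg hg₁ hw
    hw₁ hw₂ i j => ?_⟩
  have hΘ : ∀ {φ : Euc 2 → ℝ} (s : ℝ), ContDiff ℝ ∞ φ →
      ContDiff ℝ ∞ fun x => φ x + s * φ (reflect x) := fun s h1 =>
    h1.add (contDiff_const.mul (contDiff_comp_reflect h1))
  have hz1 := pd_one_eq_zero_of_even (hd hχ.1) hsym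
  have zero_or : ∀ i : Fin 2, i = 0 ∨ i = 1 := fun i => by fin_cases i <;> simp
  -- Even extension. In the first two formulas the normal test functions vanish on the flat
  -- boundary: the normal derivative of an even function is zero there, in the second case that of
  -- `χ`. The third formula is the Neumann condition.
  have hCf := hC 1 f f₁ f₂ (by simp) If If₁ If₂ (fun φ hφ i => by
    refine ⟨?_, ?_, hf₁ i _ (hχ.mul (hΘ 1 hφ))⟩
    · refine (hf i).green If (If₁ i) (hχ.mul ((hΘ 1 hφ).pd i)) ((zero_or i).imp id ?_)
      rintro rfl t
      rw [pd_add_reflect (hd hφ), reflect_mk]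
      simp [reflSign]
    · refine (hf i).green If (If₁ i) ((hχ.pd i).mul (hΘ 1 hφ)) ((zero_or i).imp id ?_)
      rintro rfl t
      rw [hz1, zero_mul])
  -- Odd extension. The first two formulas are the Dirichlet condition. In the third the symmetrized
  -- test function vanishes on the flat boundary, so the interior weak derivative suffices.
  have hCg := hC (-1) g g₁ g₂ (by simp) Ig Ig₁ Ig₂ (fun φ hφ i => by
    refine ⟨hg i _ (hχ.mul ((hΘ (-1) hφ).pd i)), hg i _ ((hχ.pd i).mul (hΘ (-1) hφ)), ?_⟩
    refine (hg₁ i).green (Ig₁ i) (Ig₂ i) (hχ.mul (hΘ (-1) hφ)) (Or.inr fun t => ?_)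
    rw [reflect_mk]
    simp)
  set A := refl 1 (fun x => χ x * f x) with hA
  set B := refl (-1) (fun x => χ x * g x) with hB
  have li : ∀ (s : ℝ) {h : Euc 2 → ℝ}, Integrable h μ → LocallyIntegrable (refl s h) := fun s h hh =>
    (memLp_one_iff_integrable.1 (memLp_refl (memLp_one_iff_integrable.2 hh))).locallyIntegrable
  have lA : LocallyIntegrable A := li 1 (hχ.integrable_mul If)
  have lB : LocallyIntegrable B := li (-1) (hχ.integrable_mul Ig)
  have lind : ∀ {h : Euc 2 → ℝ}, Integrable h μ → LocallyIntegrable ((openHalfDisk 2).indicator h) :=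
    fun hh => ((integrable_indicator_iff hU.measurableSet).2 hh).locallyIntegrable
  have e : ∀ m, pd i (pd j (conv (moll m) fun x => A x + B x)) =
      pd i (pd j (conv (moll m) A)) + pd i (pd j (conv (moll m) B)) := by
    intro m
    have sA := contDiff_moll_conv m lA
    have sB := contDiff_moll_conv m lB
    have e1 : pd j (conv (moll m) fun x => A x + B x) =
        fun x => pd j (conv (moll m) A) x + pd j (conv (moll m) B) x := by
      rw [conv_add (contDiff_moll m).continuous (hasCompactSupport_moll m) lA lB]
      exact funext fun x => pd_add (hd sA) (hd sB) j x
    rw [e1]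
    exact funext fun x => pd_add (hd (sA.pd j)) (hd (sB.pd j)) i x
  -- the second derivatives of the cut off function
  set z₁ : Euc 2 → ℝ := fun x => pd j χ x * w x + χ x * w₁ j x with hz₁
  set z₂ : Euc 2 → ℝ := fun x => (pd i (pd j χ) x * w x + pd j χ x * w₁ i x) +
    (pd i χ x * w₁ j x + χ x * w₂ i j x) with hz₂
  have I1 := (hχ.pd j).integrable_mul Iw
  have I2 := hχ.integrable_mul (Iw₁ j)
  have I3 := ((hχ.pd j).pd i).integrable_mul Iw
  have I4 := (hχ.pd j).integrable_mul (Iw₁ i)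
  have I5 := (hχ.pd i).integrable_mul (Iw₁ j)
  have I6 := hχ.integrable_mul (Iw₂ i j)
  have d1 : WeakDeriv (openHalfDisk 2) j (fun x => A x + B x) ((openHalfDisk 2).indicator z₁) := by
    refine ((hw₁ j).cutoff_mul hχ Iw (Iw₁ j)).congr ?_ ?_ <;>
    filter_upwards [ae_restrict_mem hU.measurableSet] with x hx
    · rw [hA, hB, refl_eq_of_mem hx, refl_eq_of_mem hx, hw]
      ring
    · rw [indicator_of_mem hx]
  have d2 : WeakDeriv (openHalfDisk 2) i ((openHalfDisk 2).indicator z₁)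
      ((openHalfDisk 2).indicator z₂) := by
    have a1 := (hw₁ i).cutoff_mul (hχ.pd j) Iw (Iw₁ i)
    have a2 := (hw₂ i j).cutoff_mul hχ (Iw₁ j) (Iw₂ i j)
    rw [weakDeriv_iff_green] at a1 a2
    have a3 : WeakDeriv (openHalfDisk 2) i z₁ z₂ := by
      rw [weakDeriv_iff_green]
      intro φ h1 h2 h3
      have ht := IsTest.of_tsupport_subset h1 h3
      have b1 := a1 φ h1 h2 h3
      have b2 := a2 φ h1 h2 h3
      rw [Green] at b1 b2 ⊢
      simp only [hz₁, hz₂, mul_add (pd i φ _)]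
      rw [integral_add ((ht.pd i).integrable_mul I1) ((ht.pd i).integrable_mul I2), b1, b2, ← neg_add]
      have b3 := integral_add (ht.integrable_mul (I3.add I4)) (ht.integrable_mul (I5.add I6))
      simp only [Pi.add_apply] at b3
      rw [← b3]
      refine congrArg _ (integral_congr_ae (Eventually.of_forall fun x => ?_))
      simp only
      ring
    refine a3.congr ?_ ?_ <;>
    filter_upwards [ae_restrict_mem hU.measurableSet] with x hx <;> rw [indicator_of_mem hx]
  -- The sum of the two extensions equals `χ w` on the half disk. For `f` and `g` only the pure
  -- second derivatives that form the Laplacian are given; the full Hessian is available for `w`, so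
  -- the limit of the mollified Hessians is identified for the sum.
  have main := eLpNorm_restrict_le_of_moll_conv hU (p := r) (lA.add lB) (lind (I1.add I2))
    (lind ((I3.add I4).add (I5.add I6))) d1 d2 fun m => by
      rw [show A + B = fun x => A x + B x from rfl, e m]
      exact (eLpNorm_add_le ((contDiff_moll_conv m lA).pd j |>.pd i).continuous.aestronglyMeasurable
        ((contDiff_moll_conv m lB).pd j |>.pd i).continuous.aestronglyMeasurable hr1).trans
        (add_le_add (hCf m i j) (hCg m i j))
  have e4 : eLpNorm ((openHalfDisk 2).indicator z₂) r μ = eLpNorm z₂ r μ := by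
    refine eLpNorm_congr_ae ?_
    filter_upwards [ae_restrict_mem hU.measurableSet] with x hx
    rw [indicator_of_mem hx]
  replace main := e4.symm.trans_le main
  have e5 : (fun x => χ x * w₂ i j x) = z₂ - ((fun x => pd i (pd j χ) x * w x) +
      (fun x => pd j χ x * w₁ i x) + fun x => pd i χ x * w₁ j x) := by
    ext x
    simp only [hz₂, Pi.sub_apply, Pi.add_apply]
    ring
  have hsum : ∀ l, eLpNorm (w₁ l) r (volume.restrict (openHalfDisk 1)) ≤
      ∑ l, eLpNorm (w₁ l) r (volume.restrict (openHalfDisk 1)) := fun l =>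
    Finset.single_le_sum (f := fun l => eLpNorm (w₁ l) r (volume.restrict (openHalfDisk 1)))
      (fun _ _ => zero_le) (Finset.mem_univ l)
  rw [e5]
  refine (eLpNorm_sub_le ((I3.add I4).add (I5.add I6)).1 ((I3.add I4).add I5).1 hr1).trans ?_
  refine (add_le_add main (((eLpNorm_add_le (I3.add I4).1 I5.1 hr1).trans
    (add_le_add (eLpNorm_add_le I3.1 I4.1 hr1) le_rfl)))).trans ?_
  refine (add_le_add le_rfl (add_le_add (add_le_add (hM (pd i (pd j χ)) (Or.inr ⟨(i, j), rfl⟩) w)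
    ((hM (pd j χ) (Or.inl (Or.inr ⟨j, rfl⟩)) (w₁ i)).trans (mul_le_mul_right (hsum i) _)))
    ((hM (pd i χ) (Or.inl (Or.inr ⟨i, rfl⟩)) (w₁ j)).trans (mul_le_mul_right (hsum j) _)))).trans ?_
  push_cast
  generalize eLpNorm (fun x => χ x * ∑ i, f₂ i x) r μ = a1
  generalize eLpNorm (fun x => χ x * ∑ i, g₂ i x) r μ = a2
  generalize ∑ i, eLpNorm (f₁ i) r (volume.restrict (openHalfDisk 1)) = a3
  generalize ∑ i, eLpNorm (g₁ i) r (volume.restrict (openHalfDisk 1)) = a4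
  generalize ∑ i, eLpNorm (w₁ i) r (volume.restrict (openHalfDisk 1)) = a5
  generalize eLpNorm f r (volume.restrict (openHalfDisk 1)) = a6
  generalize eLpNorm g r (volume.restrict (openHalfDisk 1)) = a7
  generalize eLpNorm w r (volume.restrict (openHalfDisk 1)) = a8
  calc C * (a1 + a3 + a6) + C * (a2 + a4 + a7) + (M * a8 + M * a5 + M * a5)
      ≤ C * (a1 + a3 + a6) + C * (a2 + a4 + a7) + (M * a8 + M * a5 + M * a5) +
        (C * (a5 + a8) + 2 * M * (a1 + a2 + a3 + a4 + a6 + a7) + M * a8) := le_self_add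
    _ = _ := by ring

/-! ### The multiplicative Sobolev inequality under reflection. -/

theorem mul_refl_of_even {χ G : Euc 2 → ℝ} (hsym : ∀ x, χ (reflect x) = χ x) (s : ℝ) (x : Euc 2) :
    χ x * refl s G x = refl s (fun x => χ x * G x) x := by
  have h : ∀ x, χ x * (openHalfDisk 2).indicator G x =
      (openHalfDisk 2).indicator (fun x => χ x * G x) x := by
    intro x
    by_cases hx : x ∈ openHalfDisk 2
    · simp [indicator_of_mem hx]
    · simp [indicator_of_notMem hx]
  simp only [refl]
  rw [← h, ← h (reflect x), hsym]
  ring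

theorem pd_mul_refl_of_even {χ G : Euc 2 → ℝ} (hχ : Differentiable ℝ χ)
    (hsym : ∀ x, χ (reflect x) = χ x) (i : Fin 2) (x : Euc 2) :
    pd i χ x * refl 1 G x = refl (reflSign i) (fun x => pd i χ x * G x) x := by
  have h : ∀ x, pd i χ x * (openHalfDisk 2).indicator G x =
      (openHalfDisk 2).indicator (fun x => pd i χ x * G x) x := by
    intro x
    by_cases hx : x ∈ openHalfDisk 2
    · simp [indicator_of_mem hx]
    · simp [indicator_of_notMem hx]
  have h2 := pd_comp_reflect hχ i x
  simp only [hsym] at h2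
  simp only [refl]
  rw [← h, ← h (reflect x), mul_add, one_mul, ← mul_assoc, h2]

theorem abs_reflSign (i : Fin 2) : |reflSign i| = 1 := by
  fin_cases i <;> simp [reflSign]

/-- The multiplicative Sobolev inequality on a half disk. -/
theorem exists_halfDisk_mul_sq_le {p : ℝ} (hp1 : 1 < p) (hp2 : p ≤ 2) {χ : Euc 2 → ℝ}
    (hχ : IsTest χ) (hs : tsupport χ ⊆ Metric.ball 0 1) (hsym : ∀ x, χ (reflect x) = χ x) :
    ∃ C : ℝ≥0, ∀ (q : Euc 2 → ℝ) (q₁ : Fin 2 → Euc 2 → ℝ),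
      MemLp q 2 (volume.restrict (openHalfDisk 2)) →
      (∀ i, MemLp (q₁ i) (ENNReal.ofReal p) (volume.restrict (openHalfDisk 2))) →
      (∀ i, WeakDeriv (openHalfDisk 2) i q (q₁ i)) →
      eLpNorm (fun x => χ x * q x ^ 2) (ENNReal.ofReal p) (volume.restrict (openHalfDisk 2)) ≤
        C * eLpNorm q 2 (volume.restrict (openHalfDisk 2)) *
          (∑ i, eLpNorm (fun x => χ x * q₁ i x) (ENNReal.ofReal p)
            (volume.restrict (openHalfDisk 2)) +
          eLpNorm q (ENNReal.ofReal p) (volume.restrict (openHalfDisk 1))) := by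
  obtain ⟨C, hC⟩ := exists_eLpNorm_mul_sq_le hp1 hp2
  set r := ENNReal.ofReal p with hr
  have hr1 : 1 ≤ r := by
    rw [← ENNReal.ofReal_one]; exact ENNReal.ofReal_le_ofReal hp1.le
  have hr2 : r ≤ 2 := by
    rw [hr, show (2 : ℝ≥0∞) = ENNReal.ofReal 2 by simp]
    exact ENNReal.ofReal_le_ofReal hp2
  obtain ⟨M, hM⟩ := exists_multiplier_bound hχ hs r
  set μ := (volume : Measure (Euc 2)).restrict (openHalfDisk 2) with hμ
  have hd : ∀ {f : Euc 2 → ℝ}, ContDiff ℝ ∞ f → Differentiable ℝ f :=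
    fun h => h.differentiable (by simp)
  refine ⟨C * 2 * (2 * (1 + 2 * M)), fun q q₁ hq hq₁ hw => ?_⟩
  have hqr : MemLp q r μ := hq.mono_exponent hr2
  have iq : Integrable q μ := hq.integrable (by norm_num)
  have iq₁ : ∀ i, Integrable (q₁ i) μ := fun i => (hq₁ i).integrable hr1
  have zero_or : ∀ i : Fin 2, i = 0 ∨ i = 1 := fun i => by fin_cases i <;> simp
  -- First derivatives of an even extension need no boundary condition.
  have hwQ : ∀ i, WeakDeriv (Metric.ball 0 2) i (refl 1 q) (refl (1 * reflSign i) (q₁ i)) := fun i =>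
    weakDeriv_refl iq (iq₁ i) fun ψ h1 _ h3 =>
      (hw i).green iq (iq₁ i) (IsTest.add_reflect ⟨h1, h3⟩ _) ((zero_or i).imp id (by
        rintro rfl t
        rw [reflect_mk]
        simp [reflSign]))
  have main := hC χ (refl 1 q) (fun i => refl (1 * reflSign i) (q₁ i)) hχ.1 hs (memLp_refl hq)
    (memLp_refl hqr) (fun i => memLp_refl (hq₁ i)) hwQ
  have e1 : eLpNorm (fun x => χ x * q x ^ 2) r μ ≤ eLpNorm (fun x => χ x * refl 1 q x ^ 2) r volume := by
    refine le_trans (eLpNorm_congr_ae ?_).le (eLpNorm_mono_measure _ Measure.restrict_le_self)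
    filter_upwards [ae_restrict_mem (isOpen_openHalfDisk 2).measurableSet] with x hx
    rw [refl_eq_of_mem hx]
  refine (e1.trans main).trans ?_
  have e2 : eLpNorm (refl 1 q) 2 volume ≤ 2 * eLpNorm q 2 μ :=
    eLpNorm_refl_le (by simp) (by norm_num) hq.1
  have e3 : ∀ i, eLpNorm (fun x => χ x * refl (1 * reflSign i) (q₁ i) x) r volume ≤
      2 * eLpNorm (fun x => χ x * q₁ i x) r μ := by
    intro i
    simp only [mul_refl_of_even hsym]
    exact eLpNorm_refl_le (by rw [one_mul, abs_reflSign]) hr1 (hχ.integrable_mul (iq₁ i)).1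
  have e4 : ∀ i, eLpNorm (fun x => pd i χ x * refl 1 q x) r volume ≤
      2 * (M * eLpNorm q r (volume.restrict (openHalfDisk 1))) := by
    intro i
    simp only [pd_mul_refl_of_even (hd hχ.1) hsym]
    exact (eLpNorm_refl_le (abs_reflSign i) hr1 ((hχ.pd i).integrable_mul iq).1).trans
      (mul_le_mul_right (hM (pd i χ) (Or.inl (Or.inr ⟨i, rfl⟩)) q) _)
  refine (mul_le_mul' (mul_le_mul_right e2 _)
    (Finset.sum_le_sum fun i _ => add_le_add (e3 i) (e4 i))).trans ?_
  rw [Finset.sum_add_distrib, ← Finset.mul_sum]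
  simp only [Finset.sum_const, Finset.card_univ, Fintype.card_fin, nsmul_eq_mul]
  push_cast
  generalize eLpNorm q 2 μ = a
  generalize ∑ i, eLpNorm (fun x => χ x * q₁ i x) r μ = b
  generalize eLpNorm q r (volume.restrict (openHalfDisk 1)) = c
  calc C * (2 * a) * (2 * b + 2 * (2 * (M * c)))
      ≤ C * (2 * a) * (2 * b + 2 * (2 * (M * c)) + (4 * M * b + 2 * c)) := by
        exact mul_le_mul_right le_self_add _
    _ = _ := by ring

/-! ### Continuity -/

theorem norm_le_integral_deriv {f f' : ℝ → ℝ} (h : ∀ x, HasDerivAt f (f' x) x) (hc : Continuous f')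
    (hs : HasCompactSupport f) (a : ℝ) : ‖f a‖ ≤ ∫ x, ‖f' x‖ := by
  have hf' : f' = deriv f := funext fun x => (h x).deriv.symm
  have hi : Integrable f' := hc.integrable_of_hasCompactSupport (hf' ▸ hs.deriv)
  have hlim : Tendsto f atBot (𝓝 0) := by
    refine tendsto_const_nhds.congr' ?_
    obtain ⟨R, hR⟩ := hs.isBounded.subset_closedBall (0 : ℝ)
    filter_upwards [eventually_lt_atBot (-R)] with x hx
    by_contra h0
    have := mem_closedBall_zero_iff.1 (hR (subset_tsupport f (Ne.symm h0)))
    rw [Real.norm_eq_abs] at this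
    linarith [neg_abs_le x]
  have e := integral_Iic_of_hasDerivAt_of_tendsto' (a := a) (fun x _ => h x) hi.integrableOn hlim
  rw [sub_zero] at e
  rw [← e]
  exact (norm_integral_le_integral_norm _).trans
    (setIntegral_le_integral hi.norm (Eventually.of_forall fun x => norm_nonneg _))

/-- The normal derivative is integrated along a vertical line, and each of its values is bounded by
the integral of the mixed derivative along a horizontal line. Integrability of one second derivative
thus suffices, which covers every `p ≥ 1`. -/
theorem norm_le_integral_pd_pd {φ : Euc 2 → ℝ} (h : ContDiff ℝ ∞ φ) (hc : HasCompactSupport φ)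
    (x : Euc 2) : ‖φ x‖ ≤ ∫ y, ‖pd 0 (pd 1 φ) y‖ := by
  have hd : ∀ {f : Euc 2 → ℝ}, ContDiff ℝ ∞ f → Differentiable ℝ f :=
    fun h => h.differentiable (by simp)
  have cs : ∀ {f : Euc 2 → ℝ} {γ : ℝ → Euc 2}, HasCompactSupport f → (∀ t, |t| ≤ ‖γ t‖) →
      HasCompactSupport fun t => f (γ t) := by
    intro f γ hf hγ
    obtain ⟨R, hR⟩ := hf.isBounded.subset_closedBall (0 : Euc 2)
    refine HasCompactSupport.of_support_subset_isCompact (isCompact_closedBall (0 : ℝ) R) fun t ht => ?_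
    rw [mem_closedBall_zero_iff]
    exact (hγ t).trans (mem_closedBall_zero_iff.1 (hR (subset_tsupport f ht)))
  have n0 : ∀ s t : ℝ, |s| ≤ ‖(!₂[s, t] : Euc 2)‖ ∧ |t| ≤ ‖(!₂[s, t] : Euc 2)‖ := fun s t =>
    abs_le_of_mem_ball le_rfl
  have c1 : ∀ {f : Euc 2 → ℝ}, Continuous f → ∀ s : ℝ, Continuous fun t => f !₂[s, t] := fun hf s =>
    hf.comp (continuous_mk.comp (by fun_prop : Continuous fun t : ℝ => (s, t)))
  have c2 : ∀ {f : Euc 2 → ℝ}, Continuous f → ∀ t : ℝ, Continuous fun s => f !₂[s, t] := fun hf t =>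
    hf.comp (continuous_mk.comp (by fun_prop : Continuous fun s : ℝ => (s, t)))
  have h1 := h.pd 1
  have h01 := h1.pd 0
  have hc1 := hasCompactSupport_pd hc 1
  have hc01 := hasCompactSupport_pd hc1 0
  have hint : Integrable fun z : ℝ × ℝ => ‖pd 0 (pd 1 φ) !₂[z.1, z.2]‖ :=
    ((integrable_euc_iff _).1 (h01.continuous.integrable_of_hasCompactSupport hc01)).norm
  have hx : x = !₂[x 0, x 1] := by ext i; fin_cases i <;> rfl
  have s1 : ‖φ x‖ ≤ ∫ t, ‖pd 1 φ !₂[x 0, t]‖ := by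
    rw [hx]
    exact norm_le_integral_deriv (f := fun t => φ !₂[x 0, t]) (fun t => hasDerivAt_mk_one (hd h) (x 0) t)
      (c1 h1.continuous (x 0)) (cs hc fun t => (n0 _ _).2) (x 1)
  refine s1.trans ?_
  rw [integral_euc_eq fun y => ‖pd 0 (pd 1 φ) y‖, Measure.volume_eq_prod, integral_prod_symm _ hint]
  refine integral_mono_of_nonneg (Eventually.of_forall fun t => norm_nonneg _)
    hint.integral_prod_right (Eventually.of_forall fun t => ?_)
  exact norm_le_integral_deriv (f := fun s => pd 1 φ !₂[s, t])
    (fun s => hasDerivAt_mk_zero (hd h1) s t) (c2 h01.continuous t) (cs hc1 fun s => (n0 _ _).1) (x 0)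

/-- A function with compact support whose mixed second derivative is integrable is continuous. -/
theorem exists_continuous_of_mixed {v v₁ v₂ : Euc 2 → ℝ} (hv : Integrable v) (hv₁ : Integrable v₁)
    (hv₂ : Integrable v₂) (hc : HasCompactSupport v) (h1 : WeakDeriv univ 1 v v₁)
    (h2 : WeakDeriv univ 0 v₁ v₂) :
    ∃ V : Euc 2 → ℝ, Continuous V ∧ V =ᵐ[volume] v ∧
      ∀ x, ENNReal.ofReal ‖V x‖ ≤ eLpNorm v₂ 1 volume := by
  have hd : ∀ {f : Euc 2 → ℝ}, ContDiff ℝ ∞ f → Differentiable ℝ f :=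
    fun h => h.differentiable (by simp)
  have m2 : MemLp v₂ 1 volume := memLp_one_iff_integrable.2 hv₂
  set f : ℕ → Euc 2 → ℝ := fun m => conv (moll m) v with hf
  have sm : ∀ m, ContDiff ℝ ∞ (f m) := fun m => contDiff_moll_conv m hv.locallyIntegrable
  have cm : ∀ m, HasCompactSupport (f m) := fun m => hasCompactSupport_conv (hasCompactSupport_moll m) hc
  have sm2 : ∀ m, Continuous (conv (moll m) v₂) := fun m =>
    (contDiff_moll_conv m hv₂.locallyIntegrable).continuous
  have epd : ∀ m, pd 0 (pd 1 (f m)) = conv (moll m) v₂ := by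
    intro m
    have e1 : pd 1 (f m) = conv (moll m) v₁ :=
      funext fun x => h1.pd_moll_conv hv.locallyIntegrable (subset_univ _)
    rw [e1]
    exact funext fun x => h2.pd_moll_conv hv₁.locallyIntegrable (subset_univ _)
  have bound : ∀ {φ : Euc 2 → ℝ}, ContDiff ℝ ∞ φ → HasCompactSupport φ → ∀ x,
      ENNReal.ofReal ‖φ x‖ ≤ eLpNorm (pd 0 (pd 1 φ)) 1 volume := by
    intro φ a b x
    have hi : Integrable (pd 0 (pd 1 φ)) := ((a.pd 1).pd 0).continuous.integrable_of_hasCompactSupport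
      (hasCompactSupport_pd (hasCompactSupport_pd b 1) 0)
    rw [eLpNorm_one_eq_lintegral_enorm, ← ofReal_integral_norm_eq_lintegral_enorm hi]
    exact ENNReal.ofReal_le_ofReal (norm_le_integral_pd_pd a b x)
  set e : ℕ → ℝ≥0∞ := fun m => eLpNorm (fun x => conv (moll m) v₂ x - v₂ x) 1 volume with he
  have he0 : Tendsto e atTop (𝓝 0) := tendsto_moll_conv le_rfl (by norm_num) m2
  -- The supremum bound for differences of mollifications makes the sequence uniformly Cauchy.
  have diff : ∀ m l x, edist (f m x) (f l x) ≤ e m + e l := by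
    intro m l x
    have b := bound ((sm m).sub (sm l)) ((cm m).sub (cm l)) x
    have e2 : pd 0 (pd 1 fun x => f m x - f l x) = (fun x => conv (moll m) v₂ x - v₂ x) -
        fun x => conv (moll l) v₂ x - v₂ x := by
      have e3 : pd 1 (fun x => f m x - f l x) = fun x => pd 1 (f m) x - pd 1 (f l) x :=
        funext fun x => pd_sub (hd (sm m)) (hd (sm l)) 1 x
      rw [e3]
      ext x
      rw [pd_sub (hd ((sm m).pd 1)) (hd ((sm l).pd 1)), epd, epd]
      simp
    rw [edist_eq_enorm_sub, ← ofReal_norm]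
    refine b.trans ?_
    rw [e2]
    exact eLpNorm_sub_le ((sm2 m).aestronglyMeasurable.sub hv₂.1)
      ((sm2 l).aestronglyMeasurable.sub hv₂.1) le_rfl
  have hcau : ∀ x, CauchySeq fun m => f m x := by
    intro x
    rw [EMetric.cauchySeq_iff]
    intro ε hε
    obtain ⟨N, hN⟩ := eventually_atTop.1 (he0.eventually_lt_const (ENNReal.half_pos hε.ne'))
    refine ⟨N, fun m hm l hl => (diff m l x).trans_lt ?_⟩
    rw [← ENNReal.add_halves ε]
    exact ENNReal.add_lt_add (hN m hm) (hN l hl)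
  choose V hV using fun x => cauchySeq_tendsto_of_complete (hcau x)
  have hunif : ∀ m x, edist (f m x) (V x) ≤ e m := by
    intro m x
    have l1 : Tendsto (fun l => edist (f m x) (f l x)) atTop (𝓝 (edist (f m x) (V x))) :=
      tendsto_const_nhds.edist (hV x)
    have l2 : Tendsto (fun l => e m + e l) atTop (𝓝 (e m + 0)) := tendsto_const_nhds.add he0
    rw [add_zero] at l2
    exact le_of_tendsto_of_tendsto' l1 l2 fun l => diff m l x
  have hu : TendstoUniformly f V atTop := by
    rw [EMetric.tendstoUniformly_iff]
    intro ε hε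
    filter_upwards [he0.eventually_lt_const hε] with m hm x
    rw [edist_comm]
    exact (hunif m x).trans_lt hm
  refine ⟨V, hu.continuous (Frequently.of_forall fun m => (sm m).continuous), ?_, fun x => ?_⟩
  · filter_upwards [ae_tendsto_moll_conv hv.locallyIntegrable] with x hx
    exact tendsto_nhds_unique (hV x) hx
  · have l1 : Tendsto (fun m => ENNReal.ofReal ‖f m x‖) atTop (𝓝 (ENNReal.ofReal ‖V x‖)) :=
      (ENNReal.continuous_ofReal.tendsto _).comp (hV x).norm
    refine le_of_tendsto' l1 fun m => (bound (sm m) (cm m) x).trans ?_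
    rw [epd]
    exact eLpNorm_moll_conv_le m hv₂.1 le_rfl (by norm_num)

/-- The supremum estimate on a half disk by the mixed second derivative. -/
theorem exists_halfDisk_sup_le {χ : Euc 2 → ℝ}
    (hχ : IsTest χ) (hs : tsupport χ ⊆ Metric.ball 0 1) :
    ∃ C : ℝ≥0, ∀ h h₀ h₁ h₂ : Euc 2 → ℝ, Integrable h (volume.restrict (openHalfDisk 2)) →
      Integrable h₀ (volume.restrict (openHalfDisk 2)) →
      Integrable h₁ (volume.restrict (openHalfDisk 2)) →
      Integrable h₂ (volume.restrict (openHalfDisk 2)) →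
      WeakDeriv (openHalfDisk 2) 0 h h₀ → WeakDeriv (openHalfDisk 2) 1 h h₁ →
      WeakDeriv (openHalfDisk 2) 0 h₁ h₂ →
      ∃ V : Euc 2 → ℝ, Continuous V ∧
        (∀ᵐ x ∂(volume.restrict (openHalfDisk 2)), V x = χ x * h x) ∧
        ∀ x, ENNReal.ofReal ‖V x‖ ≤
          C * (eLpNorm (fun x => χ x * h₂ x) 1 (volume.restrict (openHalfDisk 2)) +
            (eLpNorm h₀ 1 (volume.restrict (openHalfDisk 1)) +
              eLpNorm h₁ 1 (volume.restrict (openHalfDisk 1)) +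
              eLpNorm h 1 (volume.restrict (openHalfDisk 1)))) := by
  obtain ⟨M, hM⟩ := exists_multiplier_bound hχ hs 1
  set μ := (volume : Measure (Euc 2)).restrict (openHalfDisk 2) with hμ
  refine ⟨2 * (1 + M), fun h h₀ h₁ h₂ Ih Ih₀ Ih₁ Ih₂ w0 w1 w2 => ?_⟩
  set z₁ : Euc 2 → ℝ := fun x => pd 1 χ x * h x + χ x * h₁ x with hz₁
  set z₂ : Euc 2 → ℝ := fun x => (pd 0 (pd 1 χ) x * h x + pd 1 χ x * h₀ x) +
    (pd 0 χ x * h₁ x + χ x * h₂ x) with hz₂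
  have I0 := hχ.integrable_mul Ih
  have I1 := (hχ.pd 1).integrable_mul Ih
  have I2 := hχ.integrable_mul Ih₁
  have I3 := ((hχ.pd 1).pd 0).integrable_mul Ih
  have I4 := (hχ.pd 1).integrable_mul Ih₀
  have I5 := (hχ.pd 0).integrable_mul Ih₁
  have I6 := hχ.integrable_mul Ih₂
  have hΘ : ∀ {φ : Euc 2 → ℝ} (s : ℝ), ContDiff ℝ ∞ φ →
      ContDiff ℝ ∞ fun x => φ x + s * φ (reflect x) := fun s h1 =>
    h1.add (contDiff_const.mul (contDiff_comp_reflect h1))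
  -- The even extension is differentiated first in the normal direction, against test functions
  -- vanishing on the flat boundary, and then tangentially. Hence the mixed derivative requires no
  -- boundary condition.
  have d1 : WeakDeriv univ 1 (refl 1 fun x => χ x * h x) (refl (1 * reflSign 1) z₁) := by
    refine weakDeriv_refl I0 (I1.add I2) fun ψ h1 _ _ => ?_
    refine green_cutoff_mul hχ (hΘ _ h1) Ih Ih₁ (w1.green Ih Ih₁ (hχ.mul (hΘ _ h1)) (Or.inr fun t => ?_))
    rw [reflect_mk]
    simp [reflSign]
  have d2 : WeakDeriv univ 0 (refl (1 * reflSign 1) z₁) (refl (1 * reflSign 1 * reflSign 0) z₂) := by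
    refine weakDeriv_refl (I1.add I2) ((I3.add I4).add (I5.add I6)) fun ψ h1 _ _ => ?_
    have hθ := hΘ (φ := ψ) (1 * reflSign 1 * reflSign 0) h1
    have b1 := green_cutoff_mul (hχ.pd 1) hθ Ih Ih₀ (w0.green Ih Ih₀ ((hχ.pd 1).mul hθ) (Or.inl rfl))
    have b2 := green_cutoff_mul hχ hθ Ih₁ Ih₂ (w2.green Ih₁ Ih₂ (hχ.mul hθ) (Or.inl rfl))
    set Θ : Euc 2 → ℝ := fun x => ψ x + 1 * reflSign 1 * reflSign 0 * ψ (reflect x)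
    rw [Green] at b1 b2 ⊢
    have j1 : Integrable (fun x => pd 0 Θ x * (pd 1 χ x * h x)) μ :=
      (((hχ.pd 1).mul (hθ.pd 0)).integrable_mul Ih).congr
        (Eventually.of_forall fun x => by simp only; ring)
    have j2 : Integrable (fun x => pd 0 Θ x * (χ x * h₁ x)) μ :=
      ((hχ.mul (hθ.pd 0)).integrable_mul Ih₁).congr
        (Eventually.of_forall fun x => by simp only; ring)
    have j3 : Integrable (fun x => Θ x * (pd 0 (pd 1 χ) x * h x + pd 1 χ x * h₀ x)) μ :=
      ((((hχ.pd 1).pd 0).mul hθ).integrable_mul Ih |>.add (((hχ.pd 1).mul hθ).integrable_mul Ih₀)).congr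
        (Eventually.of_forall fun x => by simp only [Pi.add_apply]; ring)
    have j4 : Integrable (fun x => Θ x * (pd 0 χ x * h₁ x + χ x * h₂ x)) μ :=
      (((hχ.pd 0).mul hθ).integrable_mul Ih₁ |>.add ((hχ.mul hθ).integrable_mul Ih₂)).congr
        (Eventually.of_forall fun x => by simp only [Pi.add_apply]; ring)
    change (∫ x in openHalfDisk 2, pd 0 Θ x * (pd 1 χ x * h x + χ x * h₁ x)) = -∫ x in openHalfDisk 2,
      Θ x * ((pd 0 (pd 1 χ) x * h x + pd 1 χ x * h₀ x) + (pd 0 χ x * h₁ x + χ x * h₂ x))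
    simp only [mul_add (pd 0 Θ _)]
    rw [integral_add j1 j2, b1, b2, ← neg_add, ← integral_add j3 j4]
    refine congrArg _ (integral_congr_ae (Eventually.of_forall fun x => ?_))
    ring
  have mi : ∀ {s : ℝ} {k : Euc 2 → ℝ}, Integrable k μ → Integrable (refl s k) := fun hk =>
    memLp_one_iff_integrable.1 (memLp_refl (memLp_one_iff_integrable.2 hk))
  obtain ⟨V, hVc, hVe, hVb⟩ := exists_continuous_of_mixed (mi I0) (mi (I1.add I2))
    (mi ((I3.add I4).add (I5.add I6))) (hasCompactSupport_refl _ _) d1 d2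
  refine ⟨V, hVc, ?_, fun x => (hVb x).trans ?_⟩
  · filter_upwards [ae_restrict_of_ae hVe, ae_restrict_mem (isOpen_openHalfDisk 2).measurableSet]
      with x hx hxU
    rw [hx, refl_eq_of_mem hxU]
  · refine (eLpNorm_refl_le (by simp [reflSign]) le_rfl ((I3.add I4).add (I5.add I6)).1).trans ?_
    refine (mul_le_mul_right ((eLpNorm_add_le (I3.add I4).1 (I5.add I6).1 le_rfl).trans
      (add_le_add (eLpNorm_add_le I3.1 I4.1 le_rfl) (eLpNorm_add_le I5.1 I6.1 le_rfl))) 2).trans ?_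
    refine (mul_le_mul_right (add_le_add (add_le_add (hM (pd 0 (pd 1 χ)) (Or.inr ⟨(0, 1), rfl⟩) h)
      (hM (pd 1 χ) (Or.inl (Or.inr ⟨1, rfl⟩)) h₀)) (add_le_add (hM (pd 0 χ)
      (Or.inl (Or.inr ⟨0, rfl⟩)) h₁) le_rfl)) 2).trans ?_
    push_cast
    generalize eLpNorm (fun x => χ x * h₂ x) 1 μ = a
    generalize eLpNorm h₀ 1 (volume.restrict (openHalfDisk 1)) = b
    generalize eLpNorm h₁ 1 (volume.restrict (openHalfDisk 1)) = c
    generalize eLpNorm h 1 (volume.restrict (openHalfDisk 1)) = d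
    calc 2 * (M * d + M * b + (M * c + a)) ≤ 2 * (M * d + M * b + (M * c + a)) +
          2 * (M * a + b + c + d) := le_self_add
      _ = _ := by ring

/-! ### The Poincaré inequality -/

theorem lintegral_rpow_le_of_isProbabilityMeasure {X : Type*} [MeasurableSpace X] {μ : Measure X}
    [IsProbabilityMeasure μ] {g : X → ℝ≥0∞} (hg : AEMeasurable g μ) {p : ℝ} (hp : 1 < p) :
    (∫⁻ x, g x ∂μ) ^ p ≤ ∫⁻ x, g x ^ p ∂μ := by
  have h := ENNReal.lintegral_mul_le_Lp_mul_Lq μ (Real.HolderConjugate.conjExponent hp) hg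
    (aemeasurable_const (b := (1 : ℝ≥0∞)))
  have h0 : 0 < p := by linarith
  simp only [Pi.mul_apply, mul_one, ENNReal.one_rpow, lintegral_const, measure_univ] at h
  calc (∫⁻ x, g x ∂μ) ^ p ≤ ((∫⁻ x, g x ^ p ∂μ) ^ (1 / p)) ^ p := ENNReal.rpow_le_rpow h h0.le
    _ = _ := by rw [← ENNReal.rpow_mul, one_div, inv_mul_cancel₀ h0.ne', ENNReal.rpow_one]

/-- Contraction towards a point of a convex set maps the set into itself, and its Jacobian `s²` is
at least `1 / 4`. -/
theorem setLIntegral_comp_convex_le {D : Set (Euc 2)} (hD : MeasurableSet D) (hc : Convex ℝ D)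
    {G : Euc 2 → ℝ≥0∞} (hG : Measurable G) {s : ℝ} (hs : 1 / 2 ≤ s) (hs1 : s ≤ 1) {c : Euc 2}
    (hcD : c ∈ D) : ∫⁻ x in D, G (s • x + (1 - s) • c) ≤ 4 * ∫⁻ x in D, G x := by
  have hs0 : s ≠ 0 := by linarith
  have hF : Measurable (D.indicator G) := hG.indicator hD
  have h1 : ∫⁻ x in D, G (s • x + (1 - s) • c) ≤ ∫⁻ x, D.indicator G (s • x + (1 - s) • c) := by
    rw [← lintegral_indicator hD]
    refine lintegral_mono fun x => ?_
    by_cases hx : x ∈ D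
    · have : s • x + (1 - s) • c ∈ D := hc hx hcD (by linarith) (by linarith) (by ring)
      rw [indicator_of_mem hx, indicator_of_mem this]
    · rw [indicator_of_notMem hx]
      exact zero_le
  have h2 : ∫⁻ x, D.indicator G (s • x + (1 - s) • c) = ∫⁻ x, D.indicator G (s • x) := by
    rw [← lintegral_add_right_eq_self (fun x => D.indicator G (s • x)) (s⁻¹ • (1 - s) • c)]
    refine lintegral_congr fun x => ?_
    rw [smul_add, smul_inv_smul₀ hs0]
  have h3 : ∫⁻ x, D.indicator G (s • x) = ENNReal.ofReal |(s ^ 2)⁻¹| * ∫⁻ x in D, G x := by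
    have := Measure.map_addHaar_smul (volume : Measure (Euc 2)) hs0
    rw [← lintegral_map hF (measurable_const_smul s), this, lintegral_smul_measure,
      lintegral_indicator hD]
    simp
  rw [h2, h3] at h1
  refine h1.trans (mul_le_mul_left ?_ _)
  rw [show (4 : ℝ≥0∞) = ENNReal.ofReal 4 by simp]
  refine ENNReal.ofReal_le_ofReal ?_
  rw [abs_of_pos (by positivity), inv_le_comm₀ (by positivity) (by norm_num)]
  nlinarith

theorem enorm_sub_le_lintegral_fderiv {f : Euc 2 → ℝ} (hf : ContDiff ℝ 1 f) {x y : Euc 2}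
    (hxy : ‖y - x‖ ≤ 2) :
    ‖f x - f y‖ₑ ≤ ∫⁻ t in Ioc (0 : ℝ) 1, 2 * ‖fderiv ℝ f (x + t • (y - x))‖ₑ := by
  have hd : ∀ t : ℝ, HasDerivAt (fun t : ℝ => f (x + t • (y - x)))
      (fderiv ℝ f (x + t • (y - x)) (y - x)) t := by
    intro t
    have h1 : HasDerivAt (fun t : ℝ => x + t • (y - x)) (y - x) t := by
      simpa using ((hasDerivAt_id t).smul_const (y - x)).const_add x
    exact (hf.differentiable (by simp) _).hasFDerivAt.comp_hasDerivAt t h1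
  have hcont : Continuous fun t : ℝ => fderiv ℝ f (x + t • (y - x)) (y - x) :=
    ((hf.continuous_fderiv (by simp)).comp (by fun_prop)).clm_apply continuous_const
  have e := intervalIntegral.integral_eq_sub_of_hasDerivAt (a := 0) (b := 1) (fun t _ => hd t)
    (hcont.intervalIntegrable 0 1)
  simp only [one_smul, zero_smul, add_zero, add_sub_cancel] at e
  rw [← enorm_neg, neg_sub, ← e, intervalIntegral.integral_of_le zero_le_one]
  refine (enorm_integral_le_lintegral_enorm _).trans (lintegral_mono fun t => ?_)
  rw [← ofReal_norm, ← ofReal_norm]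
  refine le_trans ?_ (le_of_eq (by
    rw [ENNReal.ofReal_mul (by norm_num), ENNReal.ofReal_ofNat] :
      ENNReal.ofReal (2 * ‖fderiv ℝ f (x + t • (y - x))‖) = _))
  refine ENNReal.ofReal_le_ofReal ((ContinuousLinearMap.le_opNorm _ _).trans ?_)
  rw [mul_comm]
  gcongr

/-- The difference `f x - f y`, averaged over `y`, is bounded by the integral of the gradient along
the segment, and Jensen's inequality moves the power inside. For `t ≥ 1 / 2` the point of the
segment is a contraction of `y` towards `x` with ratio `t`, and the integral in `y` is taken first.
For `t ≤ 1 / 2` the roles of `x` and `y` are exchanged. So the Jacobian never degenerates. -/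
theorem lintegral_sub_average_rpow_le {D : Set (Euc 2)} (hD : MeasurableSet D) (hc : Convex ℝ D)
    (hdiam : ∀ x ∈ D, ∀ y ∈ D, ‖y - x‖ ≤ 2) (h0 : volume D ≠ 0) (ht : volume D ≠ ⊤)
    {f : Euc 2 → ℝ} (hf : ContDiff ℝ 1 f) (hfi : IntegrableOn f D) {p : ℝ} (hp : 1 < p) :
    ∫⁻ x in D, ‖f x - ⨍ y in D, f y‖ₑ ^ p ≤ 4 * ∫⁻ x in D, (2 * ‖fderiv ℝ f x‖ₑ) ^ p := by
  have hcD : (volume D)⁻¹ ≠ ⊤ := ENNReal.inv_ne_top.2 h0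
  set ν := (volume D)⁻¹ • (volume : Measure (Euc 2)).restrict D with hν
  set τ := (volume : Measure ℝ).restrict (Ioc 0 1) with hτ
  have : IsProbabilityMeasure ν := ⟨by
    rw [hν, Measure.smul_apply, Measure.restrict_apply_univ, smul_eq_mul, ENNReal.inv_mul_cancel h0 ht]⟩
  have : IsProbabilityMeasure τ := ⟨by simp [hτ]⟩
  have lν : ∀ F : Euc 2 → ℝ≥0∞, ∫⁻ x, F x ∂ν = (volume D)⁻¹ * ∫⁻ x in D, F x := fun F => by
    rw [hν, lintegral_smul_measure, smul_eq_mul]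
  have aeD : ∀ᵐ x ∂ν, x ∈ D := by
    rw [hν]
    exact Measure.ae_smul_measure (ae_restrict_mem hD) _
  have hav : ⨍ y in D, f y = ∫ y, f y ∂ν := by
    rw [average_eq', hν, Measure.restrict_apply_univ]
  have hfν : Integrable f ν := hfi.smul_measure hcD
  set g : Euc 2 → ℝ≥0∞ := fun z => 2 * ‖fderiv ℝ f z‖ₑ with hg
  have hgc : Measurable g := ((hf.continuous_fderiv (by simp)).enorm.measurable).const_mul 2
  have hgp : Measurable fun z => g z ^ p := hgc.pow_const p
  have mline : Measurable fun z : Euc 2 × Euc 2 × ℝ => z.1 + z.2.2 • (z.2.1 - z.1) :=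
    (by fun_prop : Continuous fun z : Euc 2 × Euc 2 × ℝ => z.1 + z.2.2 • (z.2.1 - z.1)).measurable
  have claimA : ∀ x ∈ D, ‖f x - ⨍ y in D, f y‖ₑ ≤
      ∫⁻ z, g (x + z.2 • (z.1 - x)) ∂(ν.prod τ) := by
    intro x hx
    have e1 : f x - ⨍ y in D, f y = ∫ y, (f x - f y) ∂ν := by
      rw [integral_sub (integrable_const _) hfν, hav]
      simp
    rw [e1, lintegral_prod (fun z : Euc 2 × ℝ => g (x + z.2 • (z.1 - x))) ((hgc.comp (mline.comp measurable_prodMk_left)).aemeasurable)]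
    refine (enorm_integral_le_lintegral_enorm _).trans (lintegral_mono_ae ?_)
    filter_upwards [aeD] with y hy
    exact enorm_sub_le_lintegral_fderiv hf (hdiam x hx y hy)
  have claimB : ∫⁻ x, ‖f x - ⨍ y in D, f y‖ₑ ^ p ∂ν ≤
      ∫⁻ x, ∫⁻ z, g (x + z.2 • (z.1 - x)) ^ p ∂(ν.prod τ) ∂ν := by
    refine lintegral_mono_ae ?_
    filter_upwards [aeD] with x hx
    refine (ENNReal.rpow_le_rpow (claimA x hx) (by linarith)).trans ?_
    exact lintegral_rpow_le_of_isProbabilityMeasure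
      ((hgc.comp (mline.comp measurable_prodMk_left)).aemeasurable) hp
  have inner : ∀ {s : ℝ} {c : Euc 2}, 1 / 2 ≤ s → s ≤ 1 → c ∈ D →
      ∫⁻ x, g (s • x + (1 - s) • c) ^ p ∂ν ≤ 4 * ∫⁻ x, g x ^ p ∂ν := by
    intro s c h1 h2 hcd
    rw [lν, lν, mul_left_comm]
    exact mul_le_mul_right (setLIntegral_comp_convex_le hD hc hgp h1 h2 hcd) _
  have hJ : ∀ t ∈ Ioc (0 : ℝ) 1, ∫⁻ x, ∫⁻ y, g (x + t • (y - x)) ^ p ∂ν ∂ν ≤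
      4 * ∫⁻ x, g x ^ p ∂ν := by
    intro t ht
    rcases le_total (1 / 2) t with h | h
    · calc _ ≤ ∫⁻ x, 4 * ∫⁻ x, g x ^ p ∂ν ∂ν := by
            refine lintegral_mono_ae ?_
            filter_upwards [aeD] with x hx
            refine le_trans (le_of_eq ?_) (inner h ht.2 hx)
            refine lintegral_congr fun y => ?_
            congr 2
            module
        _ = _ := by simp
    · rw [lintegral_lintegral_swap]
      · calc _ ≤ ∫⁻ x, 4 * ∫⁻ x, g x ^ p ∂ν ∂ν := by
              refine lintegral_mono_ae ?_
              filter_upwards [aeD] with y hy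
              refine le_trans (le_of_eq ?_) (inner (s := 1 - t) (by linarith) (by linarith [ht.1]) hy)
              refine lintegral_congr fun x => ?_
              congr 2
              module
          _ = _ := by simp
      · exact (hgp.comp (by fun_prop : Continuous fun z : Euc 2 × Euc 2 =>
          z.1 + t • (z.2 - z.1)).measurable).aemeasurable
  have claimC : ∫⁻ x, ∫⁻ z, g (x + z.2 • (z.1 - x)) ^ p ∂(ν.prod τ) ∂ν ≤ 4 * ∫⁻ x, g x ^ p ∂ν := by
    have e1 : ∀ x, ∫⁻ z, g (x + z.2 • (z.1 - x)) ^ p ∂(ν.prod τ) =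
        ∫⁻ t, ∫⁻ y, g (x + t • (y - x)) ^ p ∂ν ∂τ := fun x =>
      lintegral_prod_symm _ ((hgp.comp (mline.comp measurable_prodMk_left)).aemeasurable)
    simp only [e1]
    rw [lintegral_lintegral_swap]
    · calc _ ≤ ∫⁻ t, 4 * ∫⁻ x, g x ^ p ∂ν ∂τ := by
            refine lintegral_mono_ae ?_
            filter_upwards [ae_restrict_mem measurableSet_Ioc] with t ht
            exact hJ t ht
        _ = _ := by simp
    · have hm : Measurable fun w : (Euc 2 × ℝ) × Euc 2 => g (w.1.1 + w.1.2 • (w.2 - w.1.1)) ^ p :=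
        hgp.comp (by fun_prop : Continuous fun w : (Euc 2 × ℝ) × Euc 2 =>
          w.1.1 + w.1.2 • (w.2 - w.1.1)).measurable
      exact hm.lintegral_prod_right'.aemeasurable
  have fin := claimB.trans claimC
  rw [lν, lν, mul_left_comm] at fin
  exact (ENNReal.mul_le_mul_iff_right (ENNReal.inv_ne_zero.2 ht) hcD).1 fin

theorem convex_openHalfDisk (r : ℝ) : Convex ℝ (openHalfDisk r) := by
  rw [openHalfDisk_eq]
  refine Convex.inter ?_ (convex_ball 0 r)
  exact (convex_Ioi (0 : ℝ)).linear_preimage (EuclideanSpace.proj (1 : Fin 2) : Euc 2 →L[ℝ] ℝ).toLinearMap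

theorem volume_openHalfDisk_ne_zero {r : ℝ} (hr : 0 < r) : volume (openHalfDisk r) ≠ 0 := by
  refine ((isOpen_openHalfDisk r).measure_pos volume ⟨!₂[0, r / 2], ?_, ?_⟩).ne'
  · have h : ‖(!₂[0, r / 2] : Euc 2)‖ = r / 2 := by
      simp [EuclideanSpace.norm_eq, Real.sqrt_sq_eq_abs]
      positivity
    rw [h]
    linarith
  · simpa using hr

theorem volume_openHalfDisk_ne_top (r : ℝ) : volume (openHalfDisk r) ≠ ⊤ := by
  have := (isFiniteMeasure_openHalfDisk r).measure_univ_lt_top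
  rw [Measure.restrict_apply_univ] at this
  exact this.ne

theorem volume_coord_eq_zero : volume {x : Euc 2 | x 1 = 0} = 0 := by
  have h := Measure.addHaar_submodule (volume : Measure (Euc 2))
    (LinearMap.ker (EuclideanSpace.proj (1 : Fin 2) : Euc 2 →L[ℝ] ℝ).toLinearMap) (by
      intro h
      rw [LinearMap.ker_eq_top] at h
      have := congrArg (fun A : Euc 2 →ₗ[ℝ] ℝ => A (EuclideanSpace.single 1 1)) h
      simp at this)
  exact h

theorem closedHalfDisk_ae_eq {r : ℝ} (hr : r ≠ 0) :
    closedHalfDisk r =ᵐ[volume] openHalfDisk r := by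
  have h : ∀ᵐ x : Euc 2, x ∉ Metric.sphere (0 : Euc 2) r ∧ x ∉ {x : Euc 2 | x 1 = 0} := by
    refine Filter.Eventually.and ?_ ?_
    · exact measure_eq_zero_iff_ae_notMem.1 (Measure.addHaar_sphere_of_ne_zero volume 0 hr)
    · exact measure_eq_zero_iff_ae_notMem.1 volume_coord_eq_zero
  filter_upwards [h] with x hx
  rw [mem_sphere_zero_iff_norm] at hx
  refine propext ⟨fun h => ⟨lt_of_le_of_ne h.1 hx.1, lt_of_le_of_ne h.2 (Ne.symm hx.2)⟩,
    fun h => ⟨h.1.le, h.2.le⟩⟩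

/-- The Poincaré inequality on the half disk for limits of smooth functions. -/
theorem exists_poincare {p : ℝ} (hp1 : 1 < p) :
    ∃ C : ℝ≥0, ∀ (f : Euc 2 → ℝ) (f₁ : Fin 2 → Euc 2 → ℝ) (w : ℕ → Euc 2 → ℝ),
      (∀ m, ContDiff ℝ ∞ (w m)) →
      MemLp f (ENNReal.ofReal p) (volume.restrict (openHalfDisk 1)) →
      (∀ i, AEStronglyMeasurable (f₁ i) (volume.restrict (openHalfDisk 1))) →
      Tendsto (fun m => eLpNorm (fun x => w m x - f x) (ENNReal.ofReal p)
        (volume.restrict (openHalfDisk 1))) atTop (𝓝 0) →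
      (∀ i, Tendsto (fun m => eLpNorm (fun x => pd i (w m) x - f₁ i x) (ENNReal.ofReal p)
        (volume.restrict (openHalfDisk 1))) atTop (𝓝 0)) →
      eLpNorm (fun x => f x - ⨍ y in openHalfDisk 1, f y) (ENNReal.ofReal p)
          (volume.restrict (openHalfDisk 1)) ≤
        C * ∑ i, eLpNorm (f₁ i) (ENNReal.ofReal p) (volume.restrict (openHalfDisk 1)) := by
  set r := ENNReal.ofReal p with hr
  have hp0 : 0 < p := by linarith
  have hr1 : 1 ≤ r := by
    rw [← ENNReal.ofReal_one]; exact ENNReal.ofReal_le_ofReal hp1.le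
  have hrt : r ≠ ⊤ := ENNReal.ofReal_ne_top
  have hr0 : r ≠ 0 := (zero_lt_one.trans_le hr1).ne'
  have hrp : r.toReal = p := ENNReal.toReal_ofReal hp0.le
  set μ := (volume : Measure (Euc 2)).restrict (openHalfDisk 1) with hμ
  have hUm := (isOpen_openHalfDisk 1).measurableSet
  obtain ⟨K, hK⟩ : ∃ K : ℝ≥0, (K : ℝ≥0∞) = (4 * 2 ^ p) ^ p⁻¹ := by
    refine ⟨((4 * 2 ^ p : ℝ≥0∞) ^ p⁻¹).toNNReal, ENNReal.coe_toNNReal ?_⟩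
    refine ENNReal.rpow_ne_top_of_nonneg (by positivity) (ENNReal.mul_ne_top (by norm_num) ?_)
    exact ENNReal.rpow_ne_top_of_nonneg hp0.le (by norm_num)
  have smooth : ∀ g : Euc 2 → ℝ, ContDiff ℝ ∞ g →
      eLpNorm (fun x => g x - ⨍ y in openHalfDisk 1, g y) r μ ≤ K * ∑ i, eLpNorm (pd i g) r μ := by
    intro g hg
    have hgi : IntegrableOn g (openHalfDisk 1) := by
      have := hg.continuous.continuousOn.integrableOn_compact (μ := volume)
        (isCompact_closedBall (0 : Euc 2) 1)
      refine this.mono_set fun x hx => ?_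
      rw [mem_closedBall_zero_iff]
      exact hx.1.le
    have h := lintegral_sub_average_rpow_le hUm (convex_openHalfDisk 1) (fun x hx y hy => by
        have := norm_sub_le y x
        linarith [hx.1, hy.1]) (volume_openHalfDisk_ne_zero one_pos) (volume_openHalfDisk_ne_top 1)
      (hg.of_le (by norm_cast)) hgi hp1
    have h1 : eLpNorm (fun x => g x - ⨍ y in openHalfDisk 1, g y) r μ ≤
        K * eLpNorm (fderiv ℝ g) r μ := by
      rw [eLpNorm_eq_lintegral_rpow_enorm_toReal hr0 hrt, eLpNorm_eq_lintegral_rpow_enorm_toReal hr0 hrt,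
        hrp, hK, one_div, ← ENNReal.mul_rpow_of_nonneg _ _ (by positivity : 0 ≤ p⁻¹)]
      refine ENNReal.rpow_le_rpow (h.trans_eq ?_) (by positivity)
      simp only [ENNReal.mul_rpow_of_nonneg _ _ hp0.le]
      rw [lintegral_const_mul', mul_assoc]
      exact ENNReal.rpow_ne_top_of_nonneg hp0.le (by norm_num)
    refine h1.trans (mul_le_mul_right ?_ _)
    rw [Fin.sum_univ_two]
    refine le_trans (eLpNorm_mono_real (g := fun x => ‖pd 0 g x‖ + ‖pd 1 g x‖) (norm_fderiv_le g)) ?_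
    refine (eLpNorm_add_le (f := fun x => ‖pd 0 g x‖) (g := fun x => ‖pd 1 g x‖)
      (hg.pd 0).continuous.norm.aestronglyMeasurable
      (hg.pd 1).continuous.norm.aestronglyMeasurable hr1).trans_eq ?_
    rw [eLpNorm_norm, eLpNorm_norm]
  refine ⟨K, fun f f₁ w hw hf hf₁ c0 c1 => ?_⟩
  have hwi : ∀ m, Integrable (w m) μ := fun m => by
    have := (hw m).continuous.continuousOn.integrableOn_compact (μ := volume)
      (isCompact_closedBall (0 : Euc 2) 1)
    refine this.mono_set fun x hx => ?_
    rw [mem_closedBall_zero_iff]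
    exact hx.1.le
  have hfi : Integrable f μ := hf.integrable hr1
  have cav : Tendsto (fun m => ⨍ y in openHalfDisk 1, w m y) atTop
      (𝓝 (⨍ y in openHalfDisk 1, f y)) := by
    simp only [average_eq]
    refine Tendsto.const_smul ?_ _
    refine tendsto_integral_of_L1 _ hfi.1 (Eventually.of_forall hwi) ?_
    have := tendsto_eLpNorm_one hr1 (fun m => (hwi m).1.sub hfi.1) c0
    simp only [eLpNorm_one_eq_lintegral_enorm] at this
    exact this
  obtain ⟨ns, hns, hae⟩ := (tendstoInMeasure_of_tendsto_eLpNorm (p := r) hr0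
      (fun m => (hwi m).1) hf.1 c0).exists_seq_tendsto_ae
  refine eLpNorm_le_of_ae_tendsto (f := fun m x => w (ns m) x - ⨍ y in openHalfDisk 1, w (ns m) y)
    (b := fun m => K * ∑ i, (eLpNorm (f₁ i) r μ +
      eLpNorm (fun x => pd i (w (ns m)) x - f₁ i x) r μ))
    (fun m => (hwi _).1.sub aestronglyMeasurable_const) (Eventually.of_forall fun m => ?_) ?_ ?_
  · refine (smooth _ (hw _)).trans (mul_le_mul_right (Finset.sum_le_sum fun i _ => ?_) _)
    have e : pd i (w (ns m)) = f₁ i + fun x => pd i (w (ns m)) x - f₁ i x := by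
      ext x; simp
    calc eLpNorm (pd i (w (ns m))) r μ
        = eLpNorm (f₁ i + fun x => pd i (w (ns m)) x - f₁ i x) r μ := by rw [← e]
      _ ≤ _ := eLpNorm_add_le (hf₁ i)
        (((hw _).pd i).continuous.aestronglyMeasurable.sub (hf₁ i)) hr1
  · refine ENNReal.Tendsto.const_mul (tendsto_finsetSum _ fun i _ => ?_) (Or.inr ENNReal.coe_ne_top)
    have := ((c1 i).comp hns.tendsto_atTop).const_add (eLpNorm (f₁ i) r μ)
    rwa [add_zero] at this
  · filter_upwards [hae] with x hx
    exact hx.sub (cav.comp hns.tendsto_atTop)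

/-! ### The cutoff function -/

/-- A radial cutoff function. -/
def chi (x : Euc 2) : ℝ := Real.smoothTransition (4 * (9 / 16 - ‖x‖ ^ 2))

theorem chi_eq_zero {x : Euc 2} (hx : 3 / 4 ≤ ‖x‖) : chi x = 0 := by
  refine Real.smoothTransition.zero_of_nonpos ?_
  nlinarith [norm_nonneg x]

theorem chi_eq_one {x : Euc 2} (hx : ‖x‖ ≤ 1 / 2) : chi x = 1 := by
  refine Real.smoothTransition.one_of_one_le ?_
  nlinarith [norm_nonneg x]

theorem chi_nonneg (x : Euc 2) : 0 ≤ chi x := Real.smoothTransition.nonneg _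

theorem contDiff_chi : ContDiff ℝ ∞ chi :=
  Real.smoothTransition.contDiff.comp
    (contDiff_const.mul (contDiff_const.sub (contDiff_norm_sq ℝ)))

theorem tsupport_chi_subset : tsupport chi ⊆ Metric.ball 0 1 := by
  have h : tsupport chi ⊆ Metric.closedBall 0 (3 / 4) := by
    refine closure_minimal (fun x hx => ?_) Metric.isClosed_closedBall
    rw [mem_closedBall_zero_iff]
    by_contra h
    exact hx (chi_eq_zero (not_le.1 h).le)
  exact h.trans (Metric.closedBall_subset_ball (by norm_num))

theorem isTest_chi : IsTest chi :=
  ⟨contDiff_chi, tsupport_chi_subset.trans (Metric.ball_subset_ball (by norm_num))⟩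

theorem chi_reflect (x : Euc 2) : chi (reflect x) = chi x := by
  simp [chi]

theorem integral_chi_pos : 0 < ∫ t in Ioo (-2 : ℝ) 2, chi !₂[t, 0] := by
  have hc : Continuous fun t : ℝ => chi !₂[t, 0] := contDiff_chi.continuous.comp
    (continuous_mk.comp (by fun_prop : Continuous fun t : ℝ => (t, (0 : ℝ))))
  have h1 : ∫ t in Ioo (-(1 / 2) : ℝ) (1 / 2), chi !₂[t, 0] ≤ ∫ t in Ioo (-2 : ℝ) 2, chi !₂[t, 0] := by
    refine setIntegral_mono_set ?_ (Eventually.of_forall fun t => chi_nonneg _)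
      (Ioo_subset_Ioo (by norm_num) (by norm_num)).eventuallyLE
    exact (hc.continuousOn.integrableOn_compact (isCompact_Icc (a := (-2 : ℝ)) (b := 2))).mono_set
      Ioo_subset_Icc_self
  have h2 : ∫ t in Ioo (-(1 / 2) : ℝ) (1 / 2), chi !₂[t, 0] = 1 := by
    rw [setIntegral_congr_fun (g := fun _ => (1 : ℝ)) measurableSet_Ioo fun t ht => ?_]
    · simp
      norm_num
    · refine chi_eq_one ?_
      rw [norm_mk_zero, abs_le]
      exact ⟨ht.1.le, ht.2.le⟩
  linarith

/-- A function with zero boundary values is close to a constant only if the constant is small. -/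
theorem exists_const_le : ∃ C : ℝ≥0, ∀ (g g₁ : Euc 2 → ℝ) (c : ℝ),
    Integrable g (volume.restrict (openHalfDisk 2)) →
    Integrable g₁ (volume.restrict (openHalfDisk 2)) → Green 1 g g₁ chi →
    ENNReal.ofReal ‖c‖ ≤ C * (eLpNorm (fun x => g x - c) 1 (volume.restrict (openHalfDisk 1)) +
      eLpNorm g₁ 1 (volume.restrict (openHalfDisk 1))) := by
  obtain ⟨M, hM⟩ := exists_multiplier_bound isTest_chi tsupport_chi_subset 1
  set κ := ∫ t in Ioo (-2 : ℝ) 2, chi !₂[t, 0] with hκ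
  have hκ0 : 0 < κ := integral_chi_pos
  refine ⟨(Real.toNNReal κ⁻¹) * M, fun g g₁ c hg hg₁ hG => ?_⟩
  set μ := (volume : Measure (Euc 2)).restrict (openHalfDisk 2) with hμ
  have e1 := setIntegral_openHalfDisk_pd (contDiff_chi.of_le (by norm_cast)) isTest_chi.2 1
  rw [if_neg (by simp)] at e1
  have ig : Integrable (fun x => g x - c) μ := hg.sub (integrable_const c)
  have i1 := (isTest_chi.pd 1).integrable_mul hg
  have i2 : Integrable (pd 1 chi) μ := by
    simpa using (isTest_chi.pd 1).integrable_mul (integrable_const (1 : ℝ))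
  have i3 := (isTest_chi.pd 1).integrable_mul ig
  have i4 := isTest_chi.integrable_mul hg₁
  have e2 : ∫ x, pd 1 chi x * (g x - c) ∂μ = (∫ x, pd 1 chi x * g x ∂μ) - c * ∫ x, pd 1 chi x ∂μ := by
    rw [← integral_const_mul, ← integral_sub i1 (i2.const_mul c)]
    exact integral_congr_ae (Eventually.of_forall fun x => by simp only; ring)
  rw [Green] at hG
  -- By the divergence theorem the integral of the normal derivative of `chi` is `-κ`. Testing the
  -- zero trace of `g` with `chi` removes `g` itself, and the identity is solved for `c`.
  have e3 : c = κ⁻¹ * ((∫ x, pd 1 chi x * (g x - c) ∂μ) + ∫ x, chi x * g₁ x ∂μ) := by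
    rw [e2, hG, e1, ← hκ]
    field_simp
    ring
  have b : ∀ {k : Euc 2 → ℝ}, ENNReal.ofReal ‖∫ x, k x ∂μ‖ ≤ eLpNorm k 1 μ := by
    intro k
    rw [ofReal_norm, eLpNorm_one_eq_lintegral_enorm]
    exact enorm_integral_le_lintegral_enorm _
  have e4 : ‖c‖ ≤ κ⁻¹ * (‖∫ x, pd 1 chi x * (g x - c) ∂μ‖ + ‖∫ x, chi x * g₁ x ∂μ‖) := by
    conv_lhs => rw [e3]
    rw [norm_mul, Real.norm_of_nonneg (by positivity : 0 ≤ κ⁻¹)]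
    exact mul_le_mul_of_nonneg_left (norm_add_le _ _) (by positivity)
  refine (ENNReal.ofReal_le_ofReal e4).trans ?_
  rw [ENNReal.ofReal_mul (by positivity), ENNReal.ofReal_add (norm_nonneg _) (norm_nonneg _)]
  have b1 := b.trans (hM (pd 1 chi) (Or.inl (Or.inr ⟨1, rfl⟩)) fun x => g x - c)
  have b2 := b.trans (hM chi (by simp) g₁)
  refine (mul_le_mul_right (add_le_add b1 b2) _).trans_eq ?_
  rw [ENNReal.coe_mul, mul_assoc, ← mul_add]
  rfl

/-! ### The normal projection of a submanifold -/

/-- The space of the coordinates that vanish on an `n`-dimensional submanifold in a chart. -/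
abbrev Codim (L n : ℕ) : Type := EuclideanSpace ℝ {i : Fin L // n ≤ i.val}

/-- The projection to the last coordinates. -/
def codimProj (L n : ℕ) : Euc L →L[ℝ] Codim L n :=
  LinearMap.toContinuousLinearMap
    { toFun := fun x => WithLp.toLp 2 fun i => x i.1
      map_add' := fun x y => by ext i; simp
      map_smul' := fun c x => by ext i; simp }

@[simp] theorem codimProj_apply {L n : ℕ} (x : Euc L) (i : {i : Fin L // n ≤ i.val}) :
    codimProj L n x i = x i.1 := rfl

theorem codimProj_surjective (L n : ℕ) : Function.Surjective (codimProj L n) := by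
  intro c
  refine ⟨WithLp.toLp 2 fun i => if h : n ≤ i.val then c ⟨i, h⟩ else 0, ?_⟩
  ext i
  simp [i.2]

section Chart

variable {L : ℕ} {Φ : OpenPartialHomeomorph (Euc L) (Euc L)}

theorem chart_symm_comp (h1 : ContDiffOn ℝ ∞ Φ Φ.source) (h2 : ContDiffOn ℝ ∞ Φ.symm Φ.target)
    {z : Euc L} (hz : z ∈ Φ.source) (v : Euc L) :
    fderiv ℝ Φ.symm (Φ z) (fderiv ℝ Φ z v) = v := by
  have d1 : DifferentiableAt ℝ Φ z :=
    (h1.contDiffAt (Φ.open_source.mem_nhds hz)).differentiableAt (by simp)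
  have d2 : DifferentiableAt ℝ Φ.symm (Φ z) :=
    (h2.contDiffAt (Φ.open_target.mem_nhds (Φ.map_source hz))).differentiableAt (by simp)
  have h := d2.hasFDerivAt.comp z d1.hasFDerivAt
  have e : Φ.symm ∘ Φ =ᶠ[𝓝 z] id := Φ.eventually_left_inverse hz
  have := (h.congr_of_eventuallyEq e.symm).unique (hasFDerivAt_id z)
  exact congrArg (fun A : Euc L →L[ℝ] Euc L => A v) this

theorem chart_comp_symm (h1 : ContDiffOn ℝ ∞ Φ Φ.source) (h2 : ContDiffOn ℝ ∞ Φ.symm Φ.target)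
    {z : Euc L} (hz : z ∈ Φ.source) (v : Euc L) :
    fderiv ℝ Φ z (fderiv ℝ Φ.symm (Φ z) v) = v := by
  have := chart_symm_comp (Φ := Φ.symm) h2 h1 (z := Φ z) (Φ.map_source hz) v
  simpa [Φ.left_inv hz] using this

end Chart

/-- Near each of its points a submanifold is contained in the zero set of a submersion whose kernel
is the tangent space. -/
theorem exists_submersion {L n : ℕ} {S : Set (Euc L)}
    (hS : IsSubmanifoldWithBoundary n S) {y : Euc L} (hy : y ∈ S) :
    ∃ (U : Set (Euc L)) (h : Euc L → Codim L n), IsOpen U ∧ y ∈ U ∧ ContDiffOn ℝ ∞ h U ∧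
      (∀ z ∈ U, Function.Surjective (fderiv ℝ h z)) ∧
      ∀ z ∈ S ∩ U, h z = 0 ∧ tangentSpace S z = LinearMap.ker (fderiv ℝ h z).toLinearMap := by
  obtain ⟨Φ, hyΦ, h1, h2, hΦ⟩ := hS.2 y hy
  have hd : ∀ z ∈ Φ.source, DifferentiableAt ℝ Φ z := fun z hz =>
    (h1.contDiffAt (Φ.open_source.mem_nhds hz)).differentiableAt (by simp)
  have hfd : ∀ z ∈ Φ.source, HasFDerivAt (fun z => codimProj L n (Φ z))
      ((codimProj L n).comp (fderiv ℝ Φ z)) z := fun z hz =>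
    (codimProj L n).hasFDerivAt.comp z (hd z hz).hasFDerivAt
  have hzero : ∀ z ∈ Φ.source, z ∈ S → ∀ i : Fin L, n ≤ i.val → Φ z i = 0 := by
    intro z hz hzS
    rcases hΦ with h | h
    · exact (h z hz).1 hzS
    · exact ((h z hz).1 hzS).1
  have hzero' : ∀ z ∈ Φ.source, z ∈ S → codimProj L n (Φ z) = 0 := by
    intro z hz hzS
    ext i
    exact hzero z hz hzS i.1 i.2
  refine ⟨Φ.source, fun z => codimProj L n (Φ z), Φ.open_source, hyΦ,
    (codimProj L n).contDiff.comp_contDiffOn h1, fun z hz => ?_, fun z hz => ⟨hzero' z hz.2 hz.1, ?_⟩⟩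
  · rw [(hfd z hz).fderiv]
    refine (codimProj_surjective L n).comp fun v => ⟨fderiv ℝ Φ.symm (Φ z) v, ?_⟩
    exact chart_comp_symm h1 h2 hz v
  · obtain ⟨hzS, hzU⟩ := hz
    rw [(hfd z hzU).fderiv]
    -- On `S` the submersion agrees with the zero function, and two derivatives within `S` agree on
    -- the tangent cone; this gives one inclusion. For the other, segments in the chart are mapped
    -- back into `S`.
    refine le_antisymm (Submodule.span_le.2 fun v hv => ?_) fun v hv => ?_
    · have e1 := (hfd z hzU).hasFDerivWithinAt (s := S)
      have e2 : HasFDerivWithinAt (fun z => codimProj L n (Φ z)) (0 : Euc L →L[ℝ] Codim L n) S z := by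
        refine (hasFDerivWithinAt_const (0 : Codim L n) z S).congr_of_eventuallyEq ?_
          (hzero' z hzU hzS)
        filter_upwards [mem_nhdsWithin_of_mem_nhds (Φ.open_source.mem_nhds hzU),
          self_mem_nhdsWithin] with x hx hxS
        exact hzero' x hx hxS
      exact e1.unique_on e2 hv
    · set w := fderiv ℝ Φ z v with hw
      have hwi : ∀ i : Fin L, n ≤ i.val → w i = 0 := fun i hi =>
        congrArg (fun c : Codim L n => c ⟨i, hi⟩) (show codimProj L n w = 0 from hv)
      -- it suffices to treat the vectors that point into the manifold
      have key : ∀ w : Euc L, (∀ i : Fin L, n ≤ i.val → w i = 0) →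
          (∀ i : Fin L, i.val = 0 → 0 ≤ w i) → fderiv ℝ Φ.symm (Φ z) w ∈ tangentSpace S z := by
        intro w hw0 hw1
        have hc : Continuous fun t : ℝ => Φ z + t • w := by fun_prop
        have hev : ∀ᶠ t in 𝓝 (0 : ℝ), Φ z + t • w ∈ Φ.target := by
          refine hc.continuousAt.eventually (Φ.open_target.mem_nhds ?_)
          simpa using Φ.map_source hzU
        obtain ⟨δ, hδ, hδt⟩ := Metric.eventually_nhds_iff.1 hev
        set M := {x ∈ Φ.target | Φ.symm x ∈ S} with hM
        have hseg : segment ℝ (Φ z) (Φ z + (δ / 2) • w) ⊆ M := by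
          rintro x ⟨a, b, ha, hb, hab, rfl⟩
          have ex : a • Φ z + b • (Φ z + (δ / 2) • w) = Φ z + (b * (δ / 2)) • w := by
            rw [smul_add, ← add_assoc, ← add_smul, hab, one_smul, smul_smul]
          rw [ex]
          have ht : Φ z + (b * (δ / 2)) • w ∈ Φ.target := by
            refine hδt ?_
            rw [dist_zero_right, Real.norm_eq_abs, abs_of_nonneg (by positivity)]
            nlinarith
          refine ⟨ht, ?_⟩
          have hs := Φ.map_target ht
          have hr : Φ (Φ.symm (Φ z + (b * (δ / 2)) • w)) = Φ z + (b * (δ / 2)) • w := Φ.right_inv ht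
          have c1 : ∀ i : Fin L, n ≤ i.val → (Φ z + (b * (δ / 2)) • w) i = 0 := by
            intro i hi
            simp [hzero z hzU hzS i hi, hw0 i hi]
          rcases hΦ with h | h
          · rw [h _ hs, hr]
            exact c1
          · rw [h _ hs, hr]
            refine ⟨c1, fun i hi => ?_⟩
            have := ((h z hzU).1 hzS).2 i hi
            have := hw1 i hi
            simp only [PiLp.add_apply, PiLp.smul_apply, smul_eq_mul]
            positivity
        have t1 := mem_tangentConeAt_of_segment_subset hseg
        rw [add_sub_cancel_left] at t1
        have d2 : DifferentiableAt ℝ Φ.symm (Φ z) :=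
          (h2.contDiffAt (Φ.open_target.mem_nhds (Φ.map_source hzU))).differentiableAt (by simp)
        have t2 := (d2.hasFDerivAt.hasFDerivWithinAt (s := M)).mapsTo_tangent_cone t1
        rw [Φ.left_inv hzU, map_smul] at t2
        have t3 : (δ / 2) • fderiv ℝ Φ.symm (Φ z) w ∈ tangentSpace S z := by
          refine Submodule.subset_span (tangentConeAt_mono ?_ t2)
          rintro _ ⟨x, hx, rfl⟩
          exact hx.2
        exact (Submodule.smul_mem_iff _ (half_pos hδ).ne').1 t3
      have hv' : v = fderiv ℝ Φ.symm (Φ z) w := (chart_symm_comp h1 h2 hzU v).symm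
      rw [hv']
      -- At a boundary point a vector with negative first coordinate points outwards. Its negative
      -- points inwards, and the tangent space is a linear span.
      by_cases hpos : ∀ i : Fin L, i.val = 0 → 0 ≤ w i
      · exact key w hwi hpos
      · push Not at hpos
        obtain ⟨i, hi, hneg⟩ := hpos
        have := key (-w) (fun j hj => by simp [hwi j hj]) (fun j hj => by
          have : j = i := Fin.ext (hj.trans hi.symm)
          subst this
          simpa using hneg.le)
        rw [map_neg] at this
        exact (Submodule.neg_mem_iff _).1 this

/-! ### The orthogonal projection to the kernel of a surjective linear map. -/

section Adjoint

variable {E F : Type*} [NormedAddCommGroup E] [InnerProductSpace ℝ E] [FiniteDimensional ℝ E]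
  [NormedAddCommGroup F] [InnerProductSpace ℝ F] [FiniteDimensional ℝ F]

/-- The adjoint as a continuous linear map. -/
def adjointCLM (E F : Type*) [NormedAddCommGroup E] [InnerProductSpace ℝ E] [FiniteDimensional ℝ E]
    [NormedAddCommGroup F] [InnerProductSpace ℝ F] [FiniteDimensional ℝ F] :
    (E →L[ℝ] F) →L[ℝ] (F →L[ℝ] E) :=
  haveI := FiniteDimensional.complete ℝ E
  haveI := FiniteDimensional.complete ℝ F
  LinearMap.toContinuousLinearMap
    { toFun := fun A => LinearMap.toContinuousLinearMap (LinearMap.adjoint (A : E →ₗ[ℝ] F))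
      map_add' := fun A B => by ext x; simp
      map_smul' := fun c A => by ext x; simp }

theorem adjointCLM_inner (A : E →L[ℝ] F) (x : E) (y : F) :
    inner ℝ (adjointCLM E F A y) x = inner ℝ y (A x) :=
  LinearMap.adjoint_inner_left (A : E →ₗ[ℝ] F) x y

/-- The right inverse of a surjective linear map whose range is normal to the kernel. -/
def normalInverse (A : E →L[ℝ] F) : F →L[ℝ] E :=
  (adjointCLM E F A).comp (Ring.inverse (A.comp (adjointCLM E F A)))

theorem isUnit_comp_adjointCLM {A : E →L[ℝ] F} (hA : Function.Surjective A) :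
    IsUnit (A.comp (adjointCLM E F A)) := by
  have := FiniteDimensional.complete ℝ F
  have hinj : Function.Injective (A.comp (adjointCLM E F A)).toLinearMap := by
    rw [← LinearMap.ker_eq_bot, LinearMap.ker_eq_bot']
    intro v hv
    have h1 : inner ℝ (adjointCLM E F A v) (adjointCLM E F A v) = (0 : ℝ) := by
      rw [adjointCLM_inner]
      have : A (adjointCLM E F A v) = 0 := hv
      rw [this, inner_zero_right]
    have h2 := inner_self_eq_zero.1 h1
    obtain ⟨x, hx⟩ := hA v
    have h3 := adjointCLM_inner A x v
    rw [h2, inner_zero_left, hx] at h3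
    exact inner_self_eq_zero.1 h3.symm
  rw [ContinuousLinearMap.isUnit_iff_bijective]
  exact ⟨hinj, LinearMap.injective_iff_surjective.1 hinj⟩

theorem apply_normalInverse {A : E →L[ℝ] F} (hA : Function.Surjective A) (v : F) :
    A (normalInverse A v) = v := by
  have := Ring.mul_inverse_cancel _ (isUnit_comp_adjointCLM hA)
  exact congrArg (fun B : F →L[ℝ] F => B v) this

/-- The vector subtracted lies in the range of the adjoint, hence is orthogonal to the kernel. The
formula shows that the projection to the tangent space depends smoothly on the point and extends to
a neighbourhood in `ℝ^L`. -/
theorem starProjection_ker {A : E →L[ℝ] F} (hA : Function.Surjective A) (x : E) :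
    (LinearMap.ker A.toLinearMap).starProjection x = x - normalInverse A (A x) := by
  refine (Submodule.eq_starProjection_of_mem_of_inner_eq_zero ?_ fun w hw => ?_)
  · rw [LinearMap.mem_ker]
    change A (x - normalInverse A (A x)) = 0
    rw [map_sub, apply_normalInverse hA, sub_self]
  · rw [sub_sub_cancel]
    change inner ℝ (adjointCLM E F A _) w = 0
    rw [adjointCLM_inner, show A w = 0 from hw, inner_zero_right]

theorem contDiffOn_normalInverse {h : E → F} {U : Set E} (hU : IsOpen U) (hh : ContDiffOn ℝ ∞ h U)
    (hs : ∀ z ∈ U, Function.Surjective (fderiv ℝ h z)) :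
    ContDiffOn ℝ ∞ (fun z => normalInverse (fderiv ℝ h z)) U := by
  have := FiniteDimensional.complete ℝ F
  have h1 : ContDiffOn ℝ ∞ (fderiv ℝ h) U := hh.fderiv_of_isOpen hU (by simp)
  have h2 : ContDiffOn ℝ ∞ (fun z => adjointCLM E F (fderiv ℝ h z)) U :=
    (adjointCLM E F).contDiff.comp_contDiffOn h1
  refine h2.clm_comp fun z hz => ?_
  have h3 := isUnit_comp_adjointCLM (hs z hz)
  have h4 := contDiffAt_ringInverse ℝ (n := ∞) h3.unit
  exact (h4.comp_contDiffWithinAt (x := z)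
    (f := fun z => (fderiv ℝ h z).comp (adjointCLM E F (fderiv ℝ h z))) ((h1.clm_comp h2) z hz))

end Adjoint

/-- The second fundamental form of a zero set of a submersion. -/
theorem norm_secondFundamentalForm_le {L n : ℕ} {S U : Set (Euc L)} {h : Euc L → Codim L n}
    (hU : IsOpen U) (hh : ContDiffOn ℝ ∞ h U) (hs : ∀ z ∈ U, Function.Surjective (fderiv ℝ h z))
    (hS : ∀ z ∈ S ∩ U, tangentSpace S z = LinearMap.ker (fderiv ℝ h z).toLinearMap)
    {z : Euc L} (hz : z ∈ S ∩ U) {X : Euc L} (hX : fderiv ℝ h z X = 0) :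
    ‖secondFundamentalForm S z X X‖ ≤
      ‖fderiv ℝ (fun z => (normalInverse (fderiv ℝ h z)).comp (fderiv ℝ h z)) z‖ * ‖X‖ * ‖X‖ := by
  set Q := fun z => (normalInverse (fderiv ℝ h z)).comp (fderiv ℝ h z) with hQ
  have hQc : ContDiffOn ℝ ∞ Q U :=
    (contDiffOn_normalInverse hU hh hs).clm_comp (hh.fderiv_of_isOpen hU (by simp))
  have hQd : HasFDerivAt Q (fderiv ℝ Q z) z :=
    ((hQc.contDiffAt (hU.mem_nhds hz.2)).differentiableAt (by simp)).hasFDerivAt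
  -- On `S` the field of projections agrees with `X - Q z X`, which is smooth on an open set of
  -- `ℝ^L`, so a derivative within `S` is obtained from an ordinary one.
  have hf : HasFDerivWithinAt (fun z => (tangentSpace S z).starProjection X)
      (-((fderiv ℝ Q z).flip X)) S z := by
    have h1 : HasFDerivAt (fun z => X - Q z X) (-((fderiv ℝ Q z).flip X)) z := by
      have := (hQd.clm_apply (hasFDerivAt_const X z)).const_sub X
      refine this.congr_fderiv ?_
      ext v
      simp
    have e : ∀ x ∈ S ∩ U, (tangentSpace S x).starProjection X = X - Q x X := by
      intro x hx
      simp only [hS x hx]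
      exact starProjection_ker (hs x hx.2) X
    refine h1.hasFDerivWithinAt.congr_of_eventuallyEq ?_ (e z hz)
    filter_upwards [mem_nhdsWithin_of_mem_nhds (hU.mem_nhds hz.2), self_mem_nhdsWithin] with x hx hxS
    exact e x ⟨hxS, hx⟩
  have hXT : X ∈ Submodule.span ℝ (tangentConeAt ℝ S z) := by
    change X ∈ tangentSpace S z
    rw [hS z hz]
    exact hX
  -- A derivative within `S` is determined only on the span of the tangent cone, and `X` lies in
  -- that span.
  have heq := LinearMap.eqOn_span (f := (fderivWithin ℝ (fun z => (tangentSpace S z).starProjection X) S z).toLinearMap)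
    (g := (-((fderiv ℝ Q z).flip X)).toLinearMap)
    (fun v hv => hf.differentiableWithinAt.hasFDerivWithinAt.unique_on hf hv) hXT
  have heq' : fderivWithin ℝ (fun z => (tangentSpace S z).starProjection X) S z X
      = -(fderiv ℝ Q z X X) := heq
  rw [secondFundamentalForm, norm_neg, heq']
  refine (Submodule.norm_starProjection_apply_le _ _).trans ?_
  rw [norm_neg]
  exact (fderiv ℝ Q z).le_opNorm₂ X X

/-- On a compact submanifold the second fundamental form is bounded; tangency is expressed by
finitely many globally defined functions. -/
theorem exists_secondFundamentalForm_le {L n : ℕ} {N : Set (Euc L)} (hNc : IsCompact N)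
    (hN : IsSubmanifoldWithBoundary n N) :
    ∃ (𝓗 : Set (Euc L → ℝ)) (C : ℝ), 𝓗.Finite ∧ 0 ≤ C ∧
      (∀ H ∈ 𝓗, ContDiff ℝ ∞ H ∧ HasCompactSupport H ∧ ∀ y ∈ N, H y = 0) ∧
      ∀ y ∈ N, ∀ X, (∀ H ∈ 𝓗, fderiv ℝ H y X = 0) →
        ‖secondFundamentalForm N y X X‖ ≤ C * ‖X‖ ^ 2 := by
  refine hNc.induction_on (p := fun s => ∃ (𝓗 : Set (Euc L → ℝ)) (C : ℝ), 𝓗.Finite ∧ 0 ≤ C ∧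
      (∀ H ∈ 𝓗, ContDiff ℝ ∞ H ∧ HasCompactSupport H ∧ ∀ y ∈ N, H y = 0) ∧
      ∀ y ∈ s, ∀ X, (∀ H ∈ 𝓗, fderiv ℝ H y X = 0) →
        ‖secondFundamentalForm N y X X‖ ≤ C * ‖X‖ ^ 2) ⟨∅, 0, by simp⟩ ?_ ?_ ?_
  · rintro s t hst ⟨𝓗, C, h1, h2, h3, h4⟩
    exact ⟨𝓗, C, h1, h2, h3, fun y hy => h4 y (hst hy)⟩
  · rintro s t ⟨𝓗, C, h1, h2, h3, h4⟩ ⟨𝓗', C', h1', h2', h3', h4'⟩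
    refine ⟨𝓗 ∪ 𝓗', C + C', h1.union h1', by positivity, ?_, ?_⟩
    · rintro H (hH | hH)
      exacts [h3 H hH, h3' H hH]
    · rintro y (hy | hy) X hX
      · refine (h4 y hy X fun H hH => hX H (Or.inl hH)).trans ?_
        gcongr
        linarith
      · refine (h4' y hy X fun H hH => hX H (Or.inr hH)).trans ?_
        gcongr
        linarith
  · intro y hy
    obtain ⟨U, h, hU, hyU, hh, hs, hS⟩ := exists_submersion hN hy
    obtain ⟨r, hr, hrU⟩ := Metric.nhds_basis_closedBall.mem_iff.1 (hU.mem_nhds hyU)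
    let φ : ContDiffBump y := ⟨r / 2, r, half_pos hr, half_lt_self hr⟩
    set Q := fun z => (normalInverse (fderiv ℝ h z)).comp (fderiv ℝ h z) with hQ
    have hQc : ContDiffOn ℝ ∞ Q U :=
      (contDiffOn_normalInverse hU hh hs).clm_comp (hh.fderiv_of_isOpen hU (by simp))
    obtain ⟨C, hC⟩ := (isCompact_closedBall y r).exists_bound_of_continuousOn
      ((hQc.continuousOn_fderiv_of_isOpen hU (by simp)).mono hrU)
    have hC0 : 0 ≤ C := (norm_nonneg _).trans (hC y (Metric.mem_closedBall_self hr.le))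
    have hsub : tsupport φ ⊆ U := by
      rw [φ.tsupport_eq]
      exact hrU
    -- The functions are the components of the local submersion multiplied by a bump function. On
    -- the ball of radius `r / 2` the bump function is one, so the vanishing of their differentials
    -- on `X` says that `X` is tangent.
    refine ⟨Metric.ball y (r / 2) ∩ N, inter_mem (mem_nhdsWithin_of_mem_nhds (Metric.ball_mem_nhds y (half_pos hr))) self_mem_nhdsWithin,
      range fun i z => φ z * h z i, C, finite_range _, hC0, ?_, ?_⟩
    · rintro _ ⟨i, rfl⟩
      refine ⟨?_, φ.hasCompactSupport.mul_right, fun z hz => ?_⟩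
      · rw [contDiff_iff_contDiffAt]
        intro z
        by_cases hz : z ∈ tsupport φ
        · have hi : ContDiffAt ℝ ∞ (fun z => h z i) z :=
            (EuclideanSpace.proj (𝕜 := ℝ) i).contDiff.contDiffAt.comp z (hh.contDiffAt (hU.mem_nhds (hsub hz)))
          exact φ.contDiffAt.mul hi
        · refine contDiffAt_const (c := (0 : ℝ)) |>.congr_of_eventuallyEq ?_
          filter_upwards [(isClosed_tsupport φ).isOpen_compl.mem_nhds hz] with x hx
          rw [image_eq_zero_of_notMem_tsupport hx, zero_mul]
      · by_cases hzt : z ∈ tsupport φ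
        · simp [(hS z ⟨hz, hsub hzt⟩).1]
        · simp [image_eq_zero_of_notMem_tsupport hzt]
    · rintro z ⟨hzb, hzN⟩ X hX
      have hzU : z ∈ U := hrU (Metric.ball_subset_closedBall (Metric.ball_subset_ball (by linarith) hzb))
      have hX0 : fderiv ℝ h z X = 0 := by
        ext i
        have h1 := hX _ ⟨i, rfl⟩
        have h2 : (fun z => φ z * h z i) =ᶠ[𝓝 z] fun z => h z i := by
          filter_upwards [Metric.isOpen_ball.mem_nhds hzb] with x hx
          rw [φ.one_of_mem_closedBall (Metric.ball_subset_closedBall hx), one_mul]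
        rw [h2.fderiv_eq] at h1
        have h3 : HasFDerivAt (fun z => h z i) ((EuclideanSpace.proj (𝕜 := ℝ) i).comp (fderiv ℝ h z)) z :=
          (EuclideanSpace.proj (𝕜 := ℝ) i).hasFDerivAt.comp z
            ((hh.contDiffAt (hU.mem_nhds hzU)).differentiableAt (by simp)).hasFDerivAt
        rw [h3.fderiv] at h1
        exact h1
      refine (norm_secondFundamentalForm_le hU hh hs (fun z hz => (hS z hz).2) ⟨hzN, hzU⟩ hX0).trans ?_
      rw [mul_assoc, ← sq]
      exact mul_le_mul_of_nonneg_right (hC z (Metric.ball_subset_closedBall (Metric.ball_subset_ball (by linarith) hzb))) (sq_nonneg _)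

/-- There is a compactly supported smooth map that restricts to the identity on a given compact
submanifold and whose differential vanishes in the normal directions there. -/
theorem exists_normalProjection {L k : ℕ} {K : Set (Euc L)} (hKc : IsCompact K)
    (hK : IsSubmanifoldWithBoundary k K) :
    ∃ P : Fin L → Euc L → ℝ, ∀ a, ContDiff ℝ ∞ (P a) ∧ HasCompactSupport (P a) ∧
      ∀ y ∈ K, P a y = y a ∧
        ∀ ν, (∀ v ∈ tangentSpace K y, inner ℝ ν v = 0) → fderiv ℝ (P a) y ν = 0 := by
  -- For a family patched together from local pieces with total weight `σ`, the normal derivative is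
  -- that of `σ` times the coordinate. This form is stable under gluing and gives the claim where
  -- `σ` is constantly one.
  suffices ∃ (P : Fin L → Euc L → ℝ) (σ : Euc L → ℝ), ContDiff ℝ ∞ σ ∧
      (∀ y ∈ K, σ =ᶠ[𝓝 y] fun _ => 1) ∧ ∀ a, ContDiff ℝ ∞ (P a) ∧ HasCompactSupport (P a) ∧
      ∀ y ∈ K, P a y = σ y * y a ∧
        ∀ ν, (∀ v ∈ tangentSpace K y, inner ℝ ν v = 0) →
          fderiv ℝ (P a) y ν = fderiv ℝ σ y ν * y a by
    obtain ⟨P, σ, -, h2, h3⟩ := this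
    refine ⟨P, fun a => ⟨(h3 a).1, (h3 a).2.1, fun y hy => ⟨?_, fun ν hν => ?_⟩⟩⟩
    · rw [((h3 a).2.2 y hy).1, (h2 y hy).eq_of_nhds, one_mul]
    · rw [((h3 a).2.2 y hy).2 ν hν, (h2 y hy).fderiv_eq]
      simp
  refine hKc.induction_on (p := fun s => ∃ (P : Fin L → Euc L → ℝ) (σ : Euc L → ℝ), ContDiff ℝ ∞ σ ∧
      (∀ y ∈ s, σ =ᶠ[𝓝 y] fun _ => 1) ∧ ∀ a, ContDiff ℝ ∞ (P a) ∧ HasCompactSupport (P a) ∧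
      ∀ y ∈ K, P a y = σ y * y a ∧
        ∀ ν, (∀ v ∈ tangentSpace K y, inner ℝ ν v = 0) →
          fderiv ℝ (P a) y ν = fderiv ℝ σ y ν * y a) ?_ ?_ ?_ ?_
  · exact ⟨fun _ _ => 0, fun _ => 0, contDiff_const, by simp, fun a => ⟨contDiff_const,
      HasCompactSupport.zero, fun y _ => by simp⟩⟩
  · rintro s t hst ⟨P, σ, h1, h2, h3⟩
    exact ⟨P, σ, h1, fun y hy => h2 y (hst hy), h3⟩
  · rintro s t ⟨P, σ, h1, h2, h3⟩ ⟨P', σ', h1', h2', h3'⟩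
    -- The second piece is used with the weight left over by the first, so the total weight is one
    -- near both sets.
    refine ⟨fun a z => P a z + (1 - σ z) * P' a z, fun z => σ z + (1 - σ z) * σ' z,
      h1.add ((contDiff_const.sub h1).mul h1'), ?_, fun a =>
        ⟨(h3 a).1.add ((contDiff_const.sub h1).mul (h3' a).1),
          (h3 a).2.1.add (h3' a).2.1.mul_left, fun y hy => ⟨?_, fun ν hν => ?_⟩⟩⟩
    · rintro y (hy | hy)
      · filter_upwards [h2 y hy] with x hx
        rw [hx]
        ring
      · filter_upwards [h2' y hy] with x hx
        rw [hx]
        ring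
    · simp only [((h3 a).2.2 y hy).1, ((h3' a).2.2 y hy).1]
      ring
    · have d : ∀ {f : Euc L → ℝ}, ContDiff ℝ ∞ f → HasFDerivAt f (fderiv ℝ f y) y := fun hf =>
        (hf.differentiable (by simp) y).hasFDerivAt
      have e1 := (d (h3 a).1).add (((d h1).const_sub 1).mul (d (h3' a).1))
      have e2 := (d h1).add (((d h1).const_sub 1).mul (d h1'))
      rw [HasFDerivAt.fderiv (f := fun z => P a z + (1 - σ z) * P' a z) e1,
        HasFDerivAt.fderiv (f := fun z => σ z + (1 - σ z) * σ' z) e2]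
      simp only [add_apply, smul_apply, neg_apply, smul_eq_mul]
      rw [((h3 a).2.2 y hy).2 ν hν, ((h3' a).2.2 y hy).2 ν hν, ((h3' a).2.2 y hy).1]
      ring
  · intro y hy
    obtain ⟨U, h, hU, hyU, hh, hs, hS⟩ := exists_submersion hK hy
    obtain ⟨r, hr, hrU⟩ := Metric.nhds_basis_closedBall.mem_iff.1 (hU.mem_nhds hyU)
    let φ : ContDiffBump y := ⟨r / 2, r, half_pos hr, half_lt_self hr⟩
    have hsub : tsupport φ ⊆ U := by
      rw [φ.tsupport_eq]
      exact hrU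
    have hBc := contDiffOn_normalInverse hU hh hs
    set B := fun z => normalInverse (fderiv ℝ h z) with hB
    have hqc : ∀ a, ContDiffOn ℝ ∞ (fun z => (z - B z (h z)) a) U := fun a =>
      (EuclideanSpace.proj (𝕜 := ℝ) a).contDiff.comp_contDiffOn (contDiff_id.contDiffOn.sub (hBc.clm_apply hh))
    -- The local piece is `z - B(z) h(z)`, one Newton step towards the zero set of `h`. Where `h`
    -- vanishes its differential is `ν ↦ ν - B Dh ν`, the orthogonal projection to the tangent
    -- space, which annihilates normal vectors.
    refine ⟨Metric.ball y (r / 2), mem_nhdsWithin_of_mem_nhds (Metric.ball_mem_nhds y (half_pos hr)),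
      fun a z => φ z * (z - B z (h z)) a, φ, φ.contDiff, fun z hz => ?_, fun a =>
        ⟨?_, φ.hasCompactSupport.mul_right, fun z hz => ⟨?_, fun ν hν => ?_⟩⟩⟩
    · filter_upwards [Metric.isOpen_ball.mem_nhds hz] with x hx
      exact φ.one_of_mem_closedBall (Metric.ball_subset_closedBall hx)
    · rw [contDiff_iff_contDiffAt]
      intro z
      by_cases hz : z ∈ tsupport φ
      · exact φ.contDiffAt.mul ((hqc a).contDiffAt (hU.mem_nhds (hsub hz)))
      · refine contDiffAt_const (c := (0 : ℝ)) |>.congr_of_eventuallyEq ?_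
        filter_upwards [(isClosed_tsupport φ).isOpen_compl.mem_nhds hz] with x hx
        rw [image_eq_zero_of_notMem_tsupport hx, zero_mul]
    · by_cases hzt : z ∈ tsupport φ
      · simp [(hS z ⟨hz, hsub hzt⟩).1]
      · simp [image_eq_zero_of_notMem_tsupport hzt]
    · by_cases hzt : z ∈ tsupport φ
      · have hzU := hsub hzt
        obtain ⟨hz0, hzT⟩ := hS z ⟨hz, hzU⟩
        have d1 : HasFDerivAt φ (fderiv ℝ φ z) z := (φ.contDiff (n := 1).differentiable (by simp) z).hasFDerivAt
        have d2 : HasFDerivAt h (fderiv ℝ h z) z :=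
          ((hh.contDiffAt (hU.mem_nhds hzU)).differentiableAt (by simp)).hasFDerivAt
        have d3 : HasFDerivAt B (fderiv ℝ B z) z :=
          ((hBc.contDiffAt (hU.mem_nhds hzU)).differentiableAt (by simp)).hasFDerivAt
        have d4 := (EuclideanSpace.proj (𝕜 := ℝ) a).hasFDerivAt.comp z ((hasFDerivAt_id z).sub (d3.clm_apply d2))
        have d5 := d1.mul d4
        rw [HasFDerivAt.fderiv (f := fun z => φ z * (z - B z (h z)) a) d5]
        have hν0 : ν - B z (fderiv ℝ h z ν) = 0 := by
          rw [← starProjection_ker (hs z hzU) ν, Submodule.starProjection_apply_eq_zero_iff,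
            Submodule.mem_orthogonal', ← hzT]
          exact hν
        have hνa : ν a - (B z (fderiv ℝ h z ν)) a = 0 := congrArg (fun w : Euc L => w a) hν0
        simp [hz0, hνa, mul_comm]
      · have hev : ∀ᶠ x in 𝓝 z, φ x = 0 := by
          filter_upwards [(isClosed_tsupport φ).isOpen_compl.mem_nhds hzt] with x hx
          exact image_eq_zero_of_notMem_tsupport hx
        have e1 : (fun z => φ z * (z - B z (h z)) a) =ᶠ[𝓝 z] fun _ => 0 := by
          filter_upwards [hev] with x hx
          rw [hx, zero_mul]
        have e2 : φ =ᶠ[𝓝 z] fun _ => (0 : ℝ) := hev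
        rw [e1.fderiv_eq, e2.fderiv_eq]
        simp

/-! ### Chain rules up to the boundary -/

/-- `f` has the weak derivatives `f₁` and the trace `g` on the flat part of the boundary of the half
disk of radius two. -/
def HasTrace {F : Type*} [NormedAddCommGroup F] [NormedSpace ℝ F] (r : ℝ≥0∞) (f : Euc 2 → F)
    (f₁ : Fin 2 → Euc 2 → F) (g : ℝ → F) : Prop :=
  MemLp g r (volume.restrict (Ioo (-2) 2)) ∧
  ∃ w : ℕ → Euc 2 → F, (∀ m, ContDiff ℝ ∞ (w m)) ∧
    Tendsto (fun m => eLpNorm (fun x => w m x - f x) r (volume.restrict (openHalfDisk 2)))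
      atTop (𝓝 0) ∧
    (∀ i, Tendsto (fun m => eLpNorm (fun x => classicalPartial i (w m) x - f₁ i x) r
        (volume.restrict (openHalfDisk 2))) atTop (𝓝 0)) ∧
    Tendsto (fun m => eLpNorm (fun t => w m !₂[t, 0] - g t) r (volume.restrict (Ioo (-2) 2)))
      atTop (𝓝 0)

section Trace

variable {L : ℕ} {r : ℝ≥0∞} {f : Euc 2 → Euc L} {f₁ : Fin 2 → Euc 2 → Euc L} {g : ℝ → Euc L}

theorem continuous_classicalPartial {F : Type*} [NormedAddCommGroup F] [NormedSpace ℝ F]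
    {w : Euc 2 → F} (hw : ContDiff ℝ ∞ w) (i : Fin 2) : Continuous (classicalPartial i w) :=
  (hw.continuous_fderiv (by simp)).clm_apply continuous_const

theorem HasTrace.exists_approx (h : HasTrace r f f₁ g) (hr : 1 ≤ r)
    (hf : MemLp f r (volume.restrict (openHalfDisk 2)))
    (hf₁ : ∀ i, MemLp (f₁ i) r (volume.restrict (openHalfDisk 2))) :
    Integrable g (volume.restrict (Ioo (-2) 2)) ∧
    ∃ w : ℕ → Euc 2 → Euc L, (∀ m, ContDiff ℝ 1 (w m)) ∧
    Tendsto (fun m => eLpNorm (fun x => w m x - f x) 1 (volume.restrict (openHalfDisk 2)))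
      atTop (𝓝 0) ∧
    (∀ i, Tendsto (fun m => eLpNorm (fun x => classicalPartial i (w m) x - f₁ i x) 1
        (volume.restrict (openHalfDisk 2))) atTop (𝓝 0)) ∧
    Tendsto (fun m => eLpNorm (fun t => w m !₂[t, 0] - g t) 1 (volume.restrict (Ioo (-2) 2)))
      atTop (𝓝 0) := by
  obtain ⟨hg, w, hw, c0, c1, cT⟩ := h
  refine ⟨hg.integrable hr, w, fun m => (hw m).of_le (by simp), tendsto_eLpNorm_one hr (fun m => ?_) c0,
    fun i => tendsto_eLpNorm_one hr (fun m => ?_) (c1 i), tendsto_eLpNorm_one hr (fun m => ?_) cT⟩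
  · exact (hw m).continuous.aestronglyMeasurable.sub hf.1
  · exact (continuous_classicalPartial (hw m) i).aestronglyMeasurable.sub (hf₁ i).1
  · refine ((hw m).continuous.comp (?_ : Continuous fun t : ℝ => (!₂[t, 0] : Euc 2))).aestronglyMeasurable.sub hg.1
    exact continuous_mk.comp (continuous_id.prodMk continuous_const)

variable (h : HasTrace r f f₁ g) (hr : 1 ≤ r) (hf : MemLp f r (volume.restrict (openHalfDisk 2)))
    (hf₁ : ∀ i, MemLp (f₁ i) r (volume.restrict (openHalfDisk 2)))
    {Ψ : Euc L → ℝ} (hΨ : ContDiff ℝ 1 Ψ) {M : ℝ} (hM : ∀ z, ‖fderiv ℝ Ψ z‖ ≤ M)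

include h hr hf hf₁ hΨ hM

theorem HasTrace.integral_comp (i : Fin 2) {ψ : Euc 2 → ℝ} (hψ : IsTest ψ) :
    ∫ x in openHalfDisk 2, (pd i ψ x * Ψ (f x) + ψ x * fderiv ℝ Ψ (f x) (f₁ i x)) =
      if i = 0 then 0 else -∫ t in Ioo (-2 : ℝ) 2, ψ !₂[t, 0] * Ψ (g t) := by
  obtain ⟨hg, w, hw, c0, c1, cT⟩ := h.exists_approx hr hf hf₁
  exact green_comp hΨ hM hw (hf.integrable hr) ((hf₁ i).integrable hr) hg c0 (c1 i) cT hψ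

theorem HasTrace.green_of_boundary (i : Fin 2) {ψ : Euc 2 → ℝ} (hψ : IsTest ψ)
    (h0 : i = 0 ∨ ∫ t in Ioo (-2 : ℝ) 2, ψ !₂[t, 0] * Ψ (g t) = 0) :
    Green i (fun x => Ψ (f x)) (fun x => fderiv ℝ Ψ (f x) (f₁ i x)) ψ := by
  have h1 := h.integral_comp hr hf hf₁ hΨ hM i hψ
  rw [integral_add ((hψ.pd i).integrable_mul (integrable_comp_of_fderiv_le hΨ hM (hf.integrable hr)))
    (hψ.integrable_mul (integrable_fderiv_comp hΨ hM hf.1 ((hf₁ i).integrable hr)))] at h1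
  have h2 : (if i = 0 then (0 : ℝ) else -∫ t in Ioo (-2 : ℝ) 2, ψ !₂[t, 0] * Ψ (g t)) = 0 := by
    split_ifs with hi
    · rfl
    · rw [h0.resolve_left hi, neg_zero]
  rw [h2] at h1
  exact eq_neg_of_add_eq_zero_left h1

theorem HasTrace.weakDeriv_comp (i : Fin 2) :
    WeakDeriv (openHalfDisk 2) i (fun x => Ψ (f x)) (fun x => fderiv ℝ Ψ (f x) (f₁ i x)) := by
  refine weakDeriv_iff_green.2 fun φ h1 h2 h3 => ?_
  refine h.green_of_boundary hr hf hf₁ hΨ hM i (IsTest.of_tsupport_subset h1 h3) (Or.inr ?_)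
  have : ∀ t : ℝ, φ !₂[t, 0] = 0 := fun t => image_eq_zero_of_notMem_tsupport fun ht => by
    have := (h3 ht).2
    simp at this
  simp [this]

/-- The weak derivative of the zero function is zero. With defining functions of `N` in place of `Ψ`
this shows that the partial derivatives of `u` are tangent to `N` almost everywhere. -/
theorem HasTrace.ae_fderiv_eq_zero (i : Fin 2)
    (h0 : ∀ᵐ x ∂(volume.restrict (openHalfDisk 2)), Ψ (f x) = 0) :
    ∀ᵐ x ∂(volume.restrict (openHalfDisk 2)), fderiv ℝ Ψ (f x) (f₁ i x) = 0 := by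
  have hi := integrable_fderiv_comp hΨ hM hf.1 ((hf₁ i).integrable hr)
  have key := (isOpen_openHalfDisk 2).ae_eq_zero_of_integral_contDiff_smul_eq_zero
    (f := fun x => fderiv ℝ Ψ (f x) (f₁ i x))
    (locallyIntegrableOn_of_locallyIntegrable_restrict hi.locallyIntegrable) (fun φ h1 h2 h3 => by
      have e : Green i (fun x => Ψ (f x)) (fun x => fderiv ℝ Ψ (f x) (f₁ i x)) φ :=
        weakDeriv_iff_green.1 (h.weakDeriv_comp hr hf hf₁ hΨ hM i) φ h1 h2 h3
      have e2 : ∫ x in openHalfDisk 2, pd i φ x * Ψ (f x) = 0 := by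
        refine integral_eq_zero_of_ae ?_
        filter_upwards [h0] with x hx
        simp [hx]
      rw [Green, e2, eq_comm, neg_eq_zero] at e
      rw [← setIntegral_eq_integral_of_forall_compl_eq_zero (s := openHalfDisk 2) fun x hx => by
        rw [image_eq_zero_of_notMem_tsupport fun hx2 => hx (h3 hx2), zero_smul]]
      exact e)
  rw [ae_restrict_iff' (isOpen_openHalfDisk 2).measurableSet]
  exact key

end Trace

theorem WeakDeriv.finsetSum {ι : Type*} {s : Finset ι} {i : Fin 2} {f g : ι → Euc 2 → ℝ}
    (h : ∀ c ∈ s, WeakDeriv (openHalfDisk 2) i (f c) (g c))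
    (hf : ∀ c ∈ s, Integrable (f c) (volume.restrict (openHalfDisk 2)))
    (hg : ∀ c ∈ s, Integrable (g c) (volume.restrict (openHalfDisk 2))) :
    WeakDeriv (openHalfDisk 2) i (fun x => ∑ c ∈ s, f c x) (fun x => ∑ c ∈ s, g c x) := by
  refine weakDeriv_iff_green.2 fun φ h1 h2 h3 => ?_
  have ht := IsTest.of_tsupport_subset h1 h3
  simp only [Green, Finset.mul_sum]
  rw [integral_finsetSum _ fun c hc => (ht.pd i).integrable_mul (hf c hc),
    integral_finsetSum _ fun c hc => ht.integrable_mul (hg c hc), ← Finset.sum_neg_distrib]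
  exact Finset.sum_congr rfl fun c hc => weakDeriv_iff_green.1 (h c hc) φ h1 h2 h3

theorem Green.sub {i : Fin 2} {f g f' g' ψ : Euc 2 → ℝ} (hψ : IsTest ψ) (h : Green i f g ψ)
    (h' : Green i f' g' ψ)
    (hf : Integrable f (volume.restrict (openHalfDisk 2)))
    (hg : Integrable g (volume.restrict (openHalfDisk 2)))
    (hf' : Integrable f' (volume.restrict (openHalfDisk 2)))
    (hg' : Integrable g' (volume.restrict (openHalfDisk 2))) :
    Green i (fun x => f x - f' x) (fun x => g x - g' x) ψ := by
  simp only [Green, mul_sub] at h h' ⊢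
  rw [integral_sub ((hψ.pd i).integrable_mul hf) ((hψ.pd i).integrable_mul hf'),
    integral_sub (hψ.integrable_mul hg) (hψ.integrable_mul hg'), h, h']
  ring

theorem WeakDeriv.sub {i : Fin 2} {f g f' g' : Euc 2 → ℝ} (h : WeakDeriv (openHalfDisk 2) i f g)
    (h' : WeakDeriv (openHalfDisk 2) i f' g')
    (hf : Integrable f (volume.restrict (openHalfDisk 2)))
    (hg : Integrable g (volume.restrict (openHalfDisk 2)))
    (hf' : Integrable f' (volume.restrict (openHalfDisk 2)))
    (hg' : Integrable g' (volume.restrict (openHalfDisk 2))) :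
    WeakDeriv (openHalfDisk 2) i (fun x => f x - f' x) (fun x => g x - g' x) :=
  weakDeriv_iff_green.2 fun φ h1 h2 h3 =>
    (weakDeriv_iff_green.1 h φ h1 h2 h3).sub (IsTest.of_tsupport_subset h1 h3)
      (weakDeriv_iff_green.1 h' φ h1 h2 h3) hf hg hf' hg'

/-- A map of the half disk of radius two with its weak derivatives of first and second order and
the boundary values of the map and of its outward normal derivative. -/
structure HalfDiskMap {L : ℕ} (r : ℝ≥0∞) (u : Euc 2 → Euc L) (u₁ : Fin 2 → Euc 2 → Euc L)
    (u₂ : Fin 2 → Fin 2 → Euc 2 → Euc L) (b d : ℝ → Euc L) : Prop where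
  memLp : MemLp u r (volume.restrict (openHalfDisk 2))
  memLp₁ : ∀ i, MemLp (u₁ i) r (volume.restrict (openHalfDisk 2))
  memLp₂ : ∀ i j, MemLp (u₂ i j) r (volume.restrict (openHalfDisk 2))
  memLp_two : ∀ i, MemLp (u₁ i) 2 (volume.restrict (openHalfDisk 2))
  weakDeriv : ∀ i a, WeakDeriv (openHalfDisk 2) i (fun x => u x a) (fun x => u₁ i x a)
  weakDeriv₂ : ∀ i j a, WeakDeriv (openHalfDisk 2) i (fun x => u₁ j x a) (fun x => u₂ i j x a)
  hasTrace : HasTrace r u u₁ b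
  hasTrace₁ : HasTrace r (fun x => -u₁ 1 x) (fun i x => -u₂ i 1 x) d

section Composition

variable {L : ℕ} {X : Type*} [MeasurableSpace X] {μ : Measure X} {r : ℝ≥0∞} {P : Euc L → ℝ} {M : ℝ}

theorem memLp_fderiv_comp (hP : ContDiff ℝ ∞ P) (hM : ∀ y, ‖fderiv ℝ P y‖ ≤ M) {u v : X → Euc L}
    (hu : AEStronglyMeasurable u μ) (hv : MemLp v r μ) :
    MemLp (fun x => fderiv ℝ P (u x) (v x)) r μ := by
  refine hv.of_le_mul (c := M) (isBoundedBilinearMap_apply.continuous.comp_aestronglyMeasurable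
    (((hP.continuous_fderiv (by simp)).comp_aestronglyMeasurable hu).prodMk hv.1)) (.of_forall fun x => ?_)
  exact (fderiv ℝ P (u x)).le_of_opNorm_le (hM _) _

theorem contDiff_fderiv_apply (hP : ContDiff ℝ ∞ P) (w : Euc L) :
    ContDiff ℝ ∞ (fun z => fderiv ℝ P z w) :=
  (hP.fderiv_right (m := ∞) (by simp)).clm_apply contDiff_const

theorem fderiv_fderiv_apply (hP : ContDiff ℝ ∞ P) (w z v : Euc L) :
    fderiv ℝ (fun z => fderiv ℝ P z w) z v = fderiv ℝ (fderiv ℝ P) z v w := by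
  have h := ((hP.fderiv_right (m := ∞) (by simp)).differentiable (by simp) z).hasFDerivAt
  rw [(h.clm_apply (hasFDerivAt_const w z)).fderiv]
  simp

theorem clm_apply_eq_sum (A : Euc L →L[ℝ] ℝ) (v : Euc L) :
    A v = ∑ c, A (EuclideanSpace.single c 1) * v c := by
  conv_lhs => rw [← (EuclideanSpace.basisFun (Fin L) ℝ).sum_repr v]
  simp [map_sum, mul_comm]

end Composition

namespace HalfDiskMap

variable {L : ℕ} {r : ℝ≥0∞} {u : Euc 2 → Euc L} {u₁ : Fin 2 → Euc 2 → Euc L}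
    {u₂ : Fin 2 → Fin 2 → Euc 2 → Euc L} {b d : ℝ → Euc L} {P : Euc L → ℝ}

/-- The second derivative of a composition. -/
def compDeriv₂ (P : Euc L → ℝ) (u : Euc 2 → Euc L) (u₁ : Fin 2 → Euc 2 → Euc L)
    (u₂ : Fin 2 → Fin 2 → Euc 2 → Euc L) (i : Fin 2) (x : Euc 2) : ℝ :=
  fderiv ℝ (fderiv ℝ P) (u x) (u₁ i x) (u₁ i x) + fderiv ℝ P (u x) (u₂ i i x)

theorem compDeriv₂_eq_sum (hP : ContDiff ℝ ∞ P) (i : Fin 2) (x : Euc 2) :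
    compDeriv₂ P u u₁ u₂ i x = ∑ c, (fderiv ℝ (fun z => fderiv ℝ P z (EuclideanSpace.single c 1))
      (u x) (u₁ i x) * u₁ i x c + fderiv ℝ P (u x) (EuclideanSpace.single c 1) * u₂ i i x c) := by
  simp only [fderiv_fderiv_apply hP]
  rw [Finset.sum_add_distrib, ← clm_apply_eq_sum, ← clm_apply_eq_sum, compDeriv₂]

variable (h : HalfDiskMap r u u₁ u₂ b d) (hr : 1 ≤ r) (hP : ContDiff ℝ ∞ P)
  (hPc : HasCompactSupport P)

include h hr hP hPc

/-- In coordinates `DP(u) ∂ᵢu` is a sum of products. One factor is bounded with derivative in `L²`,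
the other is in `L²` with integrable derivative, as `WeakDeriv.mul` requires. The square
integrability of the gradient is what makes the quadratic term integrable. -/
theorem integrable_and_weakDeriv_comp (i : Fin 2) :
    Integrable (compDeriv₂ P u u₁ u₂ i) (volume.restrict (openHalfDisk 2)) ∧
    WeakDeriv (openHalfDisk 2) i (fun x => fderiv ℝ P (u x) (u₁ i x)) (compDeriv₂ P u u₁ u₂ i) := by
  obtain ⟨M, hM0, hM1, hM2⟩ := exists_fderiv_bound hP hPc
  have hA : ∀ c : Fin L, ∀ z, ‖fderiv ℝ P z (EuclideanSpace.single c 1)‖ ≤ M := fun c z => by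
    simpa using (fderiv ℝ P z).le_of_opNorm_le (hM1 z) (EuclideanSpace.single c 1)
  have hA' : ∀ c : Fin L, ∀ z, ‖fderiv ℝ (fun z => fderiv ℝ P z (EuclideanSpace.single c 1)) z‖ ≤ M :=
    fun c z => ContinuousLinearMap.opNorm_le_bound _ hM0 fun v => by
      rw [fderiv_fderiv_apply hP]
      simpa using hM2 z v (EuclideanSpace.single c 1)
  have hQ := fun c : Fin L => contDiff_fderiv_apply hP (EuclideanSpace.single c 1)
  have comp : ∀ {r : ℝ≥0∞} {v : Euc 2 → Euc L}, MemLp v r (volume.restrict (openHalfDisk 2)) → ∀ c,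
      MemLp (fun x => v x c) r (volume.restrict (openHalfDisk 2)) := fun hv c =>
    (EuclideanSpace.proj (𝕜 := ℝ) c).comp_memLp' hv
  have m1 : ∀ c : Fin L, MemLp (fun x => fderiv ℝ P (u x) (EuclideanSpace.single c 1)) ⊤
      (volume.restrict (openHalfDisk 2)) := fun c =>
    memLp_top_of_bound ((hQ c).continuous.comp_aestronglyMeasurable h.memLp.1) M
      (.of_forall fun x => hA c _)
  have m2 : ∀ c : Fin L, MemLp (fun x => fderiv ℝ (fun z => fderiv ℝ P z (EuclideanSpace.single c 1))
      (u x) (u₁ i x)) 2 (volume.restrict (openHalfDisk 2)) := fun c =>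
    memLp_fderiv_comp (hQ c) (hA' c) h.memLp.1 (h.memLp_two i)
  have m3 := fun c => (comp (h.memLp_two i) c)
  have m4 := fun c => (comp (h.memLp₂ i i) c).integrable hr
  have w := fun c : Fin L => (h.hasTrace.weakDeriv_comp hr h.memLp h.memLp₁ ((hQ c).of_le (by simp)) (hA' c) i).mul
    (h.weakDeriv₂ i i c) (m1 c) (m2 c) (m3 c) (m4 c)
  have i1 : ∀ c : Fin L, Integrable (fun x => fderiv ℝ P (u x) (EuclideanSpace.single c 1) * u₁ i x c)
      (volume.restrict (openHalfDisk 2)) := fun c =>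
    ((m3 c).integrable (by norm_num)).bdd_mul (m1 c).1 (.of_forall fun x => hA c _)
  have i2 : ∀ c : Fin L, Integrable (fun x => fderiv ℝ (fun z => fderiv ℝ P z (EuclideanSpace.single c 1))
      (u x) (u₁ i x) * u₁ i x c + fderiv ℝ P (u x) (EuclideanSpace.single c 1) * u₂ i i x c)
      (volume.restrict (openHalfDisk 2)) := fun c =>
    ((m2 c).integrable_mul (m3 c)).add ((m4 c).bdd_mul (m1 c).1 (.of_forall fun x => hA c _))
  have e := WeakDeriv.finsetSum (s := Finset.univ) (fun c _ => w c) (fun c _ => i1 c) (fun c _ => i2 c)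
  have e1 : compDeriv₂ P u u₁ u₂ i = _ := funext (compDeriv₂_eq_sum hP i)
  rw [e1]
  refine ⟨integrable_finsetSum _ fun c _ => i2 c, ?_⟩
  simp only [← clm_apply_eq_sum] at e
  exact e

/-- The tangential derivative never sees the flat boundary. For the normal one `green_neumann` is
applied to `v = -∂u/∂x²`, whose trace is `d`. -/
theorem green_comp₂ (hbd : ∀ᵐ t ∂(volume.restrict (Ioo (-2 : ℝ) 2)), fderiv ℝ P (b t) (d t) = 0)
    (i : Fin 2) {ψ : Euc 2 → ℝ} (hψ : IsTest ψ) :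
    Green i (fun x => fderiv ℝ P (u x) (u₁ i x)) (compDeriv₂ P u u₁ u₂ i) ψ := by
  obtain ⟨M, hM0, hM1, hM2⟩ := exists_fderiv_bound hP hPc
  obtain rfl | rfl : i = 0 ∨ i = 1 := by fin_cases i <;> simp
  · obtain ⟨h1, h2⟩ := h.integrable_and_weakDeriv_comp hr hP hPc 0
    exact h2.green ((memLp_fderiv_comp hP hM1 h.memLp.1 (h.memLp₁ 0)).integrable hr) h1 hψ (Or.inl rfl)
  · obtain ⟨hb, W, hW, c0, c1, cT⟩ := h.hasTrace.exists_approx hr h.memLp h.memLp₁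
    obtain ⟨hd, V, hV, d0, d1, dT⟩ := h.hasTrace₁.exists_approx hr (h.memLp₁ 1).neg
      fun i => (h.memLp₂ i 1).neg
    have := green_neumann hP hPc hW hV (h.memLp.integrable hr) (h.memLp_two 1) (h.memLp_two 1).neg
      ((h.memLp₂ 1 1).neg.integrable hr) hb hd c0 d0 (c1 1) (d1 1) cT dT hbd hψ
    simp only [Green, Pi.neg_apply, map_neg, mul_neg, mul_add, ← neg_add, integral_neg] at this
    simp only [Green, compDeriv₂, mul_add]
    linarith

end HalfDiskMap

/-! ### Estimates for maps of the half disk -/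

section Components

variable {L : ℕ} {X : Type*} [MeasurableSpace X] {μ : Measure X} {r : ℝ≥0∞}

theorem eLpNorm_component_le (v : X → Euc L) (a : Fin L) :
    eLpNorm (fun x => v x a) r μ ≤ eLpNorm v r μ :=
  eLpNorm_mono fun x => PiLp.norm_apply_le (v x) a

theorem norm_le_sum_component (v : Euc L) : ‖v‖ ≤ ∑ a, ‖v a‖ := by
  conv_lhs => rw [← (EuclideanSpace.basisFun (Fin L) ℝ).sum_repr v]
  refine (norm_sum_le _ _).trans_eq (Finset.sum_congr rfl fun a _ => ?_)
  rw [norm_smul]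
  simp

theorem eLpNorm_le_sum_component (hr : 1 ≤ r) {v : X → Euc L} (hv : AEStronglyMeasurable v μ) :
    eLpNorm v r μ ≤ ∑ a, eLpNorm (fun x => v x a) r μ := by
  refine (eLpNorm_mono_real (g := ∑ a, fun x => ‖v x a‖) fun x => ?_).trans
    ((eLpNorm_sum_le (fun a _ => ?_) hr).trans_eq (Finset.sum_congr rfl fun a _ => eLpNorm_norm _))
  · simpa using norm_le_sum_component (v x)
  · exact ((EuclideanSpace.proj (𝕜 := ℝ) a).continuous.comp_aestronglyMeasurable hv).norm

theorem memLp_component {v : X → Euc L} (hv : MemLp v r μ) (a : Fin L) :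
    MemLp (fun x => v x a) r μ :=
  (EuclideanSpace.proj (𝕜 := ℝ) a).comp_memLp' hv

theorem setAverage_component {s : Set X} {v : X → Euc L} (hv : IntegrableOn v s μ) (a : Fin L) :
    (⨍ x in s, v x ∂μ) a = ⨍ x in s, v x a ∂μ := by
  rw [setAverage_eq, setAverage_eq, PiLp.smul_apply]
  congr 1
  exact ((EuclideanSpace.proj (𝕜 := ℝ) a).integral_comp_comm hv).symm

end Components

theorem restrict_openHalfDisk_le {s : ℝ} (hs : s ≤ 2) :
    (volume : Measure (Euc 2)).restrict (openHalfDisk s) ≤ volume.restrict (openHalfDisk 2) :=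
  Measure.restrict_mono_set _ (openHalfDisk_subset hs)

theorem exists_poincare_map (L : ℕ) {p : ℝ} (hp1 : 1 < p) :
    ∃ C : ℝ≥0, ∀ (u : Euc 2 → Euc L) (u₁ : Fin 2 → Euc 2 → Euc L) (b : ℝ → Euc L),
      MemLp u (ENNReal.ofReal p) (volume.restrict (openHalfDisk 2)) →
      (∀ i, MemLp (u₁ i) (ENNReal.ofReal p) (volume.restrict (openHalfDisk 2))) →
      HasTrace (ENNReal.ofReal p) u u₁ b →
      eLpNorm (fun x => u x - ⨍ y in openHalfDisk 1, u y) (ENNReal.ofReal p)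
          (volume.restrict (openHalfDisk 1)) ≤
        C * ∑ i, eLpNorm (u₁ i) (ENNReal.ofReal p) (volume.restrict (openHalfDisk 1)) := by
  obtain ⟨C, hC⟩ := exists_poincare hp1
  have hr : 1 ≤ ENNReal.ofReal p := by
    rw [← ENNReal.ofReal_one]
    exact ENNReal.ofReal_le_ofReal hp1.le
  refine ⟨L * C, fun u u₁ b hu hu₁ ⟨_, w, hw, c0, c1, _⟩ => ?_⟩
  have hm := restrict_openHalfDisk_le (s := 1) (by norm_num)
  have hu' := hu.mono_measure hm
  have hu₁' := fun i => (hu₁ i).mono_measure hm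
  have sq0 : ∀ {F : ℕ → Euc 2 → Euc L} (a : Fin L), Tendsto (fun m => eLpNorm (F m) (ENNReal.ofReal p)
      (volume.restrict (openHalfDisk 2))) atTop (𝓝 0) → Tendsto (fun m => eLpNorm (fun x => F m x a)
      (ENNReal.ofReal p) (volume.restrict (openHalfDisk 1))) atTop (𝓝 0) := fun a hF =>
    tendsto_of_tendsto_of_tendsto_of_le_of_le tendsto_const_nhds hF (fun _ => zero_le)
      fun m => (eLpNorm_component_le _ a).trans (eLpNorm_mono_measure _ hm)
  have hcomp : ∀ a : Fin L, eLpNorm (fun x => u x a - ⨍ y in openHalfDisk 1, u y a) (ENNReal.ofReal p)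
          (volume.restrict (openHalfDisk 1)) ≤
        C * ∑ i, eLpNorm (u₁ i) (ENNReal.ofReal p) (volume.restrict (openHalfDisk 1)) := by
    intro a
    refine (hC (fun x => u x a) (fun i x => u₁ i x a) (fun m x => w m x a)
      (fun m => contDiff_euclidean.1 (hw m) a) (memLp_component hu' a)
      (fun i => (memLp_component (hu₁' i) a).1) (sq0 (F := fun m x => w m x - u x) a c0) fun i => ?_).trans ?_
    · refine (sq0 (F := fun m x => classicalPartial i (w m) x - u₁ i x) a (c1 i)).congr fun m => ?_
      congr 1
      ext x
      have h1 : HasFDerivAt (fun x => w m x a) ((EuclideanSpace.proj (𝕜 := ℝ) a).comp (fderiv ℝ (w m) x)) x :=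
        (EuclideanSpace.proj (𝕜 := ℝ) a).hasFDerivAt.comp x ((hw m).differentiable (by simp) x).hasFDerivAt
      rw [pd, h1.fderiv]
      rfl
    · gcongr with i
      exact eLpNorm_component_le _ a
  refine (eLpNorm_le_sum_component hr (hu'.1.sub aestronglyMeasurable_const)).trans ?_
  refine (Finset.sum_le_sum fun a _ => ?_).trans_eq
    (b := ∑ _a : Fin L, C * ∑ i, eLpNorm (u₁ i) (ENNReal.ofReal p) (volume.restrict (openHalfDisk 1))) ?_
  · simp only [Pi.sub_apply, PiLp.sub_apply, setAverage_component (hu'.integrable hr)]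
    exact hcomp a
  · simp [mul_assoc]

theorem abs_chi_le (x : Euc 2) : ‖chi x‖ ≤ (1 : ℝ≥0) := by
  rw [Real.norm_of_nonneg (chi_nonneg x)]
  exact Real.smoothTransition.le_one _

theorem eLpNorm_one_le {r : ℝ≥0∞} (hr : 1 ≤ r) :
    ∃ C : ℝ≥0, ∀ (s : ℝ) (_ : s ≤ 2) {F : Type} [NormedAddCommGroup F] (f : Euc 2 → F),
      AEStronglyMeasurable f (volume.restrict (openHalfDisk s)) →
      eLpNorm f 1 (volume.restrict (openHalfDisk s)) ≤ C * eLpNorm f r (volume.restrict (openHalfDisk s)) := by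
  have hexp : 0 ≤ 1 / (1 : ℝ≥0∞).toReal - 1 / r.toReal := by
    rw [ENNReal.toReal_one, div_one, sub_nonneg]
    rcases eq_or_ne r ⊤ with rfl | hrt
    · simp
    · rw [div_le_one (ENNReal.toReal_pos (by positivity) hrt), ← ENNReal.toReal_one]
      exact ENNReal.toReal_mono hrt hr
  have hne := ENNReal.rpow_ne_top_of_nonneg hexp (measure_ne_top (volume.restrict (openHalfDisk 2)) univ)
  refine ⟨((volume.restrict (openHalfDisk 2) univ) ^ (1 / (1 : ℝ≥0∞).toReal - 1 / r.toReal)).toNNReal,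
    fun s hs F _ f hf => ?_⟩
  rw [ENNReal.coe_toNNReal hne, mul_comm]
  refine (eLpNorm_le_eLpNorm_mul_rpow_measure_univ hr hf).trans ?_
  gcongr
  exact openHalfDisk_subset hs

theorem add_le_mul_of_le {a b Y : ℝ≥0∞} {C D : ℝ≥0} (ha : a ≤ C * Y) (hb : b ≤ D * Y) :
    a + b ≤ (C + D : ℝ≥0) * Y := by
  rw [ENNReal.coe_add, add_mul]
  exact add_le_add ha hb

/-- The quadratic term. -/
theorem exists_quadratic_le (L : ℕ) {p : ℝ} (hp1 : 1 < p) (hp2 : p ≤ 2) :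
    ∃ C : ℝ≥0, ∀ (u : Euc 2 → Euc L) (u₁ : Fin 2 → Euc 2 → Euc L)
      (u₂ : Fin 2 → Fin 2 → Euc 2 → Euc L) (b d : ℝ → Euc L) (ε : ℝ≥0∞),
      HalfDiskMap (ENNReal.ofReal p) u u₁ u₂ b d →
      (∀ i, eLpNorm (u₁ i) 2 (volume.restrict (openHalfDisk 2)) ≤ ε) →
      eLpNorm (fun x => chi x * ∑ i, ‖u₁ i x‖ ^ 2) (ENNReal.ofReal p) (volume.restrict (openHalfDisk 2)) ≤
        C * (ε * (∑ a, ∑ i, ∑ j, eLpNorm (fun x => chi x * u₂ i j x a) (ENNReal.ofReal p)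
            (volume.restrict (openHalfDisk 2)) +
          ∑ i, eLpNorm (u₁ i) (ENNReal.ofReal p) (volume.restrict (openHalfDisk 1)))) := by
  obtain ⟨C, hC⟩ := exists_halfDisk_mul_sq_le hp1 hp2 isTest_chi tsupport_chi_subset chi_reflect
  have hr : 1 ≤ ENNReal.ofReal p := by
    rw [← ENNReal.ofReal_one]
    exact ENNReal.ofReal_le_ofReal hp1.le
  refine ⟨2 * L * C, fun u u₁ u₂ b d ε h hε => ?_⟩
  set X := ∑ a, ∑ i, ∑ j, eLpNorm (fun x => chi x * u₂ i j x a) (ENNReal.ofReal p)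
            (volume.restrict (openHalfDisk 2)) with hX
  set G := ∑ i, eLpNorm (u₁ i) (ENNReal.ofReal p) (volume.restrict (openHalfDisk 1)) with hG
  have key : ∀ (i : Fin 2) (a : Fin L), eLpNorm (fun x => chi x * u₁ i x a ^ 2) (ENNReal.ofReal p)
      (volume.restrict (openHalfDisk 2)) ≤ C * (ε * (X + G)) := by
    intro i a
    refine (hC (fun x => u₁ i x a) (fun j x => u₂ j i x a) (memLp_component (h.memLp_two i) a)
      (fun j => memLp_component (h.memLp₂ j i) a) fun j => h.weakDeriv₂ j i a).trans ?_
    rw [mul_assoc]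
    refine mul_le_mul_right (mul_le_mul' ((eLpNorm_component_le _ a).trans (hε i)) (add_le_add ?_ ?_)) _
    · refine le_trans (Finset.sum_le_sum fun j _ => ?_) (Finset.single_le_sum (f := fun a => ∑ i, ∑ j,
        eLpNorm (fun x => chi x * u₂ i j x a) (ENNReal.ofReal p)
            (volume.restrict (openHalfDisk 2))) (fun _ _ => zero_le) (Finset.mem_univ a))
      exact Finset.single_le_sum (f := fun i => eLpNorm (fun x => chi x * u₂ j i x a) (ENNReal.ofReal p)
            (volume.restrict (openHalfDisk 2))) (fun _ _ => zero_le) (Finset.mem_univ i)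
    · exact (eLpNorm_component_le _ a).trans (Finset.single_le_sum (f := fun i => eLpNorm (u₁ i)
        (ENNReal.ofReal p) (volume.restrict (openHalfDisk 1))) (fun _ _ => zero_le) (Finset.mem_univ i))
  have e : (fun x => chi x * ∑ i, ‖u₁ i x‖ ^ 2) = ∑ ia : Fin 2 × Fin L, fun x => chi x * u₁ ia.1 x ia.2 ^ 2 := by
    ext x
    rw [Finset.sum_apply, Fintype.sum_prod_type, Finset.mul_sum]
    refine Finset.sum_congr rfl fun i _ => ?_
    rw [EuclideanSpace.norm_sq_eq, Finset.mul_sum]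
    simp
  rw [e]
  refine (eLpNorm_sum_le (fun ia _ => ?_) hr).trans ((Finset.sum_le_sum fun ia _ => key ia.1 ia.2).trans_eq ?_)
  · exact contDiff_chi.continuous.aestronglyMeasurable.mul ((memLp_component (h.memLp_two ia.1) ia.2).1.pow 2)
  · simp [mul_assoc]

/-- The boundary values of a map and of its normal derivative are adapted to `P`. -/
def AdaptedBoundary {L : ℕ} (P : Fin L → Euc L → ℝ) (b d : ℝ → Euc L) : Prop :=
  ∀ᵐ t ∂(volume.restrict (Ioo (-2 : ℝ) 2)), ∀ a, P a (b t) = b t a ∧ fderiv ℝ (P a) (b t) (d t) = 0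

theorem weakDeriv_const (i : Fin 2) (c : ℝ) :
    WeakDeriv (openHalfDisk 2) i (fun _ => c) (fun _ => (0 : ℝ)) := by
  refine weakDeriv_iff_green.2 fun φ h1 _ h3 => ?_
  have h0 : ∀ t : ℝ, φ !₂[t, 0] = 0 := fun t => image_eq_zero_of_notMem_tsupport fun ht => by
    have := (h3 ht).2
    simp at this
  rw [Green, integral_mul_const, setIntegral_openHalfDisk_pd (h1.of_le (by simp)) (IsTest.of_tsupport_subset h1 h3).2]
  simp [h0]

/-- Here `f = P(u) - P(m)` and `g = u - P(u)` in `exists_halfDisk_estimate`, with `m` the mean of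
`u`. A Neumann condition tolerates the subtraction of a constant, a Dirichlet condition does not. So
the Poincaré inequality controls `f` directly but `g` only up to the constant `m - P(m)`, and it is
the zero trace of `g` that makes this constant small. -/
theorem exists_component_hessian_le {L : ℕ} {p : ℝ} (hp1 : 1 < p) (hp2 : p ≤ 2) {P : Fin L → Euc L → ℝ}
    (hP : ∀ a, ContDiff ℝ ∞ (P a)) (hPc : ∀ a, HasCompactSupport (P a)) (A : ℝ≥0) (a : Fin L) :
    ∃ C : ℝ≥0, ∀ (u τ : Euc 2 → Euc L) (u₁ : Fin 2 → Euc 2 → Euc L)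
      (u₂ : Fin 2 → Fin 2 → Euc 2 → Euc L) (b d : ℝ → Euc L),
      HalfDiskMap (ENNReal.ofReal p) u u₁ u₂ b d → AdaptedBoundary P b d →
      AEStronglyMeasurable τ (volume.restrict (openHalfDisk 2)) →
      (∀ᵐ x ∂(volume.restrict (openHalfDisk 2)), ‖∑ i, u₂ i i x‖ ≤ ‖τ x‖ + A * ∑ i, ‖u₁ i x‖ ^ 2) →
      ∀ i j, eLpNorm (fun x => chi x * u₂ i j x a) (ENNReal.ofReal p) (volume.restrict (openHalfDisk 2)) ≤
        C * (eLpNorm τ (ENNReal.ofReal p) (volume.restrict (openHalfDisk 1)) +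
          eLpNorm (fun x => chi x * ∑ i, ‖u₁ i x‖ ^ 2) (ENNReal.ofReal p) (volume.restrict (openHalfDisk 2)) +
          ∑ i, eLpNorm (u₁ i) (ENNReal.ofReal p) (volume.restrict (openHalfDisk 1))) := by
  have hr : 1 ≤ ENNReal.ofReal p := by
    rw [← ENNReal.ofReal_one]
    exact ENNReal.ofReal_le_ofReal hp1.le
  obtain ⟨C₁, hC₁⟩ := exists_halfDisk_estimate hp1 hp2 isTest_chi tsupport_chi_subset chi_reflect
  obtain ⟨C₂, hC₂⟩ := exists_poincare_map L hp1
  obtain ⟨C₃, hC₃⟩ := exists_const_le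
  obtain ⟨C₄, hC₄⟩ := eLpNorm_one_le hr
  obtain ⟨M', hM'0, hM1', hM2'⟩ := exists_fderiv_bound (hP a) (hPc a)
  lift M' to ℝ≥0 using hM'0 with M hM
  set V : ℝ≥0∞ := eLpNorm (fun _ : Euc 2 => (1 : ℝ)) (ENNReal.ofReal p) (volume.restrict (openHalfDisk 1)) with hV
  have hVt : V ≠ ⊤ := (memLp_const (1 : ℝ)).2.ne
  set B : ℝ≥0 := (1 + M) * (1 + A) with hB
  set Cg : ℝ≥0 := (1 + M) * C₂ + V.toNNReal * (C₃ * (C₄ * ((1 + M) * C₂) + C₄ * (1 + M))) with hCg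
  refine ⟨C₁ * (B + B + (M + (1 + M) + 1) + (M * C₂ + Cg + (M * C₂ + Cg))), ?_⟩
  intro u τ u₁ u₂ b d h hbd hτ hΔ i j
  set μ := (volume : Measure (Euc 2)).restrict (openHalfDisk 2) with hμ
  set μ₁ := (volume : Measure (Euc 2)).restrict (openHalfDisk 1) with hμ₁
  have hm : μ₁ ≤ μ := restrict_openHalfDisk_le (by norm_num)
  set r := ENNReal.ofReal p with hrp
  set G := ∑ i, eLpNorm (u₁ i) r μ₁ with hG
  set e := fun x => ∑ i, ‖u₁ i x‖ ^ 2 with he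
  set Y := eLpNorm τ r μ₁ + eLpNorm (fun x => chi x * e x) r μ + G with hY
  have hGY : G ≤ Y := le_add_self
  set m := ⨍ y in openHalfDisk 1, u y with hm_def
  have hpoin : eLpNorm (fun x => u x - m) r μ₁ ≤ C₂ * G := hC₂ u u₁ b h.memLp h.memLp₁ h.hasTrace
  have hu₁G : ∀ i, eLpNorm (u₁ i) r μ₁ ≤ G := fun i =>
    Finset.single_le_sum (f := fun i => eLpNorm (u₁ i) r μ₁) (fun _ _ => zero_le) (Finset.mem_univ i)
  -- the complementary function and its derivative
  have hΨ : ContDiff ℝ ∞ (fun z : Euc L => z a - P a z) := (EuclideanSpace.proj (𝕜 := ℝ) a).contDiff.sub (hP a)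
  have hΨd : ∀ z v, fderiv ℝ (fun z : Euc L => z a - P a z) z v = v a - fderiv ℝ (P a) z v := fun z v => by
    have h1 := (EuclideanSpace.proj (𝕜 := ℝ) a).hasFDerivAt (x := z)
    have h2 := ((hP a).differentiable (by simp) z).hasFDerivAt
    rw [HasFDerivAt.fderiv (f := fun z : Euc L => z a - P a z) (h1.sub h2)]
    rfl
  have hΨM : ∀ z, ‖fderiv ℝ (fun z : Euc L => z a - P a z) z‖ ≤ (1 + M : ℝ≥0) := fun z =>
    ContinuousLinearMap.opNorm_le_bound _ (by positivity) fun v => by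
      rw [hΨd, NNReal.coe_add, add_mul, NNReal.coe_one, one_mul]
      exact (norm_sub_le _ _).trans (add_le_add (PiLp.norm_apply_le v a) ((fderiv ℝ (P a) z).le_of_opNorm_le (hM1' z) v))
  have hui := h.memLp.integrable hr
  have hu₁i := fun i => (h.memLp₁ i).integrable hr
  have ca : ∀ {v : Euc 2 → Euc L}, Integrable v μ → Integrable (fun x => v x a) μ := fun hv =>
    (EuclideanSpace.proj (𝕜 := ℝ) a).integrable_comp hv
  have lip1 := fun z => lipschitz_of_fderiv_le ((hP a).of_le (by simp)) hM1' z m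
  have lip2 := fun z => lipschitz_of_fderiv_le (hΨ.of_le (by simp)) hΨM z m
  have iP := integrable_comp_of_fderiv_le ((hP a).of_le (by simp)) hM1' hui
  have iP₁ := fun i => integrable_fderiv_comp ((hP a).of_le (by simp)) hM1' h.memLp.1 (hu₁i i)
  have iP₂ := fun i => h.integrable_and_weakDeriv_comp hr (hP a) (hPc a) i
  have iΨ := integrable_comp_of_fderiv_le (hΨ.of_le (by simp)) hΨM hui
  have hbd1 : ∀ᵐ t ∂(volume.restrict (Ioo (-2 : ℝ) 2)), fderiv ℝ (P a) (b t) (d t) = 0 :=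
    hbd.mono fun t ht => (ht a).2
  have hbd2 : ∀ ψ : Euc 2 → ℝ, ∫ t in Ioo (-2 : ℝ) 2, ψ !₂[t, 0] * (b t a - P a (b t)) = 0 := fun ψ => by
    refine integral_eq_zero_of_ae ?_
    filter_upwards [hbd] with t ht
    simp [(ht a).1]
  -- the weak derivatives of the two parts
  have wP : ∀ i, WeakDeriv (openHalfDisk 2) i (fun x => P a (u x)) (fun x => fderiv ℝ (P a) (u x) (u₁ i x)) :=
    fun i => h.hasTrace.weakDeriv_comp hr h.memLp h.memLp₁ ((hP a).of_le (by simp)) hM1' i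
  have wsub : ∀ (c : ℝ) (i : Fin 2) {f f₁ : Euc 2 → ℝ}, Integrable f μ → Integrable f₁ μ →
      WeakDeriv (openHalfDisk 2) i f f₁ → WeakDeriv (openHalfDisk 2) i (fun x => f x - c) f₁ := by
    intro c i f f₁ hf hf₁ hw
    have := hw.sub (weakDeriv_const i c) hf hf₁ (integrable_const c) (integrable_const 0)
    simpa using this
  have gΨ : ∀ i ψ, IsTest ψ → Green i (fun x => u x a - P a (u x)) (fun x => u₁ i x a - fderiv ℝ (P a) (u x) (u₁ i x)) ψ := by
    intro i ψ hψ
    have := h.hasTrace.green_of_boundary hr h.memLp h.memLp₁ (hΨ.of_le (by simp)) hΨM i hψ (Or.inr (hbd2 ψ))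
    simp only [hΨd] at this
    exact this
  -- The full function is shifted by the same constant `P a m` as its Neumann part; the Dirichlet
  -- part stays unshifted.
  have est := hC₁ (fun x => P a (u x) - P a m) (fun x => u x a - P a (u x)) (fun x => u x a - P a m)
    (fun i x => fderiv ℝ (P a) (u x) (u₁ i x)) (HalfDiskMap.compDeriv₂ (P a) u u₁ u₂)
    (fun i x => u₁ i x a - fderiv ℝ (P a) (u x) (u₁ i x))
    (fun i x => u₂ i i x a - HalfDiskMap.compDeriv₂ (P a) u u₁ u₂ i x)
    (fun i x => u₁ i x a) (fun i j x => u₂ i j x a)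
    (iP.sub (integrable_const _)) iP₁ (fun i => (iP₂ i).1) iΨ (fun i => (ca (hu₁i i)).sub (iP₁ i))
    (fun i => (ca ((h.memLp₂ i i).integrable hr)).sub (iP₂ i).1) ((ca hui).sub (integrable_const _))
    (fun i => ca (hu₁i i)) (fun i j => ca ((h.memLp₂ i j).integrable hr))
    (fun i => wsub _ i iP (iP₁ i) (wP i))
    (fun i ψ hψ => h.green_comp₂ hr (hP a) (hPc a) hbd1 i hψ) gΨ
    (fun i => (h.weakDeriv₂ i i a).sub (iP₂ i).2 (ca (hu₁i i)) (ca ((h.memLp₂ i i).integrable hr)) (iP₁ i) (iP₂ i).1)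
    (fun x => by ring) (fun i => wsub _ i (ca hui) (ca (hu₁i i)) (h.weakDeriv i a)) (fun i j => h.weakDeriv₂ i j a) i j
  refine est.trans ?_
  rw [ENNReal.coe_mul, mul_assoc]
  refine mul_le_mul_right ?_ _
  -- second-order terms
  have he0 : ∀ x, 0 ≤ e x := fun x => Finset.sum_nonneg fun i _ => sq_nonneg _
  have hem : AEStronglyMeasurable (fun x => chi x * e x) μ := by
    refine contDiff_chi.continuous.aestronglyMeasurable.mul ?_
    have := Finset.aestronglyMeasurable_fun_sum (Finset.univ : Finset (Fin 2)) (fun i _ => ((h.memLp₁ i).1.norm.pow 2))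
    exact this
  have hΔP : ∀ x, ‖∑ i, HalfDiskMap.compDeriv₂ (P a) u u₁ u₂ i x‖ ≤ M * ‖∑ i, u₂ i i x‖ + M * e x := by
    intro x
    simp only [HalfDiskMap.compDeriv₂, Finset.sum_add_distrib]
    rw [add_comm, ← map_sum]
    refine (norm_add_le _ _).trans (add_le_add ((fderiv ℝ (P a) (u x)).le_of_opNorm_le (hM1' _) _) ?_)
    rw [he, Finset.mul_sum]
    refine norm_sum_le_of_le _ fun i _ => ?_
    rw [sq, ← mul_assoc]
    exact hM2' _ _ _
  -- Both Laplacians satisfy the same pointwise bound by `|τ| + |∇u|²`. The constant `B = (1 + M) (1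
  -- + A)` collects the bounds for `P` and for the second fundamental form.
  have second : ∀ (F : Euc 2 → ℝ), (∀ᵐ x ∂μ, ‖F x‖ ≤ B * (‖τ x‖ + e x)) →
      eLpNorm (fun x => chi x * F x) r μ ≤ B * Y := by
    intro F hF
    have h1 : ∀ᵐ x ∂μ, ‖chi x * F x‖ ≤ B * ‖chi x * ‖τ x‖ + chi x * e x‖ := by
      filter_upwards [hF] with x hx
      rw [← mul_add, norm_mul, norm_mul, Real.norm_of_nonneg (add_nonneg (norm_nonneg (τ x)) (he0 x))]
      calc ‖chi x‖ * ‖F x‖ ≤ ‖chi x‖ * (B * (‖τ x‖ + e x)) := by gcongr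
        _ = _ := by ring
    refine (eLpNorm_le_nnreal_smul_eLpNorm_of_ae_le_mul (c := B) (h1.mono fun x hx => by
      exact_mod_cast hx) r).trans ?_
    rw [ENNReal.smul_def, smul_eq_mul]
    refine mul_le_mul_right ?_ _
    refine (eLpNorm_add_le (f := fun x => chi x * ‖τ x‖) (g := fun x => chi x * e x)
      (contDiff_chi.continuous.aestronglyMeasurable.mul hτ.norm) hem hr).trans ?_
    refine le_trans (add_le_add (?_ : _ ≤ eLpNorm τ r μ₁) le_rfl) le_self_add
    refine (eLpNorm_mul_restrict_le abs_chi_le tsupport_chi_subset r).trans_eq ?_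
    rw [ENNReal.coe_one, one_mul, eLpNorm_norm]
  have hMA : ∀ x, ‖∑ i, u₂ i i x‖ ≤ ‖τ x‖ + A * e x →
      (1 + M) * ‖∑ i, u₂ i i x‖ + M * e x ≤ B * (‖τ x‖ + e x) := by
    intro x hx
    have h1 : (0 : ℝ) ≤ A * ‖τ x‖ := by positivity
    have h2 : (0 : ℝ) ≤ M * (A * ‖τ x‖) := by positivity
    have h3 : (0 : ℝ) ≤ 1 + M := by positivity
    have h4 := mul_le_mul_of_nonneg_left hx h3
    rw [hB]
    push_cast
    linarith [he0 x]
  have s1 := second (fun x => ∑ i, HalfDiskMap.compDeriv₂ (P a) u u₁ u₂ i x) (hΔ.mono fun x hx =>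
    ((hΔP x).trans (by linarith [norm_nonneg (∑ i, u₂ i i x)])).trans (hMA x hx))
  have s2 := second (fun x => ∑ i, (u₂ i i x a - HalfDiskMap.compDeriv₂ (P a) u u₁ u₂ i x)) (hΔ.mono fun x hx => by
    refine le_trans ?_ (hMA x hx)
    rw [Finset.sum_sub_distrib]
    have h1 : ‖∑ i, u₂ i i x a‖ ≤ ‖∑ i, u₂ i i x‖ := by
      have := PiLp.norm_apply_le (∑ i, u₂ i i x) a
      simpa using this
    have := (norm_sub_le _ _).trans (add_le_add h1 (hΔP x))
    linarith)
  -- first-order terms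
  have lin : ∀ {F : Euc 2 → ℝ} {H : Euc 2 → Euc L} {D : ℝ≥0}, (∀ x, ‖F x‖ ≤ D * ‖H x‖) →
      eLpNorm F r μ₁ ≤ D * eLpNorm H r μ₁ := fun hF =>
    (eLpNorm_le_nnreal_smul_eLpNorm_of_ae_le_mul (.of_forall fun x => by exact_mod_cast hF x) r)
  have bΨ : ∀ i x, ‖u₁ i x a - fderiv ℝ (P a) (u x) (u₁ i x)‖ ≤ (1 + M : ℝ≥0) * ‖u₁ i x‖ := fun i x => by
    rw [← hΨd]
    exact (fderiv ℝ (fun z : Euc L => z a - P a z) (u x)).le_of_opNorm_le (hΨM _) _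
  have t1 : ∑ i, eLpNorm (fun x => fderiv ℝ (P a) (u x) (u₁ i x)) r μ₁ ≤ M * Y := by
    refine le_trans ?_ (mul_le_mul_right hGY _)
    rw [hG, Finset.mul_sum]
    exact Finset.sum_le_sum fun i _ => lin fun x => (fderiv ℝ (P a) (u x)).le_of_opNorm_le (hM1' _) _
  have t2 : ∑ i, eLpNorm (fun x => u₁ i x a - fderiv ℝ (P a) (u x) (u₁ i x)) r μ₁ ≤ (1 + M : ℝ≥0) * Y := by
    refine le_trans ?_ (mul_le_mul_right hGY _)
    rw [hG, Finset.mul_sum]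
    exact Finset.sum_le_sum fun i _ => lin (bΨ i)
  have t3 : ∑ i, eLpNorm (fun x => u₁ i x a) r μ₁ ≤ (1 : ℝ≥0) * Y := by
    rw [ENNReal.coe_one, one_mul]
    exact (Finset.sum_le_sum fun i _ => eLpNorm_component_le _ a).trans hGY
  -- zeroth-order terms
  have z1 : eLpNorm (fun x => P a (u x) - P a m) r μ₁ ≤ (M * C₂ : ℝ≥0) * Y := by
    rw [ENNReal.coe_mul, mul_assoc]
    exact (lin fun x => lip1 (u x)).trans (mul_le_mul_right (hpoin.trans (mul_le_mul_right hGY _)) _)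
  have z2' : eLpNorm (fun x => (u x a - P a (u x)) - (m a - P a m)) r μ₁ ≤ (1 + M : ℝ≥0) * (C₂ * G) :=
    (lin fun x => lip2 (u x)).trans (mul_le_mul_right hpoin _)
  have hiΨ1 := iΨ.1.mono_measure hm
  -- By the Lipschitz bound and the Poincaré inequality `u - P(u)` is within `C ‖∇u‖_p` of the
  -- constant `m - P(m)`. As it has zero trace, `exists_const_le` bounds the constant.
  have hconst : ENNReal.ofReal ‖m a - P a m‖ ≤
      (C₃ * (C₄ * ((1 + M) * C₂) + C₄ * (1 + M)) : ℝ≥0) * G := by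
    refine (hC₃ _ _ (m a - P a m) iΨ ((ca (hu₁i 1)).sub (iP₁ 1)) (gΨ 1 chi isTest_chi)).trans ?_
    rw [ENNReal.coe_mul, mul_assoc]
    refine mul_le_mul_right (add_le_mul_of_le ?_ ?_) _
    · refine (hC₄ 1 (by norm_num) _ (hiΨ1.sub aestronglyMeasurable_const)).trans ?_
      refine (mul_le_mul_right z2' _).trans_eq ?_
      push_cast
      ring
    · refine (hC₄ 1 (by norm_num) _ (((ca (hu₁i 1)).sub (iP₁ 1)).1.mono_measure hm)).trans ?_
      rw [ENNReal.coe_mul, mul_assoc]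
      exact mul_le_mul_right ((lin (bΨ 1)).trans (mul_le_mul_right (hu₁G 1) _)) _
  have z2 : eLpNorm (fun x => u x a - P a (u x)) r μ₁ ≤ (Cg : ℝ≥0) * Y := by
    refine le_trans ?_ (mul_le_mul_right hGY _)
    have h1 : (fun x => u x a - P a (u x)) = (fun x => (u x a - P a (u x)) - (m a - P a m)) +
        fun x => (m a - P a m) • (1 : ℝ) := by
      ext x
      simp
    rw [h1]
    refine (eLpNorm_add_le (hiΨ1.sub aestronglyMeasurable_const) aestronglyMeasurable_const hr).trans ?_
    refine add_le_mul_of_le (z2'.trans_eq (by push_cast; ring)) ?_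
    refine (eLpNorm_const_smul_le (c := m a - P a m) (f := fun _ : Euc 2 => (1 : ℝ))).trans ?_
    rw [← ofReal_norm, ENNReal.coe_mul, ENNReal.coe_toNNReal hVt, mul_comm, mul_assoc]
    exact mul_le_mul_right hconst _
  have z3 : eLpNorm (fun x => u x a - P a m) r μ₁ ≤ (M * C₂ + Cg : ℝ≥0) * Y := by
    refine le_trans (le_of_eq_of_le ?_ (eLpNorm_add_le (μ := μ₁) (p := r) (f := fun x => P a (u x) - P a m)
      (g := fun x => u x a - P a (u x)) ((iP.sub (integrable_const _)).1.mono_measure hm) hiΨ1 hr))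
      (add_le_mul_of_le z1 z2)
    congr 1
    ext x
    simp
  exact add_le_mul_of_le (add_le_mul_of_le (add_le_mul_of_le s1 s2) (add_le_mul_of_le (add_le_mul_of_le t1 t2) t3))
    (add_le_mul_of_le (add_le_mul_of_le z1 z2) z3)

/-! ### Absorption of the quadratic term, and the oscillation. -/

theorem le_two_mul_of_le_add_half {X a : ℝ≥0∞} (hX : X ≠ ⊤) (h : X ≤ a + 2⁻¹ * X) : X ≤ 2 * a := by
  have h2 : X = 2⁻¹ * X + 2⁻¹ * X := by
    rw [← add_mul, ENNReal.inv_two_add_inv_two, one_mul]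
  have hX2 : 2⁻¹ * X ≠ ⊤ := ENNReal.mul_ne_top (by simp) hX
  have h3 : 2⁻¹ * X ≤ a := by
    rw [h2, ← h2] at h
    nth_rewrite 1 [h2] at h
    exact (ENNReal.add_le_add_iff_right hX2).1 h
  calc X = 2 * (2⁻¹ * X) := by rw [two_mul, ← h2]
    _ ≤ 2 * a := mul_le_mul_right h3 _

/-- The Hessian of a map with small energy is controlled by the tension field and the gradient. -/
theorem exists_hessian_le {L : ℕ} {p : ℝ} (hp1 : 1 < p) (hp2 : p ≤ 2) {P : Fin L → Euc L → ℝ}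
    (hP : ∀ a, ContDiff ℝ ∞ (P a)) (hPc : ∀ a, HasCompactSupport (P a)) (A : ℝ≥0) :
    ∃ ε C : ℝ≥0, 0 < ε ∧ ∀ (u τ : Euc 2 → Euc L) (u₁ : Fin 2 → Euc 2 → Euc L)
      (u₂ : Fin 2 → Fin 2 → Euc 2 → Euc L) (b d : ℝ → Euc L),
      HalfDiskMap (ENNReal.ofReal p) u u₁ u₂ b d → AdaptedBoundary P b d →
      AEStronglyMeasurable τ (volume.restrict (openHalfDisk 2)) →
      (∀ᵐ x ∂(volume.restrict (openHalfDisk 2)), ‖∑ i, u₂ i i x‖ ≤ ‖τ x‖ + A * ∑ i, ‖u₁ i x‖ ^ 2) →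
      (∀ i, eLpNorm (u₁ i) 2 (volume.restrict (openHalfDisk 2)) ≤ ε) →
      ∑ a, ∑ i, ∑ j, eLpNorm (fun x => chi x * u₂ i j x a) (ENNReal.ofReal p)
          (volume.restrict (openHalfDisk 2)) ≤
        C * (∑ i, eLpNorm (u₁ i) (ENNReal.ofReal p) (volume.restrict (openHalfDisk 1)) +
          eLpNorm τ (ENNReal.ofReal p) (volume.restrict (openHalfDisk 1))) := by
  choose D hD using exists_component_hessian_le hp1 hp2 hP hPc A
  obtain ⟨C, hC⟩ := exists_quadratic_le L hp1 hp2
  set B : ℝ≥0 := ∑ a, 2 * (2 * D a) with hB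
  -- The energy threshold makes the coefficient `B C ε` of the absorbed Hessian at most `1 / 2`; the
  -- summand `1` keeps the denominator positive.
  refine ⟨(2 * (B * C + 1))⁻¹, 2 * (B + 1), by positivity, fun u τ u₁ u₂ b d h hbd hτ hΔ hε => ?_⟩
  set r := ENNReal.ofReal p with hr
  set μ := (volume : Measure (Euc 2)).restrict (openHalfDisk 2) with hμ
  set X := ∑ a, ∑ i, ∑ j, eLpNorm (fun x => chi x * u₂ i j x a) r μ with hX
  set G := ∑ i, eLpNorm (u₁ i) r (volume.restrict (openHalfDisk 1)) with hG
  set T := eLpNorm τ r (volume.restrict (openHalfDisk 1)) with hT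
  set Q := eLpNorm (fun x => chi x * ∑ i, ‖u₁ i x‖ ^ 2) r μ with hQ
  -- The Hessian is in `L^p` by assumption. Without this finiteness nothing could be subtracted.
  have hXt : X ≠ ⊤ := by
    simp only [hX, ne_eq, ENNReal.sum_eq_top, not_exists, not_and]
    intro a _ i _ j _ htop
    have := (eLpNorm_mul_restrict_le (h := fun x => u₂ i j x a) abs_chi_le tsupport_chi_subset r).trans_lt
      (ENNReal.mul_lt_top (by simp) (((memLp_component (h.memLp₂ i j) a).mono_measure
        (restrict_openHalfDisk_le (s := 1) (by norm_num))).2))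
    exact this.ne htop
  have h1 : X ≤ B * (T + Q + G) := by
    have : X ≤ ∑ a, ∑ _i : Fin 2, ∑ _j : Fin 2, D a * (T + Q + G) :=
      Finset.sum_le_sum fun a _ => Finset.sum_le_sum fun i _ => Finset.sum_le_sum fun j _ =>
        hD a u τ u₁ u₂ b d h hbd hτ hΔ i j
    refine this.trans_eq ?_
    simp only [Finset.sum_const, Finset.card_univ, Fintype.card_fin, nsmul_eq_mul, hB]
    push_cast
    rw [Finset.sum_mul]
    exact Finset.sum_congr rfl fun a _ => by ring
  have h2 : Q ≤ C * (((2 * (B * C + 1))⁻¹ : ℝ≥0) * (X + G)) := hC u u₁ u₂ b d _ h hε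
  have h3 : (B : ℝ≥0∞) * (C * ((2 * (B * C + 1))⁻¹ : ℝ≥0)) ≤ 2⁻¹ := by
    have : B * (C * (2 * (B * C + 1))⁻¹) ≤ 2⁻¹ := by
      rw [mul_inv, mul_left_comm C, mul_left_comm B, ← mul_assoc B, ← div_eq_mul_inv (B * C)]
      calc (2 : ℝ≥0)⁻¹ * (B * C / (B * C + 1)) ≤ 2⁻¹ * 1 := by
            gcongr
            exact div_le_one_of_le₀ (by simp) (by positivity)
        _ = 2⁻¹ := mul_one _
    calc (B : ℝ≥0∞) * (C * ((2 * (B * C + 1))⁻¹ : ℝ≥0)) = ((B * (C * (2 * (B * C + 1))⁻¹) : ℝ≥0) : ℝ≥0∞) := by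
          push_cast
          rfl
      _ ≤ ((2⁻¹ : ℝ≥0) : ℝ≥0∞) := ENNReal.coe_le_coe.2 this
      _ = 2⁻¹ := by simp
  have h4 : X ≤ (B * (T + G) + 2⁻¹ * G) + 2⁻¹ * X :=
    calc X ≤ B * (T + Q + G) := h1
      _ = B * (T + G) + B * Q := by ring
      _ ≤ B * (T + G) + B * (C * (((2 * (B * C + 1))⁻¹ : ℝ≥0) * (X + G))) :=
        add_le_add le_rfl (mul_le_mul_right h2 _)
      _ = B * (T + G) + (B * (C * ((2 * (B * C + 1))⁻¹ : ℝ≥0))) * (X + G) := by ring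
      _ ≤ B * (T + G) + 2⁻¹ * (X + G) := add_le_add le_rfl (mul_le_mul_left h3 _)
      _ = _ := by ring
  refine (le_two_mul_of_le_add_half hXt h4).trans ?_
  rw [ENNReal.coe_mul, mul_assoc]
  refine mul_le_mul_right ?_ _
  rw [ENNReal.coe_add, add_mul, add_comm G T]
  refine add_le_add le_rfl ?_
  rw [ENNReal.coe_one, one_mul]
  calc 2⁻¹ * G ≤ 1 * G := mul_le_mul_left (by simp) _
    _ ≤ T + G := by rw [one_mul]; exact le_add_self

/-- A map with integrable Hessian is continuous, and its oscillation is controlled. -/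
theorem exists_oscillation_le (L : ℕ) {p : ℝ} (hp1 : 1 < p) :
    ∃ C : ℝ≥0, ∀ (u : Euc 2 → Euc L) (u₁ : Fin 2 → Euc 2 → Euc L)
      (u₂ : Fin 2 → Fin 2 → Euc 2 → Euc L) (b d : ℝ → Euc L),
      HalfDiskMap (ENNReal.ofReal p) u u₁ u₂ b d →
      ∃ v : Euc 2 → Euc L, Continuous v ∧
        (∀ᵐ x ∂(volume.restrict (openHalfDisk (1 / 2))), v x = u x) ∧
        ∀ x y, ENNReal.ofReal ‖v x - v y‖ ≤ C * (∑ a, ∑ i, ∑ j, eLpNorm (fun x => chi x * u₂ i j x a)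
            (ENNReal.ofReal p) (volume.restrict (openHalfDisk 2)) +
          ∑ i, eLpNorm (u₁ i) (ENNReal.ofReal p) (volume.restrict (openHalfDisk 1))) := by
  have hr : 1 ≤ ENNReal.ofReal p := by
    rw [← ENNReal.ofReal_one]
    exact ENNReal.ofReal_le_ofReal hp1.le
  obtain ⟨C₁, hC₁⟩ := exists_halfDisk_sup_le isTest_chi tsupport_chi_subset
  obtain ⟨C₂, hC₂⟩ := exists_poincare_map L hp1
  obtain ⟨C₃, hC₃⟩ := eLpNorm_one_le hr
  refine ⟨L * (C₁ * (C₃ + (C₃ + C₃ + C₃ * C₂)) + C₁ * (C₃ + (C₃ + C₃ + C₃ * C₂))), fun u u₁ u₂ b d h => ?_⟩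
  set r := ENNReal.ofReal p with hrp
  set μ := (volume : Measure (Euc 2)).restrict (openHalfDisk 2) with hμ
  set μ₁ := (volume : Measure (Euc 2)).restrict (openHalfDisk 1) with hμ₁
  have hm : μ₁ ≤ μ := restrict_openHalfDisk_le (by norm_num)
  set X := ∑ a, ∑ i, ∑ j, eLpNorm (fun x => chi x * u₂ i j x a) r μ with hX
  set G := ∑ i, eLpNorm (u₁ i) r μ₁ with hG
  set m := ⨍ y in openHalfDisk 1, u y with hm_def
  have hpoin : eLpNorm (fun x => u x - m) r μ₁ ≤ C₂ * G := hC₂ u u₁ b h.memLp h.memLp₁ h.hasTrace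
  have ca : ∀ {v : Euc 2 → Euc L}, MemLp v r μ → ∀ a, Integrable (fun x => v x a) μ := fun hv a =>
    (memLp_component hv a).integrable hr
  have hGX : G ≤ X + G := le_add_self
  -- The supremum bound is applied to the cut-off of `u - m`. Subtracting the mean leaves only the
  -- gradient and the Hessian on the right, by the Poincaré inequality.
  have key : ∀ a, ∃ V : Euc 2 → ℝ, Continuous V ∧ (∀ᵐ x ∂μ, V x = chi x * (u x a - m a)) ∧
      ∀ x, ENNReal.ofReal ‖V x‖ ≤ (C₁ * (C₃ + (C₃ + C₃ + C₃ * C₂)) : ℝ≥0) * (X + G) := by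
    intro a
    have w : ∀ i, WeakDeriv (openHalfDisk 2) i (fun x => u x a - m a) (fun x => u₁ i x a) := fun i => by
      have := (h.weakDeriv i a).sub (weakDeriv_const i (m a)) (ca h.memLp a) (ca (h.memLp₁ i) a)
        (integrable_const _) (integrable_const 0)
      simpa using this
    obtain ⟨V, hV1, hV2, hV3⟩ := hC₁ (fun x => u x a - m a) (fun x => u₁ 0 x a) (fun x => u₁ 1 x a)
      (fun x => u₂ 0 1 x a) ((ca h.memLp a).sub (integrable_const _)) (ca (h.memLp₁ 0) a)
      (ca (h.memLp₁ 1) a) (ca (h.memLp₂ 0 1) a) (w 0) (w 1) (h.weakDeriv₂ 0 1 a)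
    refine ⟨V, hV1, hV2, fun x => (hV3 x).trans ?_⟩
    rw [ENNReal.coe_mul, mul_assoc]
    refine mul_le_mul_right (add_le_mul_of_le ?_ (add_le_mul_of_le (add_le_mul_of_le ?_ ?_) ?_)) _
    · refine (hC₃ 2 le_rfl _ (contDiff_chi.continuous.aestronglyMeasurable.mul
        (ca (h.memLp₂ 0 1) a).1)).trans (mul_le_mul_right (le_trans ?_ (le_self_add (b := G))) _)
      refine le_trans ?_ (Finset.single_le_sum (f := fun a => ∑ i, ∑ j, eLpNorm (fun x => chi x * u₂ i j x a)
        r μ) (fun _ _ => zero_le) (Finset.mem_univ a))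
      refine le_trans ?_ (Finset.single_le_sum (f := fun i => ∑ j, eLpNorm (fun x => chi x * u₂ i j x a)
        r μ) (fun _ _ => zero_le) (Finset.mem_univ 0))
      exact Finset.single_le_sum (f := fun j => eLpNorm (fun x => chi x * u₂ 0 j x a)
        r μ) (fun _ _ => zero_le) (Finset.mem_univ 1)
    · refine (hC₃ 1 (by norm_num) _ ((ca (h.memLp₁ 0) a).1.mono_measure hm)).trans (mul_le_mul_right ?_ _)
      exact ((eLpNorm_component_le _ a).trans (Finset.single_le_sum (f := fun i => eLpNorm (u₁ i) r μ₁)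
        (fun _ _ => zero_le) (Finset.mem_univ 0))).trans hGX
    · refine (hC₃ 1 (by norm_num) _ ((ca (h.memLp₁ 1) a).1.mono_measure hm)).trans (mul_le_mul_right ?_ _)
      exact ((eLpNorm_component_le _ a).trans (Finset.single_le_sum (f := fun i => eLpNorm (u₁ i) r μ₁)
        (fun _ _ => zero_le) (Finset.mem_univ 1))).trans hGX
    · refine (hC₃ 1 (by norm_num) _ (((ca h.memLp a).1.mono_measure hm).sub aestronglyMeasurable_const)).trans ?_
      rw [ENNReal.coe_mul, mul_assoc]
      exact mul_le_mul_right (((eLpNorm_component_le (fun x => u x - m) a).trans hpoin).trans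
        (mul_le_mul_right hGX _)) _
  choose V hV1 hV2 hV3 using key
  -- On the half disk of radius `1 / 2` the cutoff is one, so adding the mean back recovers `u`. The
  -- oscillation is at most twice the supremum of each component.
  refine ⟨fun x => WithLp.toLp 2 (fun a => V a x) + m, ?_, ?_, fun x y => ?_⟩
  · exact ((PiLp.continuous_toLp 2 _).comp (continuous_pi fun a => hV1 a)).add continuous_const
  · have hle : (volume : Measure (Euc 2)).restrict (openHalfDisk (1 / 2)) ≤ μ :=
      restrict_openHalfDisk_le (by norm_num)
    have hall := (ae_all_iff.2 hV2).filter_mono (ae_mono hle)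
    filter_upwards [hall, ae_restrict_mem (isOpen_openHalfDisk (1 / 2)).measurableSet] with x hx hxm
    ext a
    rw [PiLp.add_apply]
    change V a x + m a = u x a
    rw [hx a, chi_eq_one hxm.1.le]
    ring
  · rw [add_sub_add_right_eq_sub]
    calc ENNReal.ofReal ‖WithLp.toLp 2 (fun a => V a x) - WithLp.toLp 2 (fun a => V a y)‖
        ≤ ENNReal.ofReal (∑ a, (‖V a x‖ + ‖V a y‖)) := by
          refine ENNReal.ofReal_le_ofReal ((norm_le_sum_component _).trans (Finset.sum_le_sum fun a _ => ?_))
          exact norm_sub_le _ _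
      _ = ∑ a, (ENNReal.ofReal ‖V a x‖ + ENNReal.ofReal ‖V a y‖) := by
          rw [ENNReal.ofReal_sum_of_nonneg fun a _ => by positivity]
          exact Finset.sum_congr rfl fun a _ => ENNReal.ofReal_add (norm_nonneg _) (norm_nonneg _)
      _ ≤ ∑ _a : Fin L, ((C₁ * (C₃ + (C₃ + C₃ + C₃ * C₂)) + C₁ * (C₃ + (C₃ + C₃ + C₃ * C₂)) : ℝ≥0) : ℝ≥0∞) * (X + G) :=
          Finset.sum_le_sum fun a _ => add_le_mul_of_le (hV3 a x) (hV3 a y)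
      _ = _ := by
          rw [Finset.sum_const, Finset.card_univ, Fintype.card_fin, nsmul_eq_mul, ENNReal.coe_mul, mul_assoc]
          simp

/-! ### Weak derivatives of vector-valued maps -/

section WeakPartial

variable {F : Type*} [NormedAddCommGroup F] [NormedSpace ℝ F] {Ω Ω' : Set (Euc 2)} {i : Fin 2}
  {f f' g : Euc 2 → F}

theorem IsWeakPartial.mono (h : IsWeakPartial Ω i f g) (hΩ : Ω' ⊆ Ω) : IsWeakPartial Ω' i f g := by
  refine ⟨h.1.mono_set hΩ, h.2.1.mono_set hΩ, fun φ h1 h2 h3 => ?_⟩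
  have hz : ∀ {S : Set (Euc 2)}, tsupport φ ⊆ S → ∀ x, x ∉ S → φ x = 0 := fun hS x hx =>
    image_eq_zero_of_notMem_tsupport fun h => hx (hS h)
  have hz' : ∀ {S : Set (Euc 2)}, tsupport φ ⊆ S → ∀ x, x ∉ S → classicalPartial i φ x = 0 := fun hS x hx =>
    image_eq_zero_of_notMem_tsupport fun h => hx (hS (tsupport_pd_subset φ i h))
  have e := h.2.2 φ h1 h2 (h3.trans hΩ)
  rw [setIntegral_eq_integral_of_forall_compl_eq_zero fun x hx => by rw [hz' (h3.trans hΩ) x hx, zero_smul],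
    setIntegral_eq_integral_of_forall_compl_eq_zero fun x hx => by rw [hz (h3.trans hΩ) x hx, zero_smul]] at e
  rwa [setIntegral_eq_integral_of_forall_compl_eq_zero fun x hx => by rw [hz' h3 x hx, zero_smul],
    setIntegral_eq_integral_of_forall_compl_eq_zero fun x hx => by rw [hz h3 x hx, zero_smul]]

theorem IsWeakPartial.congr (h : IsWeakPartial Ω i f g) (hf : LocallyIntegrableOn f' Ω volume)
    (hff : f =ᵐ[volume.restrict Ω] f') : IsWeakPartial Ω i f' g := by
  refine ⟨hf, h.2.1, fun φ h1 h2 h3 => ?_⟩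
  rw [← h.2.2 φ h1 h2 h3]
  refine integral_congr_ae ?_
  filter_upwards [hff] with x hx
  rw [hx]

theorem IsWeakPartial.neg (h : IsWeakPartial Ω i f g) :
    IsWeakPartial Ω i (fun x => -f x) (fun x => -g x) := by
  refine ⟨h.1.neg, h.2.1.neg, fun φ h1 h2 h3 => ?_⟩
  simp only [smul_neg, integral_neg]
  rw [h.2.2 φ h1 h2 h3]

theorem weakPartial_ae_eq [CompleteSpace F] (hΩ : IsOpen Ω) (h : IsWeakPartial Ω i f g) :
    weakPartial Ω i f =ᵐ[volume.restrict Ω] g :=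
  (isWeakPartial_weakPartial h).ae_eq hΩ h

theorem weakPartial_weakPartial_ae_eq [CompleteSpace F] (hΩ : IsOpen Ω) {j : Fin 2} {k : Euc 2 → F}
    (h : IsWeakPartial Ω i f g) (h2 : IsWeakPartial Ω j g k) :
    weakPartial Ω j (weakPartial Ω i f) =ᵐ[volume.restrict Ω] k :=
  weakPartial_ae_eq hΩ (h2.congr (isWeakPartial_weakPartial h).2.1 (weakPartial_ae_eq hΩ h).symm)

/-- Membership asserts the existence of some weak derivatives. By uniqueness almost everywhere they
may be replaced by the chosen ones, also inside the second differentiation. -/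
theorem MemSobolev.two [CompleteSpace F] (hΩ : IsOpen Ω) {r : ℝ≥0∞} (h : MemSobolev Ω r 2 f) :
    MemLp f r (volume.restrict Ω) ∧ ∀ i, IsWeakPartial Ω i f (weakPartial Ω i f) ∧
      MemLp (weakPartial Ω i f) r (volume.restrict Ω) ∧
      ∀ j, IsWeakPartial Ω j (weakPartial Ω i f) (weakPartial Ω j (weakPartial Ω i f)) ∧
        MemLp (weakPartial Ω j (weakPartial Ω i f)) r (volume.restrict Ω) := by
  refine ⟨h.1, fun i => ?_⟩
  obtain ⟨g, hg, hgL, h2⟩ := h.2 i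
  have hw := isWeakPartial_weakPartial hg
  have he := weakPartial_ae_eq hΩ hg
  refine ⟨hw, hgL.ae_eq he.symm, fun j => ?_⟩
  obtain ⟨k, hk, hkL⟩ := h2 j
  exact ⟨isWeakPartial_weakPartial (hk.congr hw.2.1 he.symm),
    MemLp.ae_eq (weakPartial_weakPartial_ae_eq hΩ hg hk).symm hkL⟩

theorem IsTest.integrable_smul {ψ : Euc 2 → ℝ} (h : IsTest ψ)
    (hf : Integrable f (volume.restrict (openHalfDisk 2))) :
    Integrable (fun x => ψ x • f x) (volume.restrict (openHalfDisk 2)) := by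
  obtain ⟨C, hC⟩ := h.hasCompactSupport.exists_bound_of_continuous h.1.continuous
  exact hf.bdd_smul C h.1.continuous.aestronglyMeasurable (.of_forall hC)

theorem IsWeakPartial.sub_const [CompleteSpace F] {f g : Euc 2 → F} (h : IsWeakPartial (openHalfDisk 2) i f g)
    (hf : Integrable f (volume.restrict (openHalfDisk 2))) (c : F) :
    IsWeakPartial (openHalfDisk 2) i (fun x => f x - c) g := by
  refine ⟨h.1.sub ((locallyIntegrable_const c).locallyIntegrableOn _), h.2.1, fun φ h1 h2 h3 => ?_⟩
  have ht := (IsTest.of_tsupport_subset h1 h3).pd i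
  have h0 := weakDeriv_const i 1 φ h1 h2 h3
  have e : ∫ x in openHalfDisk 2, classicalPartial i φ x • c = 0 := by
    rw [setIntegral_eq_integral_of_forall_compl_eq_zero fun x hx => by
      rw [show classicalPartial i φ x = 0 from image_eq_zero_of_notMem_tsupport fun h =>
        hx (h3 (tsupport_pd_subset φ i h)), zero_smul]]
    rw [integral_smul_const]
    simp only [mul_one, mul_zero, integral_zero, neg_zero] at h0
    change (∫ x, pd i φ x) • c = 0
    rw [h0, zero_smul]
  simp only [smul_sub]
  have hi : ∀ {k : Euc 2 → F}, Integrable k (volume.restrict (openHalfDisk 2)) → Integrable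
      (fun x => classicalPartial i φ x • k x) (volume.restrict (openHalfDisk 2)) := fun hk => ht.integrable_smul hk
  rw [integral_sub (hi hf) (hi (integrable_const c)), e, sub_zero]
  exact h.2.2 φ h1 h2 h3

theorem IsWeakPartial.weakDeriv_component {L : ℕ} {f g : Euc 2 → Euc L}
    (h : IsWeakPartial (openHalfDisk 2) i f g)
    (hf : Integrable f (volume.restrict (openHalfDisk 2)))
    (hg : Integrable g (volume.restrict (openHalfDisk 2))) (a : Fin L) :
    WeakDeriv (openHalfDisk 2) i (fun x => f x a) (fun x => g x a) := by
  refine weakDeriv_iff_green.2 fun φ h1 h2 h3 => ?_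
  have ht := IsTest.of_tsupport_subset h1 h3
  have e := congrArg (EuclideanSpace.proj (𝕜 := ℝ) a) (h.2.2 φ h1 h2 h3)
  have hi : Integrable (fun x => classicalPartial i φ x • f x) (volume.restrict (openHalfDisk 2)) :=
    (ht.pd i).integrable_smul hf
  rw [map_neg, ← ContinuousLinearMap.integral_comp_comm _ hi,
    ← ContinuousLinearMap.integral_comp_comm _ (ht.integrable_smul hg)] at e
  simp only [map_smul, PiLp.proj_apply, smul_eq_mul] at e
  exact e

end WeakPartial

theorem sqrt_sum_sq_le {d : ℕ} (s : Fin d → ℝ) : √(∑ i, s i ^ 2) ≤ ∑ i, ‖s i‖ := by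
  have := norm_le_sum_component (WithLp.toLp 2 s)
  rw [EuclideanSpace.norm_eq] at this
  simpa using this

section GradNorm

variable {F : Type*} [NormedAddCommGroup F] [NormedSpace ℝ F] {Ω : Set (Euc 2)} {f : Euc 2 → F}

theorem norm_weakPartial_le (i : Fin 2) (x : Euc 2) : ‖weakPartial Ω i f x‖ ≤ ‖gradNorm Ω f x‖ := by
  rw [gradNorm, Real.norm_of_nonneg (Real.sqrt_nonneg _)]
  refine Real.le_sqrt_of_sq_le ?_
  exact Finset.single_le_sum (f := fun i => ‖weakPartial Ω i f x‖ ^ 2) (fun _ _ => sq_nonneg _) (Finset.mem_univ i)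

theorem gradNorm_le (x : Euc 2) : ‖gradNorm Ω f x‖ ≤ ∑ i, ‖weakPartial Ω i f x‖ := by
  rw [gradNorm, Real.norm_of_nonneg (Real.sqrt_nonneg _)]
  exact (sqrt_sum_sq_le _).trans_eq (by simp only [norm_norm])

theorem hessNorm_le (x : Euc 2) :
    ‖hessNorm Ω f x‖ ≤ ∑ i, ∑ j, ‖weakPartial Ω j (weakPartial Ω i f) x‖ := by
  rw [hessNorm, Real.norm_of_nonneg (Real.sqrt_nonneg _)]
  have h1 : ∀ i, ∑ j, ‖weakPartial Ω j (weakPartial Ω i f) x‖ ^ 2 =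
      √(∑ j, ‖weakPartial Ω j (weakPartial Ω i f) x‖ ^ 2) ^ 2 := fun i =>
    (Real.sq_sqrt (Finset.sum_nonneg fun _ _ => sq_nonneg _)).symm
  rw [Finset.sum_congr rfl fun i _ => h1 i]
  refine (sqrt_sum_sq_le _).trans (Finset.sum_le_sum fun i _ => ?_)
  rw [Real.norm_of_nonneg (Real.sqrt_nonneg _)]
  exact (sqrt_sum_sq_le _).trans_eq (by simp only [norm_norm])

end GradNorm

/-- A map in `W^{2,p}` with square integrable gradient and boundary traces as a `HalfDiskMap`. -/
theorem halfDiskMap_of_memSobolev {L : ℕ} {r : ℝ≥0∞} (hr : 1 ≤ r) {u : Euc 2 → Euc L}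
    (hu : MemSobolev (openHalfDisk 2) r 2 u)
    (h2 : eLpNorm (gradNorm (openHalfDisk 2) u) 2 (volume.restrict (openHalfDisk 2)) ≠ ⊤)
    {b d : ℝ → Euc L} (hb : IsTrace 2 r u b)
    (hd : IsTrace 2 r (fun x => -weakPartial (openHalfDisk 2) 1 u x) d) :
    HalfDiskMap r u (fun i => weakPartial (openHalfDisk 2) i u)
      (fun i j => weakPartial (openHalfDisk 2) i (weakPartial (openHalfDisk 2) j u)) b d := by
  obtain ⟨hu0, hu1⟩ := hu.two (isOpen_openHalfDisk 2)
  refine ⟨hu0, fun i => (hu1 i).2.1, fun i j => ((hu1 j).2.2 i).2, fun i => ⟨(hu1 i).2.1.1, ?_⟩,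
    fun i a => (hu1 i).1.weakDeriv_component (hu0.integrable hr) ((hu1 i).2.1.integrable hr) a,
    fun i j a => ((hu1 j).2.2 i).1.weakDeriv_component ((hu1 j).2.1.integrable hr)
      (((hu1 j).2.2 i).2.integrable hr) a, hb, hd.1, ?_⟩
  · exact (eLpNorm_mono (norm_weakPartial_le i)).trans_lt h2.lt_top
  · obtain ⟨-, w, hw, c0, c1, cT⟩ := hd
    -- The trace hypothesis speaks of the weak derivatives chosen for `-∂u/∂x²`; they agree almost
    -- everywhere with the negatives of the second derivatives.
    refine ⟨w, hw, c0, fun i => (c1 i).congr fun m => eLpNorm_congr_ae ?_, cT⟩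
    filter_upwards [weakPartial_ae_eq (isOpen_openHalfDisk 2) ((hu1 1).2.2 i).1.neg] with x hx
    rw [hx]

/-- Weak derivatives on the small half disk are almost everywhere those on the large one, constants
drop out, and `chi` is one on the small half disk. So the cut-off Hessian controls the Hessian
there. -/
theorem sobolevNormTwo_sub_const_le {L : ℕ} {r : ℝ≥0∞} (hr : 1 ≤ r) {u : Euc 2 → Euc L}
    (hu : MemSobolev (openHalfDisk 2) r 2 u) (c : Euc L) :
    MemSobolev (openHalfDisk (1 / 2)) r 2 (fun x => u x - c) ∧
    sobolevNormTwo (openHalfDisk (1 / 2)) r (fun x => u x - c) ≤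
      eLpNorm (fun x => u x - c) r (volume.restrict (openHalfDisk 1)) +
      ∑ i, eLpNorm (weakPartial (openHalfDisk 2) i u) r (volume.restrict (openHalfDisk 1)) +
      ∑ a, ∑ i, ∑ j, eLpNorm (fun x => chi x *
        weakPartial (openHalfDisk 2) i (weakPartial (openHalfDisk 2) j u) x a) r
        (volume.restrict (openHalfDisk 2)) := by
  set U := openHalfDisk 2 with hU
  set Ω := openHalfDisk (1 / 2) with hΩ
  have hΩo : IsOpen Ω := isOpen_openHalfDisk _
  have hsub : Ω ⊆ U := openHalfDisk_subset (by norm_num)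
  have hsub1 : Ω ⊆ openHalfDisk 1 := openHalfDisk_subset (by norm_num)
  have hle : (volume : Measure (Euc 2)).restrict Ω ≤ volume.restrict U := Measure.restrict_mono_set _ hsub
  have hle1 : (volume : Measure (Euc 2)).restrict Ω ≤ volume.restrict (openHalfDisk 1) :=
    Measure.restrict_mono_set _ hsub1
  obtain ⟨hu0, hu1⟩ := hu.two (isOpen_openHalfDisk 2)
  have w1 : ∀ i, IsWeakPartial Ω i (fun x => u x - c) (weakPartial U i u) := fun i =>
    ((hu1 i).1.sub_const (hu0.integrable hr) c).mono hsub
  have w2 : ∀ i j, IsWeakPartial Ω j (weakPartial U i u) (weakPartial U j (weakPartial U i u)) := fun i j =>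
    ((hu1 i).2.2 j).1.mono hsub
  have m2 : ∀ i j, MemLp (weakPartial U j (weakPartial U i u)) r (volume.restrict Ω) := fun i j =>
    ((hu1 i).2.2 j).2.mono_measure hle
  have m1 : ∀ i, MemLp (weakPartial U i u) r (volume.restrict Ω) := fun i => (hu1 i).2.1.mono_measure hle
  refine ⟨⟨(hu0.sub (memLp_const c)).mono_measure hle, fun i => ⟨_, w1 i, m1 i, fun j => ⟨_, w2 i j, m2 i j⟩⟩⟩,
    add_le_add (add_le_add (eLpNorm_mono_measure _ hle1) ?_) ?_⟩
  · refine (eLpNorm_mono_ae_real (g := ∑ i, fun x => ‖weakPartial U i u x‖) ?_).trans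
      ((eLpNorm_sum_le (fun i _ => (m1 i).1.norm) hr).trans (Finset.sum_le_sum fun i _ => ?_))
    · filter_upwards [ae_all_iff.2 fun i => weakPartial_ae_eq hΩo (w1 i)] with x hx
      simp only [Finset.sum_apply, ← hx]
      exact gradNorm_le x
    · rw [eLpNorm_norm]
      exact eLpNorm_mono_measure _ hle1
  · refine (eLpNorm_mono_ae_real (g := ∑ i, ∑ j, fun x => ‖weakPartial U j (weakPartial U i u) x‖) ?_).trans ?_
    · filter_upwards [ae_all_iff.2 fun i => ae_all_iff.2 fun j =>
        weakPartial_weakPartial_ae_eq hΩo (w1 i) (w2 i j)] with x hx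
      simp only [Finset.sum_apply, ← hx]
      exact hessNorm_le x
    · refine (eLpNorm_sum_le (fun i _ => Finset.aestronglyMeasurable_sum _ fun j _ => (m2 i j).1.norm) hr).trans ?_
      have h1 : ∀ i j, eLpNorm (fun x => ‖weakPartial U j (weakPartial U i u) x‖) r (volume.restrict Ω) ≤
          ∑ a, eLpNorm (fun x => chi x * weakPartial U j (weakPartial U i u) x a) r (volume.restrict U) := by
        intro i j
        rw [eLpNorm_norm]
        refine (eLpNorm_le_sum_component hr (m2 i j).1).trans (Finset.sum_le_sum fun a _ => ?_)
        refine le_of_eq_of_le (eLpNorm_congr_ae ?_) (eLpNorm_mono_measure _ hle)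
        filter_upwards [ae_restrict_mem hΩo.measurableSet] with x hx
        rw [chi_eq_one hx.1.le, one_mul]
      calc _ ≤ ∑ i, ∑ j, ∑ a, eLpNorm (fun x => chi x * weakPartial U j (weakPartial U i u) x a) r
            (volume.restrict U) := Finset.sum_le_sum fun i _ =>
              (eLpNorm_sum_le (fun j _ => (m2 i j).1.norm) hr).trans (Finset.sum_le_sum fun j _ => h1 i j)
        _ = _ := by
          rw [Finset.sum_comm]
          simp_rw [Finset.sum_comm (s := (Finset.univ : Finset (Fin 2))) (t := (Finset.univ : Finset (Fin L)))]

/-- The Laplacian is bounded by the tension field and the square of the gradient. -/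
theorem exists_laplacian_le {L n : ℕ} {N : Set (Euc L)} (hNc : IsCompact N)
    (hN : IsSubmanifoldWithBoundary n N) :
    ∃ A : ℝ≥0, ∀ {r : ℝ≥0∞} (_ : 1 ≤ r) {u : Euc 2 → Euc L} {b : ℝ → Euc L},
      MemSobolevTwoMap (openHalfDisk 2) r N u → IsTrace 2 r u b →
      ∀ᵐ x ∂(volume.restrict (openHalfDisk 2)),
        ‖∑ i, weakPartial (openHalfDisk 2) i (weakPartial (openHalfDisk 2) i u) x‖ ≤
          ‖tension (openHalfDisk 2) N u x‖ + A * ∑ i, ‖weakPartial (openHalfDisk 2) i u x‖ ^ 2 := by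
  obtain ⟨𝓗, C, hfin, hC, hH, hA⟩ := exists_secondFundamentalForm_le hNc hN
  refine ⟨⟨C, hC⟩, fun {r} hr {u b} hu hb => ?_⟩
  obtain ⟨hu0, hu1⟩ := hu.1.two (isOpen_openHalfDisk 2)
  -- Finitely many functions detect tangency, and each of them vanishes along `u`; so almost every
  -- point is good for all of them at once.
  have htan : ∀ᵐ x ∂(volume.restrict (openHalfDisk 2)), ∀ H ∈ 𝓗, ∀ i,
      fderiv ℝ H (u x) (weakPartial (openHalfDisk 2) i u x) = 0 := by
    refine (ae_ball_iff hfin.countable).2 fun H hH' => ae_all_iff.2 fun i => ?_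
    obtain ⟨h1, h2, h3⟩ := hH H hH'
    obtain ⟨M, -, hM, -⟩ := exists_fderiv_bound h1 h2
    have ht : HasTrace r u (fun i => weakPartial (openHalfDisk 2) i u) b := hb
    exact ht.ae_fderiv_eq_zero hr hu0 (fun i => (hu1 i).2.1) (h1.of_le (by simp)) hM i (hu.2.mono fun x hx => h3 _ hx)
  filter_upwards [htan, hu.2] with x hx hxN
  have e : ∑ i, weakPartial (openHalfDisk 2) i (weakPartial (openHalfDisk 2) i u) x =
      tension (openHalfDisk 2) N u x - ∑ i, secondFundamentalForm N (u x)
        (weakPartial (openHalfDisk 2) i u x) (weakPartial (openHalfDisk 2) i u x) := by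
    rw [tension, weakLaplacian, add_sub_cancel_right]
  rw [e]
  refine (norm_sub_le _ _).trans (add_le_add le_rfl ?_)
  rw [Finset.mul_sum]
  exact norm_sum_le_of_le _ fun i _ => hA (u x) hxN _ fun H hH' => hx H hH' i

theorem adaptedBoundary_of_orthogonal {L : ℕ} {K : Set (Euc L)} {P : Fin L → Euc L → ℝ}
    (hP : ∀ a, ∀ y ∈ K, P a y = y a ∧
        ∀ ν, (∀ v ∈ tangentSpace K y, inner ℝ ν v = 0) → fderiv ℝ (P a) y ν = 0) {b d : ℝ → Euc L}
    (h : ∀ᵐ t ∂(volume.restrict (Ioo (-2 : ℝ) 2)),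
      b t ∈ K ∧ ∀ v ∈ tangentSpace K (b t), inner ℝ (d t) v = 0) : AdaptedBoundary P b d :=
  h.mono fun _ ht a => ⟨(hP a _ ht.1).1, (hP a _ ht.1).2 _ ht.2⟩

end FreeBoundary

end

/-! ### The estimates for maps with free boundary. -/

theorem lemma4p1 {L n k : ℕ} (hk : 1 ≤ k) (hkn : k ≤ n)
    (N K : Set (Euc L))
    (hNc : IsCompact N) (hN : IsSubmanifoldWithBoundary n N)
    (hKc : IsCompact K) (hK : IsSubmanifold k K) (hKN : K ⊆ N)
    (p : ℝ) (hp1 : 1 < p) (hp2 : p ≤ 2) :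
    ∃ ε C : ℝ≥0, 0 < ε ∧
      ∀ u : Euc 2 → Euc L,
        MemSobolevTwoMap (openHalfDisk 2) (ENNReal.ofReal p) N u →
        MemLp (tension (openHalfDisk 2) N u) (ENNReal.ofReal p)
          (volume.restrict (openHalfDisk 2)) →
        HasFreeBoundary 2 (ENNReal.ofReal p) K u →
        eLpNorm (gradNorm (openHalfDisk 2) u) 2
            (volume.restrict (openHalfDisk 2)) +
          eLpNorm (tension (openHalfDisk 2) N u) (ENNReal.ofReal p)
            (volume.restrict (openHalfDisk 2)) ≤ (ε : ℝ≥0∞) →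
        -- the estimate of `u` minus its mean in `W^{2,p}` of the half disk of radius `1/2`
        (MemSobolev (openHalfDisk (1 / 2)) (ENNReal.ofReal p) 2
            (fun x => u x - ⨍ y in closedHalfDisk 1, u y) ∧
          sobolevNormTwo (openHalfDisk (1 / 2)) (ENNReal.ofReal p)
              (fun x => u x - ⨍ y in closedHalfDisk 1, u y) ≤
            C * (eLpNorm (gradNorm (openHalfDisk 2) u)
                  (ENNReal.ofReal p) (volume.restrict (openHalfDisk 1)) +
                eLpNorm (tension (openHalfDisk 2) N u)
                  (ENNReal.ofReal p) (volume.restrict (openHalfDisk 1)))) ∧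
        -- the oscillation of the continuous representative `v` of `u`
        ∃ v : Euc 2 → Euc L,
          ContinuousOn v (closedHalfDisk (1 / 2)) ∧
          v =ᵐ[volume.restrict (openHalfDisk (1 / 2))] u ∧
          ∀ x ∈ closedHalfDisk (1 / 2), ∀ y ∈ closedHalfDisk (1 / 2),
            ENNReal.ofReal ‖v x - v y‖ ≤
              C * (eLpNorm (gradNorm (openHalfDisk 2) u)
                    (ENNReal.ofReal p) (volume.restrict (openHalfDisk 1)) +
                  eLpNorm (tension (openHalfDisk 2) N u)
                    (ENNReal.ofReal p) (volume.restrict (openHalfDisk 1))) := by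
  have hr : 1 ≤ ENNReal.ofReal p := by
    rw [← ENNReal.ofReal_one]
    exact ENNReal.ofReal_le_ofReal hp1.le
  obtain ⟨A, hA⟩ := exists_laplacian_le hNc hN
  obtain ⟨P, hP⟩ := exists_normalProjection hKc
    (⟨hK.1, fun y hy => (hK.2 y hy).imp fun Φ h => ⟨h.1, h.2.1, h.2.2.1, Or.inl h.2.2.2⟩⟩ :
      IsSubmanifoldWithBoundary k K)
  obtain ⟨ε, C₁, hε, hC₁⟩ := exists_hessian_le hp1 hp2 (fun a => (hP a).1) (fun a => (hP a).2.1) A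
  obtain ⟨C₂, hC₂⟩ := exists_poincare_map L hp1
  obtain ⟨C₃, hC₃⟩ := exists_oscillation_le L hp1
  -- One summand for each of the two estimates. The factors `2` come from bounding the sum of the
  -- two partial derivatives by the length of the gradient.
  refine ⟨ε, (C₂ * 2 + 2 + C₁ * 2) + C₃ * (C₁ * 2 + 2), hε, fun u hu hτ ⟨b, d, hb, hd, hbd⟩ hsmall => ?_⟩
  set U := openHalfDisk 2 with hU
  set r := ENNReal.ofReal p with hrp
  set μ₁ := (volume : Measure (Euc 2)).restrict (openHalfDisk 1) with hμ₁
  have hgrad : eLpNorm (gradNorm U u) 2 (volume.restrict U) ≤ ε := le_self_add.trans hsmall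
  -- The smallness assumption in particular makes the gradient square integrable, as the structure
  -- requires.
  have h := halfDiskMap_of_memSobolev hr hu.1 (ne_top_of_le_ne_top ENNReal.coe_ne_top hgrad) hb hd
  obtain ⟨v, hv1, hv2, hv3⟩ := hC₃ u _ _ b d h
  have hX := hC₁ u (tension U N u) _ _ b d h
    (adaptedBoundary_of_orthogonal (fun a => (hP a).2.2) hbd) hτ.1 (hA hr hu hb)
    fun i => (eLpNorm_mono (norm_weakPartial_le i)).trans hgrad
  have hpoin := hC₂ u _ b h.memLp h.memLp₁ h.hasTrace
  set m := ⨍ y in openHalfDisk 1, u y with hm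
  -- The mean over the closed half disk is that over the open one, since the boundary is a null set.
  have hm' : ⨍ y in closedHalfDisk 1, u y = m := setAverage_congr (closedHalfDisk_ae_eq one_ne_zero)
  set X := ∑ a, ∑ i, ∑ j, eLpNorm (fun x => chi x * weakPartial U i (weakPartial U j u) x a) r
    (volume.restrict U) with hXdef
  set G := ∑ i, eLpNorm (weakPartial U i u) r μ₁ with hG
  set Y := eLpNorm (gradNorm U u) r μ₁ + eLpNorm (tension U N u) r μ₁ with hY
  have hGY : G ≤ (2 : ℝ≥0) * Y := by
    have : G ≤ ∑ _i : Fin 2, Y := Finset.sum_le_sum fun i _ =>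
      (eLpNorm_mono (norm_weakPartial_le i)).trans le_self_add
    simpa using this
  have hXY : X ≤ (C₁ * 2 : ℝ≥0) * Y := by
    refine hX.trans ?_
    rw [ENNReal.coe_mul, mul_assoc]
    refine mul_le_mul_right ?_ _
    have : G ≤ 2 * eLpNorm (gradNorm U u) r μ₁ := by
      have : G ≤ ∑ _i : Fin 2, eLpNorm (gradNorm U u) r μ₁ := Finset.sum_le_sum fun i _ =>
        eLpNorm_mono (norm_weakPartial_le i)
      simpa using this
    calc G + eLpNorm (tension U N u) r μ₁
        ≤ 2 * eLpNorm (gradNorm U u) r μ₁ + 2 * eLpNorm (tension U N u) r μ₁ :=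
          add_le_add this (le_mul_of_one_le_left zero_le (by norm_num))
      _ = (2 : ℝ≥0) * Y := by
          rw [hY, mul_add]
          simp
  rw [hm']
  obtain ⟨hs1, hs2⟩ := sobolevNormTwo_sub_const_le hr hu.1 m
  refine ⟨⟨hs1, hs2.trans ?_⟩, v, hv1.continuousOn, hv2, fun x _ y _ => (hv3 x y).trans ?_⟩
  · refine (add_le_mul_of_le (C := C₂ * 2 + 2) (add_le_mul_of_le ?_ hGY) hXY).trans
      (mul_le_mul_left (ENNReal.coe_le_coe.2 le_self_add) _)
    rw [ENNReal.coe_mul, mul_assoc]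
    exact hpoin.trans (mul_le_mul_right hGY _)
  · calc (C₃ : ℝ≥0∞) * (X + G) ≤ C₃ * ((C₁ * 2 + 2 : ℝ≥0) * Y) :=
          mul_le_mul_right (add_le_mul_of_le hXY hGY) _
      _ = (C₃ * (C₁ * 2 + 2) : ℝ≥0) * Y := by rw [ENNReal.coe_mul, mul_assoc]
      _ ≤ _ := mul_le_mul_left (ENNReal.coe_le_coe.2 le_add_self) _
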